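/- Let $(N,g_0,I_0,\omega_0)$ be a (nonempty, Hausdorff, second countable, finite-dimensional) real-analytic Kähler manifold, with the convention $\omega_0(u,v)=g_0(I_0u,v)$, and let $f\colon N\to M$ be a complexification of $N$: $M$ is a complex manifold with complex structure $J_M$, and $f$ is a real-analytic embedding with $T_pN\oplus J_M(T_pN)=T_{f(p)}M$ for every $p\in N$ (we identify $N$ with $f(N)$). On a sufficiently small open neighborhood of $N$ in $M$ one has the following objects. - The holomorphic extensions $H:=I_0^c$ and $\omega:=\omega_0^c$ of $I_0$ and $\omega_0$. - A local biholomorphism $(\pi_1,\pi_2)$ to $N\times\overline N$ (so $\pi_1$ is holomorphic and $\pi_2$ is antiholomorphic as a map to $N$) with $\pi_1\circ f=\pi_2\circ f=\mathrm{id}_N$. The fibers of $\pi_1$ and of $\pi_2$ define the canonical foliations $\mathcal F_1$ (vertical) and $\mathcal F_2$ (horizontal), and $(\omega,\mathcal F_1,\mathcal F_2)$ is a complex bi-Lagrangian structure: $\omega$ is a complex symplectic form and $\mathcal F_1,\mathcal F_2$ are transverse Lagrangian foliations. - The complex bi-Lagrangian connection $\nabla$, that is, the Levi-Civita connection of the holomorphic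 metric $(u,v)\mapsto\omega(F_0u,v)$, where $F_0=+1$ on $T\mathcal F_1$ and $F_0=-1$ on $T\mathcal F_2$. - An almost hyper-Hermitian structure $(g,I,J,K)$, i.e. a smooth Riemannian metric $g$ and smooth $g$-orthogonal endomorphism fields $I,J,K$ of $TM$ with $I^2=J^2=K^2=-\mathbf 1$ and $IJ=-JI=K$, such that: (i) $J=J_M$; the tensors $g$, $I$ and $\omega_I:=g(I\cdot,\cdot)$ extend $g_0$, $I_0$ and $\omega_0$ respectively; and $\omega_I-i\,\omega_K=\omega$, where $\omega_K:=g(K\cdot,\cdot)$; (ii) $g,I,J,K$ are $\nabla$-parallel along $\mathcal F_1$. **Theorem.** Such objects exist on some open neighborhood of $N$ in $M$, and the germ of $(g,H,I,J,K)$ along $N$ is unique: any two choices agree on a neighborhood of $N$. For any choice, on some open neighborhood of $N$ in $M$: 1. $(g,H,I,J,K)$ is an almost biquaternionic Hermitian structure: $g$ is a Riemannian metric, $H,I,J,K$ are smooth and satisfy the biquaternionic relations $$H^2=I^2=J^2=K^2=-\mathbf 1,\quad IJ=-JI=K,\quad HI=IH,\ HJ=JH,\ HK=KH,$$ and $H,I,J,K$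 are all $g$-orthogonal. 2. Consequently, with $F:=HJ$ and $G:=HK$, $(g,I,G,F)$ is an almost para-hyper-Hermitian structure: $I^2=-\mathbf 1$, $F^2=G^2=+\mathbf 1$, $\operatorname{tr}F=\operatorname{tr}G=0$, $IF=-FI=G$, and $I,F,G$ are smooth and $g$-orthogonal. -/

import Mathlib

open scoped Manifold ContDiff

noncomputable section

namespace BiquaternionicExtension

/-! ### Complex manifolds and their underlying real-analytic manifolds

A complex manifold is a charted space over a finite-dimensional complex normed space `E` which is a
manifold for `𝓘(ℂ, E)`. The same charts make it a real-analytic manifold for `𝓘(ℝ, E)`. In both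
cases the tangent space at `x` is a copy of `E`. -/

section General

variable {E : Type*} [NormedAddCommGroup E] [NormedSpace ℂ E]
  {M : Type*} [TopologicalSpace M] [ChartedSpace E M]

/-- The real manifold underlying a complex manifold. -/
instance isManifold_real {n : ℕ∞ω} [h : IsManifold 𝓘(ℂ, E) n M] : IsManifold 𝓘(ℝ, E) n M := by
  refine isManifold_of_contDiffOn 𝓘(ℝ, E) n M fun e e' he he' => ?_
  have := (contDiffGroupoid n 𝓘(ℂ, E)).compatible he he'
  rw [contDiffGroupoid, mem_groupoid_of_pregroupoid] at this
  exact ContDiffOn.restrict_scalars ℝ this.1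

/-- A tangent vector of the underlying real manifold, as a tangent vector of the complex manifold
(the holomorphic tangent bundle is identified with the real tangent bundle endowed with its
complex structure). -/
def toC {x : M} (v : TangentSpace 𝓘(ℝ, E) x) : TangentSpace 𝓘(ℂ, E) x := v

/-- Fields of endomorphisms of the real tangent bundle. -/
abbrev EndoField (E : Type*) [NormedAddCommGroup E] [NormedSpace ℂ E]
    (M : Type*) [TopologicalSpace M] [ChartedSpace E M] : Type _ :=
  ∀ x : M, TangentSpace 𝓘(ℝ, E) x →L[ℝ] TangentSpace 𝓘(ℝ, E) x

/-- Fields of real bilinear forms on the real tangent bundle. -/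
abbrev BilinField (E : Type*) [NormedAddCommGroup E] [NormedSpace ℂ E]
    (M : Type*) [TopologicalSpace M] [ChartedSpace E M] : Type _ :=
  ∀ x : M, TangentSpace 𝓘(ℝ, E) x →L[ℝ] TangentSpace 𝓘(ℝ, E) x →L[ℝ] ℝ

/-- Fields of complex-linear endomorphisms of the tangent bundle. -/
abbrev CEndoField (E : Type*) [NormedAddCommGroup E] [NormedSpace ℂ E]
    (M : Type*) [TopologicalSpace M] [ChartedSpace E M] : Type _ :=
  ∀ x : M, TangentSpace 𝓘(ℂ, E) x →L[ℂ] TangentSpace 𝓘(ℂ, E) x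

/-- Fields of complex bilinear forms on the tangent bundle. -/
abbrev CBilinField (E : Type*) [NormedAddCommGroup E] [NormedSpace ℂ E]
    (M : Type*) [TopologicalSpace M] [ChartedSpace E M] : Type _ :=
  ∀ x : M, TangentSpace 𝓘(ℂ, E) x →L[ℂ] TangentSpace 𝓘(ℂ, E) x →L[ℂ] ℂ

/-- The almost complex structure of a complex manifold: multiplication by `i` in the tangent
spaces. -/
def complexStructure (E : Type*) [NormedAddCommGroup E] [NormedSpace ℂ E]
    (M : Type*) [TopologicalSpace M] [ChartedSpace E M] : EndoField E M :=
  fun _ => ((Complex.I • ContinuousLinearMap.id ℂ E).restrictScalars ℝ : E →L[ℝ] E)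

/-- A complex-linear endomorphism field, seen as a real endomorphism field. -/
def CEndoField.toReal (H : CEndoField E M) : EndoField E M :=
  fun x =>
    let A : E →L[ℂ] E := H x
    (A.restrictScalars ℝ : E →L[ℝ] E)

/-! ### Regularity of tensor fields -/

section Regularity

/-- The endomorphism field `A` is smooth on `U`. -/
def IsSmoothEndoOn [IsManifold 𝓘(ℂ, E) ω M] (A : EndoField E M) (U : Set M) : Prop :=
  ContMDiffOn 𝓘(ℝ, E) (𝓘(ℝ, E).prod 𝓘(ℝ, E →L[ℝ] E)) ∞
    (fun x => (⟨x, A x⟩ : Bundle.TotalSpace (E →L[ℝ] E)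
      (fun x : M => TangentSpace 𝓘(ℝ, E) x →L[ℝ] TangentSpace 𝓘(ℝ, E) x))) U

/-- The field of bilinear forms `B` is smooth on `U`. -/
def IsSmoothBilinOn [IsManifold 𝓘(ℂ, E) ω M] (B : BilinField E M) (U : Set M) : Prop :=
  ContMDiffOn 𝓘(ℝ, E) (𝓘(ℝ, E).prod 𝓘(ℝ, E →L[ℝ] E →L[ℝ] ℝ)) ∞
    (fun x => (⟨x, B x⟩ : Bundle.TotalSpace (E →L[ℝ] E →L[ℝ] ℝ)
      (fun x : M => TangentSpace 𝓘(ℝ, E) x →L[ℝ] TangentSpace 𝓘(ℝ, E) x →L[ℝ] ℝ))) U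

/-- The complex-linear endomorphism field `A` is holomorphic on `U`. -/
def IsHolomorphicEndoOn [IsManifold 𝓘(ℂ, E) ω M] (A : CEndoField E M) (U : Set M) : Prop :=
  ContMDiffOn 𝓘(ℂ, E) (𝓘(ℂ, E).prod 𝓘(ℂ, E →L[ℂ] E)) ω
    (fun x => (⟨x, A x⟩ : Bundle.TotalSpace (E →L[ℂ] E)
      (fun x : M => TangentSpace 𝓘(ℂ, E) x →L[ℂ] TangentSpace 𝓘(ℂ, E) x))) U

/-- The field of complex bilinear forms `B` is holomorphic on `U`. -/
def IsHolomorphicBilinOn [IsManifold 𝓘(ℂ, E) ω M] (B : CBilinField E M) (U : Set M) : Prop :=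
  ContMDiffOn 𝓘(ℂ, E) (𝓘(ℂ, E).prod 𝓘(ℂ, E →L[ℂ] E →L[ℂ] ℂ)) ω
    (fun x => (⟨x, B x⟩ : Bundle.TotalSpace (E →L[ℂ] E →L[ℂ] ℂ)
      (fun x : M => TangentSpace 𝓘(ℂ, E) x →L[ℂ] TangentSpace 𝓘(ℂ, E) x →L[ℂ] ℂ))) U

end Regularity

/-! ### Connections and parallel tensors -/

section Connections

/-- The type of operators `cov` on vector fields; `cov Y x u` is `(∇_u Y)(x)`. -/
abbrev ConnectionOp (E : Type*) [NormedAddCommGroup E] [NormedSpace ℂ E]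
    (M : Type*) [TopologicalSpace M] [ChartedSpace E M] : Type _ :=
  (∀ x : M, TangentSpace 𝓘(ℝ, E) x) →
    ∀ x : M, TangentSpace 𝓘(ℝ, E) x →L[ℝ] TangentSpace 𝓘(ℝ, E) x

variable [IsManifold 𝓘(ℂ, E) ω M]

/-- The vector field `X` is differentiable at `x`. -/
def VDiffAt (X : ∀ x : M, TangentSpace 𝓘(ℝ, E) x) (x : M) : Prop :=
  MDifferentiableAt 𝓘(ℝ, E) (𝓘(ℝ, E).prod 𝓘(ℝ, E))
    (fun y => (⟨y, X y⟩ : Bundle.TotalSpace E (TangentSpace 𝓘(ℝ, E) : M → Type _))) x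

/-- `∇` is torsion-free on `U`: `∇_X Y - ∇_Y X = [X, Y]`. -/
def IsTorsionFreeOn (cov : ConnectionOp E M) (U : Set M) : Prop :=
  ∀ x ∈ U, ∀ X Y : ∀ x : M, TangentSpace 𝓘(ℝ, E) x, VDiffAt X x → VDiffAt Y x →
    cov Y x (X x) - cov X x (Y x) = VectorField.mlieBracket 𝓘(ℝ, E) X Y x

/-- On `U`, the field `B` of (real- or complex-valued) bilinear forms is `∇`-parallel in the
directions of the distribution `L`: `(∇_u B)(Y, Z) = u · B(Y, Z) - B(∇_u Y, Z) - B(Y, ∇_u Z) = 0`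
for all `u` in `L`. -/
def IsParallelBilinAlong {W : Type*} [NormedAddCommGroup W] [NormedSpace ℝ W]
    (cov : ConnectionOp E M)
    (B : ∀ x : M, TangentSpace 𝓘(ℝ, E) x → TangentSpace 𝓘(ℝ, E) x → W)
    (L : ∀ x : M, Submodule ℝ (TangentSpace 𝓘(ℝ, E) x)) (U : Set M) : Prop :=
  ∀ x ∈ U, ∀ u ∈ L x, ∀ Y Z : ∀ x : M, TangentSpace 𝓘(ℝ, E) x, VDiffAt Y x → VDiffAt Z x →
    mvfderiv 𝓘(ℝ, E) (fun y => B y (Y y) (Z y)) x u = B x (cov Y x u) (Z x) + B x (Y x) (cov Z x u)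

/-- On `U`, the endomorphism field `A` is `∇`-parallel in the directions of the distribution `L`:
`(∇_u A)(Y) = ∇_u (A Y) - A (∇_u Y) = 0` for all `u` in `L`. -/
def IsParallelEndoAlong (cov : ConnectionOp E M) (A : EndoField E M)
    (L : ∀ x : M, Submodule ℝ (TangentSpace 𝓘(ℝ, E) x)) (U : Set M) : Prop :=
  ∀ x ∈ U, ∀ u ∈ L x, ∀ Y : ∀ x : M, TangentSpace 𝓘(ℝ, E) x, VDiffAt Y x →
    cov (fun y => A y (Y y)) x u = A x (cov Y x u)

/-- `∇` is the Levi-Civita connection on `U` of the (real- or complex-valued) metric `B`: the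
torsion-free connection for which `B` is parallel. -/
structure IsLeviCivitaOn {W : Type*} [NormedAddCommGroup W] [NormedSpace ℝ W]
    (cov : ConnectionOp E M)
    (B : ∀ x : M, TangentSpace 𝓘(ℝ, E) x → TangentSpace 𝓘(ℝ, E) x → W) (U : Set M) : Prop where
  connection : IsCovariantDerivativeOn E (I := 𝓘(ℝ, E))
    (V := (TangentSpace 𝓘(ℝ, E) : M → Type _)) cov U
  torsionFree : IsTorsionFreeOn cov U
  parallel : IsParallelBilinAlong cov B (fun _ => ⊤) U

/-- The field `B` of complex bilinear forms, assumed alternating, is a closed 2-form on `U`: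
`X·B(Y,Z) - Y·B(X,Z) + Z·B(X,Y) - B([X,Y],Z) + B([X,Z],Y) - B([Y,Z],X) = 0`. -/
def IsClosedOn (B : CBilinField E M) (U : Set M) : Prop :=
  ∀ x ∈ U, ∀ X Y Z : ∀ x : M, TangentSpace 𝓘(ℝ, E) x, VDiffAt X x → VDiffAt Y x → VDiffAt Z x →
    mvfderiv 𝓘(ℝ, E) (fun y => B y (toC (Y y)) (toC (Z y))) x (X x)
      - mvfderiv 𝓘(ℝ, E) (fun y => B y (toC (X y)) (toC (Z y))) x (Y x)
      + mvfderiv 𝓘(ℝ, E) (fun y => B y (toC (X y)) (toC (Y y))) x (Z x)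
      - B x (toC (VectorField.mlieBracket 𝓘(ℝ, E) X Y x)) (toC (Z x))
      + B x (toC (VectorField.mlieBracket 𝓘(ℝ, E) X Z x)) (toC (Y x))
      - B x (toC (VectorField.mlieBracket 𝓘(ℝ, E) Y Z x)) (toC (X x)) = 0

end Connections

/-! ### Real-analytic Kähler manifolds -/

section Kahler

variable [IsManifold 𝓘(ℂ, E) ω M]

/-- Real-analytic Riemannian metrics. -/
abbrev AnalyticMetric (E : Type*) [NormedAddCommGroup E] [NormedSpace ℂ E]
    (M : Type*) [TopologicalSpace M] [ChartedSpace E M] [IsManifold 𝓘(ℂ, E) ω M] : Type _ :=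
  Bundle.ContMDiffRiemannianMetric 𝓘(ℝ, E) ω E (fun x : M => TangentSpace 𝓘(ℝ, E) x)

/-- The form `ω₀(u, v) = g₀(I₀ u, v)`. -/
def kahlerForm (g₀ : AnalyticMetric E M) : BilinField E M :=
  fun x => (g₀.inner x).comp (complexStructure E M x)

/-- The Riemannian metric `g₀` on the complex manifold is Kähler: `ω₀` is a 2-form, and the complex
structure is parallel for the Levi-Civita connection of `g₀`. -/
structure IsKahler (g₀ : AnalyticMetric E M) : Prop where
  skew : ∀ (x : M) (u v : TangentSpace 𝓘(ℝ, E) x), kahlerForm g₀ x u v = - kahlerForm g₀ x v u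
  parallel : ∃ cov : ConnectionOp E M,
    IsLeviCivitaOn cov (fun x u v => g₀.inner x u v) Set.univ ∧
    IsParallelEndoAlong cov (complexStructure E M) (fun _ => ⊤) Set.univ

end Kahler

/-! ### Hermitian structures of several kinds -/

section Hermitian

variable [IsManifold 𝓘(ℂ, E) ω M]

/-- `g` is a smooth Riemannian metric on `U`. -/
structure IsRiemannianOn (g : BilinField E M) (U : Set M) : Prop where
  smooth : IsSmoothBilinOn g U
  symm : ∀ x ∈ U, ∀ u v, g x u v = g x v u
  pos : ∀ x ∈ U, ∀ u, u ≠ 0 → 0 < g x u u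

/-- On `U`, `A` is `g`-orthogonal. -/
def IsOrthogonalOn (g : BilinField E M) (A : EndoField E M) (U : Set M) : Prop :=
  ∀ x ∈ U, ∀ u v, g x (A x u) (A x v) = g x u v

/-- Composition of endomorphism fields. -/
def EndoField.mul (A B : EndoField E M) : EndoField E M := fun x => (A x).comp (B x)

/-- `A ^ 2 = -1` on `U`. -/
def SqNegOneOn (A : EndoField E M) (U : Set M) : Prop := ∀ x ∈ U, ∀ u, A x (A x u) = -u

/-- `A ^ 2 = 1` on `U`. -/
def SqOneOn (A : EndoField E M) (U : Set M) : Prop := ∀ x ∈ U, ∀ u, A x (A x u) = u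

/-- `A B = B A` on `U`. -/
def CommuteOn (A B : EndoField E M) (U : Set M) : Prop := ∀ x ∈ U, ∀ u, A x (B x u) = B x (A x u)

/-- `A B = - B A = C` on `U`. -/
def AntiProductOn (A B C : EndoField E M) (U : Set M) : Prop :=
  ∀ x ∈ U, ∀ u, A x (B x u) = C x u ∧ - B x (A x u) = C x u

/-- Almost hyper-Hermitian structures on `U`. -/
structure IsAlmostHyperHermitianOn (g : BilinField E M) (I J K : EndoField E M)
    (U : Set M) : Prop where
  metric : IsRiemannianOn g U
  smooth : IsSmoothEndoOn I U ∧ IsSmoothEndoOn J U ∧ IsSmoothEndoOn K U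
  sq : SqNegOneOn I U ∧ SqNegOneOn J U ∧ SqNegOneOn K U
  product : AntiProductOn I J K U
  orthogonal : IsOrthogonalOn g I U ∧ IsOrthogonalOn g J U ∧ IsOrthogonalOn g K U

/-- Almost biquaternionic Hermitian structures on `U`. -/
structure IsAlmostBiquaternionicHermitianOn (g : BilinField E M) (H I J K : EndoField E M)
    (U : Set M) : Prop where
  metric : IsRiemannianOn g U
  smooth : IsSmoothEndoOn H U ∧ IsSmoothEndoOn I U ∧ IsSmoothEndoOn J U ∧ IsSmoothEndoOn K U
  sq : SqNegOneOn H U ∧ SqNegOneOn I U ∧ SqNegOneOn J U ∧ SqNegOneOn K U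
  product : AntiProductOn I J K U
  commute : CommuteOn H I U ∧ CommuteOn H J U ∧ CommuteOn H K U
  orthogonal : IsOrthogonalOn g H U ∧ IsOrthogonalOn g I U ∧ IsOrthogonalOn g J U ∧
    IsOrthogonalOn g K U

/-- Almost para-hyper-Hermitian structures `(g, I, G, F)` on `U`, for a Riemannian metric `g`: an
almost complex structure `I` and two almost para-complex structures `G`, `F`, all `g`-orthogonal,
with `I F = - F I = G`. -/
structure IsAlmostParaHyperHermitianOn (g : BilinField E M) (I G F : EndoField E M)
    (U : Set M) : Prop where
  metric : IsRiemannianOn g U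
  smooth : IsSmoothEndoOn I U ∧ IsSmoothEndoOn G U ∧ IsSmoothEndoOn F U
  sq : SqNegOneOn I U ∧ SqOneOn G U ∧ SqOneOn F U
  trace : ∀ x ∈ U, LinearMap.trace ℝ (TangentSpace 𝓘(ℝ, E) x) (G x) = 0 ∧
    LinearMap.trace ℝ (TangentSpace 𝓘(ℝ, E) x) (F x) = 0
  product : AntiProductOn I F G U
  orthogonal : IsOrthogonalOn g I U ∧ IsOrthogonalOn g G U ∧ IsOrthogonalOn g F U

end Hermitian

end General

/-! ### The complexification of a real-analytic Kähler manifold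

`N` is a complex manifold modelled on `E`, `M` a complex manifold modelled on `E'`. -/

section Complexification

variable {E : Type*} [NormedAddCommGroup E] [NormedSpace ℂ E]
  {N : Type*} [TopologicalSpace N] [ChartedSpace E N] [IsManifold 𝓘(ℂ, E) ω N]
  {E' : Type*} [NormedAddCommGroup E'] [NormedSpace ℂ E']
  {M : Type*} [TopologicalSpace M] [ChartedSpace E' M] [IsManifold 𝓘(ℂ, E') ω M]

/-- The real differential of a map between complex manifolds. -/
abbrev rd {E : Type*} [NormedAddCommGroup E] [NormedSpace ℂ E]
    {N : Type*} [TopologicalSpace N] [ChartedSpace E N]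
    {E' : Type*} [NormedAddCommGroup E'] [NormedSpace ℂ E']
    {M : Type*} [TopologicalSpace M] [ChartedSpace E' M] (f : N → M) (p : N) :
    TangentSpace 𝓘(ℝ, E) p →L[ℝ] TangentSpace 𝓘(ℝ, E') (f p) :=
  mfderiv 𝓘(ℝ, E) 𝓘(ℝ, E') f p

/-- `f : N → M` is a complexification of (the real-analytic manifold underlying) `N`: a
real-analytic embedding with maximal totally real image, `T_p N ⊕ J (T_p N) = T_p M`. -/
structure IsComplexification (E E' : Type*) [NormedAddCommGroup E] [NormedSpace ℂ E]
    [NormedAddCommGroup E'] [NormedSpace ℂ E']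
    {N : Type*} [TopologicalSpace N] [ChartedSpace E N]
    {M : Type*} [TopologicalSpace M] [ChartedSpace E' M] (f : N → M) : Prop where
  analytic : ContMDiff 𝓘(ℝ, E) 𝓘(ℝ, E') ω f
  embedding : Topology.IsEmbedding f
  immersion : ∀ p : N, Function.Injective (rd (E := E) (E' := E') f p)
  totallyReal : ∀ p : N, IsCompl
    (LinearMap.range (rd (E := E) (E' := E') f p).toLinearMap)
    ((LinearMap.range (rd (E := E) (E' := E') f p).toLinearMap).map
      (complexStructure E' M (f p)).toLinearMap)

/-- `H` is the holomorphic extension `I₀ᶜ` to `U` of the complex structure `I₀` of `N`. -/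
structure IsHolomorphicExtensionOfComplexStructure (E : Type*) [NormedAddCommGroup E]
    [NormedSpace ℂ E] {N : Type*} [TopologicalSpace N] [ChartedSpace E N]
    (f : N → M) (H : CEndoField E' M) (U : Set M) : Prop where
  holomorphic : IsHolomorphicEndoOn H U
  extends_ : ∀ (p : N) (u : TangentSpace 𝓘(ℝ, E) p),
    H.toReal (f p) (rd (E := E) (E' := E') f p u) = rd (E := E) (E' := E') f p (complexStructure E N p u)

/-- `B` is the holomorphic extension to `U` of the field `β` of bilinear forms on `N`. -/
structure IsHolomorphicExtensionOfBilin (f : N → M) (β : BilinField E N) (B : CBilinField E' M)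
    (U : Set M) : Prop where
  holomorphic : IsHolomorphicBilinOn B U
  extends_ : ∀ (p : N) (u v : TangentSpace 𝓘(ℝ, E) p),
    B (f p) (toC (rd (E := E) (E' := E') f p u)) (toC (rd (E := E) (E' := E') f p v)) = (β p u v : ℂ)

/-- The map `(q₁, q₂)` is, on `U`, a local biholomorphism to the canonical complexification
`N × N̄` which carries `f` to the diagonal embedding: `q₁` is holomorphic, `q₂` is antiholomorphic,
the kernels of their differentials are complementary, and `q₁ ∘ f = q₂ ∘ f = id`. -/
structure IsCanonicalChart (E E' : Type*) [NormedAddCommGroup E] [NormedSpace ℂ E]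
    [NormedAddCommGroup E'] [NormedSpace ℂ E']
    {N : Type*} [TopologicalSpace N] [ChartedSpace E N]
    {M : Type*} [TopologicalSpace M] [ChartedSpace E' M]
    (f : N → M) (q₁ q₂ : M → N) (U : Set M) : Prop where
  holomorphic : ContMDiffOn 𝓘(ℂ, E') 𝓘(ℂ, E) ω q₁ U
  analytic : ContMDiffOn 𝓘(ℝ, E') 𝓘(ℝ, E) ω q₂ U
  antiholomorphic : ∀ x ∈ U, ∀ u : TangentSpace 𝓘(ℝ, E') x,
    rd (E := E') (E' := E) q₂ x (complexStructure E' M x u) = - complexStructure E N (q₂ x) (rd (E := E') (E' := E) q₂ x u)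
  retract₁ : ∀ p : N, q₁ (f p) = p
  retract₂ : ∀ p : N, q₂ (f p) = p
  transverse : ∀ x ∈ U, IsCompl (LinearMap.ker (rd (E := E') (E' := E) q₁ x).toLinearMap)
    (LinearMap.ker (rd (E := E') (E' := E) q₂ x).toLinearMap)

/-- The tangent distribution to the fibres of `q`. -/
def fibreDistribution (E E' : Type*) [NormedAddCommGroup E] [NormedSpace ℂ E]
    [NormedAddCommGroup E'] [NormedSpace ℂ E']
    {N : Type*} [TopologicalSpace N] [ChartedSpace E N]
    {M : Type*} [TopologicalSpace M] [ChartedSpace E' M] (q : M → N) (x : M) : Submodule ℝ (TangentSpace 𝓘(ℝ, E') x) :=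
  LinearMap.ker (rd (E := E') (E' := E) q x).toLinearMap

/-- The canonical complex bi-Lagrangian structure `(ω, ℱ₁, ℱ₂)` on the open set `U`: `ω = ω₀ᶜ` is the
holomorphic extension of the Kähler form, `ℱ₁` and `ℱ₂` are the canonical foliations, given by the
fibres of `q₁` (the vertical leaves `{z} × N̄`) and of `q₂` (the horizontal leaves `N × {w}`), and
`F` is the associated para-complex structure, with `+1` and `-1` eigendistributions `Tℱ₁`, `Tℱ₂`. -/
structure CanonicalBiLagrangian (E' : Type*) [NormedAddCommGroup E'] [NormedSpace ℂ E']
    {M : Type*} [TopologicalSpace M] [ChartedSpace E' M] [IsManifold 𝓘(ℂ, E') ω M]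
    (f : N → M) (g₀ : AnalyticMetric E N) (U : Set M) where
  q₁ : M → N
  q₂ : M → N
  om : CBilinField E' M
  F : EndoField E' M
  canonical : IsCanonicalChart E E' f q₁ q₂ U
  extension : IsHolomorphicExtensionOfBilin f (kahlerForm g₀) om U
  alternating : ∀ x ∈ U, ∀ u, om x u u = 0
  nondegenerate : ∀ x ∈ U, ∀ u, (∀ v, om x u v = 0) → u = 0
  closed : IsClosedOn om U
  isotropic₁ : ∀ x ∈ U, ∀ u ∈ fibreDistribution E E' q₁ x, ∀ v ∈ fibreDistribution E E' q₁ x,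
    om x (toC u) (toC v) = 0
  isotropic₂ : ∀ x ∈ U, ∀ u ∈ fibreDistribution E E' q₂ x, ∀ v ∈ fibreDistribution E E' q₂ x,
    om x (toC u) (toC v) = 0
  F_eigen₁ : ∀ x ∈ U, ∀ u ∈ fibreDistribution E E' q₁ x, F x u = u
  F_eigen₂ : ∀ x ∈ U, ∀ u ∈ fibreDistribution E E' q₂ x, F x u = -u

/-- The complex bi-Lagrangian metric, characterized by `ω(u, v) = g(F u, v)`, that is (since
`F ^ 2 = 1`) `g(u, v) = ω(F u, v)`. -/
def CanonicalBiLagrangian.metric {f : N → M} {g₀ : AnalyticMetric E N} {U : Set M}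
    (S : CanonicalBiLagrangian E' f g₀ U) (x : M) (u v : TangentSpace 𝓘(ℝ, E') x) : ℂ :=
  S.om x (toC (S.F x u)) (toC v)

/-- `(g, I, J, K)` is an admissible extension of the Kähler structure of `N` off `N`, where `om` is
the holomorphic extension of the Kähler form. -/
structure IsAdmissibleExtension (f : N → M) (g₀ : AnalyticMetric E N) (om : CBilinField E' M)
    (g : BilinField E' M) (I J K : EndoField E' M) (U : Set M) : Prop where
  hyperHermitian : IsAlmostHyperHermitianOn g I J K U
  J_eq : ∀ x ∈ U, J x = complexStructure E' M x
  g_extends : ∀ (p : N) (u v : TangentSpace 𝓘(ℝ, E) p),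
    g (f p) (rd (E := E) (E' := E') f p u) (rd (E := E) (E' := E') f p v) = g₀.inner p u v
  I_extends : ∀ (p : N) (u : TangentSpace 𝓘(ℝ, E) p),
    I (f p) (rd (E := E) (E' := E') f p u) = rd (E := E) (E' := E') f p (complexStructure E N p u)
  form_extends : ∀ (p : N) (u v : TangentSpace 𝓘(ℝ, E) p),
    g (f p) (I (f p) (rd (E := E) (E' := E') f p u)) (rd (E := E) (E' := E') f p v) = kahlerForm g₀ p u v
  complexification : ∀ x ∈ U, ∀ u v : TangentSpace 𝓘(ℝ, E') x,
    (g x (I x u) v : ℂ) - Complex.I * (g x (K x u) v : ℂ) = om x (toC u) (toC v)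

/-- The package of all canonical structures on the open set `U`: the canonical complex bi-Lagrangian
structure, its complex bi-Lagrangian connection `cov` (the Levi-Civita connection of the complex
bi-Lagrangian metric), the holomorphic extension `H = I₀ᶜ` of the complex structure of `N`, and an
almost hyper-Hermitian structure `(g, I, J, K)` which is admissible and is parallel for `cov` along
the vertical foliation `ℱ₁`. -/
structure CanonicalPackage (E' : Type*) [NormedAddCommGroup E'] [NormedSpace ℂ E']
    {M : Type*} [TopologicalSpace M] [ChartedSpace E' M] [IsManifold 𝓘(ℂ, E') ω M]
    (f : N → M) (g₀ : AnalyticMetric E N) (U : Set M)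
    extends CanonicalBiLagrangian E' f g₀ U where
  cov : ConnectionOp E' M
  H : CEndoField E' M
  g : BilinField E' M
  I : EndoField E' M
  J : EndoField E' M
  K : EndoField E' M
  cov_leviCivita : IsLeviCivitaOn cov toCanonicalBiLagrangian.metric U
  H_extension : IsHolomorphicExtensionOfComplexStructure E f H U
  admissible : IsAdmissibleExtension f g₀ om g I J K U
  g_parallel : IsParallelBilinAlong cov (fun x u v => g x u v) (fibreDistribution E E' q₁) U
  I_parallel : IsParallelEndoAlong cov I (fibreDistribution E E' q₁) U
  J_parallel : IsParallelEndoAlong cov J (fibreDistribution E E' q₁) U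
  K_parallel : IsParallelEndoAlong cov K (fibreDistribution E E' q₁) U

end Complexification

end BiquaternionicExtension

end

open scoped Manifold ContDiff
noncomputable section
namespace BiquaternionicExtension

/-! ### Linear algebra of bi-Lagrangian and hyperhermitian structures on a vector space -/

section LinearAlgebra

variable {T : Type*} [NormedAddCommGroup T] [NormedSpace ℂ T]

/-! Near `N` there is a holomorphic chart of `M` with values in `E × Ē` in which `N` is the totally
real subspace `{(z, z̄)}`. It is obtained by extending a real-analytic parametrisation of `N`
holomorphically and inverting it. Holomorphic extensions exist because Taylor coefficients can be
complexified (`exists_holomorphic_extension`). They are unique because a function satisfying the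
Cauchy-Riemann equations is determined by its values on a maximal totally real subspace
(`eventually_eq_zero_of_realIncl`). In such a chart the canonical projections are therefore the
projections to the two factors, `H` is the constant `(i, -i)`, and `ω` is the extension of the local
expression of `ω₀`. So the germs of these objects exist and are unique at each point of `N`, and
`exists_of_germs` glues them. The identities of a complex bi-Lagrangian structure hold at the real
points, since `ω₀` is closed and of type `(1,1)`, and the identity theorem propagates them
(`IsLocalModel.isJet`).

Construction of `I` and `g`. The para-complex structure is `F = HJ`; its eigenspaces `V₁` (for `+1`)
and `V₂` (for `-1`) are tangent to the two foliations. Let `B` be half the pull-back of `g₀` by the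
first projection, so that `V₁` is the kernel of `B`. Nondegeneracy of `Re ω` yields a unique `I` on
`V₂` with `Re ω(Iu, v) = -B(u, v)`. It maps `V₂` onto `V₁`, and `I² = -1` dictates `I` on `V₁`. Then
`g = B + B(I·, I·)` is positive definite, `I` anticommutes with `J` and with `F`, and `g(Iu, v) = Re
ω(u, v)`; with `K = IJ` the imaginary part of `ω` is accounted for as well
(`IsBiLagrangian.isHyperI`). The formula `hyperI` expresses `I` by inverses of invertible operators,
whence its smoothness.

Parallelism. The Koszul formula and `dω = 0` show that, in the directions of `ℱ₁`, the bi-Lagrangian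
connection annihilates the constant horizontal fields of the chart (`IsJet.koszul_zero`) and
preserves `ω`. As `B` is pulled back from the space of vertical leaves, `B` is parallel along `ℱ₁`,
and so are `I` and `g`, which are built from `B` and `ω` (`parallel_modelI`, `parallel_modelG`).

Uniqueness. At the points of `N`, `I` is fixed by its restriction to `TN` and antilinearity, and `g
= -Re ω(I·, ·)`. Along a vertical leaf, evaluate on constant horizontal fields: by parallelism `g(u,
v)` and `ω(F I u, I v)` are constant. The second quantity vanishes on `N`, hence everywhere, which
forces `I` to map `V₂` into `V₁` (`swap_of_isotropic`). The first fixes `g` on `V₂`. These two facts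
determine `g` and `I` (`IsBiLagrangian.unique`, `IsLocalModel.package_eq`).

Biquaternionic relations. Since `H = -JF` and `I` anticommutes with both `J` and `F`, `H` commutes
with `I`, and it commutes with `J` by complex linearity. Orthogonality of `F`, hence of `H`, follows
from `g = -Re ω(I·, ·)`. Finally `HK = IF`, and the traces vanish by anticommutation with `I`. -/

lemma eq_zero_of_eq_neg {T : Type*} [AddCommGroup T] [Module ℝ T] {u : T} (hu : u = -u) :
    u = 0 := by
  have : (2 : ℝ) • u = 0 := by
    rw [two_smul]
    nth_rw 2 [hu]
    exact add_neg_cancel u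
  simpa using this

/-- The real part of a complex bilinear form. -/
def realPart (om : T →L[ℂ] T →L[ℂ] ℂ) : T →L[ℝ] T →L[ℝ] ℝ :=
  ((ContinuousLinearMap.compL ℝ T ℂ ℝ Complex.reCLM).comp
    (ContinuousLinearMap.restrictScalarsL ℂ T ℂ ℝ ℝ)).comp (om.restrictScalars ℝ)

@[simp] lemma realPart_apply (om : T →L[ℂ] T →L[ℂ] ℂ) (u v : T) :
    realPart om u v = (om u v).re := rfl

/-- The projection onto the `+1` eigenspace of an involution. -/
def projPlus (F : T →L[ℝ] T) : T →L[ℝ] T := (1 / 2 : ℝ) • (ContinuousLinearMap.id ℝ T + F)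

/-- The projection onto the `-1` eigenspace of an involution. -/
def projMinus (F : T →L[ℝ] T) : T →L[ℝ] T := (1 / 2 : ℝ) • (ContinuousLinearMap.id ℝ T - F)

lemma projPlus_apply (F : T →L[ℝ] T) (u : T) : projPlus F u = (1 / 2 : ℝ) • (u + F u) := rfl

lemma projMinus_apply (F : T →L[ℝ] T) (u : T) : projMinus F u = (1 / 2 : ℝ) • (u - F u) := rfl

/-- Right composition of both arguments: the form `(u, v) ↦ R (A u) (A' v)`. -/
def pullForm (R : T →L[ℝ] T →L[ℝ] ℝ) (A A' : T →L[ℝ] T) : T →L[ℝ] T →L[ℝ] ℝ :=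
  ((ContinuousLinearMap.compL ℝ T T ℝ).flip A').comp (R.comp A)

@[simp] lemma pullForm_apply (R : T →L[ℝ] T →L[ℝ] ℝ) (A A' : T →L[ℝ] T) (u v : T) :
    pullForm R A A' u v = R (A u) (A' v) := rfl

/-- The complex structure `I` of the hyperhermitian structure determined by a complex bi-Lagrangian
structure `(om, F)`, a semi-definite Hermitian form `B` with kernel the `+1` eigenspace of `F`, and
a Hermitian form `S` which coincides with `B` on the `-1` eigenspace. -/
def hyperI (om : T →L[ℂ] T →L[ℂ] ℂ) (F : T →L[ℝ] T) (B S : T →L[ℝ] T →L[ℝ] ℝ) : T →L[ℝ] T :=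
  S.inverse.comp (pullForm (realPart om) (projPlus F) (projMinus F)) - (realPart om).inverse.comp B

/-- The metric `B + B(I, I)`. -/
def hyperG (om : T →L[ℂ] T →L[ℂ] ℂ) (F : T →L[ℝ] T) (B S : T →L[ℝ] T →L[ℝ] ℝ) :
    T →L[ℝ] T →L[ℝ] ℝ :=
  B + pullForm B (hyperI om F B S) (hyperI om F B S)

/-- A complex bi-Lagrangian structure on a complex vector space: a symplectic form and an involution
with Lagrangian eigenspaces. -/
structure IsBiLagrangian (om : T →L[ℂ] T →L[ℂ] ℂ) (F : T →L[ℝ] T) : Prop where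
  alt : ∀ u, om u u = 0
  nondeg : ∀ u, (∀ v, om u v = 0) → u = 0
  F_sq : ∀ u, F (F u) = u
  F_smul_I : ∀ u, F (Complex.I • u) = Complex.I • F u
  om_F : ∀ u v, om (F u) v = - om u (F v)

/-- The compatibility conditions for `hyperI`. -/
structure IsHermitianPair (F : T →L[ℝ] T) (B S : T →L[ℝ] T →L[ℝ] ℝ) : Prop where
  B_symm : ∀ u v, B u v = B v u
  B_I : ∀ u v, B (Complex.I • u) (Complex.I • v) = B u v
  B_F : ∀ u v, B (F u) v = - B u v
  S_symm : ∀ u v, S u v = S v u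
  S_I : ∀ u v, S (Complex.I • u) (Complex.I • v) = S u v
  S_F : ∀ u v, S (F u) (F v) = S u v
  S_pos : ∀ u, u ≠ 0 → 0 < S u u
  S_eq : ∀ u v, F u = -u → S u v = B u v

/-- A space and its dual have the same finite dimension, so nondegeneracy suffices. Invertibility
gives `ContinuousLinearMap.inverse` its intended meaning in `hyperI`. -/
lemma isInvertible_of_injective [FiniteDimensional ℝ T] {R : T →L[ℝ] T →L[ℝ] ℝ}
    (hR : ∀ u, (∀ v, R u v = 0) → u = 0) : R.IsInvertible := by
  have hinj : Function.Injective R.toLinearMap := by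
    rw [← LinearMap.ker_eq_bot, LinearMap.ker_eq_bot']
    intro u hu
    exact hR u fun v => by
      have := congrArg (fun L : T →L[ℝ] ℝ => L v) hu
      simpa using this
  have hdim : Module.finrank ℝ T = Module.finrank ℝ (T →L[ℝ] ℝ) := by
    rw [LinearEquiv.finrank_eq (LinearMap.toContinuousLinearMap (𝕜 := ℝ) (E := T) (F' := ℝ)).symm]
    exact (Subspace.dual_finrank_eq (K := ℝ) (V := T)).symm
  refine ⟨(LinearEquiv.ofInjectiveOfFinrankEq R.toLinearMap hinj hdim).toContinuousLinearEquiv, ?_⟩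
  ext u v
  rfl

namespace IsBiLagrangian

variable {om : T →L[ℂ] T →L[ℂ] ℂ} {F : T →L[ℝ] T} (h : IsBiLagrangian om F)
include h

lemma skew (u v : T) : om u v = - om v u := by
  have := h.alt (u + v)
  simp only [map_add, add_apply, h.alt, zero_add, add_zero] at this
  linear_combination this

/-- Replacing `v` by `i v` turns the real part into the imaginary part up to sign. Thus equations
for real parts alone can define real-linear maps such as `I`. -/
lemma re_nondeg (u : T) (hu : ∀ v, (om u v).re = 0) : u = 0 := by
  refine h.nondeg u fun v => Complex.ext (hu v) ?_
  have := hu (Complex.I • v)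
  simpa using this

lemma eq_of_re {u u' : T} (hu : ∀ v, (om u v).re = (om u' v).re) : u = u' := by
  refine sub_eq_zero.1 (h.re_nondeg _ fun v => ?_)
  simp [hu v]

lemma isInvertible_realPart [FiniteDimensional ℝ T] : (realPart om).IsInvertible :=
  isInvertible_of_injective fun u hu => h.re_nondeg u hu

lemma isotropic_plus {u v : T} (hu : F u = u) (hv : F v = v) : om u v = 0 := by
  have := h.om_F u v
  rw [hu, hv] at this
  linear_combination this / 2

lemma isotropic_minus {u v : T} (hu : F u = -u) (hv : F v = -v) : om u v = 0 := by
  have := h.om_F u v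
  rw [hu, hv] at this
  simp only [map_neg, neg_apply, neg_neg] at this
  linear_combination -this / 2

lemma F_projPlus (u : T) : F (projPlus F u) = projPlus F u := by
  rw [projPlus_apply, map_smul, map_add, h.F_sq, add_comm]

lemma F_projMinus (u : T) : F (projMinus F u) = - projMinus F u := by
  rw [projMinus_apply, map_smul, map_sub, h.F_sq, ← smul_neg, neg_sub]

omit h in
lemma projPlus_add_projMinus (u : T) : projPlus F u + projMinus F u = u := by
  rw [projPlus_apply, projMinus_apply]
  module

omit h in
lemma projPlus_of_plus {u : T} (hu : F u = u) : projPlus F u = u := by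
  rw [projPlus_apply, hu]; module

lemma om_projPlus (u v : T) : om (projPlus F u) v = om (projPlus F u) (projMinus F v) := by
  conv_lhs => rw [← projPlus_add_projMinus (F := F) v]
  rw [map_add, h.isotropic_plus (h.F_projPlus u) (h.F_projPlus v), zero_add]

lemma om_projMinus (u v : T) : om (projMinus F u) v = om (projMinus F u) (projPlus F v) := by
  conv_lhs => rw [← projPlus_add_projMinus (F := F) v]
  rw [map_add, h.isotropic_minus (h.F_projMinus u) (h.F_projMinus v), add_zero]

variable [FiniteDimensional ℝ T] {B S : T →L[ℝ] T →L[ℝ] ℝ} (h' : IsHermitianPair F B S)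
include h'

omit h [FiniteDimensional ℝ T] in
lemma B_F_right (u v : T) : B u (F v) = - B u v := by
  rw [h'.B_symm, h'.B_F, h'.B_symm]

omit h [FiniteDimensional ℝ T] in
lemma B_plus {u : T} (v : T) (hu : F u = u) : B u v = 0 := by
  have := h'.B_F u v
  rw [hu] at this
  linarith

omit h [FiniteDimensional ℝ T] in
lemma B_smul_I (u v : T) : B (Complex.I • u) v = - B u (Complex.I • v) := by
  rw [← h'.B_I u, smul_smul, Complex.I_mul_I]
  simp

omit h [FiniteDimensional ℝ T] in
lemma S_smul_I (u v : T) : S (Complex.I • u) v = - S u (Complex.I • v) := by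
  rw [← h'.S_I u, smul_smul, Complex.I_mul_I]
  simp

omit h [FiniteDimensional ℝ T] in
lemma S_nondeg {u u' : T} (hu : ∀ v, S u v = S u' v) : u = u' := by
  by_contra hne
  have := h'.S_pos _ (sub_ne_zero.2 hne)
  have h2 := hu (u - u')
  simp only [map_sub, sub_apply] at this h2
  linarith

omit h in
lemma isInvertible_S : S.IsInvertible :=
  isInvertible_of_injective fun u hu => S_nondeg h' (u' := 0) (by simpa using hu)

omit h' in
/-- The part `V₂ → V₁` of `hyperI`. -/
lemma exists_lower (B : T →L[ℝ] T →L[ℝ] ℝ) : ∃ A : T →L[ℝ] T, A = - (realPart om).inverse.comp B ∧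
    ∀ u v, (om (A u) v).re = - B u v := by
  refine ⟨_, rfl, fun u v => ?_⟩
  have := h.isInvertible_realPart.self_apply_inverse (B u)
  have h2 := congrArg (fun L : T →L[ℝ] ℝ => L v) this
  simp only [realPart_apply] at h2
  simp [h2]

/-- The part `V₁ → V₂` of `hyperI`. -/
lemma exists_upper : ∃ C : T →L[ℝ] T,
    C = S.inverse.comp (pullForm (realPart om) (projPlus F) (projMinus F)) ∧
    ∀ u v, S (C u) v = (om (projPlus F u) v).re := by
  refine ⟨_, rfl, fun u v => ?_⟩
  have := (isInvertible_S h').self_apply_inverse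
    (pullForm (realPart om) (projPlus F) (projMinus F) u)
  have h2 := congrArg (fun L : T →L[ℝ] ℝ => L v) this
  simp only [pullForm_apply, realPart_apply] at h2
  simp only [ContinuousLinearMap.coe_comp, Function.comp_apply]
  rw [h2, h.om_projPlus u v]

/-- The decomposition of `hyperI` with its algebraic properties. -/
lemma hyperI_split : ∃ A C : T →L[ℝ] T, (∀ u, hyperI om F B S u = A u + C u) ∧
    (∀ u v, (om (A u) v).re = - B u v) ∧ (∀ u v, S (C u) v = (om (projPlus F u) v).re) ∧
    (∀ u, F (A u) = A u) ∧ (∀ u, A (F u) = - A u) ∧ (∀ u, F (C u) = - C u) ∧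
    (∀ u, C (F u) = C u) ∧ (∀ u, A (Complex.I • u) = - (Complex.I • A u)) ∧
    (∀ u, C (Complex.I • u) = - (Complex.I • C u)) ∧ (∀ u, A (A u) = 0) ∧ (∀ u, C (C u) = 0) ∧
    (∀ u, C (A u) = - projMinus F u) ∧ (∀ u, A (C u) = - projPlus F u) := by
  obtain ⟨A, hA', hA⟩ := h.exists_lower B
  obtain ⟨C, hC', hC⟩ := h.exists_upper h'
  have FA : ∀ u, F (A u) = A u := fun u => h.eq_of_re fun v => by
    rw [h.om_F, Complex.neg_re, hA, hA, B_F_right h', neg_neg]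
  have AF : ∀ u, A (F u) = - A u := fun u => h.eq_of_re fun v => by
    rw [hA, h'.B_F, map_neg, neg_apply, Complex.neg_re, hA]
  have FC : ∀ u, F (C u) = - C u := fun u => S_nondeg h' fun v => by
    have : S (F (C u)) v = S (C u) (F v) := by
      rw [← h'.S_F (C u), h.F_sq]
    rw [this, hC, map_neg, neg_apply, hC]
    have h3 := h.om_F (projPlus F u) v
    rw [h.F_projPlus] at h3
    rw [h3]
    simp
  have CF : ∀ u, C (F u) = C u := fun u => S_nondeg h' fun v => by
    have : projPlus F (F u) = projPlus F u := by
      rw [projPlus_apply, h.F_sq, projPlus_apply, add_comm]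
    rw [hC, hC, this]
  -- `A` has values in the `+1` eigenspace, where `AF` makes it vanish. Symmetrically, `C` has
  -- values in the `-1` eigenspace and vanishes there.
  have AA : ∀ u, A (A u) = 0 := fun u => by
    have : A (A u) = - A (A u) := by
      conv_lhs => rw [← FA u, AF]
    exact eq_zero_of_eq_neg this
  have CC : ∀ u, C (C u) = 0 := fun u => by
    have : C (C u) = - C (C u) := by
      conv_lhs => rw [← CF (C u), FC, map_neg]
    exact eq_zero_of_eq_neg this
  refine ⟨A, C, fun u => ?_, hA, hC, FA, AF, FC, CF, fun u => ?_, fun u => ?_, AA, CC,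
    fun u => ?_, fun u => ?_⟩
  · rw [hA', hC', hyperI]
    simp only [sub_apply, neg_apply]
    abel
  · refine h.eq_of_re fun v => ?_
    have h1 := hA u (Complex.I • v)
    rw [hA, B_smul_I h', neg_neg]
    simp only [map_smul, smul_eq_mul] at h1
    simp only [map_neg, map_smul, neg_apply, smul_apply,
      smul_eq_mul, Complex.neg_re]
    linarith
  · refine S_nondeg h' fun v => ?_
    have h1 := hC u (Complex.I • v)
    have h3 : projPlus F (Complex.I • u) = Complex.I • projPlus F u := by
      rw [projPlus_apply, projPlus_apply, h.F_smul_I, ← smul_add, smul_comm]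
    rw [hC, map_neg, neg_apply, S_smul_I h', h1, h3]
    simp
  -- Since `A u` is in the `+1` eigenspace, the projection in the definition of `C` disappears, and
  -- `C (A u)` is governed by `-B u`, which is `-S` of the `-1` component of `u`. The last bullet is
  -- the mirror computation.
  · refine S_nondeg h' fun v => ?_
    rw [hC, projPlus_of_plus (FA u), map_neg, neg_apply, hA,
      h'.S_eq _ _ (h.F_projMinus u)]
    rw [projMinus_apply, map_smul, map_sub]
    simp only [smul_apply, sub_apply, h'.B_F, smul_eq_mul]
    ring
  · refine h.eq_of_re fun v => ?_
    rw [hA, ← h'.S_eq _ _ (FC u), hC]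
    simp

/-- `hyperI` is the quaternionic structure associated with `B`. -/
structure IsHyperI (om : T →L[ℂ] T →L[ℂ] ℂ) (F : T →L[ℝ] T) (B : T →L[ℝ] T →L[ℝ] ℝ)
    (I : T →L[ℝ] T) : Prop where
  sq : ∀ u, I (I u) = -u
  smul_I : ∀ u, I (Complex.I • u) = - (Complex.I • I u)
  F_comm : ∀ u, I (F u) = - F (I u)
  re_om : ∀ u v, B (I u) v - B u (I v) = (om u v).re
  re_om_minus : ∀ u v, F u = -u → (om (I u) v).re = - B u v
  definite : ∀ u, B u u + B (I u) (I u) = 0 → u = 0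
  nonneg : ∀ u, 0 ≤ B u u

/-- `B` is `S` evaluated on the `-1` components, so it is nonnegative and its null vectors are
exactly the `+1` eigenvectors. If `u` and `I u` are both null, then `I u = C u` lies in both
eigenspaces, hence vanishes, and `u = -I (I u) = 0`. -/
lemma isHyperI : IsHyperI om F B (hyperI om F B S) := by
  obtain ⟨A, C, hI, hA, hC, FA, AF, FC, CF, AI, CI, AA, CC, CA, AC⟩ := h.hyperI_split h'
  have hB : ∀ u, B u u = S (projMinus F u) (projMinus F u) := fun u => by
    rw [h'.S_eq _ _ (h.F_projMinus u), projMinus_apply]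
    simp only [map_smul, map_sub, smul_apply, sub_apply,
      h'.B_F, smul_eq_mul, B_F_right h']
    ring
  have hpos : ∀ u, 0 ≤ B u u := fun u => by
    rw [hB]
    by_cases h0 : projMinus F u = 0
    · simp [h0]
    · exact (h'.S_pos _ h0).le
  have hzero : ∀ u, B u u = 0 → F u = u := fun u hu => by
    rw [hB] at hu
    have h0 : projMinus F u = 0 := by
      by_contra h0
      exact (h'.S_pos _ h0).ne' hu
    have h1 := h.F_projPlus u
    have h2 := projPlus_add_projMinus (F := F) u
    rw [h0, add_zero] at h2
    rwa [h2] at h1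
  have sq : ∀ u, hyperI om F B S (hyperI om F B S u) = -u := fun u => by
    rw [hI, hI u, map_add, map_add, AA, CC, CA, AC, zero_add, add_zero, ← neg_add,
      projPlus_add_projMinus]
  have hminus : ∀ u, F u = -u → C u = 0 := fun u hu => by
    have := CF u
    rw [hu, map_neg] at this
    exact eq_zero_of_eq_neg this.symm
  have hplus : ∀ u, F u = u → A u = 0 := fun u hu => by
    have := AF u
    rw [hu] at this
    exact eq_zero_of_eq_neg this
  refine ⟨sq, fun u => ?_, fun u => ?_, fun u v => ?_, fun u v hu => ?_, fun u hu => ?_, hpos⟩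
  · rw [hI, hI, AI, CI, smul_add, neg_add]
  · rw [hI, hI, AF, CF, map_add, FA, FC]
    abel
  · have h1 : ∀ u v, B (hyperI om F B S u) v = S (C u) v := fun u v => by
      rw [hI, map_add, add_apply, B_plus h' v (FA u), zero_add,
        h'.S_eq _ _ (FC u)]
    -- The two terms give the contributions to `Re om u v` of the `+1` and the `-1` component of
    -- `u`; the second one needs the skewness of `om` and the isotropy of the eigenspaces.
    rw [h'.B_symm u, h1, h1, hC, hC]
    have h2 : (om (projPlus F v) u) = - om (projMinus F u) v := by
      rw [h.om_projPlus, h.skew, ← h.om_projMinus]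
    rw [h2, Complex.neg_re, sub_neg_eq_add, ← Complex.add_re, ← add_apply,
      ← map_add, projPlus_add_projMinus]
  · rw [hI, hminus u hu, add_zero, hA]
  · have h1 := hpos u
    have h2 := hpos (hyperI om F B S u)
    have h3 := hzero u (by linarith)
    have h4 := hzero _ (show B (hyperI om F B S u) (hyperI om F B S u) = 0 by linarith)
    rw [hI, hplus u h3, zero_add, FC] at h4
    have h5 : C u = 0 := eq_zero_of_eq_neg h4.symm
    have h6 := sq u
    rw [hI u, hplus u h3, h5] at h6
    simpa using h6.symm

omit h h' [FiniteDimensional ℝ T] in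
/-- Pointwise uniqueness: a metric and an orthogonal complex structure which are compatible with a
bi-Lagrangian structure are determined by the metric on the `-1` eigenspace, when they exchange
the eigenspaces. -/
lemma unique (h : IsBiLagrangian om F) {g g' : T →L[ℝ] T →L[ℝ] ℝ} {I I' : T →L[ℝ] T}
    (hI : ∀ u, I (I u) = -u) (hI' : ∀ u, I' (I' u) = -u)
    (hg : ∀ u v, g (I u) v = (om u v).re) (hg' : ∀ u v, g' (I' u) v = (om u v).re)
    (ho : ∀ u v, g (I u) (I v) = g u v)
    (hpos : ∀ u, g u u = 0 → u = 0)
    (hF : ∀ u, F u = -u → F (I u) = I u) (hF' : ∀ u, F u = -u → F (I' u) = I' u)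
    (heq : ∀ u v, F u = -u → F v = -v → g u v = g' u v) :
    g = g' ∧ I = I' ∧ ∀ u, I (F u) = - F (I u) := by
  have hminus : ∀ u, F u = -u → I u = I' u := fun u hu => h.eq_of_re fun v => by
    conv_lhs => rw [← projPlus_add_projMinus (F := F) v]
    conv_rhs => rw [← projPlus_add_projMinus (F := F) v]
    rw [map_add, map_add, h.isotropic_plus (hF u hu) (h.F_projPlus v),
      h.isotropic_plus (hF' u hu) (h.F_projPlus v), zero_add, zero_add, ← hg, ← hg', hI, hI',
      map_neg, map_neg, neg_apply, neg_apply,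
      heq _ _ hu (h.F_projMinus v)]
  -- Decompose `I w = a + b` along the eigenspaces. From `I a + I b = -w` and `I b ∈ V₁` one gets `I
  -- a ∈ V₁`. Then `g(a, a) = g(I a, I a) = Re om a (I a) = 0` by isotropy, so `a = 0`.
  have hswap : ∀ w, F w = w → F (I w) = - I w := fun w hw => by
    have h1 : F (I (projMinus F (I w))) = I (projMinus F (I w)) := hF _ (h.F_projMinus _)
    have h2 : I (projPlus F (I w)) + I (projMinus F (I w)) = -w := by
      rw [← map_add, projPlus_add_projMinus, hI]
    have h3 : F (I (projPlus F (I w))) = I (projPlus F (I w)) := by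
      rw [eq_sub_of_add_eq h2, map_sub, map_neg, hw, h1]
    have h4 : projPlus F (I w) = 0 := hpos _ (by
      rw [← ho, hg, h.isotropic_plus (h.F_projPlus _) h3, Complex.zero_re])
    have h5 := h.F_projMinus (I w)
    have h6 := projPlus_add_projMinus (F := F) (I w)
    rw [h4, zero_add] at h6
    rwa [h6] at h5
  have hplus : ∀ w, F w = w → I w = I' w := fun w hw => by
    have h1 := hminus _ (hswap w hw)
    rw [hI] at h1
    have h2 := hI' (I w)
    rw [← h1, map_neg] at h2
    exact (neg_inj.1 h2).symm
  have hII : ∀ u, I u = I' u := fun u => by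
    rw [← projPlus_add_projMinus (F := F) u, map_add, map_add, hplus _ (h.F_projPlus u),
      hminus _ (h.F_projMinus u)]
  refine ⟨?_, ContinuousLinearMap.ext hII, fun u => ?_⟩
  · ext u v
    have h1 : ∀ u v, g u v = - (om (I u) v).re := fun u v => by rw [← hg, hI]; simp
    have h2 : ∀ u v, g' u v = - (om (I' u) v).re := fun u v => by rw [← hg', hI']; simp
    rw [h1, h2, hII]
  · conv_lhs => rw [← projPlus_add_projMinus (F := F) u]
    conv_rhs => rw [← projPlus_add_projMinus (F := F) u]
    simp only [map_add, h.F_projPlus, h.F_projMinus, map_neg, hswap _ (h.F_projPlus u),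
      hF _ (h.F_projMinus u)]
    abel

omit h h' [FiniteDimensional ℝ T] in
/-- If `om (F I u) (I v) = 0` for `u`, `v` in the `-1` eigenspace `V₂`, then `I` maps `V₂` to the
`+1` eigenspace. -/
lemma swap_of_isotropic {om : T →L[ℂ] T →L[ℂ] ℂ} {F : T →L[ℝ] T} (h : IsBiLagrangian om F)
    {g : T →L[ℝ] T →L[ℝ] ℝ} {I : T →L[ℝ] T}
    (hI : ∀ u, I (I u) = -u) (hg : ∀ u v, g (I u) v = (om u v).re)
    (hsymm : ∀ u v, g u v = g v u) (hpos : ∀ u, g u u = 0 → u = 0)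
    (hiso : ∀ u v, F u = -u → F v = -v → (om (F (I u)) (I v)).re = 0)
    {u : T} (hu : F u = -u) : F (I u) = I u := by
  have h1 : ∀ v, F v = -v → (om (I u) (I v)).re = 0 := fun v hv => by
    rw [← hg, hI, map_neg, neg_apply, hsymm, hg, h.isotropic_minus hv hu]
    simp
  -- Both `Re om (I u) (I v)` and `Re om (F (I u)) (I v)` vanish, hence so does their
  -- half-difference, which is `g` of the `-1` component of `I u` with `v` up to sign. Testing on
  -- that component kills it.
  have h2 : ∀ v, F v = -v → g (projMinus F (I u)) v = 0 := fun v hv => by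
    have h3 : (om (projMinus F (I u)) (I v)).re = 0 := by
      rw [projMinus_apply]
      rw [← realPart_apply]
      simp [hiso u v hu hv, h1 v hv]
    have h4 := hg (I v) (projMinus F (I u))
    rw [hI, map_neg, neg_apply, h.skew, Complex.neg_re, h3, hsymm] at h4
    linarith
  have h3 := hpos _ (h2 _ (h.F_projMinus (I u)))
  have h5 := h.F_projPlus (I u)
  have h6 := projPlus_add_projMinus (F := F) (I u)
  rw [h3, add_zero] at h6
  rwa [h6] at h5

end IsBiLagrangian

end LinearAlgebra

end BiquaternionicExtension
end

open scoped Manifold ContDiff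
noncomputable section
namespace BiquaternionicExtension

/-! ### The standard complexification of a complex vector space -/

section StandardComplexification

open Filter Topology

/-- A model of the complex conjugate of the vector space `E`. -/
abbrev ConjModel (E : Type*) [NormedAddCommGroup E] [NormedSpace ℂ E] : Type :=
  Fin (Module.finrank ℂ E) → ℂ

/-- The standard complexification `E × Ē` of the complex vector space `E`. -/
abbrev StdComplexification (E : Type*) [NormedAddCommGroup E] [NormedSpace ℂ E] : Type _ :=
  E × ConjModel E

variable (E : Type*) [NormedAddCommGroup E] [NormedSpace ℂ E] [FiniteDimensional ℂ E]

/-- The real-linear equivalence underlying a complex-linear one. -/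
def realEquiv {V W : Type*} [NormedAddCommGroup V] [NormedSpace ℂ V] [NormedAddCommGroup W]
    [NormedSpace ℂ W] (e : V ≃L[ℂ] W) : V ≃L[ℝ] W :=
  { e.toLinearEquiv.restrictScalars ℝ with
    continuous_toFun := e.continuous
    continuous_invFun := e.symm.continuous }

@[simp] lemma realEquiv_apply {V W : Type*} [NormedAddCommGroup V] [NormedSpace ℂ V]
    [NormedAddCommGroup W] [NormedSpace ℂ W] (e : V ≃L[ℂ] W) (v : V) : realEquiv e v = e v := rfl

/-- The antilinear isomorphism from `E` to its complex conjugate. -/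
def conjEquiv : E ≃L[ℝ] ConjModel E :=
  (realEquiv (Module.finBasis ℂ E).equivFunL).trans
    (ContinuousLinearEquiv.piCongrRight (M := fun _ => ℂ) (N := fun _ => ℂ)
      fun _ => Complex.conjCLE)

variable {E}

lemma conjEquiv_smul_I (x : E) : conjEquiv E (Complex.I • x) = -(Complex.I • conjEquiv E x) := by
  ext j
  simp [conjEquiv]

lemma conjEquiv_symm_smul_I (w : ConjModel E) :
    (conjEquiv E).symm (Complex.I • w) = -(Complex.I • (conjEquiv E).symm w) := by
  apply (conjEquiv E).injective
  rw [map_neg, conjEquiv_smul_I]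
  simp

variable (E) in
/-- The embedding of `E` in its complexification as a totally real subspace. -/
def realIncl : E →L[ℝ] StdComplexification E :=
  (ContinuousLinearMap.id ℝ E).prod (conjEquiv E : E →L[ℝ] ConjModel E)

@[simp] lemma realIncl_apply (x : E) : realIncl E x = (x, conjEquiv E x) := rfl

variable (E) in
/-- The real part of a vector in the complexification. -/
def stdRe : StdComplexification E →L[ℝ] E :=
  (1 / 2 : ℝ) • (ContinuousLinearMap.fst ℝ E (ConjModel E) +
    ((conjEquiv E).symm : ConjModel E →L[ℝ] E).comp (ContinuousLinearMap.snd ℝ E (ConjModel E)))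

variable (E) in
/-- The imaginary part of a vector in the complexification. -/
def stdIm : StdComplexification E →L[ℝ] E :=
  (-(Complex.I / 2)) • (ContinuousLinearMap.fst ℝ E (ConjModel E) -
    ((conjEquiv E).symm : ConjModel E →L[ℝ] E).comp (ContinuousLinearMap.snd ℝ E (ConjModel E)))

lemma stdRe_apply (Z : StdComplexification E) :
    stdRe E Z = (1 / 2 : ℝ) • (Z.1 + (conjEquiv E).symm Z.2) := rfl

lemma stdIm_apply (Z : StdComplexification E) :
    stdIm E Z = (-(Complex.I / 2)) • (Z.1 - (conjEquiv E).symm Z.2) := rfl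

lemma stdRe_realIncl (x : E) : stdRe E (realIncl E x) = x := by
  simp only [stdRe_apply, realIncl_apply, ContinuousLinearEquiv.symm_apply_apply]
  module

lemma stdIm_realIncl (x : E) : stdIm E (realIncl E x) = 0 := by
  simp [stdIm_apply]

lemma I_smul_I_smul {V : Type*} [AddCommGroup V] [Module ℂ V] (x : V) :
    Complex.I • Complex.I • x = -x := by
  rw [smul_smul, Complex.I_mul_I, neg_one_smul]

lemma real_half_smul {V : Type*} [AddCommGroup V] [Module ℂ V] [Module ℝ V] [IsScalarTower ℝ ℂ V]
    (x : V) : (1 / 2 : ℝ) • x = (1 / 2 : ℂ) • x := by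
  rw [← algebraMap_smul ℂ (1 / 2 : ℝ) x]
  simp

lemma stdRe_smul_I (Z : StdComplexification E) : stdRe E (Complex.I • Z) = - stdIm E Z := by
  rw [stdRe_apply, stdIm_apply, Prod.smul_fst, Prod.smul_snd, conjEquiv_symm_smul_I, real_half_smul]
  module

lemma stdIm_smul_I (Z : StdComplexification E) : stdIm E (Complex.I • Z) = stdRe E Z := by
  rw [stdRe_apply, stdIm_apply, Prod.smul_fst, Prod.smul_snd, conjEquiv_symm_smul_I, real_half_smul,
    sub_neg_eq_add, ← smul_add, smul_smul]
  congr 1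
  linear_combination -(1 / 2 : ℂ) * Complex.I_mul_I

/-- This is total reality of the embedded copy of `E`. It reduces every identity between
complex-linear maps to real vectors. -/
lemma realIncl_re_add_im (Z : StdComplexification E) :
    realIncl E (stdRe E Z) + Complex.I • realIncl E (stdIm E Z) = Z := by
  have h : Complex.I • stdIm E Z = (1 / 2 : ℂ) • (Z.1 - (conjEquiv E).symm Z.2) := by
    rw [stdIm_apply, smul_smul]
    congr 1
    linear_combination -(1 / 2 : ℂ) * Complex.I_mul_I
  refine Prod.ext ?_ ?_
  · change stdRe E Z + Complex.I • stdIm E Z = Z.1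
    rw [h, stdRe_apply, real_half_smul]
    module
  · change conjEquiv E (stdRe E Z) + Complex.I • conjEquiv E (stdIm E Z) = Z.2
    have : Complex.I • conjEquiv E (stdIm E Z) = - conjEquiv E (Complex.I • stdIm E Z) := by
      rw [conjEquiv_smul_I, neg_neg]
    rw [this, h, stdRe_apply, ← map_neg, ← map_add, real_half_smul,
      ContinuousLinearEquiv.eq_symm_apply _ |>.1 ?_]
    module

variable {W : Type*} [NormedAddCommGroup W] [NormedSpace ℂ W]

lemma smul_eq_re_im {V : Type*} [AddCommGroup V] [Module ℂ V] [Module ℝ V] [IsScalarTower ℝ ℂ V]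
    (z : ℂ) (x : V) : z • x = z.re • x + z.im • (Complex.I • x) := by
  conv_lhs => rw [← Complex.re_add_im z]
  rw [add_smul, mul_smul, ← Complex.coe_algebraMap, algebraMap_smul, algebraMap_smul]

/-- The complex-linear extension of a real-linear map to the complexification. -/
def complexify (L : E →L[ℝ] W) : StdComplexification E →L[ℂ] W where
  toFun Z := L (stdRe E Z) + Complex.I • L (stdIm E Z)
  map_add' Z Z' := by simp only [map_add, smul_add]; abel
  map_smul' z Z := by
    have h1 : L (stdRe E (Complex.I • Z)) + Complex.I • L (stdIm E (Complex.I • Z)) =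
        Complex.I • (L (stdRe E Z) + Complex.I • L (stdIm E Z)) := by
      rw [stdRe_smul_I, stdIm_smul_I, smul_add, I_smul_I_smul, map_neg]
      abel
    have h2 := smul_eq_re_im z Z
    rw [RingHom.id_apply, smul_eq_re_im z (_ + _), ← h1, h2]
    simp only [map_add, map_smul, smul_add, smul_comm Complex.I (_ : ℝ)]
    abel
  cont := by
    have : Continuous fun Z => L (stdRe E Z) + Complex.I • L (stdIm E Z) := by fun_prop
    exact this

lemma complexify_apply (L : E →L[ℝ] W) (Z : StdComplexification E) :
    complexify L Z = L (stdRe E Z) + Complex.I • L (stdIm E Z) := rfl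

@[simp] lemma complexify_realIncl (L : E →L[ℝ] W) (x : E) :
    complexify L (realIncl E x) = L x := by
  rw [complexify_apply, stdRe_realIncl, stdIm_realIncl, map_zero, smul_zero, add_zero]

/-- Complex-linear maps which agree on the totally real subspace coincide. -/
lemma ext_of_realIncl {L L' : StdComplexification E →L[ℂ] W}
    (h : ∀ x, L (realIncl E x) = L' (realIncl E x)) : L = L' := by
  refine ContinuousLinearMap.ext fun Z => ?_
  rw [← realIncl_re_add_im Z, map_add, map_add, map_smul, map_smul, h, h]

/-! ### Holomorphic extension of real-analytic functions -/

/-- The coordinates of the complexification associated with a real basis. -/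
def stdCoord (k : Fin (Module.finrank ℝ E)) : StdComplexification E →L[ℂ] ℂ :=
  haveI : FiniteDimensional ℝ E := FiniteDimensional.complexToReal E
  complexify (Complex.ofRealCLM.comp ((Module.finBasis ℝ E).coord k).toContinuousLinearMap)

/-- The complexification of a real multilinear map. -/
def complexifyMultilinear {n : ℕ} (p : ContinuousMultilinearMap ℝ (fun _ : Fin n => E) W) :
    ContinuousMultilinearMap ℂ (fun _ : Fin n => StdComplexification E) W :=
  haveI : FiniteDimensional ℝ E := FiniteDimensional.complexToReal E
  ∑ s : Fin n → Fin (Module.finrank ℝ E),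
    ((ContinuousMultilinearMap.mkPiAlgebraFin ℂ n ℂ).compContinuousLinearMap
      fun j => stdCoord (E := E) (s j)).smulRight (p fun j => Module.finBasis ℝ E (s j))

lemma complexifyMultilinear_apply {n : ℕ}
    (p : ContinuousMultilinearMap ℝ (fun _ : Fin n => E) W) (Z : Fin n → StdComplexification E) :
    complexifyMultilinear p Z = ∑ s : Fin n → Fin (Module.finrank ℝ E),
      haveI : FiniteDimensional ℝ E := FiniteDimensional.complexToReal E
      (∏ j, stdCoord (s j) (Z j)) • p fun j => Module.finBasis ℝ E (s j) := by
  simp [complexifyMultilinear, List.prod_ofFn]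

/-- Each argument is expanded in the real basis used in the definition; on real vectors the
functions `stdCoord` are the real coordinates. -/
lemma complexifyMultilinear_realIncl {n : ℕ}
    (p : ContinuousMultilinearMap ℝ (fun _ : Fin n => E) W) (x : Fin n → E) :
    complexifyMultilinear p (fun j => realIncl E (x j)) = p x := by
  haveI : FiniteDimensional ℝ E := FiniteDimensional.complexToReal E
  rw [complexifyMultilinear_apply]
  have h1 : p x = p fun j => ∑ k, ((Module.finBasis ℝ E).repr (x j) k) • Module.finBasis ℝ E k := by
    congr 1
    ext1 j
    exact ((Module.finBasis ℝ E).sum_repr (x j)).symm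
  rw [h1, ContinuousMultilinearMap.map_sum]
  refine Finset.sum_congr rfl fun s _ => ?_
  rw [ContinuousMultilinearMap.map_smul_univ,
    ← algebraMap_smul ℂ (∏ i, (Module.finBasis ℝ E).repr (x i) (s i)), map_prod]
  congr 1
  refine Finset.prod_congr rfl fun j _ => ?_
  rw [stdCoord, complexify_realIncl]
  simp

/-- The constant depends on the basis only, neither on the degree nor on the map. A loss of
geometric size shrinks the radius of convergence but keeps it positive. -/
lemma norm_complexifyMultilinear_le : ∃ C : ℝ, 0 < C ∧ ∀ {n : ℕ}
    (p : ContinuousMultilinearMap ℝ (fun _ : Fin n => E) W),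
    ‖complexifyMultilinear p‖ ≤ ‖p‖ * C ^ n := by
  haveI : FiniteDimensional ℝ E := FiniteDimensional.complexToReal E
  set D : ℝ := ∑ k : Fin (Module.finrank ℝ E), ‖stdCoord (E := E) k‖ * ‖Module.finBasis ℝ E k‖
    with hD
  have hD0 : 0 ≤ D := Finset.sum_nonneg fun k _ => by positivity
  -- `D` itself is `0` when `E` is trivial, whereas the constant has to be positive.
  refine ⟨D + 1, by positivity, fun {n} p => ?_⟩
  refine ContinuousMultilinearMap.opNorm_le_bound (by positivity) fun Z => ?_
  rw [complexifyMultilinear_apply]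
  refine (norm_sum_le _ _).trans ?_
  have h1 : ∀ s : Fin n → Fin (Module.finrank ℝ E),
      ‖(∏ j, stdCoord (s j) (Z j)) • p fun j => Module.finBasis ℝ E (s j)‖ ≤
        (‖p‖ * ∏ j, ‖Z j‖) * ∏ j, (‖stdCoord (E := E) (s j)‖ * ‖Module.finBasis ℝ E (s j)‖) := by
    intro s
    rw [norm_smul, norm_prod]
    calc _ ≤ (∏ j, (‖stdCoord (E := E) (s j)‖ * ‖Z j‖)) *
          (‖p‖ * ∏ j, ‖Module.finBasis ℝ E (s j)‖) := by
          gcongr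
          · exact ContinuousLinearMap.le_opNorm _ _
          · exact p.le_opNorm _
      _ = _ := by
          simp only [Finset.prod_mul_distrib]
          ring
  refine (Finset.sum_le_sum fun s _ => h1 s).trans ?_
  rw [← Finset.mul_sum]
  have h2 : ∑ s : Fin n → Fin (Module.finrank ℝ E),
      ∏ j, (‖stdCoord (E := E) (s j)‖ * ‖Module.finBasis ℝ E (s j)‖) = D ^ n := by
    rw [hD, ← Fin.prod_const n, Finset.prod_univ_sum]
    simp
  rw [h2, mul_right_comm]
  gcongr
  linarith

/-- A real-analytic function on `E` extends to a holomorphic function on the complexification. -/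
lemma exists_holomorphic_extension [CompleteSpace W] {φ : E → W} {a : E} (hφ : AnalyticAt ℝ φ a) :
    ∃ Φ : StdComplexification E → W, AnalyticAt ℂ Φ (realIncl E a) ∧
      ∀ᶠ x in 𝓝 a, Φ (realIncl E x) = φ x := by
  obtain ⟨p, r, hp⟩ := hφ
  obtain ⟨C, hC0, hC⟩ := norm_complexifyMultilinear_le (E := E) (W := W)
  obtain ⟨D, ρ, hD, hρ, hle⟩ := p.le_mul_pow_of_radius_pos (hp.r_pos.trans_le hp.r_le)
  let q : FormalMultilinearSeries ℂ (StdComplexification E) W :=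
    fun n => complexifyMultilinear (p n)
  have hq : 0 < q.radius := by
    -- The coefficients of `p` are bounded by `D * ρ ^ n`, those of `q` by `D * (ρ * C) ^ n`; hence
    -- this lower bound for the radius of `q`.
    have h1 : (0 : ℝ) < 1 / (ρ * C) := by positivity
    have h2 : ((1 / (ρ * C)).toNNReal : ENNReal) ≤ q.radius := by
      refine q.le_radius_of_bound D fun n => ?_
      rw [Real.coe_toNNReal _ h1.le]
      calc ‖q n‖ * (1 / (ρ * C)) ^ n ≤ (D * ρ ^ n * C ^ n) * (1 / (ρ * C)) ^ n := by
            gcongr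
            exact (hC (p n)).trans (by gcongr; exact hle n)
        _ = D := by
            rw [one_div, inv_pow, mul_pow]
            field_simp
    refine lt_of_lt_of_le ?_ h2
    simpa using h1
  have hs := q.hasFPowerSeriesOnBall hq
  refine ⟨fun Z => q.sum (Z - realIncl E a), ?_, ?_⟩
  · have := hs.comp_sub (realIncl E a)
    rw [zero_add] at this
    exact this.analyticAt
  · have h1 : ∀ᶠ x in 𝓝 a, x ∈ Metric.eball a r := Metric.eball_mem_nhds _ hp.r_pos
    have h2 : ∀ᶠ x in 𝓝 a, realIncl E (x - a) ∈ Metric.eball (0 : StdComplexification E) q.radius := by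
      have : ContinuousAt (fun x => realIncl E (x - a)) a := by fun_prop
      refine this.preimage_mem_nhds ?_
      rw [sub_self, map_zero]
      exact Metric.eball_mem_nhds _ hq
    filter_upwards [h1, h2] with x hx1 hx2
    have h3 := hp.hasSum_sub hx1
    have h4 := hs.hasSum hx2
    rw [← map_sub]
    rw [zero_add] at h4
    refine h4.unique ?_
    convert h3 using 2 with n
    exact complexifyMultilinear_realIncl (p n) fun _ => x - a

/-! ### The identity theorem on the totally real subspace -/

/-- Only the diagonal values of the Taylor coefficients enter the sum of the series, and `n!` times
such a value is an iterated derivative. -/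
lemma eventually_eq_zero_of_iteratedFDeriv {V : Type*} [NormedAddCommGroup V] [NormedSpace ℝ V]
    {W : Type*} [NormedAddCommGroup W] [NormedSpace ℝ W] [CompleteSpace W]
    {G : V → W} {z : V} (hG : AnalyticAt ℝ G z)
    (h : ∀ n m, iteratedFDeriv ℝ n G z m = 0) : ∀ᶠ y in 𝓝 z, G y = 0 := by
  obtain ⟨p, r, hp⟩ := hG
  filter_upwards [Metric.eball_mem_nhds z hp.r_pos] with y hy
  have h1 := hp.hasSum_sub hy
  have h2 : ∀ n, p n (fun _ => y - z) = 0 := fun n => by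
    have := hp.factorial_smul (y - z) n
    rw [h n] at this
    have h3 : (n.factorial : ℝ) • p n (fun _ => y - z) = 0 := by
      rw [Nat.cast_smul_eq_nsmul]; exact this
    exact (smul_eq_zero.1 h3).resolve_left (by positivity)
  simp only [h2] at h1
  exact h1.unique hasSum_zero

/-- A real-analytic function which satisfies the Cauchy-Riemann equations and vanishes on the
totally real subspace vanishes identically near that subspace. -/
lemma eventually_eq_zero_of_realIncl [CompleteSpace W] {G : StdComplexification E → W} {a : E}
    (hG : AnalyticAt ℝ G (realIncl E a))
    (hCR : ∀ᶠ Z in 𝓝 (realIncl E a), ∀ v, fderiv ℝ G Z (Complex.I • v) = Complex.I • fderiv ℝ G Z v)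
    (h0 : ∀ᶠ x in 𝓝 a, G (realIncl E x) = 0) : ∀ᶠ Z in 𝓝 (realIncl E a), G Z = 0 := by
  have hr : Tendsto (realIncl E) (𝓝 a) (𝓝 (realIncl E a)) := (realIncl E).continuous.continuousAt
  refine eventually_eq_zero_of_iteratedFDeriv hG fun n => ?_
  -- The induction runs over all functions at once. If `G` satisfies the hypotheses, its
  -- differential vanishes at real points in real directions, and by Cauchy-Riemann in all
  -- directions. The function `fderiv ℝ G · v` again satisfies Cauchy-Riemann because second
  -- derivatives are symmetric, so the induction hypothesis applies to it.
  induction n generalizing G with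
  | zero =>
    intro m
    simpa using h0.self_of_nhds
  | succ n ih =>
    intro m
    have hd : ∀ᶠ x in 𝓝 a, ∀ v, fderiv ℝ G (realIncl E x) v = 0 := by
      filter_upwards [h0.eventually_nhds, hr.eventually hCR,
        hr.eventually hG.eventually_analyticAt] with x hx hx2 hx3 v
      have h1 : ∀ u, fderiv ℝ G (realIncl E x) (realIncl E u) = 0 := fun u => by
        have h2 : HasFDerivAt (fun y => G (realIncl E y))
            ((fderiv ℝ G (realIncl E x)).comp (realIncl E)) x :=
          hx3.differentiableAt.hasFDerivAt.comp x (realIncl E).hasFDerivAt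
        have h3 : HasFDerivAt (fun y => G (realIncl E y)) (0 : E →L[ℝ] W) x :=
          (hasFDerivAt_const (0 : W) x).congr_of_eventuallyEq hx
        exact congrArg (fun L : E →L[ℝ] W => L u) (h2.unique h3)
      rw [← realIncl_re_add_im v, map_add, hx2, h1, h1, smul_zero, add_zero]
    rw [iteratedFDeriv_succ_apply_right]
    set v := m (Fin.last n) with hv
    have h1 : iteratedFDeriv ℝ n (fun y => fderiv ℝ G y) (realIncl E a) (Fin.init m) v =
        iteratedFDeriv ℝ n (fun y => fderiv ℝ G y v) (realIncl E a) (Fin.init m) := by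
      have := (ContinuousLinearMap.apply ℝ W v).iteratedFDeriv_comp_left
        (f := fun y => fderiv ℝ G y) (x := realIncl E a) (n := ω) hG.fderiv.contDiffAt
        (i := n) le_top
      exact (congrArg (fun L : ContinuousMultilinearMap ℝ
        (fun _ : Fin n => StdComplexification E) W => L (Fin.init m)) this).symm
    rw [h1]
    have hG' : AnalyticAt ℝ (fun y => fderiv ℝ G y v) (realIncl E a) :=
      ((ContinuousLinearMap.apply ℝ W v).analyticAt _).comp hG.fderiv
    refine ih hG' ?_ (hd.mono fun x hx => hx v) (Fin.init m)
    filter_upwards [hCR.eventually_nhds, hG.eventually_analyticAt] with Z hZ hZa w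
    have hsymm : IsSymmSndFDerivAt ℝ G Z :=
      (hZa.contDiffAt (n := ω)).isSymmSndFDerivAt (by simp)
    have hD : ∀ t u, fderiv ℝ (fun y => fderiv ℝ G y u) Z t = fderiv ℝ (fderiv ℝ G) Z t u :=
      fun t u => by
        have := ((ContinuousLinearMap.apply ℝ W u).hasFDerivAt.comp Z
          hZa.fderiv.differentiableAt.hasFDerivAt).fderiv
        exact congrArg (fun L : StdComplexification E →L[ℝ] W => L t) this
    rw [hD, hD, hsymm.eq, ← hD, hsymm.eq w v, ← hD]
    have hEq : (fun y => fderiv ℝ G y (Complex.I • w)) =ᶠ[𝓝 Z]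
        fun y => Complex.I • fderiv ℝ G y w := hZ.mono fun y hy => hy w
    rw [hEq.fderiv_eq, fderiv_fun_const_smul]
    · rfl
    · exact (((ContinuousLinearMap.apply ℝ W w).analyticAt _).comp hZa.fderiv).differentiableAt

/-- The identity theorem for holomorphic functions on the complexification. -/
lemma eventually_eq_of_realIncl [CompleteSpace W] {G G' : StdComplexification E → W} {a : E}
    (hG : AnalyticAt ℂ G (realIncl E a)) (hG' : AnalyticAt ℂ G' (realIncl E a))
    (h0 : ∀ᶠ x in 𝓝 a, G (realIncl E x) = G' (realIncl E x)) :
    ∀ᶠ Z in 𝓝 (realIncl E a), G Z = G' Z := by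
  have h1 := hG.sub hG'
  have := eventually_eq_zero_of_realIncl (G := G - G') (h1.restrictScalars (𝕜 := ℝ)) ?_
    (h0.mono fun x hx => sub_eq_zero.2 hx)
  · exact this.mono fun Z hZ => sub_eq_zero.1 hZ
  · filter_upwards [h1.eventually_analyticAt] with Z hZ v
    rw [hZ.differentiableAt.fderiv_restrictScalars ℝ]
    simp

end StandardComplexification

end BiquaternionicExtension
end

open scoped Manifold ContDiff
noncomputable section
namespace BiquaternionicExtension

/-! ### Gluing germs along a subset -/

section Gluing

open Filter Topology

/-- Germs of functions given along a subset `S`, which are unique at the points of `S`, glue to a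
function. -/
lemma exists_of_germs {X D : Type*} [TopologicalSpace X] [RegularSpace X]
    [SecondCountableTopology X] [Nonempty D] (S : Set X) (P : (X → D) → X → Prop)
    (hlocal : ∀ d d' x, x ∈ S → P d x → d =ᶠ[𝓝 x] d' → P d' x)
    (hopen : ∀ d x, x ∈ S → P d x → ∀ᶠ y in 𝓝 x, y ∈ S → P d y)
    (huniq : ∀ d d' x, x ∈ S → P d x → P d' x → d =ᶠ[𝓝 x] d')
    (hex : ∀ x ∈ S, ∃ d, P d x) : ∃ d, ∀ x ∈ S, P d x := by
  classical
  rcases S.eq_empty_or_nonempty with rfl | ⟨s₀, hs₀⟩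
  · exact ⟨fun _ => Classical.arbitrary D, fun x hx => hx.elim⟩
  choose δ hδ using fun s : S => hex s s.2
  -- Control on the closure of `V` is essential: a point of `S` either lies in that closure, where
  -- uniqueness compares germs, or has a neighbourhood missing `V`.
  have hV : ∀ s : S, ∃ V : Set X, IsOpen V ∧ (s : X) ∈ V ∧
      ∀ y ∈ closure V, y ∈ S → P (δ s) y := fun s => by
    obtain ⟨C, ⟨hC, hCc⟩, hCs⟩ := (closed_nhds_basis (s : X)).mem_iff.1 (hopen _ _ s.2 (hδ s))
    refine ⟨interior C, isOpen_interior, mem_interior_iff_mem_nhds.2 hC, fun y hy => ?_⟩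
    exact hCs (closure_minimal interior_subset hCc hy)
  choose V hVo hVs hVP using hV
  obtain ⟨T, hT, hTV⟩ := TopologicalSpace.isOpen_iUnion_countable V hVo
  have hTne : T.Nonempty := by
    have : s₀ ∈ ⋃ s, V s := Set.mem_iUnion.2 ⟨⟨s₀, hs₀⟩, hVs _⟩
    rw [← hTV] at this
    obtain ⟨s, hs, _⟩ := Set.mem_iUnion₂.1 this
    exact ⟨s, hs⟩
  obtain ⟨e, rfl⟩ := hT.exists_eq_range hTne
  have hcover : ∀ s : S, ∃ n, (s : X) ∈ V (e n) := fun s => by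
    have : (s : X) ∈ ⋃ s, V s := Set.mem_iUnion.2 ⟨s, hVs _⟩
    rw [← hTV] at this
    simpa using this
  -- At each point the first member of the countable cover decides. Near a point of the `m`-th
  -- member only the indices up to `m` can be selected, so finitely many comparisons suffice.
  let d : X → D := fun x => if h : ∃ n, x ∈ V (e n) then δ (e (Nat.find h)) x else
    Classical.arbitrary D
  refine ⟨d, fun s hs => ?_⟩
  obtain ⟨m, hm⟩ := hcover ⟨s, hs⟩
  have hPm : P (δ (e m)) s := hVP _ _ (subset_closure hm) hs
  refine hlocal _ _ s hs hPm ?_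
  have hn : ∀ n ∈ Finset.range (m + 1), ∀ᶠ x in 𝓝 s, x ∈ V (e n) → δ (e m) x = δ (e n) x := by
    intro n _
    by_cases hsn : s ∈ closure (V (e n))
    · exact (huniq _ _ s hs hPm (hVP _ _ hsn hs)).mono fun x hx _ => hx
    · filter_upwards [isClosed_closure.isOpen_compl.mem_nhds hsn] with x hx hx2
      exact (hx (subset_closure hx2)).elim
  filter_upwards [(Filter.eventually_all_finset _).2 hn, (hVo _).mem_nhds hm] with x hx hxm
  have hex : ∃ n, x ∈ V (e n) := ⟨m, hxm⟩
  have hle : Nat.find hex ≤ m := Nat.find_min' hex hxm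
  simp only [d, dif_pos hex]
  exact hx _ (Finset.mem_range.2 (by omega)) (Nat.find_spec hex)

end Gluing

end BiquaternionicExtension
end

open scoped Manifold ContDiff
noncomputable section
namespace BiquaternionicExtension

/-! ### Charts with values in a normed space -/

section Charts

open Filter Topology

variable {𝕜 : Type*} [RCLike 𝕜]
  {E : Type*} [NormedAddCommGroup E] [NormedSpace 𝕜 E]
  {G : Type*} [NormedAddCommGroup G] [NormedSpace 𝕜 G]
  {G' : Type*} [NormedAddCommGroup G'] [NormedSpace 𝕜 G']
  {W : Type*} [NormedAddCommGroup W] [NormedSpace 𝕜 W]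
  {M : Type*} [TopologicalSpace M] [ChartedSpace E M]

/-- Analytic charts of the manifold `M` with values in a normed space `G`. -/
structure IsChart (𝕜 : Type*) [RCLike 𝕜] (E : Type*) [NormedAddCommGroup E] [NormedSpace 𝕜 E]
    {G : Type*} [NormedAddCommGroup G] [NormedSpace 𝕜 G]
    {M : Type*} [TopologicalSpace M] [ChartedSpace E M] (Θ : OpenPartialHomeomorph M G) :
    Prop where
  smooth : ContMDiffOn 𝓘(𝕜, E) 𝓘(𝕜, G) ω Θ Θ.source
  smooth_symm : ContMDiffOn 𝓘(𝕜, G) 𝓘(𝕜, E) ω Θ.symm Θ.target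

variable (𝕜 E) in
/-- The differential of a chart. -/
def dT (Θ : OpenPartialHomeomorph M G) (x : M) : E →L[𝕜] G := mfderiv 𝓘(𝕜, E) 𝓘(𝕜, G) Θ x

variable (𝕜 E) in
/-- The differential of the inverse of a chart. -/
def dS (Θ : OpenPartialHomeomorph M G) (y : G) : G →L[𝕜] E := mfderiv 𝓘(𝕜, G) 𝓘(𝕜, E) Θ.symm y

lemma isChart_chartAt [IsManifold 𝓘(𝕜, E) ω M] (x : M) : IsChart 𝕜 E (chartAt E x) :=
  ⟨contMDiffOn_chart, contMDiffOn_chart_symm⟩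

namespace IsChart

variable {Θ : OpenPartialHomeomorph M G} (hΘ : IsChart 𝕜 E Θ)
  {Θ' : OpenPartialHomeomorph M G'} (hΘ' : IsChart 𝕜 E Θ')
include hΘ

lemma contMDiffAt {x : M} (hx : x ∈ Θ.source) : ContMDiffAt 𝓘(𝕜, E) 𝓘(𝕜, G) ω Θ x :=
  hΘ.smooth.contMDiffAt (Θ.open_source.mem_nhds hx)

lemma contMDiffAt_symm {y : G} (hy : y ∈ Θ.target) : ContMDiffAt 𝓘(𝕜, G) 𝓘(𝕜, E) ω Θ.symm y :=
  hΘ.smooth_symm.contMDiffAt (Θ.open_target.mem_nhds hy)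

lemma mdifferentiable : Θ.MDifferentiable 𝓘(𝕜, E) 𝓘(𝕜, G) :=
  ⟨hΘ.smooth.mdifferentiableOn (by simp), hΘ.smooth_symm.mdifferentiableOn (by simp)⟩

lemma mdifferentiableAt {x : M} (hx : x ∈ Θ.source) : MDifferentiableAt 𝓘(𝕜, E) 𝓘(𝕜, G) Θ x :=
  hΘ.mdifferentiable.mdifferentiableAt hx

lemma mdifferentiableAt_symm {y : G} (hy : y ∈ Θ.target) :
    MDifferentiableAt 𝓘(𝕜, G) 𝓘(𝕜, E) Θ.symm y :=
  hΘ.mdifferentiable.mdifferentiableAt_symm hy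

lemma dS_dT {x : M} (hx : x ∈ Θ.source) (v : E) : dS 𝕜 E Θ (Θ x) (dT 𝕜 E Θ x v) = v :=
  congrArg (fun L : E →L[𝕜] E => L v) (hΘ.mdifferentiable.symm_comp_deriv hx)

lemma dT_dS {y : G} (hy : y ∈ Θ.target) (w : G) : dT 𝕜 E Θ (Θ.symm y) (dS 𝕜 E Θ y w) = w :=
  congrArg (fun L : G →L[𝕜] G => L w) (hΘ.mdifferentiable.comp_symm_deriv hy)

lemma dT_dS' {x : M} (hx : x ∈ Θ.source) (w : G) : dT 𝕜 E Θ x (dS 𝕜 E Θ (Θ x) w) = w := by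
  have := hΘ.dT_dS (Θ.map_source hx) w
  rwa [Θ.left_inv hx] at this

lemma injective_dT {x : M} (hx : x ∈ Θ.source) {v v' : E} (h : dT 𝕜 E Θ x v = dT 𝕜 E Θ x v') :
    v = v' := by
  rw [← hΘ.dS_dT hx v, h, hΘ.dS_dT hx]

/-- The differential of a chart as an equivalence. -/
def equiv {x : M} (hx : x ∈ Θ.source) : E ≃L[𝕜] G :=
  ContinuousLinearEquiv.equivOfInverse (dT 𝕜 E Θ x) (dS 𝕜 E Θ (Θ x)) (hΘ.dS_dT hx) (hΘ.dT_dS' hx)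

lemma mdifferentiableAt_iff {φ : M → W} {x : M} (hx : x ∈ Θ.source) :
    MDifferentiableAt 𝓘(𝕜, E) 𝓘(𝕜, W) φ x ↔ DifferentiableAt 𝕜 (φ ∘ Θ.symm) (Θ x) := by
  rw [← mdifferentiableAt_iff_differentiableAt]
  constructor
  · intro h
    refine MDifferentiableAt.comp (I' := 𝓘(𝕜, E)) _ ?_ (hΘ.mdifferentiableAt_symm (Θ.map_source hx))
    rwa [Θ.left_inv hx]
  · intro h
    refine (MDifferentiableAt.comp (I' := 𝓘(𝕜, G)) x h
      (hΘ.mdifferentiableAt hx)).congr_of_eventuallyEq ?_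
    filter_upwards [Θ.open_source.mem_nhds hx] with y hy
    simp [Θ.left_inv hy]

lemma contMDiffAt_iff {n : ℕ∞ω} {φ : M → W} {x : M} (hx : x ∈ Θ.source) :
    ContMDiffAt 𝓘(𝕜, E) 𝓘(𝕜, W) n φ x ↔ ContDiffAt 𝕜 n (φ ∘ Θ.symm) (Θ x) := by
  rw [← contMDiffAt_iff_contDiffAt]
  constructor
  · intro h
    refine ContMDiffAt.comp (I' := 𝓘(𝕜, E)) _ ?_
      ((hΘ.contMDiffAt_symm (Θ.map_source hx)).of_le le_top)
    rwa [Θ.left_inv hx]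
  · intro h
    refine (ContMDiffAt.comp (I' := 𝓘(𝕜, G)) x h
      ((hΘ.contMDiffAt hx).of_le le_top)).congr_of_eventuallyEq ?_
    filter_upwards [Θ.open_source.mem_nhds hx] with y hy
    simp [Θ.left_inv hy]

lemma mfderiv_eq {φ : M → W} {x : M} (hx : x ∈ Θ.source)
    (hφ : DifferentiableAt 𝕜 (φ ∘ Θ.symm) (Θ x)) :
    (mfderiv 𝓘(𝕜, E) 𝓘(𝕜, W) φ x : E →L[𝕜] W) =
      (fderiv 𝕜 (φ ∘ Θ.symm) (Θ x)).comp (dT 𝕜 E Θ x) := by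
  have h1 : φ =ᶠ[𝓝 x] (φ ∘ Θ.symm) ∘ Θ := by
    filter_upwards [Θ.open_source.mem_nhds hx] with y hy
    simp [Θ.left_inv hy]
  have h2 := mfderiv_comp (I := 𝓘(𝕜, E)) (I' := 𝓘(𝕜, G)) (I'' := 𝓘(𝕜, W)) x
    (g := φ ∘ Θ.symm) (f := Θ) (mdifferentiableAt_iff_differentiableAt.2 hφ)
    (hΘ.mdifferentiableAt hx)
  rw [h1.mfderiv_eq, h2, mfderiv_eq_fderiv]
  rfl

lemma mvfderiv_apply {φ : M → W} {x : M} (hx : x ∈ Θ.source)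
    (hφ : DifferentiableAt 𝕜 (φ ∘ Θ.symm) (Θ x)) (u : E) :
    mvfderiv 𝓘(𝕜, E) φ x u = fderiv 𝕜 (φ ∘ Θ.symm) (Θ x) (dT 𝕜 E Θ x u) :=
  congrArg (fun L : E →L[𝕜] W => L u) (hΘ.mfderiv_eq hx hφ)

include hΘ' in
lemma contDiffAt_transition {x : M} (hx : x ∈ Θ.source) (hx' : x ∈ Θ'.source) :
    ContDiffAt 𝕜 ω (Θ' ∘ Θ.symm) (Θ x) := by
  rw [← hΘ.contMDiffAt_iff hx]
  exact hΘ'.contMDiffAt hx'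

include hΘ' in
lemma dT_eq_transition {x : M} (hx : x ∈ Θ.source) (hx' : x ∈ Θ'.source) :
    dT 𝕜 E Θ' x = (fderiv 𝕜 (Θ' ∘ Θ.symm) (Θ x)).comp (dT 𝕜 E Θ x) :=
  hΘ.mfderiv_eq hx ((hΘ.contDiffAt_transition hΘ' hx hx').differentiableAt (by simp))

include hΘ' in
lemma dS_eq_transition {x : M} (hx : x ∈ Θ.source) (hx' : x ∈ Θ'.source) :
    dS 𝕜 E Θ' (Θ' x) = (dS 𝕜 E Θ (Θ x)).comp (fderiv 𝕜 (Θ ∘ Θ'.symm) (Θ' x)) := by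
  ext w
  apply hΘ.injective_dT hx
  have h := congrArg (fun L : E →L[𝕜] G => L (dS 𝕜 E Θ' (Θ' x) w))
    (hΘ'.dT_eq_transition hΘ hx' hx)
  simp only [ContinuousLinearMap.coe_comp, Function.comp_apply, hΘ'.dT_dS' hx'] at h
  rw [ContinuousLinearMap.comp_apply, hΘ.dT_dS' hx]
  exact h

end IsChart

variable (𝕜 E) in
/-- The expression of a vector field in a chart. -/
def vecIn (Θ : OpenPartialHomeomorph M G) (X : M → E) (y : G) : G :=
  dT 𝕜 E Θ (Θ.symm y) (X (Θ.symm y))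

variable (𝕜 E) in
/-- The expression of an endomorphism field in a chart. -/
def endoIn (Θ : OpenPartialHomeomorph M G) (A : M → (E →L[𝕜] E)) (y : G) : G →L[𝕜] G :=
  (dT 𝕜 E Θ (Θ.symm y)).comp ((A (Θ.symm y)).comp (dS 𝕜 E Θ y))

/-- The pull-back of a bilinear map. -/
def pullBilin (b : E →L[𝕜] E →L[𝕜] W) (A : G →L[𝕜] E) : G →L[𝕜] G →L[𝕜] W :=
  ((ContinuousLinearMap.compL 𝕜 G E W).flip A).comp (b.comp A)

@[simp] lemma pullBilin_apply (b : E →L[𝕜] E →L[𝕜] W) (A : G →L[𝕜] E) (v w : G) :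
    pullBilin b A v w = b (A v) (A w) := rfl

variable (𝕜 E) in
/-- The expression of a field of bilinear forms in a chart. -/
def bilinIn (Θ : OpenPartialHomeomorph M G) (b : M → (E →L[𝕜] E →L[𝕜] W)) (y : G) :
    G →L[𝕜] G →L[𝕜] W :=
  pullBilin (b (Θ.symm y)) (dS 𝕜 E Θ y)

lemma _root_.ContDiffAt.pullBilin {V : Type*} [NormedAddCommGroup V] [NormedSpace 𝕜 V] {n : ℕ∞ω}
    {b : V → (E →L[𝕜] E →L[𝕜] W)} {A : V → (G →L[𝕜] E)} {v : V} (hb : ContDiffAt 𝕜 n b v)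
    (hA : ContDiffAt 𝕜 n A v) : ContDiffAt 𝕜 n (fun v => pullBilin (b v) (A v)) v := by
  have h0 : ContDiff 𝕜 n fun A : G →L[𝕜] E => (ContinuousLinearMap.compL 𝕜 G E W).flip A :=
    ContinuousLinearMap.contDiff _
  have h1 : ContDiffAt 𝕜 n (fun v => (ContinuousLinearMap.compL 𝕜 G E W).flip (A v)) v :=
    h0.contDiffAt.comp v hA
  have h2 : ContDiffAt 𝕜 n (fun v => (b v).comp (A v)) v := hb.clm_comp hA
  exact h1.clm_comp h2

namespace IsChart

variable {Θ : OpenPartialHomeomorph M G} (hΘ : IsChart 𝕜 E Θ)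
  {Θ' : OpenPartialHomeomorph M G'} (hΘ' : IsChart 𝕜 E Θ')
include hΘ hΘ'

lemma eventually_transition {x : M} (hx : x ∈ Θ.source) (hx' : x ∈ Θ'.source) :
    ∀ᶠ y in 𝓝 (Θ' x), y ∈ Θ'.target ∧ Θ'.symm y ∈ Θ.source := by
  have h1 := Θ'.open_target.mem_nhds (Θ'.map_source hx')
  have h2 : ContinuousAt Θ'.symm (Θ' x) := Θ'.continuousAt_symm (Θ'.map_source hx')
  have h3 : Θ.source ∈ 𝓝 (Θ'.symm (Θ' x)) := by
    rw [Θ'.left_inv hx']; exact Θ.open_source.mem_nhds hx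
  filter_upwards [h1, h2.preimage_mem_nhds h3] with y hy1 hy2
  exact ⟨hy1, hy2⟩

/-- Transition maps are analytic and differentiation loses nothing in the class `ω`, so the change
of chart for tensors preserves every regularity class. -/
lemma contDiffAt_fderiv_transition {x : M} (hx : x ∈ Θ.source) (hx' : x ∈ Θ'.source) :
    ContDiffAt 𝕜 ω (fun y => fderiv 𝕜 (Θ' ∘ Θ.symm) ((Θ ∘ Θ'.symm) y)) (Θ' x) := by
  have h1 : (Θ ∘ Θ'.symm) (Θ' x) = Θ x := by simp [Θ'.left_inv hx']
  refine ContDiffAt.comp (g := fderiv 𝕜 (Θ' ∘ Θ.symm)) (Θ' x) ?_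
    (hΘ'.contDiffAt_transition hΘ hx' hx)
  rw [h1]
  exact (hΘ.contDiffAt_transition hΘ' hx hx').fderiv_right (m := ω) (by simp)

lemma differentiableAt_vecIn {X : M → E} {x : M} (hx : x ∈ Θ.source) (hx' : x ∈ Θ'.source)
    (hX : DifferentiableAt 𝕜 (vecIn 𝕜 E Θ X) (Θ x)) :
    DifferentiableAt 𝕜 (vecIn 𝕜 E Θ' X) (Θ' x) := by
  have h1 : (Θ ∘ Θ'.symm) (Θ' x) = Θ x := by simp [Θ'.left_inv hx']
  have h2 : DifferentiableAt 𝕜 (vecIn 𝕜 E Θ X ∘ (Θ ∘ Θ'.symm)) (Θ' x) := by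
    refine DifferentiableAt.comp _ ?_
      ((hΘ'.contDiffAt_transition hΘ hx' hx).differentiableAt (by simp))
    rwa [h1]
  have h3 := (hΘ.contDiffAt_fderiv_transition hΘ' hx hx').differentiableAt (by simp)
  refine (h3.clm_apply h2).congr_of_eventuallyEq ?_
  filter_upwards [hΘ.eventually_transition hΘ' hx hx'] with y hy
  have hs := Θ'.map_target hy.1
  simp only [vecIn, Function.comp_apply, Θ.left_inv hy.2, hΘ.dT_eq_transition hΘ' hy.2 hs]
  rfl

lemma contDiffAt_endoIn {n : ℕ∞ω} {A : M → (E →L[𝕜] E)} {x : M} (hx : x ∈ Θ.source)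
    (hx' : x ∈ Θ'.source) (hA : ContDiffAt 𝕜 n (endoIn 𝕜 E Θ A) (Θ x)) :
    ContDiffAt 𝕜 n (endoIn 𝕜 E Θ' A) (Θ' x) := by
  have h1 : (Θ ∘ Θ'.symm) (Θ' x) = Θ x := by simp [Θ'.left_inv hx']
  have h2 : ContDiffAt 𝕜 n (endoIn 𝕜 E Θ A ∘ (Θ ∘ Θ'.symm)) (Θ' x) := by
    refine ContDiffAt.comp _ ?_ ((hΘ'.contDiffAt_transition hΘ hx' hx).of_le le_top)
    rwa [h1]
  have h3 := (hΘ.contDiffAt_fderiv_transition hΘ' hx hx').of_le (m := n) le_top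
  have h4 := ((hΘ'.contDiffAt_transition hΘ hx' hx).fderiv_right (m := ω) (by simp)).of_le
    (m := n) le_top
  refine (h3.clm_comp (h2.clm_comp h4)).congr_of_eventuallyEq ?_
  filter_upwards [hΘ.eventually_transition hΘ' hx hx'] with y hy
  have hs := Θ'.map_target hy.1
  have h5 := hΘ.dS_eq_transition hΘ' hy.2 hs
  rw [Θ'.right_inv hy.1] at h5
  simp only [endoIn, Function.comp_apply, Θ.left_inv hy.2, hΘ.dT_eq_transition hΘ' hy.2 hs, h5]
  rfl

lemma contDiffAt_bilinIn {n : ℕ∞ω} {b : M → (E →L[𝕜] E →L[𝕜] W)} {x : M} (hx : x ∈ Θ.source)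
    (hx' : x ∈ Θ'.source) (hb : ContDiffAt 𝕜 n (bilinIn 𝕜 E Θ b) (Θ x)) :
    ContDiffAt 𝕜 n (bilinIn 𝕜 E Θ' b) (Θ' x) := by
  have h1 : (Θ ∘ Θ'.symm) (Θ' x) = Θ x := by simp [Θ'.left_inv hx']
  have h2 : ContDiffAt 𝕜 n (bilinIn 𝕜 E Θ b ∘ (Θ ∘ Θ'.symm)) (Θ' x) := by
    refine ContDiffAt.comp _ ?_ ((hΘ'.contDiffAt_transition hΘ hx' hx).of_le le_top)
    rwa [h1]
  have h4 := ((hΘ'.contDiffAt_transition hΘ hx' hx).fderiv_right (m := ω) (by simp)).of_le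
    (m := n) le_top
  refine (ContDiffAt.pullBilin h2 h4).congr_of_eventuallyEq ?_
  filter_upwards [hΘ.eventually_transition hΘ' hx hx'] with y hy
  have hs := Θ'.map_target hy.1
  have h5 := hΘ.dS_eq_transition hΘ' hy.2 hs
  rw [Θ'.right_inv hy.1] at h5
  simp only [bilinIn, Function.comp_apply, Θ.left_inv hy.2, h5]
  rfl

end IsChart

/-! ### Sections of tensor bundles in charts -/

section Sections

variable [IsManifold 𝓘(𝕜, E) ω M] [IsManifold 𝓘(𝕜, E) 1 M]

/-- Regularity of sections is defined through the trivialisation at a point. Identifying the latter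
with the differential of the preferred chart, here and in `trivializationAt_symm_eq`, makes
regularity readable in any analytic chart. -/
lemma trivializationAt_apply_eq {x y : M} (hy : y ∈ (chartAt E x).source)
    (v : TangentSpace 𝓘(𝕜, E) y) :
    ((trivializationAt E (TangentSpace 𝓘(𝕜, E)) x) ⟨y, v⟩).2 = dT 𝕜 E (chartAt E x) y v := by
  have h1 := congrArg (fun L : E →L[𝕜] E => L v)
    (TangentBundle.continuousLinearMapAt_trivializationAt (𝕜 := 𝕜) (I := 𝓘(𝕜, E)) hy)
  have h2 : y ∈ (trivializationAt E (TangentSpace 𝓘(𝕜, E)) x).baseSet := by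
    simpa using hy
  have h3 : (mfderiv 𝓘(𝕜, E) 𝓘(𝕜, E) (extChartAt 𝓘(𝕜, E) x) y : E →L[𝕜] E) =
    dT 𝕜 E (chartAt E x) y := rfl
  rw [h3] at h1
  rw [← h1]
  exact (Bundle.Trivialization.coe_linearMapAt_of_mem
    (R := 𝕜) (trivializationAt E (TangentSpace 𝓘(𝕜, E)) x) h2 ▸ rfl)

end Sections

end Charts
end BiquaternionicExtension
end

open scoped Manifold ContDiff
noncomputable section
namespace BiquaternionicExtension

/-! ### Regularity of tensor fields and Lie brackets, read in arbitrary analytic charts. -/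

section Charts

open Filter Topology

variable {𝕜 : Type*} [RCLike 𝕜]
  {E : Type*} [NormedAddCommGroup E] [NormedSpace 𝕜 E]
  {G : Type*} [NormedAddCommGroup G] [NormedSpace 𝕜 G]
  {W : Type*} [NormedAddCommGroup W] [NormedSpace 𝕜 W]
  {M : Type*} [TopologicalSpace M] [ChartedSpace E M]

section Sections

variable [IsManifold 𝓘(𝕜, E) ω M] [IsManifold 𝓘(𝕜, E) 1 M]

lemma trivializationAt_symm_eq {x y : M} (hy : y ∈ (chartAt E x).source) (w : E) :
    (trivializationAt E (TangentSpace 𝓘(𝕜, E)) x).symm y w =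
      dS 𝕜 E (chartAt E x) (chartAt E x y) w := by
  have h2 : y ∈ (trivializationAt E (TangentSpace 𝓘(𝕜, E)) x).baseSet := by simpa using hy
  apply (isChart_chartAt (𝕜 := 𝕜) (E := E) x).injective_dT hy
  rw [(isChart_chartAt (𝕜 := 𝕜) (E := E) x).dT_dS' hy]
  have h3 := (trivializationAt E (TangentSpace 𝓘(𝕜, E)) x).apply_mk_symm h2 w
  have h4 := trivializationAt_apply_eq (𝕜 := 𝕜) hy
    ((trivializationAt E (TangentSpace 𝓘(𝕜, E)) x).symm y w)
  rw [h3] at h4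
  exact h4.symm

omit [IsManifold 𝓘(𝕜, E) ω M] [IsManifold 𝓘(𝕜, E) 1 M] in
lemma contDiffAt_congr {V V' : Type*} [NormedAddCommGroup V] [NormedSpace 𝕜 V]
    [NormedAddCommGroup V'] [NormedSpace 𝕜 V'] {n : ℕ∞ω} {φ φ' : V → V'} {y : V}
    (h : φ =ᶠ[𝓝 y] φ') : ContDiffAt 𝕜 n φ y ↔ ContDiffAt 𝕜 n φ' y :=
  ⟨fun h' => h'.congr_of_eventuallyEq h.symm, fun h' => h'.congr_of_eventuallyEq h⟩

lemma eventually_chartAt_symm (x : M) : ∀ᶠ y in 𝓝 (chartAt E x x),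
    y ∈ (chartAt E x).target ∧ (chartAt E x).symm y ∈ (chartAt E x).source := by
  filter_upwards [(chartAt E x).open_target.mem_nhds (mem_chart_target E x)] with y hy
  exact ⟨hy, (chartAt E x).map_target hy⟩

namespace IsChart

variable {Θ : OpenPartialHomeomorph M G} (hΘ : IsChart 𝕜 E Θ)
include hΘ

/-- Differentiability of a vector field, in terms of its expression in a chart. -/
lemma mdifferentiableAt_vector_iff {X : ∀ x : M, TangentSpace 𝓘(𝕜, E) x} {x : M}
    (hx : x ∈ Θ.source) :
    MDifferentiableAt 𝓘(𝕜, E) (𝓘(𝕜, E).prod 𝓘(𝕜, E))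
      (fun y => (⟨y, X y⟩ : Bundle.TotalSpace E (TangentSpace 𝓘(𝕜, E) : M → Type _))) x ↔
    DifferentiableAt 𝕜 (vecIn 𝕜 E Θ X) (Θ x) := by
  have hc := isChart_chartAt (𝕜 := 𝕜) (E := E) x
  have hxc := mem_chart_source E x
  rw [mdifferentiableAt_totalSpace]
  have h1 : (fun y => ((trivializationAt E (TangentSpace 𝓘(𝕜, E)) x)
      (⟨y, X y⟩ : Bundle.TotalSpace E (TangentSpace 𝓘(𝕜, E) : M → Type _))).2) =ᶠ[𝓝 x]
      fun y => dT 𝕜 E (chartAt E x) y (X y) := by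
    filter_upwards [chart_source_mem_nhds E x] with y hy
    exact trivializationAt_apply_eq hy _
  rw [h1.mdifferentiableAt_iff, hc.mdifferentiableAt_iff hxc]
  have h2 : (MDifferentiableAt 𝓘(𝕜, E) 𝓘(𝕜, E) (fun y : M => y) x) := mdifferentiableAt_id
  constructor
  · exact fun h => hc.differentiableAt_vecIn hΘ hxc hx h.2
  · exact fun h => ⟨h2, hΘ.differentiableAt_vecIn hc hx hxc h⟩

/-- Regularity of an endomorphism field, in terms of its expression in a chart. -/
lemma contMDiffAt_endo_iff {n : ℕ∞ω} {A : ∀ x : M, TangentSpace 𝓘(𝕜, E) x →L[𝕜] TangentSpace 𝓘(𝕜, E) x}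
    {x : M} (hx : x ∈ Θ.source) :
    ContMDiffAt 𝓘(𝕜, E) (𝓘(𝕜, E).prod 𝓘(𝕜, E →L[𝕜] E)) n
      (fun x => (⟨x, A x⟩ : Bundle.TotalSpace (E →L[𝕜] E)
        (fun x : M => TangentSpace 𝓘(𝕜, E) x →L[𝕜] TangentSpace 𝓘(𝕜, E) x))) x ↔
    ContDiffAt 𝕜 n (endoIn 𝕜 E Θ A) (Θ x) := by
  have hc := isChart_chartAt (𝕜 := 𝕜) (E := E) x
  have hxc := mem_chart_source E x
  rw [contMDiffAt_hom_bundle]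
  have h1 : (fun y => ContinuousLinearMap.inCoordinates E (TangentSpace 𝓘(𝕜, E)) E
      (TangentSpace 𝓘(𝕜, E)) x y x y (A y)) =ᶠ[𝓝 x]
      fun y => (dT 𝕜 E (chartAt E x) y).comp
        (ContinuousLinearMap.comp (A y : E →L[𝕜] E) (dS 𝕜 E (chartAt E x) (chartAt E x y))) := by
    filter_upwards [chart_source_mem_nhds E x] with y hy
    have h2 : y ∈ (trivializationAt E (TangentSpace 𝓘(𝕜, E)) x).baseSet := by simpa using hy
    rw [ContinuousLinearMap.inCoordinates_eq h2 h2]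
    ext w
    refine Eq.trans ?_ (trivializationAt_apply_eq hy
      (A y ((trivializationAt E (TangentSpace 𝓘(𝕜, E)) x).symm y w))) |>.trans ?_
    · rfl
    · rw [trivializationAt_symm_eq hy]
      rfl
  have h3 : ContDiffAt 𝕜 n (fun y => (dT 𝕜 E (chartAt E x) ((chartAt E x).symm y)).comp
        (ContinuousLinearMap.comp (A ((chartAt E x).symm y) : E →L[𝕜] E)
        (dS 𝕜 E (chartAt E x) (chartAt E x ((chartAt E x).symm y))))) (chartAt E x x) ↔
      ContDiffAt 𝕜 n (endoIn 𝕜 E (chartAt E x) A) (chartAt E x x) := by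
    refine contDiffAt_congr ?_
    filter_upwards [eventually_chartAt_symm (E := E) x] with y hy
    rw [(chartAt E x).right_inv hy.1]
    rfl
  rw [h1.contMDiffAt_iff, hc.contMDiffAt_iff hxc]
  refine ⟨fun h => ?_, fun h => ⟨contMDiffAt_id, ?_⟩⟩
  · exact hc.contDiffAt_endoIn hΘ hxc hx (h3.1 h.2)
  · exact h3.2 (hΘ.contDiffAt_endoIn hc hx hxc h)

/-- Regularity of a field of bilinear forms, in terms of its expression in a chart. -/
lemma contMDiffAt_bilin_iff {n : ℕ∞ω}
    {b : ∀ x : M, TangentSpace 𝓘(𝕜, E) x →L[𝕜] TangentSpace 𝓘(𝕜, E) x →L[𝕜] 𝕜}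
    {x : M} (hx : x ∈ Θ.source) :
    ContMDiffAt 𝓘(𝕜, E) (𝓘(𝕜, E).prod 𝓘(𝕜, E →L[𝕜] E →L[𝕜] 𝕜)) n
      (fun x => (⟨x, b x⟩ : Bundle.TotalSpace (E →L[𝕜] E →L[𝕜] 𝕜)
        (fun x : M => TangentSpace 𝓘(𝕜, E) x →L[𝕜] TangentSpace 𝓘(𝕜, E) x →L[𝕜] 𝕜))) x ↔
    ContDiffAt 𝕜 n (bilinIn 𝕜 E Θ b) (Θ x) := by
  have hc := isChart_chartAt (𝕜 := 𝕜) (E := E) x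
  have hxc := mem_chart_source E x
  rw [contMDiffAt_hom_bundle]
  have h1 : (fun y => ContinuousLinearMap.inCoordinates E (TangentSpace 𝓘(𝕜, E)) (E →L[𝕜] 𝕜)
      (fun y : M => TangentSpace 𝓘(𝕜, E) y →L[𝕜] 𝕜) x y x y (b y)) =ᶠ[𝓝 x]
      fun y => pullBilin (E := E) (W := 𝕜) (b y) (dS 𝕜 E (chartAt E x) (chartAt E x y)) := by
    filter_upwards [chart_source_mem_nhds E x] with y hy
    have h2 : y ∈ (trivializationAt E (TangentSpace 𝓘(𝕜, E)) x).baseSet := by simpa using hy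
    ext w w'
    have h4 := inCoordinates_apply_eq₂ (𝕜 := 𝕜) (F₁ := E) (E₁ := (TangentSpace 𝓘(𝕜, E) : M → Type _))
      (F₂ := E) (E₂ := (TangentSpace 𝓘(𝕜, E) : M → Type _)) (F₃ := 𝕜) (E₃ := Bundle.Trivial M 𝕜)
      (x₀ := x) (x := y) (ϕ := b y) (v := w) (w := w') h2 h2 (by simp)
    refine h4.trans ?_
    rw [trivializationAt_symm_eq hy, trivializationAt_symm_eq hy]
    simp
    rfl
  have h3 : ContDiffAt 𝕜 n (fun y => pullBilin (E := E) (W := 𝕜) (b ((chartAt E x).symm y))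
        (dS 𝕜 E (chartAt E x) (chartAt E x ((chartAt E x).symm y)))) (chartAt E x x) ↔
      ContDiffAt 𝕜 n (bilinIn 𝕜 E (chartAt E x) b) (chartAt E x x) := by
    refine contDiffAt_congr ?_
    filter_upwards [eventually_chartAt_symm (E := E) x] with y hy
    rw [(chartAt E x).right_inv hy.1]
    rfl
  rw [h1.contMDiffAt_iff, hc.contMDiffAt_iff hxc]
  refine ⟨fun h => ?_, fun h => ⟨contMDiffAt_id, ?_⟩⟩
  · exact hc.contDiffAt_bilinIn hΘ hxc hx (h3.1 h.2)
  · exact h3.2 (hΘ.contDiffAt_bilinIn hc hx hxc h)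

end IsChart

end Sections

section Bracket

variable [CompleteSpace E] [IsManifold 𝓘(𝕜, E) ω M] [IsManifold 𝓘(𝕜, E) 1 M]
  [IsManifold 𝓘(𝕜, E) (minSmoothness 𝕜 3) M] [CompleteSpace G]
  {Θ : OpenPartialHomeomorph M G} (hΘ : IsChart 𝕜 E Θ)
include hΘ

lemma IsChart.inverse_dS {y : G} (hy : y ∈ Θ.target) :
    (dS 𝕜 E Θ y).inverse = dT 𝕜 E Θ (Θ.symm y) := by
  have h := Θ.map_target hy
  have h1 : dS 𝕜 E Θ y = ((hΘ.equiv h).symm : G →L[𝕜] E) := by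
    ext w
    change _ = dS 𝕜 E Θ (Θ (Θ.symm y)) w
    rw [Θ.right_inv hy]
  rw [h1, ContinuousLinearMap.inverse_equiv]
  rfl

omit hΘ [CompleteSpace E] [IsManifold 𝓘(𝕜, E) ω M] [IsManifold 𝓘(𝕜, E) 1 M]
  [IsManifold 𝓘(𝕜, E) (minSmoothness 𝕜 3) M] [CompleteSpace G] in
lemma vecIn_apply {X : M → E} {x : M} (hx : x ∈ Θ.source) :
    vecIn 𝕜 E Θ X (Θ x) = dT 𝕜 E Θ x (X x) := by
  rw [vecIn, Θ.left_inv hx]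

omit hΘ [CompleteSpace E] [IsManifold 𝓘(𝕜, E) ω M] [IsManifold 𝓘(𝕜, E) 1 M]
  [IsManifold 𝓘(𝕜, E) (minSmoothness 𝕜 3) M] [CompleteSpace G] in
lemma mlieBracket_vectorSpace (V V' : G → G) (y : G) :
    VectorField.mlieBracket 𝓘(𝕜, G) V V' y = fderiv 𝕜 V' y (V y) - fderiv 𝕜 V y (V' y) := by
  have h (V V' : ∀ y : G, TangentSpace 𝓘(𝕜, G) y) :
      VectorField.mlieBracket 𝓘(𝕜, G) V V' y = VectorField.lieBracketWithin 𝕜 V V' Set.univ y := by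
    rw [← VectorField.mlieBracketWithin_univ, VectorField.mlieBracketWithin_eq_lieBracketWithin]
  refine (h V V').trans ?_
  rw [VectorField.lieBracketWithin_univ, VectorField.lieBracket]

/-- The Lie bracket in a chart. -/
lemma IsChart.dT_mlieBracket {X Y : ∀ x : M, TangentSpace 𝓘(𝕜, E) x} {x : M} (hx : x ∈ Θ.source)
    (hX : DifferentiableAt 𝕜 (vecIn 𝕜 E Θ X) (Θ x)) (hY : DifferentiableAt 𝕜 (vecIn 𝕜 E Θ Y) (Θ x)) :
    dT 𝕜 E Θ x (VectorField.mlieBracket 𝓘(𝕜, E) X Y x) =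
      fderiv 𝕜 (vecIn 𝕜 E Θ Y) (Θ x) (dT 𝕜 E Θ x (X x)) -
      fderiv 𝕜 (vecIn 𝕜 E Θ X) (Θ x) (dT 𝕜 E Θ x (Y x)) := by
  have hy := Θ.map_source hx
  have hX' := (hΘ.mdifferentiableAt_vector_iff hx).2 hX
  have hY' := (hΘ.mdifferentiableAt_vector_iff hx).2 hY
  have hl := Θ.left_inv hx
  -- Brackets commute with pull-back by the inverse chart, and this pull-back of a field is its
  -- expression `vecIn` near the point.
  have key := VectorField.mpullback_mlieBracket (I := 𝓘(𝕜, G)) (I' := 𝓘(𝕜, E)) (f := Θ.symm)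
    (x₀ := Θ x) (V := X) (W := Y) (n := ω) (by rw [hl]; exact hX') (by rw [hl]; exact hY')
    (hΘ.contMDiffAt_symm hy) le_top
  have hev : ∀ V : (∀ x : M, TangentSpace 𝓘(𝕜, E) x),
      VectorField.mpullback 𝓘(𝕜, G) 𝓘(𝕜, E) Θ.symm V =ᶠ[𝓝 (Θ x)] vecIn 𝕜 E Θ V := fun V => by
    filter_upwards [Θ.open_target.mem_nhds hy] with y hy
    exact congrArg (fun L : E →L[𝕜] G => L (V (Θ.symm y))) (hΘ.inverse_dS hy)
  have h1 := (hev (VectorField.mlieBracket 𝓘(𝕜, E) X Y)).eq_of_nhds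
  rw [h1] at key
  have h2 : VectorField.mlieBracket 𝓘(𝕜, G) (VectorField.mpullback 𝓘(𝕜, G) 𝓘(𝕜, E) Θ.symm X)
      (VectorField.mpullback 𝓘(𝕜, G) 𝓘(𝕜, E) Θ.symm Y) (Θ x) =
      VectorField.mlieBracket 𝓘(𝕜, G) (vecIn 𝕜 E Θ X) (vecIn 𝕜 E Θ Y) (Θ x) :=
    Filter.EventuallyEq.mlieBracket_vectorField_eq (hev X) (hev Y)
  have h3 := h2.trans (mlieBracket_vectorSpace (vecIn 𝕜 E Θ X) (vecIn 𝕜 E Θ Y) (Θ x))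
  exact (vecIn_apply hx).symm.trans ((key.trans h3).trans (congrArg₂ (fun a b : G =>
    fderiv 𝕜 (vecIn 𝕜 E Θ Y) (Θ x) a - fderiv 𝕜 (vecIn 𝕜 E Θ X) (Θ x) b)
    (vecIn_apply hx) (vecIn_apply hx)))

end Bracket

end Charts
end BiquaternionicExtension
end

open scoped Manifold ContDiff
noncomputable section
namespace BiquaternionicExtension

/-! ### From complex to real differentiability -/

section ComplexToReal

open Filter Topology

variable {E : Type*} [NormedAddCommGroup E] [NormedSpace ℂ E]
  {E' : Type*} [NormedAddCommGroup E'] [NormedSpace ℂ E']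
  {G : Type*} [NormedAddCommGroup G] [NormedSpace ℂ G]
  {M : Type*} [TopologicalSpace M] [ChartedSpace E M]
  {M' : Type*} [TopologicalSpace M'] [ChartedSpace E' M']

lemma contMDiffAt_real {n : ℕ∞ω} {φ : M → M'} {x : M} (h : ContMDiffAt 𝓘(ℂ, E) 𝓘(ℂ, E') n φ x) :
    ContMDiffAt 𝓘(ℝ, E) 𝓘(ℝ, E') n φ x := by
  rw [contMDiffAt_iff] at h ⊢
  exact ⟨h.1, h.2.restrict_scalars ℝ⟩

lemma hasMFDerivAt_real {φ : M → M'} {x : M} {L : E →L[ℂ] E'}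
    (h : HasMFDerivAt 𝓘(ℂ, E) 𝓘(ℂ, E') φ x L) :
    HasMFDerivAt 𝓘(ℝ, E) 𝓘(ℝ, E') φ x (L.restrictScalars ℝ) :=
  ⟨h.1, h.2.restrictScalars ℝ⟩

/-- Both differentials are derivatives of the same coordinate expression. Holomorphic data live over
`ℂ` while connections and metrics live over `ℝ`; this is the bridge. -/
lemma mfderiv_real {φ : M → M'} {x : M} (h : MDifferentiableAt 𝓘(ℂ, E) 𝓘(ℂ, E') φ x) :
    (mfderiv 𝓘(ℝ, E) 𝓘(ℝ, E') φ x : E →L[ℝ] E') =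
      (mfderiv 𝓘(ℂ, E) 𝓘(ℂ, E') φ x : E →L[ℂ] E').restrictScalars ℝ :=
  (hasMFDerivAt_real h.hasMFDerivAt).mfderiv

lemma IsChart.real {Θ : OpenPartialHomeomorph M G} (hΘ : IsChart ℂ E Θ) : IsChart ℝ E Θ :=
  ⟨fun _ hx => (contMDiffAt_real (hΘ.contMDiffAt hx)).contMDiffWithinAt,
    fun _ hy => (contMDiffAt_real (hΘ.contMDiffAt_symm hy)).contMDiffWithinAt⟩

lemma IsChart.dT_real {Θ : OpenPartialHomeomorph M G} (hΘ : IsChart ℂ E Θ) {x : M}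
    (hx : x ∈ Θ.source) (u : E) : dT ℝ E Θ x u = dT ℂ E Θ x u :=
  congrArg (fun L : E →L[ℝ] G => L u) (mfderiv_real (hΘ.mdifferentiableAt hx))

lemma IsChart.dS_real {Θ : OpenPartialHomeomorph M G} (hΘ : IsChart ℂ E Θ) {y : G}
    (hy : y ∈ Θ.target) (w : G) : dS ℝ E Θ y w = dS ℂ E Θ y w :=
  congrArg (fun L : G →L[ℝ] E => L w) (mfderiv_real (hΘ.mdifferentiableAt_symm hy))

lemma IsChart.dT_smul_I {Θ : OpenPartialHomeomorph M G} (hΘ : IsChart ℂ E Θ) {x : M}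
    (hx : x ∈ Θ.source) (u : E) : dT ℝ E Θ x (Complex.I • u) = Complex.I • dT ℝ E Θ x u := by
  rw [hΘ.dT_real hx, hΘ.dT_real hx, map_smul]

lemma IsChart.dS_smul_I {Θ : OpenPartialHomeomorph M G} (hΘ : IsChart ℂ E Θ) {y : G}
    (hy : y ∈ Θ.target) (w : G) : dS ℝ E Θ y (Complex.I • w) = Complex.I • dS ℝ E Θ y w := by
  rw [hΘ.dS_real hy, hΘ.dS_real hy, map_smul]

end ComplexToReal

/-! ### Adapted charts -/

section Polydisc

open Filter Topology Metric

variable {E : Type*} [NormedAddCommGroup E] [NormedSpace ℂ E] [FiniteDimensional ℂ E]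

/-- The product of the ball of centre `a` and radius `ρ` with its conjugate. -/
def polydisc (a : E) (ρ : ℝ) : Set (StdComplexification E) :=
  {Z | Z.1 ∈ ball a ρ ∧ (conjEquiv E).symm Z.2 ∈ ball a ρ}

lemma isOpen_polydisc (a : E) (ρ : ℝ) : IsOpen (polydisc a ρ) :=
  (isOpen_ball.preimage continuous_fst).inter
    (isOpen_ball.preimage ((conjEquiv E).symm.continuous.comp continuous_snd))

/-- Convexity supplies the connectedness needed for the identity theorem on a whole polydisc rather
than on germs. -/
lemma convex_polydisc (a : E) (ρ : ℝ) : Convex ℝ (polydisc a ρ) :=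
  ((convex_ball a ρ).linear_preimage (ContinuousLinearMap.fst ℝ E (ConjModel E)).toLinearMap).inter
    ((convex_ball a ρ).linear_preimage (((conjEquiv E).symm : ConjModel E →L[ℝ] E).comp
      (ContinuousLinearMap.snd ℝ E (ConjModel E))).toLinearMap)

lemma realIncl_mem_polydisc {a z : E} {ρ : ℝ} : realIncl E z ∈ polydisc a ρ ↔ z ∈ ball a ρ := by
  simp [polydisc]

lemma exists_polydisc_subset {a : E} {O : Set (StdComplexification E)}
    (hO : O ∈ 𝓝 (realIncl E a)) : ∃ ρ > 0, polydisc a ρ ⊆ O := by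
  have h : ContinuousAt (fun z : E × E => ((z.1, conjEquiv E z.2) : StdComplexification E)) (a, a) :=
    (continuous_fst.prodMk ((conjEquiv E).continuous.comp continuous_snd)).continuousAt
  obtain ⟨ρ, hρ, h2⟩ := Metric.mem_nhds_iff.1 (h.preimage_mem_nhds hO)
  refine ⟨ρ, hρ, fun Z hZ => ?_⟩
  have h3 : (Z.1, (conjEquiv E).symm Z.2) ∈ ball (a, a) ρ := by
    rw [← ball_prod_same]
    exact ⟨hZ.1, hZ.2⟩
  simpa using h2 h3

lemma polydisc_mono {a : E} {ρ ρ' : ℝ} (h : ρ ≤ ρ') : polydisc a ρ ⊆ polydisc a ρ' :=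
  fun _ hZ => ⟨ball_subset_ball h hZ.1, ball_subset_ball h hZ.2⟩

variable {W : Type*} [NormedAddCommGroup W] [NormedSpace ℂ W] [CompleteSpace W]

/-- The identity theorem on a polydisc. -/
lemma eqOn_polydisc {a : E} {ρ : ℝ} (hρ : 0 < ρ) {φ φ' : StdComplexification E → W}
    (h : ∀ Z ∈ polydisc a ρ, AnalyticAt ℂ φ Z) (h' : ∀ Z ∈ polydisc a ρ, AnalyticAt ℂ φ' Z)
    (heq : ∀ᶠ x in 𝓝 a, φ (realIncl E x) = φ' (realIncl E x)) : Set.EqOn φ φ' (polydisc a ρ) := by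
  have ha : realIncl E a ∈ polydisc a ρ := realIncl_mem_polydisc.2 (mem_ball_self hρ)
  exact AnalyticOnNhd.eqOn_of_preconnected_of_eventuallyEq h h'
    (convex_polydisc a ρ).isPreconnected ha
    (eventually_eq_of_realIncl (h _ ha) (h' _ ha) heq)

end Polydisc

end BiquaternionicExtension
end

open scoped Manifold ContDiff
noncomputable section
namespace BiquaternionicExtension

/-! ### Charts of `M` that straighten `N`. -/

section Adapted

open Filter Topology Metric

/-- The inverse function theorem for analytic maps. -/
lemma exists_analytic_openPartialHomeomorph {V V' : Type*} [NormedAddCommGroup V] [NormedSpace ℂ V]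
    [CompleteSpace V] [NormedAddCommGroup V'] [NormedSpace ℂ V'] {Φ : V → V'} {v : V}
    (hΦ : ContDiffAt ℂ ω Φ v) (hbij : Function.Bijective (fderiv ℂ Φ v)) [CompleteSpace V'] :
    ∃ L : OpenPartialHomeomorph V V', v ∈ L.source ∧ (∀ z, L z = Φ z) ∧
      (∀ z ∈ L.source, ContDiffAt ℂ ω L z) ∧ ∀ w ∈ L.target, ContDiffAt ℂ ω L.symm w := by
  let e : V ≃L[ℂ] V' := ContinuousLinearEquiv.ofBijective (fderiv ℂ Φ v)
    (LinearMap.ker_eq_bot.2 hbij.1) (LinearMap.range_eq_top.2 hbij.2)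
  have he : HasFDerivAt Φ (e : V →L[ℂ] V') v := by
    have : (e : V →L[ℂ] V') = fderiv ℂ Φ v := by ext; rfl
    rw [this]
    exact (hΦ.differentiableAt (by simp)).hasFDerivAt
  have hω : (ω : ℕ∞ω) ≠ ∞ := by simp
  let L₀ := hΦ.toOpenPartialHomeomorph Φ he (by simp)
  have hv : v ∈ L₀.source := hΦ.mem_toOpenPartialHomeomorph_source he (by simp)
  have h1 : ∀ᶠ z in 𝓝 v, ContDiffAt ℂ ω L₀ z := hΦ.eventually hω
  have h2 : ContDiffAt ℂ ω L₀.symm (L₀ v) := hΦ.to_localInverse he (by simp)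
  have h3 : ∀ᶠ z in 𝓝 v, ContDiffAt ℂ ω L₀.symm (L₀ z) :=
    (L₀.continuousAt hv).eventually (h2.eventually hω)
  -- The domain is cut down to points at which both the map and its inverse are analytic;
  -- analyticity is an open condition.
  obtain ⟨O, hO, hOo, hvO⟩ := _root_.mem_nhds_iff.1 (h1.and h3)
  refine ⟨L₀.restrOpen O hOo, ⟨hv, hvO⟩, fun z => rfl, fun z hz => (hO hz.2).1, fun w hw => ?_⟩
  have h4 := (L₀.restrOpen O hOo).map_target hw
  have h5 := (hO h4.2).2
  have h6 : L₀ ((L₀.restrOpen O hOo).symm w) = w := (L₀.restrOpen O hOo).right_inv hw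
  rw [h6] at h5
  exact h5

variable {E : Type*} [NormedAddCommGroup E] [NormedSpace ℂ E] [FiniteDimensional ℂ E]
  {E' : Type*} [NormedAddCommGroup E'] [NormedSpace ℂ E'] [FiniteDimensional ℂ E']

/-- The kernel is controlled by `A(E) ∩ i A(E) = 0` and the injectivity of `A`; the image is `A(E) +
i A(E)`. These are the conditions on `df` in the definition of a complexification. -/
lemma bijective_complexify {A : E →L[ℝ] E'} (hinj : Function.Injective A)
    (hA : IsCompl (LinearMap.range A.toLinearMap) ((LinearMap.range A.toLinearMap).map
      ((Complex.I • ContinuousLinearMap.id ℂ E').restrictScalars ℝ).toLinearMap)) :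
    Function.Bijective (complexify A) := by
  have hmem : ∀ x, Complex.I • A x ∈ (LinearMap.range A.toLinearMap).map
      ((Complex.I • ContinuousLinearMap.id ℂ E').restrictScalars ℝ).toLinearMap :=
    fun x => ⟨A x, ⟨x, rfl⟩, rfl⟩
  constructor
  · refine (injective_iff_map_eq_zero _).2 fun Z hZ => ?_
    rw [complexify_apply, add_eq_zero_iff_eq_neg, ← smul_neg, ← map_neg] at hZ
    have h1 : A (stdRe E Z) = 0 := by
      have := hA.disjoint.le_bot (x := A (stdRe E Z)) ⟨⟨_, rfl⟩, by rw [hZ]; exact hmem _⟩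
      simpa using this
    rw [h1] at hZ
    have h2 : stdIm E Z = 0 := by
      apply hinj
      have h3 : Complex.I • A (-stdIm E Z) = 0 := hZ.symm
      rw [smul_eq_zero_iff_right Complex.I_ne_zero, map_neg, neg_eq_zero] at h3
      rw [h3, map_zero]
    rw [← realIncl_re_add_im Z, h2, hinj (h1.trans (map_zero A).symm)]
    simp
  · intro v
    obtain ⟨_, ⟨x, rfl⟩, _, ⟨_, ⟨y, rfl⟩, rfl⟩, hv⟩ :=
      Submodule.mem_sup.1 (hA.codisjoint.eq_top ▸ Submodule.mem_top (x := v))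
    refine ⟨realIncl E x + Complex.I • realIncl E y, ?_⟩
    rw [map_add, map_smul, complexify_realIncl, complexify_realIncl]
    exact hv

variable {N : Type*} [TopologicalSpace N] [ChartedSpace E N] [IsManifold 𝓘(ℂ, E) ω N]
  {M : Type*} [TopologicalSpace M] [ChartedSpace E' M] [IsManifold 𝓘(ℂ, E') ω M]

/-- There is a holomorphic chart of `M` in which `N` is the standard totally real subspace. -/
lemma IsComplexification.exists_chart {f : N → M} (hf : IsComplexification E E' f) (p : N) :
    ∃ Θ : OpenPartialHomeomorph M (StdComplexification E), IsChart ℂ E' Θ ∧ f p ∈ Θ.source ∧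
      ∀ᶠ p' in 𝓝 p, Θ (f p') = realIncl E (chartAt E p p') := by
  set κ := chartAt E p
  set χ := chartAt E' (f p)
  set a := κ p with ha
  have hp : p ∈ κ.source := mem_chart_source E p
  have hfp : f p ∈ χ.source := mem_chart_source E' (f p)
  have h1 := hf.analytic p
  have h2 : ContDiffAt ℝ ω (χ ∘ f ∘ κ.symm) a := by
    have := (contMDiffAt_iff.1 h1).2
    simp only [modelWithCornersSelf_coe, Set.range_id] at this
    exact this
  have h3 : (rd (E := E) (E' := E') f p : E →L[ℝ] E') = fderiv ℝ (χ ∘ f ∘ κ.symm) a := by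
    have := (h1.mdifferentiableAt (by simp)).mfderiv
    simp only [modelWithCornersSelf_coe, Set.range_id, fderivWithin_univ] at this
    exact this
  -- `Φ` extends the coordinate expression of `f`. Its differential at the real point is the
  -- complexification of `df`, hence invertible, and the local inverse of `Φ` is the straightening
  -- change of coordinates.
  obtain ⟨Φ, hΦ, hΦf⟩ := exists_holomorphic_extension (h2.analyticAt)
  have h4 : fderiv ℂ Φ (realIncl E a) = complexify (fderiv ℝ (χ ∘ f ∘ κ.symm) a) := by
    refine ext_of_realIncl fun x => ?_
    rw [complexify_realIncl]
    have h5 : HasFDerivAt (Φ ∘ realIncl E)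
        (((fderiv ℂ Φ (realIncl E a)).restrictScalars ℝ).comp (realIncl E)) a :=
      (hΦ.differentiableAt.hasFDerivAt.restrictScalars ℝ).comp a (realIncl E).hasFDerivAt
    have h6 := (h5.congr_of_eventuallyEq (Filter.EventuallyEq.symm hΦf)).fderiv
    rw [h6]
    rfl
  have hbij : Function.Bijective (fderiv ℂ Φ (realIncl E a)) := by
    rw [h4, ← h3]
    exact bijective_complexify (hf.immersion p) (hf.totallyReal p)
  haveI : CompleteSpace E := FiniteDimensional.complete ℂ E
  haveI : CompleteSpace E' := FiniteDimensional.complete ℂ E'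
  obtain ⟨L, hL, hLΦ, hLs, hLt⟩ := exists_analytic_openPartialHomeomorph hΦ.contDiffAt hbij
  have hχ : IsChart ℂ E' χ := isChart_chartAt (f p)
  have h7 : ∀ᶠ z in 𝓝 a, realIncl E z ∈ L.source :=
    (realIncl E).continuous.continuousAt.eventually (L.open_source.mem_nhds hL)
  have h8 : Tendsto κ (𝓝 p) (𝓝 a) := κ.continuousAt hp
  have h9 : ∀ᶠ p' in 𝓝 p, f p' ∈ χ.source ∧ L.symm (χ (f p')) = realIncl E (κ p') ∧
      χ (f p') ∈ L.target := by
    filter_upwards [h8.eventually hΦf, h8.eventually h7, κ.open_source.mem_nhds hp,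
      h1.continuousAt.eventually (χ.open_source.mem_nhds hfp)] with p' e1 e2 e3 e4
    simp only [Function.comp_apply, κ.left_inv e3, ← hLΦ] at e1
    refine ⟨e4, ?_, ?_⟩
    · rw [← e1, L.left_inv e2]
    · rw [← e1]; exact L.map_source e2
  have hΘ : IsChart ℂ E' (χ.trans L.symm) := by
    constructor
    · intro x hx
      rw [OpenPartialHomeomorph.trans_source] at hx
      exact (ContMDiffAt.comp (I' := 𝓘(ℂ, E')) x (hLt _ hx.2).contMDiffAt
        (hχ.contMDiffAt hx.1)).contMDiffWithinAt
    · intro y hy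
      rw [OpenPartialHomeomorph.trans_target] at hy
      exact (ContMDiffAt.comp (I' := 𝓘(ℂ, E')) y (hχ.contMDiffAt_symm hy.2)
        (hLs _ hy.1).contMDiffAt).contMDiffWithinAt
  refine ⟨χ.trans L.symm, hΘ, ?_, ?_⟩
  · rw [OpenPartialHomeomorph.trans_source]
    exact ⟨hfp, h9.self_of_nhds.2.2⟩
  · filter_upwards [h9] with p' hp'
    exact hp'.2.1

/-- A holomorphic chart `Θ` of `M` around `f p`, with values in a polydisc, in which the
complexification `f` is the standard totally real embedding in terms of the chart of `N`
centred at `p`. -/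
structure IsAdapted (f : N → M) (p : N) (Θ : OpenPartialHomeomorph M (StdComplexification E))
    (ρ : ℝ) : Prop where
  isChart : IsChart ℂ E' Θ
  pos : 0 < ρ
  target_eq : Θ.target = polydisc (chartAt E p p) ρ
  ball_subset : ball (chartAt E p p) ρ ⊆ (chartAt E p).target
  symm_realIncl : ∀ z ∈ ball (chartAt E p p) ρ, Θ.symm (realIncl E z) = f ((chartAt E p).symm z)
  apply_f : ∀ p', f p' ∈ Θ.source → p' ∈ (chartAt E p).source ∧ Θ (f p') = realIncl E (chartAt E p p')

omit [FiniteDimensional ℂ E'] in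
/-- Charts which straighten `N` near `p` can be restricted to adapted charts. -/
lemma exists_isAdapted {f : N → M} (hemb : Topology.IsEmbedding f) {p : N}
    {Θ : OpenPartialHomeomorph M (StdComplexification E)} (hΘ : IsChart ℂ E' Θ)
    (hp : f p ∈ Θ.source) (hf : ∀ᶠ p' in 𝓝 p, Θ (f p') = realIncl E (chartAt E p p'))
    {O : Set M} (hO : O ∈ 𝓝 (f p)) :
    ∃ (Θ' : OpenPartialHomeomorph M (StdComplexification E)) (ρ : ℝ),
      IsAdapted (E' := E') f p Θ' ρ ∧ f p ∈ Θ'.source ∧ Θ'.source ⊆ O ∩ Θ.source ∧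
      (Θ' : M → _) = Θ ∧ (Θ'.symm : _ → M) = Θ.symm := by
  set κ := chartAt E p
  have hpκ : p ∈ κ.source := mem_chart_source E p
  have h1 : ∀ᶠ p' in 𝓝 p, p' ∈ κ.source ∧ Θ (f p') = realIncl E (κ p') ∧ f p' ∈ Θ.source :=
    Filter.Eventually.and (κ.open_source.mem_nhds hpκ)
      (hf.and (hemb.continuous.continuousAt.eventually (Θ.open_source.mem_nhds hp)))
  -- The map being an embedding, remote parts of `N` cannot return near `f p`: a neighbourhood of
  -- `p` is cut out by a neighbourhood of `f p` in `M`. This gives the clause `apply_f` for every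
  -- `p'`.
  obtain ⟨O₁, hO₁, hO₁'⟩ := hemb.isInducing.nhds_eq_comap p ▸ h1
  have hΘp := hf.self_of_nhds
  have h2 : Θ.symm ⁻¹' (O ∩ O₁) ∩ Θ.target ∈ 𝓝 (realIncl E (κ p)) := by
    rw [← hΘp]
    refine inter_mem ((Θ.continuousAt_symm (Θ.map_source hp)).preimage_mem_nhds ?_)
      (Θ.open_target.mem_nhds (Θ.map_source hp))
    rw [Θ.left_inv hp]
    exact inter_mem hO hO₁
  obtain ⟨ρ₁, hρ₁, hs₁⟩ := exists_polydisc_subset h2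
  have h3 : ∀ᶠ z in 𝓝 (κ p), z ∈ κ.target ∧ Θ (f (κ.symm z)) = realIncl E z ∧
      f (κ.symm z) ∈ Θ.source := by
    have h4 : Tendsto κ.symm (𝓝 (κ p)) (𝓝 p) := by
      have := κ.continuousAt_symm (κ.map_source hpκ)
      rwa [ContinuousAt, κ.left_inv hpκ] at this
    filter_upwards [h4.eventually h1, κ.open_target.mem_nhds (κ.map_source hpκ)] with z hz hz'
    rw [κ.right_inv hz'] at hz
    exact ⟨hz', hz.2⟩
  obtain ⟨ρ₂, hρ₂, hs₂⟩ := Metric.mem_nhds_iff.1 h3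
  -- `ρ₁` keeps the polydisc inside the target and the preimage of `O ∩ O₁`; `ρ₂` keeps the ball
  -- inside the chart of `N`, where the straightening identity holds.
  have hmin : 0 < min ρ₁ ρ₂ := lt_min hρ₁ hρ₂
  let Θ' := (Θ.symm.restrOpen (polydisc (κ p) (min ρ₁ ρ₂)) (isOpen_polydisc _ _)).symm
  have hsub : polydisc (κ p) (min ρ₁ ρ₂) ⊆ Θ.symm ⁻¹' (O ∩ O₁) ∩ Θ.target :=
    (polydisc_mono (min_le_left _ _)).trans hs₁
  have htarget : Θ'.target = polydisc (κ p) (min ρ₁ ρ₂) := by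
    change Θ.target ∩ _ = _
    exact Set.inter_eq_right.2 fun Z hZ => (hsub hZ).2
  have hsource : ∀ x ∈ Θ'.source, x ∈ Θ.source ∧ Θ x ∈ polydisc (κ p) (min ρ₁ ρ₂) := fun x hx => by
    have h5 := Θ'.map_source hx
    rw [htarget] at h5
    have h6 := Θ'.left_inv hx
    have h7 := Θ.map_target (hsub h5).2
    have h8 : Θ.symm (Θ' x) = x := h6
    rw [h8] at h7
    exact ⟨h7, h5⟩
  have hsO : ∀ x ∈ Θ'.source, x ∈ O ∧ x ∈ O₁ := fun x hx => by
    have h5 := (hsub (hsource x hx).2).1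
    rwa [Set.mem_preimage, Θ.left_inv (hsource x hx).1] at h5
  refine ⟨Θ', min ρ₁ ρ₂, ⟨⟨hΘ.smooth.mono fun x hx => (hsource x hx).1,
    hΘ.smooth_symm.mono fun y hy => hy.1⟩, hmin, htarget, fun z hz => ?_, fun z hz => ?_,
    fun p' hp' => ?_⟩, ?_, fun x hx => ⟨(hsO x hx).1, (hsource x hx).1⟩, rfl, rfl⟩
  · exact (hs₂ (ball_subset_ball (min_le_right _ _) hz)).1
  · obtain ⟨-, e2, e3⟩ := hs₂ (ball_subset_ball (min_le_right _ _) hz)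
    change Θ.symm (realIncl E z) = _
    rw [← e2, Θ.left_inv e3]
  · have h5 := hO₁' (hsO _ hp').2
    exact ⟨h5.1, h5.2.1⟩
  · have h5 : realIncl E (κ p) ∈ Θ'.target := by
      rw [htarget, realIncl_mem_polydisc]
      exact mem_ball_self hmin
    have h6 := Θ'.map_target h5
    have h7 : Θ'.symm (realIncl E (κ p)) = Θ.symm (realIncl E (κ p)) := rfl
    rwa [h7, ← hΘp, Θ.left_inv hp] at h6

end Adapted

end BiquaternionicExtension
end

open scoped Manifold ContDiff
noncomputable section
namespace BiquaternionicExtension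

section Germs

open Filter Topology Metric

variable {E : Type*} [NormedAddCommGroup E] [NormedSpace ℂ E] [FiniteDimensional ℂ E]

/-! ### Complexification of bilinear forms -/

/-- The complexification of a real bilinear form. -/
def complexifyBilin (b : E →L[ℝ] E →L[ℝ] ℝ) :
    StdComplexification E →L[ℂ] StdComplexification E →L[ℂ] ℂ :=
  haveI : FiniteDimensional ℝ E := FiniteDimensional.complexToReal E
  complexify (LinearMap.toContinuousLinearMap
    { toFun := fun u => complexify (Complex.ofRealCLM.comp (b u))
      map_add' := fun u v => ext_of_realIncl fun x => by simp [-realIncl_apply]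
      map_smul' := fun u v => ext_of_realIncl fun x => by simp [-realIncl_apply] })

@[simp] lemma complexifyBilin_realIncl (b : E →L[ℝ] E →L[ℝ] ℝ) (u v : E) :
    complexifyBilin b (realIncl E u) (realIncl E v) = b u v := by
  rw [complexifyBilin, complexify_realIncl]
  exact complexify_realIncl _ v

lemma bilin_ext_of_realIncl {W : Type*} [NormedAddCommGroup W] [NormedSpace ℂ W]
    {b b' : StdComplexification E →L[ℂ] StdComplexification E →L[ℂ] W}
    (h : ∀ u v, b (realIncl E u) (realIncl E v) = b' (realIncl E u) (realIncl E v)) : b = b' :=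
  ext_of_realIncl fun u => ext_of_realIncl fun v => h u v

omit [FiniteDimensional ℂ E] in
lemma contDiff_of_finiteDimensional {U V : Type*} [NormedAddCommGroup U] [NormedSpace ℝ U]
    [FiniteDimensional ℝ U] [NormedAddCommGroup V] [NormedSpace ℝ V] {n : ℕ∞ω} {φ : U → V}
    (h : ∀ x y, φ (x + y) = φ x + φ y) (h' : ∀ (t : ℝ) x, φ (t • x) = t • φ x) : ContDiff ℝ n φ :=
  (LinearMap.toContinuousLinearMap
    ({ toFun := φ, map_add' := h, map_smul' := h' } : U →ₗ[ℝ] V)).contDiff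

lemma contDiff_complexifyBilin {n : ℕ∞ω} : ContDiff ℝ n (complexifyBilin (E := E)) := by
  haveI : FiniteDimensional ℝ E := FiniteDimensional.complexToReal E
  exact contDiff_of_finiteDimensional
    (fun b b' => bilin_ext_of_realIncl fun u v => by simp [-realIncl_apply])
    (fun t b => bilin_ext_of_realIncl fun u v => by simp [-realIncl_apply])

variable {N : Type*} [TopologicalSpace N] [ChartedSpace E N] [IsManifold 𝓘(ℂ, E) ω N]

/-- The Kähler metric in the chart centred at `p`. -/
def localMetric (g₀ : AnalyticMetric E N) (p : N) : E → E →L[ℝ] E →L[ℝ] ℝ :=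
  bilinIn ℝ E (chartAt E p) g₀.inner

/-- The Kähler form in the chart centred at `p`. -/
def localForm (g₀ : AnalyticMetric E N) (p : N) : E → E →L[ℝ] E →L[ℝ] ℝ :=
  bilinIn ℝ E (chartAt E p) (kahlerForm g₀)

omit [FiniteDimensional ℂ E] in
lemma localForm_apply (g₀ : AnalyticMetric E N) (p : N) {z : E} (hz : z ∈ (chartAt E p).target)
    (u v : E) : localForm g₀ p z u v = localMetric g₀ p z (Complex.I • u) v := by
  have h1 := (isChart_chartAt (𝕜 := ℂ) (E := E) p).dS_smul_I hz u
  change g₀.inner ((chartAt E p).symm z) (Complex.I • (dS ℝ E (chartAt E p) z u)) _ =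
    g₀.inner ((chartAt E p).symm z) (dS ℝ E (chartAt E p) z (Complex.I • u)) _
  rw [h1]

omit [FiniteDimensional ℂ E] in
lemma contDiffAt_localMetric (g₀ : AnalyticMetric E N) (p : N) {z : E}
    (hz : z ∈ (chartAt E p).target) : ContDiffAt ℝ ω (localMetric g₀ p) z := by
  have h1 := ((isChart_chartAt (𝕜 := ℝ) (E := E) p).contMDiffAt_bilin_iff
    ((chartAt E p).map_target hz)).1 (g₀.contMDiff ((chartAt E p).symm z))
  rwa [(chartAt E p).right_inv hz] at h1

omit [FiniteDimensional ℂ E] in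
lemma contDiffAt_localForm (g₀ : AnalyticMetric E N) (p : N) {z : E}
    (hz : z ∈ (chartAt E p).target) : ContDiffAt ℝ ω (localForm g₀ p) z := by
  have h2 : ContDiffAt ℝ ω (fun z => (localMetric g₀ p z).comp
      ((Complex.I • ContinuousLinearMap.id ℂ E).restrictScalars ℝ)) z :=
    (contDiffAt_localMetric g₀ p hz).clm_comp contDiffAt_const
  refine h2.congr_of_eventuallyEq ?_
  filter_upwards [(chartAt E p).open_target.mem_nhds hz] with z hz
  ext u v
  exact localForm_apply g₀ p hz u v

/-- The Kähler form extends holomorphically. -/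
lemma exists_extension_localForm (g₀ : AnalyticMetric E N) (p : N) :
    ∃ omt : StdComplexification E → StdComplexification E →L[ℂ] StdComplexification E →L[ℂ] ℂ,
      AnalyticAt ℂ omt (realIncl E (chartAt E p p)) ∧
      ∀ᶠ z in 𝓝 (chartAt E p p), omt (realIncl E z) = complexifyBilin (localForm g₀ p z) := by
  have h1 : ContDiffAt ℝ ω (fun z => complexifyBilin (localForm g₀ p z)) (chartAt E p p) :=
    (contDiff_complexifyBilin (E := E)).contDiffAt.comp _ (contDiffAt_localForm g₀ p (mem_chart_target E p))
  exact exists_holomorphic_extension (E := E) h1.analyticAt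

/-! ### Germs of canonical structures -/

variable {E' : Type*} [NormedAddCommGroup E'] [NormedSpace ℂ E']
  {M : Type*} [TopologicalSpace M] [ChartedSpace E' M]

/-- `Θ` is a holomorphic chart around `f p` which maps `N` to the standard totally real subspace. -/
structure IsStraightening (f : N → M) (p : N) (Θ : OpenPartialHomeomorph M (StdComplexification E)) :
    Prop where
  isChart : IsChart ℂ E' Θ
  mem : f p ∈ Θ.source
  apply_f : ∀ᶠ p' in 𝓝 p, Θ (f p') = realIncl E (chartAt E p p')

/-- The last clause is the differential of the identity `Θ.symm ∘ realIncl = f ∘ κ.symm`. It carries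
conditions imposed on `df(TN)` to conditions on real vectors in the chart. -/
lemma IsStraightening.eventually_nhds {f : N → M} {p : N}
    {Θ : OpenPartialHomeomorph M (StdComplexification E)}
    (hΘ : IsStraightening (E' := E') f p Θ) (hf : ContMDiff 𝓘(ℝ, E) 𝓘(ℝ, E') ω f) :
    ∀ᶠ z in 𝓝 (chartAt E p p), z ∈ (chartAt E p).target ∧ realIncl E z ∈ Θ.target ∧
      f ((chartAt E p).symm z) ∈ Θ.source ∧ Θ (f ((chartAt E p).symm z)) = realIncl E z ∧
      Θ.symm (realIncl E z) = f ((chartAt E p).symm z) ∧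
      ∀ u, dS ℝ E' Θ (realIncl E z) (realIncl E u) = (rd (E := E) (E' := E') f ((chartAt E p).symm z) :
        E →L[ℝ] E') (dS ℝ E (chartAt E p) z u) := by
  set κ := chartAt E p
  have hp : p ∈ κ.source := mem_chart_source E p
  have h1 : ∀ᶠ z in 𝓝 (κ p), z ∈ κ.target ∧ realIncl E z ∈ Θ.target ∧
      f (κ.symm z) ∈ Θ.source ∧ Θ (f (κ.symm z)) = realIncl E z ∧
      Θ.symm (realIncl E z) = f (κ.symm z) := by
    have h4 : Tendsto κ.symm (𝓝 (κ p)) (𝓝 p) := by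
      have := κ.continuousAt_symm (κ.map_source hp)
      rwa [ContinuousAt, κ.left_inv hp] at this
    filter_upwards [h4.eventually hΘ.apply_f, κ.open_target.mem_nhds (κ.map_source hp),
      (hf.continuous.continuousAt.tendsto.comp h4).eventually
        (Θ.open_source.mem_nhds hΘ.mem)] with z e1 e2 e3
    rw [κ.right_inv e2] at e1
    exact ⟨e2, e1 ▸ Θ.map_source e3, e3, e1, e1 ▸ Θ.left_inv e3⟩
  filter_upwards [h1, h1.eventually_nhds] with z hz hz'
  refine ⟨hz.1, hz.2.1, hz.2.2.1, hz.2.2.2.1, hz.2.2.2.2, fun u => ?_⟩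
  have h2 : Θ.symm ∘ realIncl E =ᶠ[𝓝 z] f ∘ κ.symm := hz'.mono fun y hy => hy.2.2.2.2
  have h3 := h2.mfderiv_eq (I := 𝓘(ℝ, E)) (I' := 𝓘(ℝ, E'))
  have h4 := mfderiv_comp (I := 𝓘(ℝ, E)) (I' := 𝓘(ℝ, StdComplexification E)) (I'' := 𝓘(ℝ, E')) z
    (hΘ.isChart.real.mdifferentiableAt_symm hz.2.1)
    (mdifferentiableAt_iff_differentiableAt.2 (realIncl E).differentiableAt)
  have h5 := mfderiv_comp (I := 𝓘(ℝ, E)) (I' := 𝓘(ℝ, E)) (I'' := 𝓘(ℝ, E')) z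
    ((hf (κ.symm z)).mdifferentiableAt (by simp))
    ((isChart_chartAt (𝕜 := ℝ) (E := E) p).mdifferentiableAt_symm hz.1)
  have h6 : (mfderiv 𝓘(ℝ, E) 𝓘(ℝ, StdComplexification E) (realIncl E) z :
      E →L[ℝ] StdComplexification E) = realIncl E := by
    rw [mfderiv_eq_fderiv]; exact (realIncl E).fderiv
  have h7 := congrArg (fun L : E →L[ℝ] E' => L u) (h4.symm.trans (h3.trans h5))
  have h8 := congrArg (fun L : E →L[ℝ] StdComplexification E => dS ℝ E' Θ (realIncl E z) (L u)) h6
  exact h8.symm.trans h7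

end Germs

end BiquaternionicExtension
end

open scoped Manifold ContDiff
noncomputable section
namespace BiquaternionicExtension

/-! ### The canonical germs have a standard expression in a straightening chart. -/

section Germs

open Filter Topology Metric

variable {E : Type*} [NormedAddCommGroup E] [NormedSpace ℂ E] [FiniteDimensional ℂ E]
  {N : Type*} [TopologicalSpace N] [ChartedSpace E N] [IsManifold 𝓘(ℂ, E) ω N]
  {E' : Type*} [NormedAddCommGroup E'] [NormedSpace ℂ E'] [FiniteDimensional ℂ E']
  {M : Type*} [TopologicalSpace M] [ChartedSpace E' M] [IsManifold 𝓘(ℂ, E') ω M]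

variable (E) in
/-- The holomorphic extension of the complex structure of `E` to its complexification. -/
def stdH : StdComplexification E →L[ℂ] StdComplexification E :=
  (Complex.I • ContinuousLinearMap.fst ℂ E (ConjModel E)).prod
    (-(Complex.I • ContinuousLinearMap.snd ℂ E (ConjModel E)))

omit [FiniteDimensional ℂ E] in
lemma stdH_apply (Z : StdComplexification E) :
    stdH E Z = (Complex.I • Z.1, -(Complex.I • Z.2)) := rfl

lemma stdH_realIncl (u : E) : stdH E (realIncl E u) = realIncl E (Complex.I • u) := by
  rw [stdH_apply, realIncl_apply, realIncl_apply, conjEquiv_smul_I]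

/-- `(q₁, q₂, om, H)` are germs at `f p` of the canonical projections and of the holomorphic
extensions of the Kähler form and of the complex structure. -/
structure IsGermAt (f : N → M) (g₀ : AnalyticMetric E N) (q₁ q₂ : M → N) (om : CBilinField E' M)
    (H : CEndoField E' M) (p : N) : Prop where
  q₁_smooth : ContMDiffAt 𝓘(ℂ, E') 𝓘(ℂ, E) ω q₁ (f p)
  q₂_smooth : ContMDiffAt 𝓘(ℝ, E') 𝓘(ℝ, E) ω q₂ (f p)
  q₂_anti : ∀ᶠ x in 𝓝 (f p), ∀ u : TangentSpace 𝓘(ℝ, E') x,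
    rd (E := E') (E' := E) q₂ x (complexStructure E' M x u) =
      - complexStructure E N (q₂ x) (rd (E := E') (E' := E) q₂ x u)
  retract₁ : ∀ᶠ p' in 𝓝 p, q₁ (f p') = p'
  retract₂ : ∀ᶠ p' in 𝓝 p, q₂ (f p') = p'
  om_smooth : ContMDiffAt 𝓘(ℂ, E') (𝓘(ℂ, E').prod 𝓘(ℂ, E' →L[ℂ] E' →L[ℂ] ℂ)) ω
    (fun x => (⟨x, om x⟩ : Bundle.TotalSpace (E' →L[ℂ] E' →L[ℂ] ℂ)
      (fun x : M => TangentSpace 𝓘(ℂ, E') x →L[ℂ] TangentSpace 𝓘(ℂ, E') x →L[ℂ] ℂ))) (f p)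
  H_smooth : ContMDiffAt 𝓘(ℂ, E') (𝓘(ℂ, E').prod 𝓘(ℂ, E' →L[ℂ] E')) ω
    (fun x => (⟨x, H x⟩ : Bundle.TotalSpace (E' →L[ℂ] E')
      (fun x : M => TangentSpace 𝓘(ℂ, E') x →L[ℂ] TangentSpace 𝓘(ℂ, E') x))) (f p)
  om_extends : ∀ᶠ p' in 𝓝 p, ∀ u v : TangentSpace 𝓘(ℝ, E) p',
    om (f p') (toC (rd (E := E) (E' := E') f p' u)) (toC (rd (E := E) (E' := E') f p' v)) =
      (kahlerForm g₀ p' u v : ℂ)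
  H_extends : ∀ᶠ p' in 𝓝 p, ∀ u : TangentSpace 𝓘(ℝ, E) p',
    H.toReal (f p') (rd (E := E) (E' := E') f p' u) =
      rd (E := E) (E' := E') f p' (complexStructure E N p' u)

/-- The canonical structures at `x`, in a straightening chart around `f p`. -/
structure IsModelAt (q₁ q₂ : M → N) (om : CBilinField E' M) (H : CEndoField E' M) (p : N)
    (Θ : OpenPartialHomeomorph M (StdComplexification E))
    (omt : StdComplexification E → StdComplexification E →L[ℂ] StdComplexification E →L[ℂ] ℂ)
    (x : M) : Prop where
  q₁_eq : q₁ x = (chartAt E p).symm (Θ x).1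
  q₂_eq : q₂ x = (chartAt E p).symm ((conjEquiv E).symm (Θ x).2)
  om_eq : ∀ u v : E', om x u v = omt (Θ x) (dT ℂ E' Θ x u) (dT ℂ E' Θ x v)
  H_eq : ∀ u : E', dT ℂ E' Θ x (H x u) = stdH E (dT ℂ E' Θ x u)

section

variable {f : N → M} (hf : ContMDiff 𝓘(ℝ, E) 𝓘(ℝ, E') ω f) {g₀ : AnalyticMetric E N} {p : N}
  {Θ : OpenPartialHomeomorph M (StdComplexification E)}
  (hΘ : IsStraightening (E' := E') f p Θ)
  {omt : StdComplexification E → StdComplexification E →L[ℂ] StdComplexification E →L[ℂ] ℂ}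
  (homt : AnalyticAt ℂ omt (realIncl E (chartAt E p p)))
  (homt' : ∀ᶠ z in 𝓝 (chartAt E p p), omt (realIncl E z) = complexifyBilin (localForm g₀ p z))
  {q₁ q₂ : M → N} {om : CBilinField E' M} {H : CEndoField E' M}

omit [FiniteDimensional ℂ E'] [IsManifold 𝓘(ℂ, E) ω N] [IsManifold 𝓘(ℂ, E') ω M] in
include hΘ in
lemma IsStraightening.eventually_of {P : StdComplexification E → Prop}
    (h : ∀ᶠ Z in 𝓝 (realIncl E (chartAt E p p)), P Z) : ∀ᶠ x in 𝓝 (f p), P (Θ x) := by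
  rw [← hΘ.apply_f.self_of_nhds] at h
  exact (Θ.continuousAt hΘ.mem).eventually h

include hf hΘ

/-- In charts, `q₁` and the first projection are holomorphic and agree at real points because `q₁ ∘
f = id`; the identity theorem concludes. -/
lemma IsGermAt.eventually_q₁ (h : IsGermAt (E' := E') f g₀ q₁ q₂ om H p) :
    ∀ᶠ x in 𝓝 (f p), q₁ x = (chartAt E p).symm (Θ x).1 := by
  set κ := chartAt E p with hκ
  have hp : p ∈ κ.source := mem_chart_source E p
  have hqp : q₁ (f p) = p := h.retract₁.self_of_nhds
  have hΘp : Θ (f p) = realIncl E (κ p) := hΘ.apply_f.self_of_nhds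
  have hinv : Θ.symm (realIncl E (κ p)) = f p := by rw [← hΘp, Θ.left_inv hΘ.mem]
  have hmem : realIncl E (κ p) ∈ Θ.target := hΘp ▸ Θ.map_source hΘ.mem
  have h1 : ContMDiffAt 𝓘(ℂ, StdComplexification E) 𝓘(ℂ, E) ω (κ ∘ q₁ ∘ Θ.symm)
      (realIncl E (κ p)) := by
    refine ContMDiffAt.comp (I' := 𝓘(ℂ, E)) _ ?_ (ContMDiffAt.comp (I' := 𝓘(ℂ, E')) _ ?_
      (hΘ.isChart.contMDiffAt_symm hmem))
    · rw [Function.comp_apply, hinv, hqp]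
      exact (isChart_chartAt (𝕜 := ℂ) (E := E) p).contMDiffAt hp
    · rw [hinv]; exact h.q₁_smooth
  haveI : CompleteSpace E := FiniteDimensional.complete ℂ E
  have h2 := (contMDiffAt_iff_contDiffAt.1 h1).analyticAt
  have h3 : ∀ᶠ z in 𝓝 (κ p), (κ ∘ q₁ ∘ Θ.symm) (realIncl E z) = (realIncl E z).1 := by
    have h4 : Tendsto κ.symm (𝓝 (κ p)) (𝓝 p) := by
      have := κ.continuousAt_symm (κ.map_source hp)
      rwa [ContinuousAt, κ.left_inv hp] at this
    filter_upwards [hΘ.eventually_nhds hf, h4.eventually h.retract₁] with z hz hz'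
    rw [Function.comp_apply, Function.comp_apply, hz.2.2.2.2.1, hz', κ.right_inv hz.1]
    rfl
  have h5 := hΘ.eventually_of (eventually_eq_of_realIncl h2 analyticAt_fst h3)
  have h6 : ∀ᶠ x in 𝓝 (f p), q₁ x ∈ κ.source := by
    refine h.q₁_smooth.continuousAt.eventually (κ.open_source.mem_nhds ?_)
    rwa [hqp]
  filter_upwards [h5, h6, Θ.open_source.mem_nhds hΘ.mem] with x e1 e2 e3
  simp only [Function.comp_apply, Θ.left_inv e3] at e1
  rw [← e1, κ.left_inv e2]

/-- Composing the antiholomorphic `q₂` with conjugation gives a map satisfying the Cauchy-Riemann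
equations. It is only known to be real-analytic, which is why the identity theorem was stated for
real-analytic functions with these equations. -/
lemma IsGermAt.eventually_q₂ (h : IsGermAt (E' := E') f g₀ q₁ q₂ om H p) :
    ∀ᶠ x in 𝓝 (f p), q₂ x = (chartAt E p).symm ((conjEquiv E).symm (Θ x).2) := by
  set κ := chartAt E p with hκ
  have hp : p ∈ κ.source := mem_chart_source E p
  have hqp : q₂ (f p) = p := h.retract₂.self_of_nhds
  have hΘp : Θ (f p) = realIncl E (κ p) := hΘ.apply_f.self_of_nhds
  have hinv : Θ.symm (realIncl E (κ p)) = f p := by rw [← hΘp, Θ.left_inv hΘ.mem]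
  have hmem : realIncl E (κ p) ∈ Θ.target := hΘp ▸ Θ.map_source hΘ.mem
  have hκc := isChart_chartAt (𝕜 := ℂ) (E := E) p
  have h1 : ContMDiffAt 𝓘(ℝ, StdComplexification E) 𝓘(ℝ, E) ω (κ ∘ q₂ ∘ Θ.symm)
      (realIncl E (κ p)) := by
    refine ContMDiffAt.comp (I' := 𝓘(ℝ, E)) _ ?_ (ContMDiffAt.comp (I' := 𝓘(ℝ, E')) _ ?_
      (hΘ.isChart.real.contMDiffAt_symm hmem))
    · rw [Function.comp_apply, hinv, hqp]
      exact hκc.real.contMDiffAt hp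
    · rw [hinv]; exact h.q₂_smooth
  haveI : CompleteSpace E := FiniteDimensional.complete ℂ E
  have h2 := (contMDiffAt_iff_contDiffAt.1 h1)
  have hs : Tendsto Θ.symm (𝓝 (realIncl E (κ p))) (𝓝 (f p)) := by
    have := Θ.continuousAt_symm hmem
    rwa [ContinuousAt, hinv] at this
  have hqs : ∀ᶠ x in 𝓝 (f p), q₂ x ∈ κ.source := by
    refine h.q₂_smooth.continuousAt.eventually (κ.open_source.mem_nhds ?_)
    rwa [hqp]
  have hder : ∀ᶠ Z in 𝓝 (realIncl E (κ p)), ∀ v, fderiv ℝ (κ ∘ q₂ ∘ Θ.symm) Z (Complex.I • v) =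
      -(Complex.I • fderiv ℝ (κ ∘ q₂ ∘ Θ.symm) Z v) := by
    filter_upwards [hs.eventually h.q₂_anti, Θ.open_target.mem_nhds hmem, hs.eventually hqs,
      hs.eventually ((contMDiffAt_iff_contMDiffAt_nhds (by simp)).1 h.q₂_smooth)] with Z e1 e2 e3 e4 v
    have k1 := mfderiv_comp (I := 𝓘(ℝ, StdComplexification E)) (I' := 𝓘(ℝ, E')) (I'' := 𝓘(ℝ, E)) Z
      (e4.mdifferentiableAt (by simp)) (hΘ.isChart.real.mdifferentiableAt_symm e2)
    have k2 := mfderiv_comp (I := 𝓘(ℝ, StdComplexification E)) (I' := 𝓘(ℝ, E)) (I'' := 𝓘(ℝ, E)) Z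
      (f := q₂ ∘ Θ.symm) (g := κ) (hκc.real.mdifferentiableAt e3)
      (MDifferentiableAt.comp (I' := 𝓘(ℝ, E')) Z (e4.mdifferentiableAt (by simp))
        (hΘ.isChart.real.mdifferentiableAt_symm e2))
    obtain ⟨D, hD⟩ : ∃ D : E' →L[ℝ] E, D = rd (E := E') (E' := E) q₂ (Θ.symm Z) := ⟨_, rfl⟩
    have k3 : ∀ w, fderiv ℝ (κ ∘ q₂ ∘ Θ.symm) Z w = dT ℝ E κ (q₂ (Θ.symm Z)) (D (dS ℝ E' Θ Z w)) :=
      fun w => by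
        rw [k1] at k2
        rw [hD]
        exact congrArg (fun L : StdComplexification E →L[ℝ] E => L w) (mfderiv_eq_fderiv.symm.trans k2)
    have k5 : D (Complex.I • (dS ℝ E' Θ Z v)) = - (Complex.I • D (dS ℝ E' Θ Z v)) := by
      rw [hD]
      exact e1 (dS ℝ E' Θ Z v)
    rw [k3, k3, hΘ.isChart.dS_smul_I e2, k5, map_neg, hκc.dT_smul_I e3]
  have h7 : ContDiffAt ℝ ω (fun Z => conjEquiv E ((κ ∘ q₂ ∘ Θ.symm) Z) - Z.2)
      (realIncl E (κ p)) :=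
    (((conjEquiv E).contDiff.contDiffAt).comp _ h2).sub contDiffAt_snd
  have h8 : ∀ᶠ Z in 𝓝 (realIncl E (κ p)), conjEquiv E ((κ ∘ q₂ ∘ Θ.symm) Z) - Z.2 = 0 := by
    refine eventually_eq_zero_of_realIncl h7.analyticAt ?_ ?_
    · filter_upwards [hder, h2.eventually (by simp)] with Z e1 e2 v
      have k1 : HasFDerivAt (fun Z => conjEquiv E ((κ ∘ q₂ ∘ Θ.symm) Z) - Z.2)
          (((conjEquiv E : E →L[ℝ] ConjModel E).comp (fderiv ℝ (κ ∘ q₂ ∘ Θ.symm) Z)) -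
            ContinuousLinearMap.snd ℝ E (ConjModel E)) Z :=
        ((conjEquiv E).hasFDerivAt.comp Z (e2.differentiableAt (by simp)).hasFDerivAt).sub
          hasFDerivAt_snd
      rw [k1.fderiv]
      simp only [sub_apply, ContinuousLinearMap.coe_comp, Function.comp_apply,
        ContinuousLinearEquiv.coe_coe, e1, map_neg, conjEquiv_smul_I, neg_neg,
        ContinuousLinearMap.coe_snd', Prod.smul_snd, smul_sub]
    · have h4 : Tendsto κ.symm (𝓝 (κ p)) (𝓝 p) := by
        have := κ.continuousAt_symm (κ.map_source hp)
        rwa [ContinuousAt, κ.left_inv hp] at this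
      filter_upwards [hΘ.eventually_nhds hf, h4.eventually h.retract₂] with z hz hz'
      rw [Function.comp_apply, Function.comp_apply, hz.2.2.2.2.1, hz', κ.right_inv hz.1]
      exact sub_self _
  have h5 := hΘ.eventually_of h8
  filter_upwards [h5, hqs, Θ.open_source.mem_nhds hΘ.mem] with x e1 e2 e3
  simp only [Function.comp_apply, Θ.left_inv e3, sub_eq_zero] at e1
  rw [← e1, ContinuousLinearEquiv.symm_apply_apply, κ.left_inv e2]

include homt homt' in
-- The holomorphic expression of `om` and the function `omt` both extend the local Kähler form,
-- whose values determine a complex bilinear form through real vectors.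
lemma IsGermAt.eventually_om (h : IsGermAt (E' := E') f g₀ q₁ q₂ om H p) :
    ∀ᶠ x in 𝓝 (f p), ∀ u v : E', om x u v = omt (Θ x) (dT ℂ E' Θ x u) (dT ℂ E' Θ x v) := by
  set κ := chartAt E p with hκ
  have hp : p ∈ κ.source := mem_chart_source E p
  have hΘp : Θ (f p) = realIncl E (κ p) := hΘ.apply_f.self_of_nhds
  have h1 := (hΘ.isChart.contMDiffAt_bilin_iff hΘ.mem).1 h.om_smooth
  rw [hΘp] at h1
  have h4 : Tendsto κ.symm (𝓝 (κ p)) (𝓝 p) := by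
    have := κ.continuousAt_symm (κ.map_source hp)
    rwa [ContinuousAt, κ.left_inv hp] at this
  have h2 : ∀ᶠ z in 𝓝 (κ p), bilinIn ℂ E' Θ om (realIncl E z) = omt (realIncl E z) := by
    filter_upwards [hΘ.eventually_nhds hf, h4.eventually h.om_extends, homt'] with z e1 e2 e3
    rw [e3]
    refine bilin_ext_of_realIncl fun u v => ?_
    rw [complexifyBilin_realIncl]
    obtain ⟨k1, k2, -, -, k3, k4⟩ := e1
    change om (Θ.symm (realIncl E z)) (dS ℂ E' Θ (realIncl E z) (realIncl E u))
      (dS ℂ E' Θ (realIncl E z) (realIncl E v)) = _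
    rw [← hΘ.isChart.dS_real k2, ← hΘ.isChart.dS_real k2, k4, k4, k3]
    exact e2 (dS ℝ E κ z u) (dS ℝ E κ z v)
  have h5 := hΘ.eventually_of (eventually_eq_of_realIncl h1.analyticAt homt h2)
  filter_upwards [h5, Θ.open_source.mem_nhds hΘ.mem] with x e1 e3 u v
  rw [← e1]
  change _ = om (Θ.symm (Θ x)) (dS ℂ E' Θ (Θ x) (dT ℂ E' Θ x u)) (dS ℂ E' Θ (Θ x) (dT ℂ E' Θ x v))
  rw [hΘ.isChart.dS_dT e3, hΘ.isChart.dS_dT e3, Θ.left_inv e3]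

/-- The chart of `N` is holomorphic, so the complex structure of `N` is constant in it. Its
holomorphic extension is then the constant `stdH`. -/
lemma IsGermAt.eventually_H (h : IsGermAt (E' := E') f g₀ q₁ q₂ om H p) :
    ∀ᶠ x in 𝓝 (f p), ∀ u : E', dT ℂ E' Θ x (H x u) = stdH E (dT ℂ E' Θ x u) := by
  set κ := chartAt E p with hκ
  have hp : p ∈ κ.source := mem_chart_source E p
  have hΘp : Θ (f p) = realIncl E (κ p) := hΘ.apply_f.self_of_nhds
  have h1 := (hΘ.isChart.contMDiffAt_endo_iff hΘ.mem).1 h.H_smooth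
  rw [hΘp] at h1
  have h4 : Tendsto κ.symm (𝓝 (κ p)) (𝓝 p) := by
    have := κ.continuousAt_symm (κ.map_source hp)
    rwa [ContinuousAt, κ.left_inv hp] at this
  have h2 : ∀ᶠ z in 𝓝 (κ p), endoIn ℂ E' Θ H (realIncl E z) = stdH E := by
    filter_upwards [hΘ.eventually_nhds hf, h4.eventually h.H_extends] with z e1 e2
    refine ext_of_realIncl fun u => ?_
    rw [stdH_realIncl]
    obtain ⟨k1, k2, -, -, k3, k4⟩ := e1
    have k5 := (isChart_chartAt (𝕜 := ℂ) (E := E) p).dS_smul_I k1 u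
    have k6 := e2 (dS ℝ E κ z u)
    change (H (f (κ.symm z)) : E' →L[ℂ] E') ((rd (E := E) (E' := E') f (κ.symm z) : E →L[ℝ] E')
      (dS ℝ E κ z u)) = (rd (E := E) (E' := E') f (κ.symm z) : E →L[ℝ] E')
        (Complex.I • dS ℝ E κ z u) at k6
    rw [← k5, ← k4, ← k4] at k6
    change dT ℂ E' Θ (Θ.symm (realIncl E z)) (H (Θ.symm (realIncl E z))
      (dS ℂ E' Θ (realIncl E z) (realIncl E u))) = _
    rw [← hΘ.isChart.dS_real k2, k3]
    refine (congrArg (dT ℂ E' Θ (f (κ.symm z))) k6).trans ?_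
    rw [← k3, hΘ.isChart.dS_real k2, hΘ.isChart.dT_dS k2]
  have h5 := hΘ.eventually_of (eventually_eq_of_realIncl h1.analyticAt analyticAt_const h2)
  filter_upwards [h5, Θ.open_source.mem_nhds hΘ.mem] with x e1 e3 u
  rw [← e1]
  change _ = dT ℂ E' Θ (Θ.symm (Θ x)) (H (Θ.symm (Θ x)) (dS ℂ E' Θ (Θ x) (dT ℂ E' Θ x u)))
  rw [hΘ.isChart.dS_dT e3, Θ.left_inv e3]

include homt homt' in
lemma IsGermAt.eventually_model (h : IsGermAt (E' := E') f g₀ q₁ q₂ om H p) :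
    ∀ᶠ x in 𝓝 (f p), IsModelAt q₁ q₂ om H p Θ omt x := by
  filter_upwards [h.eventually_q₁ hf hΘ, h.eventually_q₂ hf hΘ,
    h.eventually_om hf hΘ homt homt', h.eventually_H hf hΘ] with x h1 h2 h3 h4
  exact ⟨h1, h2, h3, h4⟩

end

end Germs

end BiquaternionicExtension
end

open scoped Manifold ContDiff
noncomputable section
namespace BiquaternionicExtension

/-! ### Existence, uniqueness and gluing of the canonical germs. -/

section Charts

variable {𝕜 : Type*} [RCLike 𝕜]
  {E : Type*} [NormedAddCommGroup E] [NormedSpace 𝕜 E]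
  {G : Type*} [NormedAddCommGroup G] [NormedSpace 𝕜 G]
  {W : Type*} [NormedAddCommGroup W] [NormedSpace 𝕜 W]
  {M : Type*} [TopologicalSpace M] [ChartedSpace E M]
  {Θ : OpenPartialHomeomorph M G} (hΘ : IsChart 𝕜 E Θ) {x : M} (hx : x ∈ Θ.source)
include hΘ hx

lemma IsChart.bilinIn_dT (b : M → (E →L[𝕜] E →L[𝕜] W)) (u v : E) :
    bilinIn 𝕜 E Θ b (Θ x) (dT 𝕜 E Θ x u) (dT 𝕜 E Θ x v) = b x u v := by
  rw [bilinIn, pullBilin_apply, hΘ.dS_dT hx, hΘ.dS_dT hx, Θ.left_inv hx]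

lemma IsChart.endoIn_dT (A : M → (E →L[𝕜] E)) (u : E) :
    endoIn 𝕜 E Θ A (Θ x) (dT 𝕜 E Θ x u) = dT 𝕜 E Θ x (A x u) := by
  rw [endoIn, ContinuousLinearMap.comp_apply, ContinuousLinearMap.comp_apply, hΘ.dS_dT hx,
    Θ.left_inv hx]

end Charts

section Germs

open Filter Topology Metric

variable {E : Type*} [NormedAddCommGroup E] [NormedSpace ℂ E] [FiniteDimensional ℂ E]
  {N : Type*} [TopologicalSpace N] [ChartedSpace E N] [IsManifold 𝓘(ℂ, E) ω N]
  {E' : Type*} [NormedAddCommGroup E'] [NormedSpace ℂ E'] [FiniteDimensional ℂ E']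
  {M : Type*} [TopologicalSpace M] [ChartedSpace E' M] [IsManifold 𝓘(ℂ, E') ω M]

omit [FiniteDimensional ℂ E'] [IsManifold 𝓘(ℂ, E') ω M] in
/-- The differential of the first canonical projection. -/
lemma rd_of_eventually_fst {Θ : OpenPartialHomeomorph M (StdComplexification E)}
    (hΘ : IsChart ℂ E' Θ) {q : M → N} {p : N} {x : M} (hx : x ∈ Θ.source)
    (hx' : (Θ x).1 ∈ (chartAt E p).target)
    (hq : ∀ᶠ y in 𝓝 x, q y = (chartAt E p).symm (Θ y).1) (u : E') :
    (rd (E := E') (E' := E) q x : E' →L[ℝ] E) u =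
      dS ℝ E (chartAt E p) (Θ x).1 (dT ℝ E' Θ x u).1 := by
  have h1 : HasMFDerivAt 𝓘(ℝ, E') 𝓘(ℝ, StdComplexification E) Θ x (dT ℝ E' Θ x) :=
    (hΘ.real.mdifferentiableAt hx).hasMFDerivAt
  have h2 : HasMFDerivAt 𝓘(ℝ, StdComplexification E) 𝓘(ℝ, E)
      (Prod.fst : StdComplexification E → E) (Θ x) (ContinuousLinearMap.fst ℝ E (ConjModel E)) :=
    hasMFDerivAt_iff_hasFDerivAt.2 hasFDerivAt_fst
  have h3 : HasMFDerivAt 𝓘(ℝ, E) 𝓘(ℝ, E) (chartAt E p).symm (Θ x).1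
      (dS ℝ E (chartAt E p) (Θ x).1) :=
    ((isChart_chartAt (𝕜 := ℝ) (E := E) p).mdifferentiableAt_symm hx').hasMFDerivAt
  have h4 := (h3.comp x (h2.comp x h1)).congr_of_eventuallyEq hq
  exact congrArg (fun L : E' →L[ℝ] E => L u) h4.mfderiv

omit [FiniteDimensional ℂ E'] [IsManifold 𝓘(ℂ, E') ω M] in
/-- The differential of the second canonical projection. -/
lemma rd_of_eventually_snd {Θ : OpenPartialHomeomorph M (StdComplexification E)}
    (hΘ : IsChart ℂ E' Θ) {q : M → N} {p : N} {x : M} (hx : x ∈ Θ.source)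
    (hx' : (conjEquiv E).symm (Θ x).2 ∈ (chartAt E p).target)
    (hq : ∀ᶠ y in 𝓝 x, q y = (chartAt E p).symm ((conjEquiv E).symm (Θ y).2)) (u : E') :
    (rd (E := E') (E' := E) q x : E' →L[ℝ] E) u =
      dS ℝ E (chartAt E p) ((conjEquiv E).symm (Θ x).2)
        ((conjEquiv E).symm (dT ℝ E' Θ x u).2) := by
  have h1 : HasMFDerivAt 𝓘(ℝ, E') 𝓘(ℝ, StdComplexification E) Θ x (dT ℝ E' Θ x) :=
    (hΘ.real.mdifferentiableAt hx).hasMFDerivAt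
  have h2 : HasMFDerivAt 𝓘(ℝ, StdComplexification E) 𝓘(ℝ, E)
      (fun Z : StdComplexification E => (conjEquiv E).symm Z.2) (Θ x)
      (((conjEquiv E).symm : ConjModel E →L[ℝ] E).comp
        (ContinuousLinearMap.snd ℝ E (ConjModel E))) :=
    hasMFDerivAt_iff_hasFDerivAt.2 ((conjEquiv E).symm.hasFDerivAt.comp _ hasFDerivAt_snd)
  have h3 : HasMFDerivAt 𝓘(ℝ, E) 𝓘(ℝ, E) (chartAt E p).symm ((conjEquiv E).symm (Θ x).2)
      (dS ℝ E (chartAt E p) ((conjEquiv E).symm (Θ x).2)) :=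
    ((isChart_chartAt (𝕜 := ℝ) (E := E) p).mdifferentiableAt_symm hx').hasMFDerivAt
  have h4 := (h3.comp x (h2.comp x h1)).congr_of_eventuallyEq hq
  exact congrArg (fun L : E' →L[ℝ] E => L u) h4.mfderiv

variable {f : N → M} (hf : ContMDiff 𝓘(ℝ, E) 𝓘(ℝ, E') ω f) {g₀ : AnalyticMetric E N} {p : N}
  {Θ : OpenPartialHomeomorph M (StdComplexification E)}
  (hΘ : IsStraightening (E' := E') f p Θ)
  {omt : StdComplexification E → StdComplexification E →L[ℂ] StdComplexification E →L[ℂ] ℂ}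
  (homt : AnalyticAt ℂ omt (realIncl E (chartAt E p p)))
  (homt' : ∀ᶠ z in 𝓝 (chartAt E p p), omt (realIncl E z) = complexifyBilin (localForm g₀ p z))
  {q₁ q₂ : M → N} {om : CBilinField E' M} {H : CEndoField E' M}

omit [FiniteDimensional ℂ E'] [IsManifold 𝓘(ℂ, E') ω M] in
include hf hΘ in
lemma IsStraightening.eventually_dT : ∀ᶠ p' in 𝓝 p, p' ∈ (chartAt E p).source ∧
    f p' ∈ Θ.source ∧ Θ (f p') = realIncl E (chartAt E p p') ∧
    ∀ u, dT ℝ E' Θ (f p') ((rd (E := E) (E' := E') f p' : E →L[ℝ] E') u) =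
      realIncl E (dT ℝ E (chartAt E p) p' u) := by
  set κ := chartAt E p with hκ
  have hp : p ∈ κ.source := mem_chart_source E p
  filter_upwards [(κ.continuousAt hp).eventually (hΘ.eventually_nhds hf),
    κ.open_source.mem_nhds hp] with p' h1 h2
  rw [κ.left_inv h2] at h1
  obtain ⟨-, k1, k2, k3, k4, k5⟩ := h1
  refine ⟨h2, k2, k3, fun u => ?_⟩
  have k6 := k5 (dT ℝ E κ p' u)
  have k7 := (isChart_chartAt (𝕜 := ℝ) (E := E) p).dS_dT h2 u
  rw [k7] at k6
  rw [← k6, ← k3, hΘ.isChart.real.dT_dS' k2]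

include hf hΘ homt homt' in
/-- Structures which have the standard expression in a straightening chart are germs of canonical
structures. -/
lemma isGermAt_of_model (h : ∀ᶠ x in 𝓝 (f p), IsModelAt q₁ q₂ om H p Θ omt x) :
    IsGermAt (E' := E') f g₀ q₁ q₂ om H p := by
  set κ := chartAt E p with hκ
  have hκc := isChart_chartAt (𝕜 := ℂ) (E := E) p
  have hp : p ∈ κ.source := mem_chart_source E p
  have hΘp : Θ (f p) = realIncl E (κ p) := hΘ.apply_f.self_of_nhds
  have hfst : (Θ (f p)).1 = κ p := by rw [hΘp]; rfl
  have hsnd : (conjEquiv E).symm (Θ (f p)).2 = κ p := by rw [hΘp]; simp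
  have htgt : κ p ∈ κ.target := κ.map_source hp
  have hs : Tendsto Θ.symm (𝓝 (Θ (f p))) (𝓝 (f p)) := by
    have := Θ.continuousAt_symm (Θ.map_source hΘ.mem)
    rwa [ContinuousAt, Θ.left_inv hΘ.mem] at this
  have hfp : Tendsto f (𝓝 p) (𝓝 (f p)) := hf.continuous.continuousAt
  refine ⟨?_, ?_, ?_, ?_, ?_, ?_, ?_, ?_, ?_⟩
  · have h1 : ContMDiffAt 𝓘(ℂ, E') 𝓘(ℂ, E) ω (κ.symm ∘ (Prod.fst ∘ Θ)) (f p) := by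
      refine ContMDiffAt.comp (I' := 𝓘(ℂ, E)) _ ?_ (ContMDiffAt.comp
        (I' := 𝓘(ℂ, StdComplexification E)) _ contDiffAt_fst.contMDiffAt
        (hΘ.isChart.contMDiffAt hΘ.mem))
      rw [Function.comp_apply, hfst]
      exact hκc.contMDiffAt_symm htgt
    exact h1.congr_of_eventuallyEq (h.mono fun x hx => hx.q₁_eq)
  · have h1 : ContMDiffAt 𝓘(ℝ, E') 𝓘(ℝ, E) ω
        (κ.symm ∘ ((fun Z : StdComplexification E => (conjEquiv E).symm Z.2) ∘ Θ)) (f p) := by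
      refine ContMDiffAt.comp (I' := 𝓘(ℝ, E)) _ ?_ (ContMDiffAt.comp
        (I' := 𝓘(ℝ, StdComplexification E)) _ ?_ (hΘ.isChart.real.contMDiffAt hΘ.mem))
      · rw [Function.comp_apply, hsnd]
        exact hκc.real.contMDiffAt_symm htgt
      · exact ((conjEquiv E).symm.contDiff.comp contDiff_snd).contDiffAt.contMDiffAt
    exact h1.congr_of_eventuallyEq (h.mono fun x hx => hx.q₂_eq)
  · have h1 : ContinuousAt (fun x => (conjEquiv E).symm (Θ x).2) (f p) :=
      ((conjEquiv E).symm.continuous.comp continuous_snd).continuousAt.comp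
        (Θ.continuousAt hΘ.mem)
    have h2 : ∀ᶠ x in 𝓝 (f p), (conjEquiv E).symm (Θ x).2 ∈ κ.target :=
      h1.eventually (κ.open_target.mem_nhds (by
        change (conjEquiv E).symm (Θ (f p)).2 ∈ κ.target; rw [hsnd]; exact htgt))
    filter_upwards [h.eventually_nhds, h2, Θ.open_source.mem_nhds hΘ.mem] with x e1 e2 e3
    intro (u : E')
    have e4 := rd_of_eventually_snd hΘ.isChart (q := q₂) e3 e2 (e1.mono fun y hy => hy.q₂_eq)
    refine (e4 (Complex.I • u)).trans ?_
    rw [hΘ.isChart.dT_smul_I e3, Prod.smul_snd, conjEquiv_symm_smul_I, map_neg,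
      hκc.dS_smul_I e2, ← e4 u]
    rfl
  · filter_upwards [hΘ.eventually_dT hf, hfp.eventually h] with p' e1 e2
    rw [e2.q₁_eq, e1.2.2.1]
    exact κ.left_inv e1.1
  · filter_upwards [hΘ.eventually_dT hf, hfp.eventually h] with p' e1 e2
    rw [e2.q₂_eq, e1.2.2.1, realIncl_apply, ContinuousLinearEquiv.symm_apply_apply]
    exact κ.left_inv e1.1
  · refine (hΘ.isChart.contMDiffAt_bilin_iff hΘ.mem).2 ?_
    rw [hΘp]
    refine homt.contDiffAt.congr_of_eventuallyEq ?_
    rw [← hΘp]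
    filter_upwards [hs.eventually h, Θ.open_target.mem_nhds (Θ.map_source hΘ.mem)] with Z e1 e2
    refine ContinuousLinearMap.ext fun u => ContinuousLinearMap.ext fun v => ?_
    refine (e1.om_eq (dS ℂ E' Θ Z u) (dS ℂ E' Θ Z v)).trans ?_
    rw [hΘ.isChart.dT_dS e2, hΘ.isChart.dT_dS e2, Θ.right_inv e2]
  · refine (hΘ.isChart.contMDiffAt_endo_iff hΘ.mem).2 ?_
    refine (contDiffAt_const (c := stdH E)).congr_of_eventuallyEq ?_
    filter_upwards [hs.eventually h, Θ.open_target.mem_nhds (Θ.map_source hΘ.mem)] with Z e1 e2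
    refine ContinuousLinearMap.ext fun u => ?_
    refine (e1.H_eq (dS ℂ E' Θ Z u)).trans ?_
    rw [hΘ.isChart.dT_dS e2]
  · filter_upwards [hΘ.eventually_dT hf, hfp.eventually h, (κ.continuousAt hp).eventually homt']
      with p' e1 e2 e3 u v
    obtain ⟨k1, k2, k3, k4⟩ := e1
    refine (e2.om_eq _ _).trans ?_
    refine (congrArg₂ (fun a b => omt (Θ (f p')) a b) ((hΘ.isChart.dT_real k2 _).symm.trans (k4 u))
      ((hΘ.isChart.dT_real k2 _).symm.trans (k4 v))).trans ?_
    simp only [k3]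
    rw [e3, complexifyBilin_realIncl]
    congr 1
    exact hκc.real.bilinIn_dT k1 (kahlerForm g₀) u v
  · filter_upwards [hΘ.eventually_dT hf, hfp.eventually h] with p' e1 e2 u
    obtain ⟨k1, k2, k3, k4⟩ := e1
    apply hΘ.isChart.real.injective_dT k2
    have k5 : ∀ w, dT ℂ E' Θ (f p') ((rd (E := E) (E' := E') f p' : E →L[ℝ] E') w) =
        realIncl E (dT ℝ E (chartAt E p) p' w) := fun w => (hΘ.isChart.dT_real k2 _).symm.trans (k4 w)
    refine (hΘ.isChart.dT_real k2 _).trans ((e2.H_eq _).trans ((congrArg (stdH E) (k5 u)).trans ?_))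
    rw [stdH_realIncl]
    exact ((k4 (Complex.I • (show E from u))).trans
      (congrArg (realIncl E) (hκc.dT_smul_I k1 u))).symm

/-- Existence of germs of canonical structures. -/
lemma exists_isGermAt (hf : IsComplexification E E' f) (g₀ : AnalyticMetric E N) (p : N) :
    ∃ q₁ q₂ om H, IsGermAt (E' := E') f g₀ q₁ q₂ om H p := by
  obtain ⟨Θ, h1, h2, h3⟩ := hf.exists_chart p
  obtain ⟨omt, h4, h5⟩ := exists_extension_localForm g₀ p
  -- The witnesses are the standard expressions pulled back by the straightening chart; values
  -- outside its source are irrelevant.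
  refine ⟨fun x => (chartAt E p).symm (Θ x).1,
    fun x => (chartAt E p).symm ((conjEquiv E).symm (Θ x).2),
    fun x => pullBilin (E := StdComplexification E) (G := E') (omt (Θ x)) (dT ℂ E' Θ x),
    fun x => (dS ℂ E' Θ (Θ x)).comp ((stdH E).comp (dT ℂ E' Θ x)),
    isGermAt_of_model hf.analytic ⟨h1, h2, h3⟩ h4 h5 ?_⟩
  filter_upwards [Θ.open_source.mem_nhds h2] with x hx
  exact ⟨rfl, rfl, fun u v => rfl, fun u => h1.dT_dS' hx _⟩

set_option synthInstance.maxHeartbeats 200000 in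
include hf in
/-- A germ of canonical structures at a point is a germ of canonical structures at the points
nearby. -/
lemma IsGermAt.eventually (h : IsGermAt (E' := E') f g₀ q₁ q₂ om H p) :
    ∀ᶠ p' in 𝓝 p, IsGermAt (E' := E') f g₀ q₁ q₂ om H p' := by
  have hfp : Tendsto f (𝓝 p) (𝓝 (f p)) := hf.continuous.continuousAt
  filter_upwards [hfp.eventually ((contMDiffAt_iff_contMDiffAt_nhds (by simp)).1 h.q₁_smooth),
    hfp.eventually ((contMDiffAt_iff_contMDiffAt_nhds (by simp)).1 h.q₂_smooth),
    hfp.eventually h.q₂_anti.eventually_nhds, h.retract₁.eventually_nhds,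
    h.retract₂.eventually_nhds,
    hfp.eventually ((contMDiffAt_iff_contMDiffAt_nhds (by simp)).1 h.om_smooth),
    hfp.eventually ((contMDiffAt_iff_contMDiffAt_nhds (by simp)).1 h.H_smooth),
    h.om_extends.eventually_nhds, h.H_extends.eventually_nhds] with p' e1 e2 e3 e4 e5 e6 e7 e8 e9
  exact ⟨e1, e2, e3, e4, e5, e6, e7, e8, e9⟩

/-- Uniqueness of germs of canonical structures. -/
lemma IsGermAt.eventuallyEq (hf : IsComplexification E E' f)
    (h : IsGermAt (E' := E') f g₀ q₁ q₂ om H p) {q₁' q₂' : M → N} {om' : CBilinField E' M}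
    {H' : CEndoField E' M} (h' : IsGermAt (E' := E') f g₀ q₁' q₂' om' H' p) :
    ∀ᶠ x in 𝓝 (f p), q₁ x = q₁' x ∧ q₂ x = q₂' x ∧ om x = om' x ∧ H x = H' x := by
  obtain ⟨Θ, h1, h2, h3⟩ := hf.exists_chart p
  obtain ⟨omt, h4, h5⟩ := exists_extension_localForm g₀ p
  filter_upwards [h.eventually_model hf.analytic ⟨h1, h2, h3⟩ h4 h5,
    h'.eventually_model hf.analytic ⟨h1, h2, h3⟩ h4 h5, Θ.open_source.mem_nhds h2] with x e1 e2 e3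
  refine ⟨e1.q₁_eq.trans e2.q₁_eq.symm, e1.q₂_eq.trans e2.q₂_eq.symm, ?_, ?_⟩
  · ext u v
    exact (e1.om_eq u v).trans (e2.om_eq u v).symm
  · ext1 u
    exact h1.injective_dT e3 ((e1.H_eq u).trans (e2.H_eq u).symm)

/-- Passing through the model form avoids testing each clause separately: having the standard
expression near `f p` visibly depends only on the germ. -/
lemma IsGermAt.congr (h : IsGermAt (E' := E') f g₀ q₁ q₂ om H p) (hf : IsComplexification E E' f)
    {q₁' q₂' : M → N} {om' : CBilinField E' M} {H' : CEndoField E' M}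
    (heq : ∀ᶠ x in 𝓝 (f p), q₁ x = q₁' x ∧ q₂ x = q₂' x ∧ om x = om' x ∧ H x = H' x) :
    IsGermAt (E' := E') f g₀ q₁' q₂' om' H' p := by
  obtain ⟨Θ, h1, h2, h3⟩ := hf.exists_chart p
  obtain ⟨omt, h4, h5⟩ := exists_extension_localForm g₀ p
  refine isGermAt_of_model hf.analytic ⟨h1, h2, h3⟩ h4 h5 ?_
  filter_upwards [h.eventually_model hf.analytic ⟨h1, h2, h3⟩ h4 h5, heq] with x e1 e2
  obtain ⟨k1, k2, k3, k4⟩ := e2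
  exact ⟨k1 ▸ e1.q₁_eq, k2 ▸ e1.q₂_eq, k3 ▸ e1.om_eq, k4 ▸ e1.H_eq⟩

/-- Existence of canonical structures around `N`. -/
lemma exists_forall_isGermAt [T2Space M] [SecondCountableTopology M] [Nonempty N]
    (hf : IsComplexification E E' f) (g₀ : AnalyticMetric E N) :
    ∃ q₁ q₂ om H, ∀ p, IsGermAt (E' := E') f g₀ q₁ q₂ om H p := by
  -- Local compactness together with the Hausdorff property gives the regularity required by the
  -- gluing lemma.
  haveI : LocallyCompactSpace M :=
    haveI : ProperSpace E' := FiniteDimensional.proper ℂ E'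
    ChartedSpace.locallyCompactSpace E' M
  -- The four objects are glued as a single function. The quantifier over `p` makes `P` a predicate
  -- on points of `M`; injectivity of `f` leaves at most one `p`.
  let P : (M → N × N × (E' →L[ℂ] E' →L[ℂ] ℂ) × (E' →L[ℂ] E')) → M → Prop := fun d x =>
    ∀ p, f p = x → IsGermAt (E' := E') f g₀ (fun x => (d x).1) (fun x => (d x).2.1)
      (fun x => (d x).2.2.1) (fun x => (d x).2.2.2) p
  obtain ⟨d, hd⟩ := exists_of_germs (Set.range f) P
    (fun d d' x _ h heq p hp => by
      refine (h p hp).congr hf ?_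
      rw [hp]
      exact heq.mono fun y hy => ⟨congrArg (·.1) hy, congrArg (·.2.1) hy,
        congrArg (·.2.2.1) hy, congrArg (·.2.2.2) hy⟩)
    (fun d x hx h => by
      obtain ⟨p, rfl⟩ := hx
      have h1 := (h p rfl).eventually hf.analytic
      rw [hf.embedding.isInducing.nhds_eq_comap] at h1
      obtain ⟨O, hO, hO'⟩ := h1
      filter_upwards [hO] with y hy _ p' hp'
      exact hO' (by rw [Set.mem_preimage, hp']; exact hy))
    (fun d d' x hx h h' => by
      obtain ⟨p, rfl⟩ := hx
      refine ((h p rfl).eventuallyEq hf (h' p rfl)).mono fun y hy => ?_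
      exact Prod.ext hy.1 (Prod.ext hy.2.1 (Prod.ext hy.2.2.1 hy.2.2.2)))
    (fun x hx => by
      obtain ⟨p, rfl⟩ := hx
      obtain ⟨q₁, q₂, om, H, h⟩ := exists_isGermAt hf g₀ p
      refine ⟨fun x => (q₁ x, q₂ x, om x, H x), fun p' hp' => ?_⟩
      rw [hf.embedding.injective hp']
      exact h)
  exact ⟨_, _, _, _, fun p => hd (f p) ⟨p, rfl⟩ p rfl⟩

end Germs

end BiquaternionicExtension
end

open scoped Manifold ContDiff
noncomputable section
namespace BiquaternionicExtension

/-! ### One-jets of bi-Lagrangian structures and the Koszul formula -/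

section Jets

variable {A C : Type*} [NormedAddCommGroup A] [NormedSpace ℂ A] [NormedAddCommGroup C]
  [NormedSpace ℂ C]

variable (A C) in
/-- The standard para-complex structure of a product, with `+1` eigenspace `0 × C`. -/
def stdF : A × C →L[ℂ] A × C :=
  (-(ContinuousLinearMap.fst ℂ A C)).prod (ContinuousLinearMap.snd ℂ A C)

@[simp] lemma stdF_apply (u : A × C) : stdF A C u = (-u.1, u.2) := rfl

lemma stdF_stdF (u : A × C) : stdF A C (stdF A C u) = u := by simp

/-- The one-jet of a complex symplectic form for which the factors of `A × C` are Lagrangian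
foliations. -/
structure IsJet (o : A × C →L[ℂ] A × C →L[ℂ] ℂ) (D : A × C →L[ℂ] A × C →L[ℂ] A × C →L[ℂ] ℂ) :
    Prop where
  alt : ∀ u, o u u = 0
  D_alt : ∀ w u, D w u u = 0
  iso₁ : ∀ u v, u.1 = 0 → v.1 = 0 → o u v = 0
  D_iso₁ : ∀ w u v, u.1 = 0 → v.1 = 0 → D w u v = 0
  iso₂ : ∀ u v, u.2 = 0 → v.2 = 0 → o u v = 0
  D_iso₂ : ∀ w u v, u.2 = 0 → v.2 = 0 → D w u v = 0
  closed : ∀ u v w, D u v w + D v w u + D w u v = 0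
  nondeg : ∀ u, (∀ v, o u v = 0) → u = 0

/-- `X` is the value of the Levi-Civita connection of the metric `o (F ·, ·)` on the constant
fields `u` and `v`, according to the Koszul formula. -/
def IsKoszul (o : A × C →L[ℂ] A × C →L[ℂ] ℂ) (D : A × C →L[ℂ] A × C →L[ℂ] A × C →L[ℂ] ℂ)
    (u v X : A × C) : Prop :=
  ∀ w, 2 * o (stdF A C X) w = D u (stdF A C v) w + D v (stdF A C u) w - D w (stdF A C u) v

lemma skew_of_alt {V : Type*} [NormedAddCommGroup V] [NormedSpace ℂ V] {b : V →L[ℂ] V →L[ℂ] ℂ}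
    (h : ∀ u, b u u = 0) (u v : V) : b u v = - b v u := by
  have := h (u + v)
  simp only [map_add, add_apply, h, zero_add, add_zero] at this
  linear_combination this

lemma split_apply (b : A × C →L[ℂ] A × C →L[ℂ] ℂ) (u v : A × C) :
    b u v = b (u.1, 0) (v.1, 0) + b (u.1, 0) (0, v.2) + b (0, u.2) (v.1, 0) +
      b (0, u.2) (0, v.2) := by
  have h : ∀ w : A × C, w = (w.1, 0) + (0, w.2) := fun w => by simp
  conv_lhs => rw [h u, h v]
  simp only [map_add, add_apply]
  ring

/-- Isotropy of both factors leaves only the mixed terms, and in those the two arguments are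
eigenvectors of opposite sign. -/
lemma bilin_stdF {b : A × C →L[ℂ] A × C →L[ℂ] ℂ} (h₁ : ∀ u v, u.1 = 0 → v.1 = 0 → b u v = 0)
    (h₂ : ∀ u v, u.2 = 0 → v.2 = 0 → b u v = 0) (u v : A × C) :
    b (stdF A C u) v = - b u (stdF A C v) := by
  have hn : ∀ a : A, ((-a, 0) : A × C) = -(a, 0) := fun a => by simp
  rw [split_apply b (stdF A C u), split_apply b u]
  simp only [stdF_apply, hn, map_neg, neg_apply, h₁ (0, _) (0, _) rfl rfl,
    h₂ (_, 0) (_, 0) rfl rfl]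
  ring

namespace IsJet

variable {o : A × C →L[ℂ] A × C →L[ℂ] ℂ} {D : A × C →L[ℂ] A × C →L[ℂ] A × C →L[ℂ] ℂ}
  (h : IsJet o D)
include h

lemma skew (u v : A × C) : o u v = - o v u := skew_of_alt h.alt u v

lemma D_skew (w u v : A × C) : D w u v = - D w v u := skew_of_alt (h.D_alt w) u v

lemma o_stdF (u v : A × C) : o (stdF A C u) v = - o u (stdF A C v) :=
  bilin_stdF h.iso₁ h.iso₂ u v

lemma D_stdF (w u v : A × C) : D w (stdF A C u) v = - D w u (stdF A C v) :=
  bilin_stdF (h.D_iso₁ w) (h.D_iso₂ w) u v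

lemma eq_of_stdF {X X' : A × C} (hX : ∀ w, o (stdF A C X) w = o (stdF A C X') w) : X = X' := by
  have h1 : stdF A C X - stdF A C X' = 0 := h.nondeg _ fun v => by
    rw [map_sub, sub_apply, hX v, sub_self]
  rw [← stdF_stdF X, ← stdF_stdF X', sub_eq_zero.1 h1]

lemma koszul_unique {u v X X' : A × C} (hX : IsKoszul o D u v X) (hX' : IsKoszul o D u v X') :
    X = X' :=
  h.eq_of_stdF fun w => by linear_combination (hX w - hX' w) / 2

/-- Absence of torsion for constant fields: the first two Koszul terms are exchanged, and the last
is symmetric because `D w (F ·) ·` is a symmetric form. -/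
lemma koszul_symm {u v X : A × C} (hX : IsKoszul o D u v X) : IsKoszul o D v u X := fun w => by
  rw [hX w, h.D_stdF w u v, h.D_skew w u]
  ring

/-- The connection preserves the metric. -/
lemma koszul_metric {u v w X Y : A × C} (hX : IsKoszul o D u v X) (hY : IsKoszul o D u w Y) :
    o (stdF A C X) w + o (stdF A C v) Y = D u (stdF A C v) w := by
  have h1 := hX w
  have h2 := hY v
  have h3 : o (stdF A C v) Y = o (stdF A C Y) v := by
    rw [h.o_stdF, h.skew, neg_neg]
  have h4 : D u (stdF A C w) v = D u (stdF A C v) w := by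
    rw [h.D_stdF, h.D_skew, neg_neg]
  rw [h3]
  linear_combination (h1 + h2 + h4) / 2

/-- The leaves of the first foliation carry a Bott connection for which the constant horizontal
fields are parallel. -/
lemma koszul_zero {u v X : A × C} (hu : u.1 = 0) (hv : v.2 = 0) (hX : IsKoszul o D u v X) :
    X = 0 := by
  refine h.eq_of_stdF fun w => ?_
  have hFu : stdF A C u = u := Prod.ext (by simp [hu]) rfl
  have hFv : stdF A C v = -v := Prod.ext rfl (by simp [hv])
  have h1 := hX w
  rw [hFu, hFv, map_neg, neg_apply] at h1
  -- Closedness makes the three Koszul terms cancel.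
  have h2 : D u v w = - D v w u - D w u v := by linear_combination h.closed u v w
  rw [h2, h.D_skew v u w] at h1
  simp only [map_zero, zero_apply]
  linear_combination h1 / 2

/-- The connection preserves the first foliation. -/
lemma koszul_vertical {u v X : A × C} (hu : u.1 = 0) (hv : v.1 = 0) (hX : IsKoszul o D u v X) :
    X.1 = 0 := by
  have hFu : stdF A C u = u := Prod.ext (by simp [hu]) rfl
  have hFv : stdF A C v = v := Prod.ext (by simp [hv]) rfl
  -- When `u` and `v` are vertical, isotropy kills every Koszul term against vertical `w`. The
  -- horizontal part of `X` is then orthogonal to both factors, and nondegeneracy removes it.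
  have h0 : ∀ w : A × C, w.1 = 0 → o (stdF A C X) w = 0 := fun w hw => by
    have h1 := hX w
    rw [hFu, hFv, h.D_iso₁ _ _ _ hv hw, h.D_iso₁ _ _ _ hu hw, h.D_iso₁ _ _ _ hu hv] at h1
    linear_combination h1 / 2
  have h1 : ((-X.1, 0) : A × C) = 0 := h.nondeg _ fun w => by
    have h2 := h0 (0, w.2) rfl
    rw [split_apply] at h2 ⊢
    simp only [stdF_apply, h.iso₁ (0, _) (0, _) rfl rfl, Prod.mk_zero_zero, map_zero,
      zero_apply, add_zero, zero_add] at h2 ⊢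
    rw [h2, h.iso₂ _ _ rfl rfl, add_zero]
  simpa using h1

/-- Existence of the Levi-Civita connection. -/
lemma exists_koszul [FiniteDimensional ℂ A] [FiniteDimensional ℂ C] :
    ∃ Γ : A × C →L[ℂ] A × C →L[ℂ] A × C, ∀ u v, IsKoszul o D u v (Γ u v) := by
  have hinj : Function.Injective (o.comp (stdF A C)).toLinearMap := by
    refine (injective_iff_map_eq_zero _).2 fun X hX => h.eq_of_stdF fun w => ?_
    have := congrArg (fun L : A × C →L[ℂ] ℂ => L w) hX
    exact this.trans (by rw [map_zero, map_zero])
  have hdim : Module.finrank ℂ (A × C) = Module.finrank ℂ (A × C →L[ℂ] ℂ) := by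
    rw [← (LinearMap.toContinuousLinearMap (𝕜 := ℂ) (E := A × C) (F' := ℂ)).finrank_eq]
    exact (Subspace.dual_finrank_eq (K := ℂ) (V := A × C)).symm
  haveI : FiniteDimensional ℂ (A × C →L[ℂ] ℂ) :=
    (LinearMap.toContinuousLinearMap (𝕜 := ℂ) (E := A × C) (F' := ℂ)).finiteDimensional
  -- `e` is the isomorphism with the dual given by the metric. The Christoffel symbol is its inverse
  -- applied to half of the Koszul expression, assembled from the bounded operators `DF`, `DF.flip`
  -- and `T` so that it is bilinear by construction.
  let e : (A × C) ≃L[ℂ] (A × C →L[ℂ] ℂ) :=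
    (LinearEquiv.ofInjectiveOfFinrankEq _ hinj hdim).toContinuousLinearEquiv
  have he : ∀ X w, e X w = o (stdF A C X) w := fun X w => rfl
  let DF : A × C →L[ℂ] A × C →L[ℂ] A × C →L[ℂ] ℂ :=
    ((ContinuousLinearMap.compL ℂ (A × C) (A × C) (A × C →L[ℂ] ℂ)).flip (stdF A C)).comp D
  have hDF : ∀ u v w, DF u v w = D u (stdF A C v) w := fun u v w => rfl
  let T : A × C →L[ℂ] A × C →L[ℂ] A × C →L[ℂ] ℂ :=
    ((ContinuousLinearMap.flipₗᵢ ℂ (A × C) (A × C) ℂ).toContinuousLinearEquiv :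
      (A × C →L[ℂ] A × C →L[ℂ] ℂ) →L[ℂ] (A × C →L[ℂ] A × C →L[ℂ] ℂ)).comp DF.flip
  have hT : ∀ u v w, T u v w = D w (stdF A C u) v := fun u v w => rfl
  let P : (A × C →L[ℂ] A × C →L[ℂ] ℂ) →L[ℂ] (A × C →L[ℂ] A × C) :=
    ContinuousLinearMap.compL ℂ (A × C) (A × C →L[ℂ] ℂ) (A × C)
      ((1 / 2 : ℂ) • (e.symm : (A × C →L[ℂ] ℂ) →L[ℂ] A × C))
  have hP : ∀ L v w, o (stdF A C (P L v)) w = (1 / 2 : ℂ) * L v w := fun L v w => by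
    change o (stdF A C ((1 / 2 : ℂ) • e.symm (L v))) w = _
    rw [map_smul, map_smul, smul_apply, ← he, ContinuousLinearEquiv.apply_symm_apply, smul_eq_mul]
  refine ⟨P.comp DF + P.comp DF.flip - P.comp T, fun u v w => ?_⟩
  simp only [add_apply, sub_apply, ContinuousLinearMap.comp_apply, map_add, map_sub, hP,
    ContinuousLinearMap.flip_apply, hDF, hT]
  ring

end IsJet

end Jets

end BiquaternionicExtension
end

open scoped Manifold ContDiff
noncomputable section
namespace BiquaternionicExtension

/-! ### Coordinate fields -/

section CoordFields

open Filter Topology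

variable {E : Type*} [NormedAddCommGroup E] [NormedSpace ℂ E]
  {G : Type*} [NormedAddCommGroup G] [NormedSpace ℝ G]
  {W : Type*} [NormedAddCommGroup W] [NormedSpace ℝ W]
  {M : Type*} [TopologicalSpace M] [ChartedSpace E M]

/-- The coordinate fields of a chart. -/
def coordField (Θ : OpenPartialHomeomorph M G) (V : G) : ∀ x : M, TangentSpace 𝓘(ℝ, E) x :=
  fun x => dS ℝ E Θ (Θ x) V

namespace IsChart

variable {Θ : OpenPartialHomeomorph M G} (hΘ : IsChart ℝ E Θ)
include hΘ

lemma vecIn_coordField (V : G) {Z : G} (hZ : Z ∈ Θ.target) :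
    vecIn ℝ E Θ (coordField Θ V) Z = V := by
  change dT ℝ E Θ (Θ.symm Z) (dS ℝ E Θ (Θ (Θ.symm Z)) V) = V
  rw [Θ.right_inv hZ, hΘ.dT_dS hZ]

lemma eventually_vecIn_coordField (V : G) {x : M} (hx : x ∈ Θ.source) :
    vecIn ℝ E Θ (coordField Θ V) =ᶠ[𝓝 (Θ x)] fun _ => V := by
  filter_upwards [Θ.open_target.mem_nhds (Θ.map_source hx)] with Z hZ
  exact hΘ.vecIn_coordField V hZ

lemma mvfderiv_of_eqOn {φ : M → W} {φt : G → W} {x : M} (hx : x ∈ Θ.source)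
    (hφ : ∀ᶠ y in 𝓝 x, φ y = φt (Θ y)) (hd : DifferentiableAt ℝ φt (Θ x)) (u : E) :
    mvfderiv 𝓘(ℝ, E) φ x u = fderiv ℝ φt (Θ x) (dT ℝ E Θ x u) := by
  have hs : Tendsto Θ.symm (𝓝 (Θ x)) (𝓝 x) := by
    have := Θ.continuousAt_symm (Θ.map_source hx)
    rwa [ContinuousAt, Θ.left_inv hx] at this
  have h1 : φ ∘ Θ.symm =ᶠ[𝓝 (Θ x)] φt := by
    filter_upwards [hs.eventually hφ, Θ.open_target.mem_nhds (Θ.map_source hx)] with Z hZ hZ'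
    rw [Function.comp_apply, hZ, Θ.right_inv hZ']
  rw [hΘ.mvfderiv_apply hx (hd.congr_of_eventuallyEq h1), h1.fderiv_eq]

variable [IsManifold 𝓘(ℂ, E) ω M]

lemma vdiffAt_iff {X : ∀ x : M, TangentSpace 𝓘(ℝ, E) x} {x : M} (hx : x ∈ Θ.source) :
    VDiffAt X x ↔ DifferentiableAt ℝ (vecIn ℝ E Θ X) (Θ x) :=
  hΘ.mdifferentiableAt_vector_iff hx

lemma vdiffAt_coordField (V : G) {x : M} (hx : x ∈ Θ.source) :
    VDiffAt (coordField (E := E) Θ V) x :=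
  (hΘ.vdiffAt_iff hx).2
    ((differentiableAt_const V).congr_of_eventuallyEq (hΘ.eventually_vecIn_coordField V hx))

/-- The Lie bracket in a chart. -/
lemma dT_bracket [CompleteSpace E] [CompleteSpace G] {X Y : ∀ x : M, TangentSpace 𝓘(ℝ, E) x} {x : M}
    (hx : x ∈ Θ.source) (hX : VDiffAt X x) (hY : VDiffAt Y x) :
    dT ℝ E Θ x (VectorField.mlieBracket 𝓘(ℝ, E) X Y x) =
      fderiv ℝ (vecIn ℝ E Θ Y) (Θ x) (dT ℝ E Θ x (X x)) -
      fderiv ℝ (vecIn ℝ E Θ X) (Θ x) (dT ℝ E Θ x (Y x)) := by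
  haveI : IsManifold 𝓘(ℝ, E) (minSmoothness ℝ 3) M := IsManifold.of_le (n := ω) le_top
  exact hΘ.dT_mlieBracket hx ((hΘ.vdiffAt_iff hx).1 hX) ((hΘ.vdiffAt_iff hx).1 hY)

lemma mlieBracket_coordField [CompleteSpace E] [CompleteSpace G] (V V' : G) {x : M}
    (hx : x ∈ Θ.source) :
    VectorField.mlieBracket 𝓘(ℝ, E) (coordField Θ V) (coordField Θ V') x = 0 := by
  apply hΘ.injective_dT hx
  refine (hΘ.dT_bracket hx (hΘ.vdiffAt_coordField V hx) (hΘ.vdiffAt_coordField V' hx)).trans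
    (Eq.trans ?_ (map_zero (dT ℝ E Θ x)).symm)
  rw [(hΘ.eventually_vecIn_coordField V hx).fderiv_eq,
    (hΘ.eventually_vecIn_coordField V' hx).fderiv_eq]
  simp

end IsChart

end CoordFields

/-! ### The Kähler form is closed -/

section Kahler

open Filter Topology

variable {E : Type*} [NormedAddCommGroup E] [NormedSpace ℂ E] [FiniteDimensional ℂ E]
  {N : Type*} [TopologicalSpace N] [ChartedSpace E N] [IsManifold 𝓘(ℂ, E) ω N]
  {g₀ : AnalyticMetric E N}

omit [FiniteDimensional ℂ E] in
lemma IsKahler.localForm_skew (h : IsKahler g₀) (p : N) (z u v : E) :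
    localForm g₀ p z u v = - localForm g₀ p z v u :=
  h.skew _ _ _

omit [FiniteDimensional ℂ E] in
-- This says that the form is of type `(1,1)`, which will make the canonical foliations Lagrangian.
lemma IsKahler.localForm_I (h : IsKahler g₀) (p : N) {z : E} (hz : z ∈ (chartAt E p).target)
    (u v : E) : localForm g₀ p z (Complex.I • u) v = - localForm g₀ p z u (Complex.I • v) := by
  rw [h.localForm_skew p z u, localForm_apply g₀ p hz, localForm_apply g₀ p hz, I_smul_I_smul,
    I_smul_I_smul, map_neg, neg_apply, map_neg, neg_apply, neg_neg, neg_inj]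
  exact g₀.symm _ _ _

/-- A form that is parallel for a torsion-free connection is closed. Here `ω₀ = g₀(I₀·, ·)` is
parallel because both `g₀` and `I₀` are, and the Christoffel terms cancel in the cyclic sum. -/
lemma IsKahler.localForm_closed (h : IsKahler g₀) (p : N) {z : E}
    (hz : z ∈ (chartAt E p).target) (u v w : E) :
    fderiv ℝ (localForm g₀ p) z u v w + fderiv ℝ (localForm g₀ p) z v w u +
      fderiv ℝ (localForm g₀ p) z w u v = 0 := by
  haveI : CompleteSpace E := FiniteDimensional.complete ℂ E
  obtain ⟨cov, hLC, hI⟩ := h.parallel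
  set κ := chartAt E p with hκ
  have hκc : IsChart ℂ E κ := isChart_chartAt p
  have hκr := hκc.real
  set x := κ.symm z with hx
  have hxs : x ∈ κ.source := κ.map_target hz
  have hxz : κ x = z := κ.right_inv hz
  let e : E → N → E := fun V => coordField κ V
  have he : ∀ V, VDiffAt (e V) x := fun V => hκr.vdiffAt_coordField V hxs
  -- `c` is the Christoffel symbol read on coordinate fields; it is symmetric since these commute.
  let c : E → E → E := fun U V => cov (e V) x (e U x)
  have hc : ∀ U V, c U V = c V U := fun U V => by
    have h1 := hLC.torsionFree x (Set.mem_univ x) (e U) (e V) (he U) (he V)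
    have h2 := h1.trans (hκr.mlieBracket_coordField U V hxs)
    exact sub_eq_zero.1 h2
  let β : E →L[ℝ] E →L[ℝ] ℝ := kahlerForm g₀ x
  have hβ : ∀ U V, β U V = - β V U := fun U V => h.skew x U V
  have hIe : ∀ y ∈ κ.source, ∀ V, Complex.I • e V y = e (Complex.I • V) y := fun y hy V =>
    (hκc.dS_smul_I (κ.map_source hy) V).symm
  have key : ∀ U V W : E, fderiv ℝ (localForm g₀ p) z U V W = β (c U V) (e W x) + β (e V x) (c U W) := by
    intro U V W
    -- As the chart is holomorphic, `I₀` maps coordinate fields to coordinate fields, so the field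
    -- `I₀ V` is admissible in the metric identity.
    have hIV : VDiffAt (fun y => complexStructure E N y (e V y)) x := by
      refine (hκr.vdiffAt_iff hxs).2 ((differentiableAt_const (Complex.I • V)).congr_of_eventuallyEq ?_)
      filter_upwards [κ.open_target.mem_nhds (κ.map_source hxs)] with Z hZ
      refine Eq.trans ?_ (hκr.vecIn_coordField (Complex.I • V) hZ)
      exact congrArg (dT ℝ E κ (κ.symm Z)) (hIe _ (κ.map_target hZ) V)
    have h1 := hLC.parallel x (Set.mem_univ x) (e U x) trivial _ (e W) hIV (he W)
    have h2 := hI x (Set.mem_univ x) (e U x) trivial (e V) (he V)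
    have hd : DifferentiableAt ℝ (localForm g₀ p) z :=
      (contDiffAt_localForm g₀ p hz).differentiableAt (by simp)
    have h3 : mvfderiv 𝓘(ℝ, E) (fun y => g₀.inner y (complexStructure E N y (e V y)) (e W y)) x
        (e U x) = fderiv ℝ (fun Z => localForm g₀ p Z V W) (κ x) (dT ℝ E κ x (e U x)) := by
      refine hκr.mvfderiv_of_eqOn (φt := fun Z => localForm g₀ p Z V W) hxs ?_ ?_ (e U x)
      · filter_upwards [κ.open_source.mem_nhds hxs] with y hy
        change _ = kahlerForm g₀ (κ.symm (κ y)) (dS ℝ E κ (κ y) V) (dS ℝ E κ (κ y) W)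
        rw [κ.left_inv hy]
        rfl
      · rw [hxz]
        exact (hd.clm_apply (differentiableAt_const V)).clm_apply (differentiableAt_const W)
    have h4 : dT ℝ E κ x (e U x) = U := hκr.dT_dS' hxs U
    have h5 : fderiv ℝ (fun Z => localForm g₀ p Z V W) z U = fderiv ℝ (localForm g₀ p) z U V W := by
      have := ((hd.hasFDerivAt.clm_apply (hasFDerivAt_const V z)).clm_apply
        (hasFDerivAt_const W z)).fderiv
      rw [this]
      simp
    rw [h4, hxz, h5] at h3
    refine h3.symm.trans (h1.trans ?_)
    exact congrArg (fun X : E => (g₀.inner x : E →L[ℝ] E →L[ℝ] ℝ) X (e W x) + β (e V x) (c U W)) h2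
  rw [key, key, key]
  linear_combination congrArg (fun X => β X (e w x)) (hc u v) +
    congrArg (fun X => β X (e u x)) (hc v w) + congrArg (fun X => β X (e v x)) (hc w u) +
    hβ (e v x) (c u w) + hβ (e w x) (c v u) + hβ (e u x) (c w v)

end Kahler

end BiquaternionicExtension
end

open scoped Manifold ContDiff
noncomputable section
namespace BiquaternionicExtension

/-! ### Local models and the identities propagated from `N`. -/

section LocalModel

open Filter Topology Metric

variable {E : Type*} [NormedAddCommGroup E] [NormedSpace ℂ E] [FiniteDimensional ℂ E]
  {N : Type*} [TopologicalSpace N] [ChartedSpace E N] [IsManifold 𝓘(ℂ, E) ω N]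
  {E' : Type*} [NormedAddCommGroup E'] [NormedSpace ℂ E'] [FiniteDimensional ℂ E']
  {M : Type*} [TopologicalSpace M] [ChartedSpace E' M] [IsManifold 𝓘(ℂ, E') ω M]

/-- An adapted chart in whose domain the canonical structures have the standard expression. -/
structure IsLocalModel (f : N → M) (g₀ : AnalyticMetric E N) (q₁ q₂ : M → N)
    (om : CBilinField E' M) (H : CEndoField E' M) (p : N)
    (Θ : OpenPartialHomeomorph M (StdComplexification E)) (ρ : ℝ)
    (omt : StdComplexification E → StdComplexification E →L[ℂ] StdComplexification E →L[ℂ] ℂ) :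
    Prop where
  adapted : IsAdapted (E' := E') f p Θ ρ
  model : ∀ x ∈ Θ.source, IsModelAt q₁ q₂ om H p Θ omt x
  analytic : ∀ Z ∈ polydisc (chartAt E p p) ρ, AnalyticAt ℂ omt Z
  omt_realIncl : ∀ z ∈ ball (chartAt E p p) ρ,
    omt (realIncl E z) = complexifyBilin (localForm g₀ p z)
  nondeg : ∀ Z ∈ polydisc (chartAt E p p) ρ, ∀ u, (∀ v, omt Z u v = 0) → u = 0

/-- Against a real vector the value is `b (Re u) v + i b (Im u) v`; real and imaginary parts
separate the two components of `u`. -/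
lemma complexifyBilin_nondeg {b : E →L[ℝ] E →L[ℝ] ℝ} (hb : ∀ u, (∀ v, b u v = 0) → u = 0)
    {u : StdComplexification E} (hu : ∀ v, complexifyBilin b u v = 0) : u = 0 := by
  have h1 : ∀ v, (b (stdRe E u) v : ℂ) + Complex.I * (b (stdIm E u) v : ℂ) = 0 := fun v => by
    rw [← complexifyBilin_realIncl, ← complexifyBilin_realIncl, ← hu (realIncl E v)]
    conv_rhs => rw [← realIncl_re_add_im u]
    rw [map_add, add_apply, map_smul, smul_apply, smul_eq_mul]
  have h2 : stdRe E u = 0 := hb _ fun v => by simpa using congrArg Complex.re (h1 v)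
  have h3 : stdIm E u = 0 := hb _ fun v => by simpa using congrArg Complex.im (h1 v)
  rw [← realIncl_re_add_im u, h2, h3]
  simp

omit [FiniteDimensional ℂ E] in
lemma localMetric_pos (g₀ : AnalyticMetric E N) (p : N) {z : E} (hz : z ∈ (chartAt E p).target)
    {u : E} (hu : u ≠ 0) : 0 < localMetric g₀ p z u u := by
  refine g₀.pos _ _ fun h0 => hu ?_
  have h1 := (isChart_chartAt (𝕜 := ℝ) (E := E) p).dT_dS hz u
  rw [← h1]
  exact (congrArg (dT ℝ E (chartAt E p) ((chartAt E p).symm z)) h0).trans (map_zero _)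

omit [FiniteDimensional ℂ E] in
lemma localForm_nondeg (g₀ : AnalyticMetric E N) (p : N) {z : E} (hz : z ∈ (chartAt E p).target)
    {u : E} (hu : ∀ v, localForm g₀ p z u v = 0) : u = 0 := by
  by_contra hne
  have h1 := hu (Complex.I • u)
  rw [localForm_apply g₀ p hz] at h1
  exact (localMetric_pos g₀ p hz (smul_ne_zero Complex.I_ne_zero hne)).ne' h1

/-- Existence of local models. -/
lemma IsGermAt.exists_localModel {f : N → M} {g₀ : AnalyticMetric E N} {q₁ q₂ : M → N}
    {om : CBilinField E' M} {H : CEndoField E' M} {p : N} (hf : IsComplexification E E' f)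
    (h : IsGermAt (E' := E') f g₀ q₁ q₂ om H p) {O : Set M} (hO : O ∈ 𝓝 (f p)) :
    ∃ Θ ρ omt, IsLocalModel f g₀ q₁ q₂ om H p Θ ρ omt ∧ f p ∈ Θ.source ∧ Θ.source ⊆ O := by
  obtain ⟨Θ, h1, h2, h3⟩ := hf.exists_chart p
  obtain ⟨omt, h4, h5⟩ := exists_extension_localForm g₀ p
  have hmod := h.eventually_model hf.analytic ⟨h1, h2, h3⟩ h4 h5
  have hΘp : Θ (f p) = realIncl E (chartAt E p p) := h3.self_of_nhds
  -- Injectivity of a linear map is an open condition, and it holds at the centre because the Kähler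
  -- form is nondegenerate.
  have hnd : ∀ᶠ Z in 𝓝 (realIncl E (chartAt E p p)), Function.Injective (omt Z) := by
    refine h4.continuousAt.eventually (ContinuousLinearMap.isOpen_injective.mem_nhds ?_)
    refine (injective_iff_map_eq_zero _).2 fun u hu => ?_
    rw [h5.self_of_nhds] at hu
    exact complexifyBilin_nondeg (fun u => localForm_nondeg g₀ p (mem_chart_target E p))
      fun v => by rw [hu]; rfl
  have hgood : ∀ᶠ Z in 𝓝 (realIncl E (chartAt E p p)), Function.Injective (omt Z) ∧
      AnalyticAt ℂ omt Z := hnd.and h4.eventually_analyticAt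
  have hgood' : ∀ᶠ x in 𝓝 (f p), Function.Injective (omt (Θ x)) ∧ AnalyticAt ℂ omt (Θ x) :=
    (IsStraightening.mk h1 h2 h3).eventually_of hgood
  have h5' : ∀ᶠ p' in 𝓝 p, omt (realIncl E (chartAt E p p')) =
      complexifyBilin (localForm g₀ p (chartAt E p p')) :=
    ((chartAt E p).continuousAt (mem_chart_source E p)).eventually h5
  obtain ⟨O₂, hO₂, hO₂'⟩ := hf.embedding.isInducing.nhds_eq_comap p ▸ h5'
  obtain ⟨Θ', ρ, k1, k2, k3, k4, k5⟩ := exists_isAdapted hf.embedding h1 h2 h3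
    (inter_mem hO (inter_mem hO₂ (hmod.and hgood')))
  have hpre : ∀ Z ∈ polydisc (chartAt E p p) ρ, ∃ x ∈ Θ'.source, Θ' x = Z := fun Z hZ => by
    rw [← k1.target_eq] at hZ
    exact ⟨Θ'.symm Z, Θ'.map_target hZ, Θ'.right_inv hZ⟩
  refine ⟨Θ', ρ, omt, ⟨k1, fun x hx => ?_, fun Z hZ => ?_, fun z hz => ?_, fun Z hZ u hu => ?_⟩, k2,
    fun x hx => (k3 hx).1.1⟩
  · obtain ⟨e1, e2, e3, e4⟩ := (k3 hx).1.2.2.1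
    have hd : dT ℂ E' Θ' x = dT ℂ E' Θ x := by rw [dT, dT, k4]
    exact ⟨by rw [k4]; exact e1, by rw [k4]; exact e2, by rw [k4, hd]; exact e3, by rw [hd]; exact e4⟩
  · obtain ⟨x, hx, rfl⟩ := hpre Z hZ
    rw [k4]
    exact (k3 hx).1.2.2.2.2
  · have h6 : f ((chartAt E p).symm z) ∈ Θ'.source := by
      rw [← k1.symm_realIncl z hz]
      refine Θ'.map_target ?_
      rw [k1.target_eq]
      exact realIncl_mem_polydisc.2 hz
    have h7 := hO₂' (show f ((chartAt E p).symm z) ∈ O₂ from (k3 h6).1.2.1)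
    simp only [Set.mem_ofPred_eq, (chartAt E p).right_inv (k1.ball_subset hz)] at h7
    exact h7
  · obtain ⟨x, hx, rfl⟩ := hpre Z hZ
    rw [k4] at hu
    refine (k3 hx).1.2.2.2.1 (a₂ := 0) ?_
    rw [map_zero]
    exact ContinuousLinearMap.ext hu

/-- Vertical vectors are the vectors `(u + i I₀ u) / 2`, that is, the `-i` eigenspace of the
complexified structure. The next lemma is the counterpart for `+i`. -/
lemma zero_snd_eq (w : ConjModel E) : ((0, w) : StdComplexification E) =
    realIncl E ((1 / 2 : ℝ) • (conjEquiv E).symm w) +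
      Complex.I • realIncl E (Complex.I • (1 / 2 : ℝ) • (conjEquiv E).symm w) := by
  refine Prod.ext ?_ ?_
  · simp only [realIncl_apply, Prod.fst_add, Prod.smul_fst, I_smul_I_smul, add_neg_cancel]
  · simp only [realIncl_apply, Prod.snd_add, Prod.smul_snd, conjEquiv_smul_I, smul_neg,
      I_smul_I_smul, neg_neg, map_smul, ContinuousLinearEquiv.apply_symm_apply]
    module

lemma fst_zero_eq (a : E) : ((a, 0) : StdComplexification E) =
    realIncl E ((1 / 2 : ℝ) • a) - Complex.I • realIncl E (Complex.I • (1 / 2 : ℝ) • a) := by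
  refine Prod.ext ?_ ?_
  · simp only [realIncl_apply, Prod.fst_sub, Prod.smul_fst, I_smul_I_smul, sub_neg_eq_add]
    module
  · simp only [realIncl_apply, Prod.snd_sub, Prod.smul_snd, conjEquiv_smul_I, smul_neg,
      I_smul_I_smul, neg_neg, sub_self]

/-- A form of type `(1,1)` vanishes on two vectors of the same type. -/
lemma complexifyBilin_vertical {b : E →L[ℝ] E →L[ℝ] ℝ}
    (hb : ∀ u v, b (Complex.I • u) v = - b u (Complex.I • v)) (w w' : ConjModel E) :
    complexifyBilin b (0, w) (0, w') = 0 := by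
  have hb' : ∀ u v, b (Complex.I • u) (Complex.I • v) = b u v := fun u v => by
    rw [hb, I_smul_I_smul, map_neg, neg_neg]
  rw [zero_snd_eq, zero_snd_eq]
  generalize (1 / 2 : ℝ) • (conjEquiv E).symm w = u
  generalize (1 / 2 : ℝ) • (conjEquiv E).symm w' = v
  simp only [map_add, map_smul, add_apply, smul_apply, complexifyBilin_realIncl, smul_eq_mul]
  rw [hb', hb]
  push_cast
  linear_combination (b u v : ℂ) * Complex.I_mul_I

lemma complexifyBilin_horizontal {b : E →L[ℝ] E →L[ℝ] ℝ}
    (hb : ∀ u v, b (Complex.I • u) v = - b u (Complex.I • v)) (a a' : E) :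
    complexifyBilin b (a, 0) (a', 0) = 0 := by
  have hb' : ∀ u v, b (Complex.I • u) (Complex.I • v) = b u v := fun u v => by
    rw [hb, I_smul_I_smul, map_neg, neg_neg]
  rw [fst_zero_eq, fst_zero_eq]
  generalize (1 / 2 : ℝ) • a = u
  generalize (1 / 2 : ℝ) • a' = v
  simp only [map_sub, map_smul, sub_apply, smul_apply, complexifyBilin_realIncl, smul_eq_mul]
  rw [hb', hb]
  push_cast
  linear_combination (b u v : ℂ) * Complex.I_mul_I

lemma complexifyBilin_alt {b : E →L[ℝ] E →L[ℝ] ℝ} (hb : ∀ u v, b u v = - b v u)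
    (u : StdComplexification E) : complexifyBilin b u u = 0 := by
  have h0 : ∀ u, b u u = 0 := fun u => by have := hb u u; linarith
  rw [← realIncl_re_add_im u]
  simp only [map_add, map_smul, add_apply, smul_apply, complexifyBilin_realIncl, smul_eq_mul, h0,
    hb (stdIm E u) (stdRe E u)]
  push_cast
  ring

omit [FiniteDimensional ℂ E] in
lemma fderiv_eq_zero_of_eventually {V : Type*} [NormedAddCommGroup V] [NormedSpace ℂ V]
    {b : V → V →L[ℂ] V →L[ℂ] ℂ} {Z u v : V} (hb : DifferentiableAt ℂ b Z)
    (h : ∀ᶠ Z in 𝓝 Z, b Z u v = 0) (w : V) : fderiv ℂ b Z w u v = 0 := by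
  have h1 := (hb.hasFDerivAt.clm_apply (hasFDerivAt_const u Z)).clm_apply (hasFDerivAt_const v Z)
  have h2 : HasFDerivAt (fun Z => b Z u v) (0 : V →L[ℂ] ℂ) Z :=
    (hasFDerivAt_const (0 : ℂ) Z).congr_of_eventuallyEq h
  have h3 := congrArg (fun L : V →L[ℂ] ℂ => L w) (h1.unique h2)
  simpa using h3

namespace IsLocalModel

variable {f : N → M} {g₀ : AnalyticMetric E N} {q₁ q₂ : M → N}
  {om : CBilinField E' M} {H : CEndoField E' M} {p : N}
  {Θ : OpenPartialHomeomorph M (StdComplexification E)} {ρ : ℝ}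
  {omt : StdComplexification E → StdComplexification E →L[ℂ] StdComplexification E →L[ℂ] ℂ}
  (h : IsLocalModel f g₀ q₁ q₂ om H p Θ ρ omt)
include h

omit [FiniteDimensional ℂ E'] [IsManifold 𝓘(ℂ, E') ω M] in
/-- An identity between holomorphic expressions which holds on `N` holds everywhere. -/
lemma identity {φ : StdComplexification E → ℂ}
    (hφ : ∀ Z ∈ polydisc (chartAt E p p) ρ, AnalyticAt ℂ φ Z)
    (h0 : ∀ z ∈ ball (chartAt E p p) ρ, φ (realIncl E z) = 0) :
    ∀ Z ∈ polydisc (chartAt E p p) ρ, φ Z = 0 :=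
  eqOn_polydisc h.adapted.pos hφ (fun _ _ => analyticAt_const)
    (by filter_upwards [ball_mem_nhds _ h.adapted.pos] with z hz using h0 z hz)

omit [FiniteDimensional ℂ E'] [IsManifold 𝓘(ℂ, E') ω M] in
lemma analyticAt_fderiv_apply (u v w : StdComplexification E) {Z : StdComplexification E}
    (hZ : Z ∈ polydisc (chartAt E p p) ρ) : AnalyticAt ℂ (fun Z => fderiv ℂ omt Z u v w) Z := by
  have h1 : AnalyticAt ℂ (fun Z => fderiv ℂ (fun Z => omt Z v w) Z u) Z := by
    have h2 : AnalyticAt ℂ (fun Z => omt Z v w) Z :=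
      (((h.analytic Z hZ).contDiffAt (n := ω)).clm_apply contDiffAt_const |>.clm_apply
        contDiffAt_const).analyticAt
    exact ((h2.fderiv.contDiffAt (n := ω)).clm_apply contDiffAt_const).analyticAt
  refine h1.congr ?_
  filter_upwards [(isOpen_polydisc _ _).mem_nhds hZ] with Z hZ
  have h3 := (((h.analytic Z hZ).differentiableAt.hasFDerivAt.clm_apply
    (hasFDerivAt_const v Z)).clm_apply (hasFDerivAt_const w Z)).fderiv
  rw [h3]
  simp

omit [FiniteDimensional ℂ E'] [IsManifold 𝓘(ℂ, E') ω M] in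
-- Differentiate along real directions the identity between `omt` at real points and the
-- complexified Kähler form.
lemma fderiv_realIncl {z : E} (hz : z ∈ ball (chartAt E p p) ρ) (u v w : E) :
    fderiv ℂ omt (realIncl E z) (realIncl E u) (realIncl E v) (realIncl E w) =
      (fderiv ℝ (localForm g₀ p) z u v w : ℂ) := by
  have hzt := h.adapted.ball_subset hz
  have h1 : HasFDerivAt omt (fderiv ℂ omt (realIncl E z)) (realIncl E z) :=
    (h.analytic _ (realIncl_mem_polydisc.2 hz)).differentiableAt.hasFDerivAt
  have h2 := (h1.clm_apply (hasFDerivAt_const (realIncl E v) _)).clm_apply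
    (hasFDerivAt_const (realIncl E w) _)
  have h3 := (h2.restrictScalars ℝ).comp z (realIncl E).hasFDerivAt
  have h4 : HasFDerivAt (localForm g₀ p) (fderiv ℝ (localForm g₀ p) z) z :=
    ((contDiffAt_localForm g₀ p hzt).differentiableAt (by simp)).hasFDerivAt
  have h5 := (h4.clm_apply (hasFDerivAt_const v z)).clm_apply (hasFDerivAt_const w z)
  have h6 := (Complex.ofRealCLM.hasFDerivAt (x := localForm g₀ p z v w)).comp z h5
  have h7 := h6.congr_of_eventuallyEq (f₁ := (fun Z => omt Z (realIncl E v) (realIncl E w)) ∘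
    realIncl E) (by
      filter_upwards [isOpen_ball.mem_nhds hz] with z hz
      rw [Function.comp_apply, Function.comp_apply, h.omt_realIncl z hz, complexifyBilin_realIncl]
      rfl)
  have h8 := congrArg (fun L : E →L[ℝ] ℂ => L u) (h3.unique h7)
  simpa [-realIncl_apply] using h8

omit [FiniteDimensional ℂ E'] [IsManifold 𝓘(ℂ, E') ω M] in
-- For fixed real vectors the cyclic sum is holomorphic in `Z` and vanishes on `N` since `ω₀` is
-- closed, so the identity theorem applies.
lemma closed_realIncl (hg₀ : IsKahler g₀) (u v w : E) : ∀ Z ∈ polydisc (chartAt E p p) ρ,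
    fderiv ℂ omt Z (realIncl E u) (realIncl E v) (realIncl E w) +
    fderiv ℂ omt Z (realIncl E v) (realIncl E w) (realIncl E u) +
    fderiv ℂ omt Z (realIncl E w) (realIncl E u) (realIncl E v) = 0 :=
  h.identity (fun Z hZ => ((h.analyticAt_fderiv_apply _ _ _ hZ).add
    (h.analyticAt_fderiv_apply _ _ _ hZ)).add (h.analyticAt_fderiv_apply _ _ _ hZ))
    fun z hz => by
      rw [h.fderiv_realIncl hz, h.fderiv_realIncl hz, h.fderiv_realIncl hz, ← Complex.ofReal_add,
        ← Complex.ofReal_add, hg₀.localForm_closed p (h.adapted.ball_subset hz), Complex.ofReal_zero]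

omit [FiniteDimensional ℂ E'] [IsManifold 𝓘(ℂ, E') ω M] in
/-- The one-jet of the holomorphic symplectic form. -/
lemma isJet (hg₀ : IsKahler g₀) {Z : StdComplexification E}
    (hZ : Z ∈ polydisc (chartAt E p p) ρ) : IsJet (omt Z) (fderiv ℂ omt Z) := by
  have han : ∀ u v, ∀ Z ∈ polydisc (chartAt E p p) ρ, AnalyticAt ℂ (fun Z => omt Z u v) Z :=
    fun u v Z hZ => (((h.analytic Z hZ).contDiffAt (n := ω)).clm_apply contDiffAt_const |>.clm_apply
      contDiffAt_const).analyticAt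
  have hI : ∀ z ∈ ball (chartAt E p p) ρ, ∀ u v, localForm g₀ p z (Complex.I • u) v =
      - localForm g₀ p z u (Complex.I • v) :=
    fun z hz u v => hg₀.localForm_I p (h.adapted.ball_subset hz) u v
  have hd : ∀ Z ∈ polydisc (chartAt E p p) ρ, ∀ u v,
      (∀ Z ∈ polydisc (chartAt E p p) ρ, omt Z u v = 0) → ∀ w, fderiv ℂ omt Z w u v = 0 :=
    fun Z hZ u v h0 w => fderiv_eq_zero_of_eventually (h.analytic Z hZ).differentiableAt (by
      filter_upwards [(isOpen_polydisc _ _).mem_nhds hZ] with Z hZ using h0 Z hZ) w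
  have halt : ∀ u, ∀ Z ∈ polydisc (chartAt E p p) ρ, omt Z u u = 0 := fun u =>
    h.identity (han u u) fun z hz => by
      rw [h.omt_realIncl z hz]
      exact complexifyBilin_alt (hg₀.localForm_skew p z) u
  have hiso₁ : ∀ u v : StdComplexification E, u.1 = 0 → v.1 = 0 →
      ∀ Z ∈ polydisc (chartAt E p p) ρ, omt Z u v = 0 := by
    rintro ⟨u₁, u₂⟩ ⟨v₁, v₂⟩ rfl rfl
    refine h.identity (han _ _) fun z hz => ?_
    rw [h.omt_realIncl z hz]
    exact complexifyBilin_vertical (hI z hz) _ _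
  have hiso₂ : ∀ u v : StdComplexification E, u.2 = 0 → v.2 = 0 →
      ∀ Z ∈ polydisc (chartAt E p p) ρ, omt Z u v = 0 := by
    rintro ⟨u₁, u₂⟩ ⟨v₁, v₂⟩ rfl rfl
    refine h.identity (han _ _) fun z hz => ?_
    rw [h.omt_realIncl z hz]
    exact complexifyBilin_horizontal (hI z hz) _ _
  refine ⟨fun u => halt u Z hZ, fun w u => hd Z hZ u u (halt u) w, fun u v hu hv => hiso₁ u v hu hv Z hZ,
    fun w u v hu hv => hd Z hZ u v (hiso₁ u v hu hv) w, fun u v hu hv => hiso₂ u v hu hv Z hZ,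
    fun w u v hu hv => hd Z hZ u v (hiso₂ u v hu hv) w, ?_, h.nondeg Z hZ⟩
  have hcl := h.closed_realIncl hg₀
  have hcl' := fun u v w => hcl u v w Z hZ
  generalize fderiv ℂ omt Z = D at hcl'
  intro u v w
  rw [← realIncl_re_add_im u, ← realIncl_re_add_im v, ← realIncl_re_add_im w]
  simp only [map_add, map_smul, add_apply, smul_apply, smul_eq_mul, smul_add]
  generalize stdRe E u = u₁, stdIm E u = u₂, stdRe E v = v₁, stdIm E v = v₂,
    stdRe E w = w₁, stdIm E w = w₂
  -- Writing each vector as a real plus `i` times a real one, trilinearity yields eight instances of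
  -- the real identity, weighted by powers of `i`.
  linear_combination hcl' u₁ v₁ w₁ + Complex.I * (hcl' u₂ v₁ w₁ + hcl' u₁ v₂ w₁ + hcl' u₁ v₁ w₂) +
    Complex.I ^ 2 * (hcl' u₂ v₂ w₁ + hcl' u₂ v₁ w₂ + hcl' u₁ v₂ w₂) + Complex.I ^ 3 * hcl' u₂ v₂ w₂

end IsLocalModel

end LocalModel

end BiquaternionicExtension
end

open scoped Manifold ContDiff
noncomputable section
namespace BiquaternionicExtension

/-! ### Naturality and smooth dependence of the hyperhermitian structure -/

section Naturality

variable {T : Type*} [NormedAddCommGroup T] [NormedSpace ℂ T]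
  {G : Type*} [NormedAddCommGroup G] [NormedSpace ℂ G]

namespace IsBiLagrangian

/-- The conditions fix `I` on the `-1` eigenspace by nondegeneracy of `Re om`, and on the `+1`
eigenspace by `I² = -1`, since `I` exchanges the two. In particular the auxiliary form `S` does not
influence the result. -/
lemma IsHyperI.ext {om : T →L[ℂ] T →L[ℂ] ℂ} {F : T →L[ℝ] T} (h : IsBiLagrangian om F)
    {B : T →L[ℝ] T →L[ℝ] ℝ} {I I' : T →L[ℝ] T} (hI : IsHyperI om F B I)
    (hI' : IsHyperI om F B I') : I = I' := by
  have hminus : ∀ u, F u = -u → I u = I' u := fun u hu => h.eq_of_re fun v => by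
    rw [hI.re_om_minus u v hu, hI'.re_om_minus u v hu]
  have hplus : ∀ w, F w = w → I w = I' w := fun w hw => by
    have h1 : F (I w) = - I w := by
      have := hI.F_comm w
      rw [hw] at this
      exact (neg_eq_iff_eq_neg.2 this).symm
    have h2 := hminus _ h1
    rw [hI.sq] at h2
    have h3 := hI'.sq (I w)
    rw [← h2, map_neg] at h3
    exact (neg_inj.1 h3).symm
  refine ContinuousLinearMap.ext fun u => ?_
  rw [← projPlus_add_projMinus (F := F) u, map_add, map_add, hplus _ (h.F_projPlus u),
    hminus _ (h.F_projMinus u)]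

variable {om : T →L[ℂ] T →L[ℂ] ℂ} {F : T →L[ℝ] T} {omt : G →L[ℂ] G →L[ℂ] ℂ} {Ft : G →L[ℝ] G}
  {B S : T →L[ℝ] T →L[ℝ] ℝ} {Bt St : G →L[ℝ] G →L[ℝ] ℝ} {I : T →L[ℝ] T} {It : G →L[ℝ] G}
  {e : T → G}

lemma pullback (e : T ≃L[ℂ] G) (h : IsBiLagrangian omt Ft) (hom : ∀ u v, om u v = omt (e u) (e v))
    (hF : ∀ u, e (F u) = Ft (e u)) : IsBiLagrangian om F where
  alt u := by rw [hom, h.alt]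
  nondeg u hu := e.injective <| by
    rw [map_zero]
    refine h.nondeg _ fun v => ?_
    rw [← e.apply_symm_apply v, ← hom, hu]
  F_sq u := e.injective <| by rw [hF, hF, h.F_sq]
  F_smul_I u := e.injective <| by rw [hF, e.map_smul, e.map_smul, h.F_smul_I, hF]
  om_F u v := by rw [hom, hom, hF, hF, h.om_F]

lemma _root_.BiquaternionicExtension.IsHermitianPair.pullback (e : T ≃L[ℂ] G)
    (h : IsHermitianPair Ft Bt St)
    (hF : ∀ u, e (F u) = Ft (e u)) (hB : ∀ u v, B u v = Bt (e u) (e v))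
    (hS : ∀ u v, S u v = St (e u) (e v)) : IsHermitianPair F B S where
  B_symm u v := by rw [hB, hB, h.B_symm]
  B_I u v := by rw [hB, hB, e.map_smul, e.map_smul, h.B_I]
  B_F u v := by rw [hB, hB, hF, h.B_F]
  S_symm u v := by rw [hS, hS, h.S_symm]
  S_I u v := by rw [hS, hS, e.map_smul, e.map_smul, h.S_I]
  S_F u v := by rw [hS, hS, hF, hF, h.S_F]
  S_pos u hu := by
    rw [hS]
    exact h.S_pos _ fun h0 => hu (e.injective (h0.trans (map_zero e).symm))
  S_eq u v hu := by
    rw [hS, hB]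
    refine h.S_eq _ _ ?_
    rw [← hF, hu, map_neg]

lemma IsHyperI.pullback (e : T ≃L[ℂ] G) (h : IsHyperI omt Ft Bt It)
    (hom : ∀ u v, om u v = omt (e u) (e v))
    (hF : ∀ u, e (F u) = Ft (e u)) (hB : ∀ u v, B u v = Bt (e u) (e v))
    (hI : ∀ u, e (I u) = It (e u)) : IsHyperI om F B I where
  sq u := e.injective <| by rw [hI, hI, h.sq, map_neg]
  smul_I u := e.injective <| by rw [hI, map_neg, e.map_smul, e.map_smul, h.smul_I, hI]
  F_comm u := e.injective <| by rw [hI, map_neg, hF, hF, hI, h.F_comm]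
  re_om u v := by rw [hB, hB, hom, hI, hI, h.re_om]
  re_om_minus u v hu := by
    rw [hom, hB, hI]
    refine h.re_om_minus _ _ ?_
    rw [← hF, hu, map_neg]
  definite u hu := e.injective <| by
    rw [map_zero]
    refine h.definite _ ?_
    rw [← hI, ← hB, ← hB, hu]
  nonneg u := by rw [hB]; exact h.nonneg _

/-- Naturality of `hyperI`. -/
lemma hyperI_pullback [FiniteDimensional ℝ T] [FiniteDimensional ℝ G] (e : T ≃L[ℂ] G)
    (h : IsBiLagrangian omt Ft)
    (h' : IsHermitianPair Ft Bt St) (hom : ∀ u v, om u v = omt (e u) (e v))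
    (hF : ∀ u, e (F u) = Ft (e u)) (hB : ∀ u v, B u v = Bt (e u) (e v))
    (hS : ∀ u v, S u v = St (e u) (e v)) (u : T) :
    e (hyperI om F B S u) = hyperI omt Ft Bt St (e u) := by
  have h1 := (h.pullback e hom hF).isHyperI (h'.pullback e hF hB hS)
  -- Instead of transporting the inverses in `hyperI`, the target structure is conjugated by `e` and
  -- recognised through its characterisation.
  let I' : T →L[ℝ] T := ((realEquiv e).symm : G →L[ℝ] T).comp
    ((hyperI omt Ft Bt St).comp (realEquiv e : T →L[ℝ] G))
  have h2 : ∀ u, e (I' u) = hyperI omt Ft Bt St (e u) := fun u => e.apply_symm_apply _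
  rw [IsHyperI.ext (h.pullback e hom hF) h1 ((h.isHyperI h').pullback e hom hF hB h2), h2]

end IsBiLagrangian

lemma contDiff_realPart [FiniteDimensional ℂ T] {n : ℕ∞ω} : ContDiff ℝ n (realPart (T := T)) := by
  haveI : FiniteDimensional ℝ (T →L[ℂ] T →L[ℂ] ℂ) := FiniteDimensional.complexToReal _
  exact contDiff_of_finiteDimensional (fun x y => by ext u v; simp) (fun t x => by ext u v; simp)

/-- `hyperI` is composed of linear operations and two inverses, and inversion is smooth at
invertible operators. The form `S` serves to express the `V₁ → V₂` part by such an inverse. -/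
lemma contDiffAt_hyperI [FiniteDimensional ℂ T] {V : Type*} [NormedAddCommGroup V]
    [NormedSpace ℝ V] {n : ℕ∞ω} {om : V → T →L[ℂ] T →L[ℂ] ℂ} {F : T →L[ℝ] T}
    {B S : V → T →L[ℝ] T →L[ℝ] ℝ} {x : V} (hom : ContDiffAt ℝ n om x) (hB : ContDiffAt ℝ n B x)
    (hS : ContDiffAt ℝ n S x) (h : IsBiLagrangian (om x) F) (h' : IsHermitianPair F (B x) (S x)) :
    ContDiffAt ℝ n (fun x => hyperI (om x) F (B x) (S x)) x := by
  haveI : FiniteDimensional ℝ T := FiniteDimensional.complexToReal T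
  haveI : CompleteSpace T := FiniteDimensional.complete ℝ T
  have h1 : ContDiffAt ℝ n (fun x => realPart (om x)) x := contDiff_realPart.contDiffAt.comp x hom
  have h2 : ContDiffAt ℝ n (fun x => (realPart (om x)).inverse) x := by
    have h5 : ContDiffAt ℝ n ContinuousLinearMap.inverse (realPart (om x)) :=
      ContinuousLinearMap.IsInvertible.contDiffAt_map_inverse h.isInvertible_realPart
    exact ContDiffAt.comp (g := ContinuousLinearMap.inverse) x h5 h1
  have h3 : ContDiffAt ℝ n (fun x => (S x).inverse) x :=
    (ContinuousLinearMap.IsInvertible.contDiffAt_map_inverse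
      (IsBiLagrangian.isInvertible_S h')).comp x hS
  have h4 : ContDiffAt ℝ n (fun x => pullForm (realPart (om x)) (projPlus F) (projMinus F)) x := by
    have h5 : ContDiffAt ℝ n (fun x => (realPart (om x)).comp (projPlus F)) x :=
      h1.clm_comp contDiffAt_const
    exact contDiffAt_const.clm_comp h5
  exact (h3.clm_comp h4).sub (h2.clm_comp hB)

lemma contDiffAt_hyperG {V : Type*} [NormedAddCommGroup V]
    [NormedSpace ℝ V] {n : ℕ∞ω} {om : V → T →L[ℂ] T →L[ℂ] ℂ} {F : T →L[ℝ] T}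
    {B S : V → T →L[ℝ] T →L[ℝ] ℝ} {x : V} (hB : ContDiffAt ℝ n B x)
    (hI : ContDiffAt ℝ n (fun x => hyperI (om x) F (B x) (S x)) x) :
    ContDiffAt ℝ n (fun x => hyperG (om x) F (B x) (S x)) x :=
  hB.add (hB.pullBilin hI)

end Naturality

/-! ### The hyperhermitian structure in a local model -/

section Model

open Filter Topology Metric

variable {E : Type*} [NormedAddCommGroup E] [NormedSpace ℂ E] [FiniteDimensional ℂ E]
  {N : Type*} [TopologicalSpace N] [ChartedSpace E N] [IsManifold 𝓘(ℂ, E) ω N]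

variable (E) in
/-- The standard para-complex structure of the complexification, as a real endomorphism. -/
def stdFR : StdComplexification E →L[ℝ] StdComplexification E :=
  (stdF E (ConjModel E)).restrictScalars ℝ

omit [FiniteDimensional ℂ E] in
@[simp] lemma stdFR_apply (u : StdComplexification E) : stdFR E u = (-u.1, u.2) := rfl

/-- The semi-definite Hermitian form of the local model. -/
def modelB (g₀ : AnalyticMetric E N) (p : N) (Z : StdComplexification E) :
    StdComplexification E →L[ℝ] StdComplexification E →L[ℝ] ℝ :=
  (1 / 2 : ℝ) • pullBilin (localMetric g₀ p Z.1) (ContinuousLinearMap.fst ℝ E (ConjModel E))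

/-- The Hermitian form of the local model. -/
def modelS (g₀ : AnalyticMetric E N) (p : N) (Z : StdComplexification E) :
    StdComplexification E →L[ℝ] StdComplexification E →L[ℝ] ℝ :=
  modelB g₀ p Z + (1 / 2 : ℝ) • pullBilin (localMetric g₀ p ((conjEquiv E).symm Z.2))
    (((conjEquiv E).symm : ConjModel E →L[ℝ] E).comp (ContinuousLinearMap.snd ℝ E (ConjModel E)))

omit [FiniteDimensional ℂ E] in
lemma modelB_apply (g₀ : AnalyticMetric E N) (p : N) (Z u v : StdComplexification E) :
    modelB g₀ p Z u v = (1 / 2 : ℝ) * localMetric g₀ p Z.1 u.1 v.1 := rfl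

lemma modelS_apply (g₀ : AnalyticMetric E N) (p : N) (Z u v : StdComplexification E) :
    modelS g₀ p Z u v = (1 / 2 : ℝ) * localMetric g₀ p Z.1 u.1 v.1 +
      (1 / 2 : ℝ) * localMetric g₀ p ((conjEquiv E).symm Z.2) ((conjEquiv E).symm u.2)
        ((conjEquiv E).symm v.2) := rfl

omit [FiniteDimensional ℂ E] in
lemma localMetric_symm (g₀ : AnalyticMetric E N) (p : N) (z u v : E) :
    localMetric g₀ p z u v = localMetric g₀ p z v u := g₀.symm _ _ _

omit [FiniteDimensional ℂ E] in
lemma IsKahler.localMetric_I {g₀ : AnalyticMetric E N} (h : IsKahler g₀) (p : N) {z : E}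
    (hz : z ∈ (chartAt E p).target) (u v : E) :
    localMetric g₀ p z (Complex.I • u) (Complex.I • v) = localMetric g₀ p z u v := by
  have h1 := localForm_apply g₀ p hz u (Complex.I • v)
  rw [← h1, h.localForm_skew, localForm_apply g₀ p hz, I_smul_I_smul, map_neg, neg_apply, neg_neg,
    localMetric_symm]

/-- `S` adds to `B` the metric of the second factor. This makes it definite, and the added term
vanishes on horizontal vectors, where `S` must agree with `B`. -/
lemma isHermitianPair_model {g₀ : AnalyticMetric E N} (h : IsKahler g₀) (p : N)
    {Z : StdComplexification E} (hZ₁ : Z.1 ∈ (chartAt E p).target)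
    (hZ₂ : (conjEquiv E).symm Z.2 ∈ (chartAt E p).target) :
    IsHermitianPair (stdFR E) (modelB g₀ p Z) (modelS g₀ p Z) where
  B_symm u v := by rw [modelB_apply, modelB_apply, localMetric_symm]
  B_I u v := by
    rw [modelB_apply, modelB_apply, Prod.smul_fst, Prod.smul_fst, h.localMetric_I p hZ₁]
  B_F u v := by
    rw [modelB_apply, modelB_apply, stdFR_apply, map_neg, neg_apply, mul_neg]
  S_symm u v := by
    rw [modelS_apply, modelS_apply, localMetric_symm, localMetric_symm g₀ p _ ((conjEquiv E).symm u.2)]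
  S_I u v := by
    simp only [modelS_apply, Prod.smul_fst, Prod.smul_snd, conjEquiv_symm_smul_I, map_neg,
      neg_apply, neg_neg, h.localMetric_I p hZ₁, h.localMetric_I p hZ₂]
  S_F u v := by
    simp only [modelS_apply, stdFR_apply, map_neg, neg_apply, neg_neg]
  S_pos u hu := by
    rw [modelS_apply]
    have nn : ∀ {z : E} (_ : z ∈ (chartAt E p).target) (w : E), 0 ≤ localMetric g₀ p z w w := by
      intro z hz w
      by_cases hw : w = 0
      · simp [hw]
      · exact (localMetric_pos g₀ p hz hw).le
    by_cases h1 : u.1 = 0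
    · have h2 : (conjEquiv E).symm u.2 ≠ 0 := fun h2 => hu <| Prod.ext h1 <| by
        simpa using h2
      have := localMetric_pos g₀ p hZ₂ h2
      have := nn hZ₁ u.1
      positivity
    · have := localMetric_pos g₀ p hZ₁ h1
      have := nn hZ₂ ((conjEquiv E).symm u.2)
      positivity
  S_eq u v hu := by
    have h1 : u.2 = 0 := eq_zero_of_eq_neg (congrArg Prod.snd hu)
    rw [modelS_apply, modelB_apply, h1]
    simp

set_option synthInstance.maxHeartbeats 200000 in
lemma contDiffAt_modelB (g₀ : AnalyticMetric E N) (p : N) {Z : StdComplexification E}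
    (hZ₁ : Z.1 ∈ (chartAt E p).target) : ContDiffAt ℝ ω (modelB g₀ p) Z := by
  have h1 : ContDiffAt ℝ ω (fun Z : StdComplexification E => localMetric g₀ p Z.1) Z :=
    (contDiffAt_localMetric g₀ p hZ₁).comp Z contDiffAt_fst
  exact (h1.pullBilin contDiffAt_const).const_smul _

set_option synthInstance.maxHeartbeats 200000 in
lemma contDiffAt_modelS (g₀ : AnalyticMetric E N) (p : N) {Z : StdComplexification E}
    (hZ₁ : Z.1 ∈ (chartAt E p).target) (hZ₂ : (conjEquiv E).symm Z.2 ∈ (chartAt E p).target) :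
    ContDiffAt ℝ ω (modelS g₀ p) Z := by
  have h1 : ContDiffAt ℝ ω
      (fun Z : StdComplexification E => localMetric g₀ p ((conjEquiv E).symm Z.2)) Z :=
    (contDiffAt_localMetric g₀ p hZ₂).comp Z
      ((conjEquiv E).symm.contDiff.contDiffAt.comp Z contDiffAt_snd)
  exact (contDiffAt_modelB g₀ p hZ₁).add ((h1.pullBilin contDiffAt_const).const_smul _)

end Model

end BiquaternionicExtension
end

open scoped Manifold ContDiff
noncomputable section
namespace BiquaternionicExtension

/-! ### The hyperhermitian structure -/

section Fields

variable {E : Type*} [NormedAddCommGroup E] [NormedSpace ℂ E]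
  {N : Type*} [TopologicalSpace N] [ChartedSpace E N] [IsManifold 𝓘(ℂ, E) ω N]
  {E' : Type*} [NormedAddCommGroup E'] [NormedSpace ℂ E']
  {M : Type*} [TopologicalSpace M] [ChartedSpace E' M]

/-- The para-complex structure of the canonical foliations. -/
def paraStructure (H : CEndoField E' M) (x : M) : E' →L[ℝ] E' :=
  EndoField.mul H.toReal (complexStructure E' M) x

/-- Half of the pull-back of the Kähler metric. -/
def baseForm (g₀ : AnalyticMetric E N) (q : M → N) (x : M) : E' →L[ℝ] E' →L[ℝ] ℝ :=
  (1 / 2 : ℝ) • pullBilin (𝕜 := ℝ) (E := E) (G := E') (W := ℝ) (g₀.inner (q x))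
    (rd (E := E') (E' := E) q x)

/-- The Kähler metric at `z`, as a form on the model space. -/
def innerAt (g₀ : AnalyticMetric E N) (z : N) : E →L[ℝ] E →L[ℝ] ℝ := g₀.inner z

lemma baseForm_apply (g₀ : AnalyticMetric E N) (q : M → N) (x : M) (u v : E') :
    baseForm g₀ q x u v = (1 / 2 : ℝ) * innerAt g₀ (q x)
      ((rd (E := E') (E' := E) q x : E' →L[ℝ] E) u)
      ((rd (E := E') (E' := E) q x : E' →L[ℝ] E) v) := rfl

lemma localMetric_eq (g₀ : AnalyticMetric E N) (p : N) (z u v : E) :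
    localMetric g₀ p z u v = innerAt g₀ ((chartAt E p).symm z) (dS ℝ E (chartAt E p) z u)
      (dS ℝ E (chartAt E p) z v) := rfl

/-- The complex structure `I`. -/
def fieldI (g₀ : AnalyticMetric E N) (q₁ q₂ : M → N) (om : CBilinField E' M)
    (H : CEndoField E' M) (x : M) : E' →L[ℝ] E' :=
  hyperI (T := E') (om x) (paraStructure H x) (baseForm g₀ q₁ x)
    (baseForm g₀ q₁ x + baseForm g₀ q₂ x)

/-- The metric `g`. -/
def fieldG (g₀ : AnalyticMetric E N) (q₁ q₂ : M → N) (om : CBilinField E' M)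
    (H : CEndoField E' M) (x : M) : E' →L[ℝ] E' →L[ℝ] ℝ :=
  hyperG (T := E') (om x) (paraStructure H x) (baseForm g₀ q₁ x)
    (baseForm g₀ q₁ x + baseForm g₀ q₂ x)

end Fields

/-! ### Comparison of the structure on `M` with its expression in a local model. -/

section LocalModel

open Filter Topology Metric

variable {E : Type*} [NormedAddCommGroup E] [NormedSpace ℂ E] [FiniteDimensional ℂ E]
  {N : Type*} [TopologicalSpace N] [ChartedSpace E N] [IsManifold 𝓘(ℂ, E) ω N]
  {E' : Type*} [NormedAddCommGroup E'] [NormedSpace ℂ E'] [FiniteDimensional ℂ E']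
  {M : Type*} [TopologicalSpace M] [ChartedSpace E' M] [IsManifold 𝓘(ℂ, E') ω M]

/-- The complex structure `I` of the local model. -/
def modelI (omt : StdComplexification E → StdComplexification E →L[ℂ] StdComplexification E →L[ℂ] ℂ)
    (g₀ : AnalyticMetric E N) (p : N) (Z : StdComplexification E) :
    StdComplexification E →L[ℝ] StdComplexification E :=
  hyperI (omt Z) (stdFR E) (modelB g₀ p Z) (modelS g₀ p Z)

/-- The metric `g` of the local model. -/
def modelG (omt : StdComplexification E → StdComplexification E →L[ℂ] StdComplexification E →L[ℂ] ℂ)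
    (g₀ : AnalyticMetric E N) (p : N) (Z : StdComplexification E) :
    StdComplexification E →L[ℝ] StdComplexification E →L[ℝ] ℝ :=
  hyperG (omt Z) (stdFR E) (modelB g₀ p Z) (modelS g₀ p Z)

namespace IsLocalModel

variable {f : N → M} {g₀ : AnalyticMetric E N} {q₁ q₂ : M → N}
  {om : CBilinField E' M} {H : CEndoField E' M} {p : N}
  {Θ : OpenPartialHomeomorph M (StdComplexification E)} {ρ : ℝ}
  {omt : StdComplexification E → StdComplexification E →L[ℂ] StdComplexification E →L[ℂ] ℂ}
  (h : IsLocalModel f g₀ q₁ q₂ om H p Θ ρ omt)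
include h

omit [FiniteDimensional ℂ E'] [IsManifold 𝓘(ℂ, E') ω M] in
lemma isChart : IsChart ℂ E' Θ := h.adapted.isChart

omit [FiniteDimensional ℂ E'] [IsManifold 𝓘(ℂ, E') ω M] in
lemma mem_polydisc {x : M} (hx : x ∈ Θ.source) : Θ x ∈ polydisc (chartAt E p p) ρ :=
  h.adapted.target_eq ▸ Θ.map_source hx

omit [FiniteDimensional ℂ E'] [IsManifold 𝓘(ℂ, E') ω M] in
lemma fst_mem {Z : StdComplexification E} (hZ : Z ∈ polydisc (chartAt E p p) ρ) :
    Z.1 ∈ (chartAt E p).target := h.adapted.ball_subset hZ.1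

omit [FiniteDimensional ℂ E'] [IsManifold 𝓘(ℂ, E') ω M] in
lemma snd_mem {Z : StdComplexification E} (hZ : Z ∈ polydisc (chartAt E p p) ρ) :
    (conjEquiv E).symm Z.2 ∈ (chartAt E p).target := h.adapted.ball_subset hZ.2

omit [FiniteDimensional ℂ E'] [IsManifold 𝓘(ℂ, E') ω M] in
lemma isBiLagrangian_model (hg₀ : IsKahler g₀) {Z : StdComplexification E}
    (hZ : Z ∈ polydisc (chartAt E p p) ρ) : IsBiLagrangian (omt Z) (stdFR E) where
  alt := (h.isJet hg₀ hZ).alt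
  nondeg := (h.isJet hg₀ hZ).nondeg
  F_sq u := stdF_stdF u
  F_smul_I u := (stdF E (ConjModel E)).map_smul _ u
  om_F := (h.isJet hg₀ hZ).o_stdF

omit [FiniteDimensional ℂ E'] [IsManifold 𝓘(ℂ, E') ω M] in
lemma isHermitianPair_model (hg₀ : IsKahler g₀) {Z : StdComplexification E}
    (hZ : Z ∈ polydisc (chartAt E p p) ρ) :
    IsHermitianPair (stdFR E) (modelB g₀ p Z) (modelS g₀ p Z) :=
  BiquaternionicExtension.isHermitianPair_model hg₀ p (h.fst_mem hZ) (h.snd_mem hZ)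

omit [FiniteDimensional ℂ E'] [IsManifold 𝓘(ℂ, E') ω M] in
lemma isHyperI_model (hg₀ : IsKahler g₀) {Z : StdComplexification E}
    (hZ : Z ∈ polydisc (chartAt E p p) ρ) :
    IsBiLagrangian.IsHyperI (omt Z) (stdFR E) (modelB g₀ p Z) (modelI omt g₀ p Z) := by
  haveI : FiniteDimensional ℝ E := FiniteDimensional.complexToReal E
  exact (h.isBiLagrangian_model hg₀ hZ).isHyperI (h.isHermitianPair_model hg₀ hZ)

omit [FiniteDimensional ℂ E'] [IsManifold 𝓘(ℂ, E') ω M] in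
lemma contDiffAt_modelI (hg₀ : IsKahler g₀) {Z : StdComplexification E}
    (hZ : Z ∈ polydisc (chartAt E p p) ρ) : ContDiffAt ℝ ω (modelI omt g₀ p) Z :=
  contDiffAt_hyperI ((h.analytic Z hZ).contDiffAt.restrict_scalars ℝ)
    (contDiffAt_modelB g₀ p (h.fst_mem hZ))
    (contDiffAt_modelS g₀ p (h.fst_mem hZ) (h.snd_mem hZ)) (h.isBiLagrangian_model hg₀ hZ)
    (h.isHermitianPair_model hg₀ hZ)

omit [FiniteDimensional ℂ E'] [IsManifold 𝓘(ℂ, E') ω M] in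
lemma contDiffAt_modelG (hg₀ : IsKahler g₀) {Z : StdComplexification E}
    (hZ : Z ∈ polydisc (chartAt E p p) ρ) : ContDiffAt ℝ ω (modelG omt g₀ p) Z :=
  contDiffAt_hyperG (contDiffAt_modelB g₀ p (h.fst_mem hZ)) (h.contDiffAt_modelI hg₀ hZ)

section

variable {x : M} (hx : x ∈ Θ.source)
include hx

omit [FiniteDimensional ℂ E'] [IsManifold 𝓘(ℂ, E') ω M] in
lemma dT_paraStructure (u : E') :
    dT ℂ E' Θ x (paraStructure H x u) = stdFR E (dT ℂ E' Θ x u) := by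
  refine ((h.model x hx).H_eq (Complex.I • u)).trans ?_
  rw [map_smul, stdH_apply, Prod.smul_fst, Prod.smul_snd, I_smul_I_smul, I_smul_I_smul, neg_neg]
  rfl

omit [FiniteDimensional ℂ E'] [IsManifold 𝓘(ℂ, E') ω M] in
lemma rd_q₁ (u : E') : (rd (E := E') (E' := E) q₁ x : E' →L[ℝ] E) u =
    dS ℝ E (chartAt E p) (Θ x).1 (dT ℂ E' Θ x u).1 := by
  rw [rd_of_eventually_fst h.isChart hx (h.fst_mem (h.mem_polydisc hx)), h.isChart.dT_real hx]
  filter_upwards [Θ.open_source.mem_nhds hx] with y hy using (h.model y hy).q₁_eq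

omit [FiniteDimensional ℂ E'] [IsManifold 𝓘(ℂ, E') ω M] in
lemma rd_q₂ (u : E') : (rd (E := E') (E' := E) q₂ x : E' →L[ℝ] E) u =
    dS ℝ E (chartAt E p) ((conjEquiv E).symm (Θ x).2)
      ((conjEquiv E).symm (dT ℂ E' Θ x u).2) := by
  rw [rd_of_eventually_snd h.isChart hx (h.snd_mem (h.mem_polydisc hx)), h.isChart.dT_real hx]
  filter_upwards [Θ.open_source.mem_nhds hx] with y hy using (h.model y hy).q₂_eq

omit [FiniteDimensional ℂ E'] [IsManifold 𝓘(ℂ, E') ω M] in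
lemma baseForm_q₁ (u v : E') :
    baseForm g₀ q₁ x u v = modelB g₀ p (Θ x) (dT ℂ E' Θ x u) (dT ℂ E' Θ x v) := by
  rw [baseForm_apply, h.rd_q₁ hx, h.rd_q₁ hx, (h.model x hx).q₁_eq, modelB_apply, localMetric_eq]

omit [FiniteDimensional ℂ E'] [IsManifold 𝓘(ℂ, E') ω M] in
lemma baseForm_add (u v : E') :
    (baseForm g₀ q₁ x + baseForm g₀ q₂ x : E' →L[ℝ] E' →L[ℝ] ℝ) u v =
      modelS g₀ p (Θ x) (dT ℂ E' Θ x u) (dT ℂ E' Θ x v) := by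
  refine Eq.trans (add_apply (baseForm g₀ q₁ x u) (baseForm g₀ q₂ x u) v) ?_
  rw [h.baseForm_q₁ hx, baseForm_apply, h.rd_q₂ hx, h.rd_q₂ hx, (h.model x hx).q₂_eq,
    modelS_apply, modelB_apply, localMetric_eq g₀ p ((conjEquiv E).symm _)]

omit [FiniteDimensional ℂ E'] [IsManifold 𝓘(ℂ, E') ω M] in
lemma isBiLagrangian (hg₀ : IsKahler g₀) : IsBiLagrangian (T := E') (om x) (paraStructure H x) :=
  IsBiLagrangian.pullback (h.isChart.equiv hx) (h.isBiLagrangian_model hg₀ (h.mem_polydisc hx))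
    (h.model x hx).om_eq (h.dT_paraStructure hx)

omit [FiniteDimensional ℂ E'] [IsManifold 𝓘(ℂ, E') ω M] in
lemma isHermitianPair (hg₀ : IsKahler g₀) : IsHermitianPair (T := E') (paraStructure H x)
    (baseForm g₀ q₁ x) (baseForm g₀ q₁ x + baseForm g₀ q₂ x) :=
  IsHermitianPair.pullback (h.isChart.equiv hx) (h.isHermitianPair_model hg₀ (h.mem_polydisc hx))
    (h.dT_paraStructure hx) (h.baseForm_q₁ hx) (h.baseForm_add hx)

omit [IsManifold 𝓘(ℂ, E') ω M] in
lemma isHyperI (hg₀ : IsKahler g₀) : IsBiLagrangian.IsHyperI (T := E') (om x) (paraStructure H x)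
    (baseForm g₀ q₁ x) (fieldI g₀ q₁ q₂ om H x) := by
  haveI : FiniteDimensional ℝ E' := FiniteDimensional.complexToReal E'
  exact (h.isBiLagrangian hx hg₀).isHyperI (h.isHermitianPair hx hg₀)

omit [IsManifold 𝓘(ℂ, E') ω M] in
-- `fieldI` is defined on all of `M` from `q₁`, `q₂`, `om` and `H`, without a chart. Naturality of
-- `hyperI` under the differential of the chart gives its expression.
lemma dT_fieldI (hg₀ : IsKahler g₀) (u : E') : dT ℂ E' Θ x (fieldI g₀ q₁ q₂ om H x u) =
    modelI omt g₀ p (Θ x) (dT ℂ E' Θ x u) := by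
  haveI : FiniteDimensional ℝ E' := FiniteDimensional.complexToReal E'
  haveI : FiniteDimensional ℝ E := FiniteDimensional.complexToReal E
  exact IsBiLagrangian.hyperI_pullback (h.isChart.equiv hx)
    (h.isBiLagrangian_model hg₀ (h.mem_polydisc hx))
    (h.isHermitianPair_model hg₀ (h.mem_polydisc hx)) (h.model x hx).om_eq
    (h.dT_paraStructure hx) (h.baseForm_q₁ hx) (h.baseForm_add hx) u

omit [IsManifold 𝓘(ℂ, E') ω M] in
lemma fieldG_eq (hg₀ : IsKahler g₀) (u v : E') : fieldG g₀ q₁ q₂ om H x u v =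
    modelG omt g₀ p (Θ x) (dT ℂ E' Θ x u) (dT ℂ E' Θ x v) := by
  change baseForm g₀ q₁ x u v + baseForm g₀ q₁ x (fieldI g₀ q₁ q₂ om H x u)
    (fieldI g₀ q₁ q₂ om H x v) = _
  rw [h.baseForm_q₁ hx, h.baseForm_q₁ hx, h.dT_fieldI hx hg₀, h.dT_fieldI hx hg₀]
  rfl

end

omit [IsManifold 𝓘(ℂ, E') ω M] in
lemma endoIn_fieldI (hg₀ : IsKahler g₀) {Z : StdComplexification E} (hZ : Z ∈ Θ.target) :
    endoIn ℝ E' Θ (fieldI g₀ q₁ q₂ om H) Z = modelI omt g₀ p Z := by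
  refine ContinuousLinearMap.ext fun u => ?_
  have h1 := h.dT_fieldI (Θ.map_target hZ) hg₀ (dS ℝ E' Θ Z u)
  rw [← h.isChart.dT_real (Θ.map_target hZ), ← h.isChart.dT_real (Θ.map_target hZ),
    h.isChart.real.dT_dS hZ, Θ.right_inv hZ] at h1
  exact h1

omit [IsManifold 𝓘(ℂ, E') ω M] in
lemma bilinIn_fieldG (hg₀ : IsKahler g₀) {Z : StdComplexification E} (hZ : Z ∈ Θ.target) :
    bilinIn ℝ E' Θ (fieldG g₀ q₁ q₂ om H) Z = modelG omt g₀ p Z := by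
  refine ContinuousLinearMap.ext fun u => ContinuousLinearMap.ext fun v => ?_
  have h1 := h.fieldG_eq (Θ.map_target hZ) hg₀ (dS ℝ E' Θ Z u) (dS ℝ E' Θ Z v)
  rw [← h.isChart.dT_real (Θ.map_target hZ), ← h.isChart.dT_real (Θ.map_target hZ),
    h.isChart.real.dT_dS hZ, h.isChart.real.dT_dS hZ, Θ.right_inv hZ] at h1
  exact h1

end IsLocalModel

end LocalModel

end BiquaternionicExtension
end

open scoped Manifold ContDiff
noncomputable section
namespace BiquaternionicExtension

/-! ### Connections in a chart -/

section ChartConnections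

open Filter Topology

variable {E : Type*} [NormedAddCommGroup E] [NormedSpace ℂ E]
  {G : Type*} [NormedAddCommGroup G] [NormedSpace ℂ G]
  {W : Type*} [NormedAddCommGroup W] [NormedSpace ℝ W]
  {M : Type*} [TopologicalSpace M] [ChartedSpace E M]

/-- The connection with Christoffel symbol `Γ` at the point `x`, in a chart. -/
def chartCov (Θ : OpenPartialHomeomorph M G) (Γ : G →L[ℂ] G →L[ℂ] G) (Y : M → E) (x : M) :
    E →L[ℝ] E :=
  (dS ℝ E Θ (Θ x)).comp ((fderiv ℝ (vecIn ℝ E Θ Y) (Θ x) +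
    (Γ.flip (dT ℝ E Θ x (Y x))).restrictScalars ℝ).comp (dT ℝ E Θ x))

variable (G) in
/-- A complex bilinear form as a real bilinear map. -/
def bilinR : (G →L[ℂ] G →L[ℂ] ℂ) →L[ℝ] (G →L[ℝ] G →L[ℝ] ℂ) :=
  (ContinuousLinearMap.compL ℝ G (G →L[ℂ] ℂ) (G →L[ℝ] ℂ)
    (ContinuousLinearMap.restrictScalarsL ℂ G ℂ ℝ ℝ)).comp
    (ContinuousLinearMap.restrictScalarsL ℂ G (G →L[ℂ] ℂ) ℝ ℝ)

@[simp] lemma bilinR_apply (b : G →L[ℂ] G →L[ℂ] ℂ) (u v : G) :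
    bilinR G b u v = b u v := rfl

lemma hasFDerivAt_real_comp {V : Type*} [NormedAddCommGroup V] [NormedSpace ℂ V] [NormedSpace ℝ V]
    [IsScalarTower ℝ ℂ V] (L : V →L[ℝ] W) {b : G → V} {b' : G →L[ℂ] V} {Z : G}
    (hb : HasFDerivAt b b' Z) :
    HasFDerivAt (fun Z => L (b Z)) (L.comp (b'.restrictScalars ℝ)) Z :=
  L.hasFDerivAt.comp Z (hb.restrictScalars ℝ)

lemma fderiv_bilinR {b : G → G →L[ℂ] G →L[ℂ] ℂ} {Z : G}
    (hb : DifferentiableAt ℂ b Z) : DifferentiableAt ℝ (fun Z => bilinR G (b Z)) Z ∧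
    ∀ u v w, fderiv ℝ (fun Z => bilinR G (b Z)) Z u v w = fderiv ℂ b Z u v w := by
  have h1 := hasFDerivAt_real_comp (W := G →L[ℝ] G →L[ℝ] ℂ)
    (V := G →L[ℂ] G →L[ℂ] ℂ) (bilinR G) hb.hasFDerivAt
  refine ⟨h1.differentiableAt, fun u v w => ?_⟩
  rw [h1.fderiv]
  rfl

namespace IsChart

variable {Θ : OpenPartialHomeomorph M G} (hΘ : IsChart ℝ E Θ)
  {Γ : G →L[ℂ] G →L[ℂ] G}
include hΘ

lemma dT_chartCov {Y : M → E} {x : M} (hx : x ∈ Θ.source) (u : E) :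
    dT ℝ E Θ x (chartCov Θ Γ Y x u) = fderiv ℝ (vecIn ℝ E Θ Y) (Θ x) (dT ℝ E Θ x u) +
      Γ (dT ℝ E Θ x u) (dT ℝ E Θ x (Y x)) :=
  hΘ.dT_dS' hx _

lemma chartCov_add {Y Y' : M → E} {x : M} (hx : x ∈ Θ.source)
    (hY : DifferentiableAt ℝ (vecIn ℝ E Θ Y) (Θ x))
    (hY' : DifferentiableAt ℝ (vecIn ℝ E Θ Y') (Θ x)) :
    chartCov Θ Γ (Y + Y') x = chartCov Θ Γ Y x + chartCov Θ Γ Y' x := by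
  refine ContinuousLinearMap.ext fun u => hΘ.injective_dT hx ?_
  have h1 : vecIn ℝ E Θ (Y + Y') = vecIn ℝ E Θ Y + vecIn ℝ E Θ Y' := by
    ext Z
    exact map_add _ _ _
  rw [add_apply, map_add, hΘ.dT_chartCov hx, hΘ.dT_chartCov hx, hΘ.dT_chartCov hx, h1,
    fderiv_add hY hY', Pi.add_apply, map_add, map_add, add_apply]
  abel

lemma chartCov_leibniz {Y : M → E} {φ : M → ℝ} {x : M} (hx : x ∈ Θ.source)
    (hY : DifferentiableAt ℝ (vecIn ℝ E Θ Y) (Θ x)) (hφ : MDifferentiableAt 𝓘(ℝ, E) 𝓘(ℝ, ℝ) φ x)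
    (u : E) : chartCov Θ Γ (φ • Y) x u =
      φ x • chartCov Θ Γ Y x u + (mvfderiv 𝓘(ℝ, E) φ x u : ℝ) • Y x := by
  refine hΘ.injective_dT hx ?_
  have hφ' := (hΘ.mdifferentiableAt_iff hx).1 hφ
  have h1 : vecIn ℝ E Θ (φ • Y) = fun Z => (φ ∘ Θ.symm) Z • vecIn ℝ E Θ Y Z := by
    ext Z
    exact (dT ℝ E Θ (Θ.symm Z)).map_smul _ _
  have h3 : fderiv ℝ (fun Z => (φ ∘ Θ.symm) Z • vecIn ℝ E Θ Y Z) (Θ x) = _ :=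
    (hφ'.hasFDerivAt.smul hY.hasFDerivAt).fderiv
  rw [map_add, map_smul, map_smul, hΘ.dT_chartCov hx, hΘ.dT_chartCov hx, h1,
    h3, hΘ.mvfderiv_apply hx hφ', Pi.smul_apply',
    (dT ℝ E Θ x).map_smul, ← vecIn_apply (𝕜 := ℝ) (E := E) (X := Y) hx]
  have h2 : Γ (dT ℝ E Θ x u) (φ x • vecIn ℝ E Θ Y (Θ x)) =
      φ x • Γ (dT ℝ E Θ x u) (vecIn ℝ E Θ Y (Θ x)) :=
    ((Γ (dT ℝ E Θ x u)).restrictScalars ℝ).map_smul _ _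
  rw [h2]
  simp only [add_apply, smul_apply, ContinuousLinearMap.smulRight_apply, Function.comp_apply,
    Θ.left_inv hx, smul_add]
  abel

/-- The derivative of a bilinear map applied to vector fields. -/
lemma mvfderiv_bilin {b : M → E → E → W} {bt : G → G →L[ℝ] G →L[ℝ] W} {x : M}
    (hx : x ∈ Θ.source)
    (hb : ∀ᶠ y in 𝓝 x, ∀ u v, b y u v = bt (Θ y) (dT ℝ E Θ y u) (dT ℝ E Θ y v))
    (hbt : DifferentiableAt ℝ bt (Θ x)) {Y Z : M → E}
    (hY : DifferentiableAt ℝ (vecIn ℝ E Θ Y) (Θ x))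
    (hZ : DifferentiableAt ℝ (vecIn ℝ E Θ Z) (Θ x)) (u : E) :
    mvfderiv 𝓘(ℝ, E) (fun y => b y (Y y) (Z y)) x u =
      fderiv ℝ bt (Θ x) (dT ℝ E Θ x u) (dT ℝ E Θ x (Y x)) (dT ℝ E Θ x (Z x)) +
      bt (Θ x) (fderiv ℝ (vecIn ℝ E Θ Y) (Θ x) (dT ℝ E Θ x u)) (dT ℝ E Θ x (Z x)) +
      bt (Θ x) (dT ℝ E Θ x (Y x)) (fderiv ℝ (vecIn ℝ E Θ Z) (Θ x) (dT ℝ E Θ x u)) := by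
  have h1 := (hbt.hasFDerivAt.clm_apply hY.hasFDerivAt).clm_apply hZ.hasFDerivAt
  rw [hΘ.mvfderiv_of_eqOn hx (φt := fun w => bt w (vecIn ℝ E Θ Y w) (vecIn ℝ E Θ Z w)) ?_
    h1.differentiableAt, h1.fderiv]
  · simp only [← vecIn_apply (𝕜 := ℝ) (E := E) hx, add_apply, ContinuousLinearMap.comp_apply,
      ContinuousLinearMap.flip_apply]
    abel
  · filter_upwards [hb, Θ.open_source.mem_nhds hx] with y hy hy'
    rw [hy, vecIn_apply hy', vecIn_apply hy']

/-- Parallelism of a bilinear map, in terms of the Christoffel symbol. -/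
lemma chartCov_bilin {b : M → E → E → W} {bt : G → G →L[ℝ] G →L[ℝ] W} {x : M}
    (hx : x ∈ Θ.source)
    (hb : ∀ᶠ y in 𝓝 x, ∀ u v, b y u v = bt (Θ y) (dT ℝ E Θ y u) (dT ℝ E Θ y v))
    (hbt : DifferentiableAt ℝ bt (Θ x)) {Y Z : M → E}
    (hY : DifferentiableAt ℝ (vecIn ℝ E Θ Y) (Θ x))
    (hZ : DifferentiableAt ℝ (vecIn ℝ E Θ Z) (Θ x)) {u : E}
    (hΓ : ∀ v w, fderiv ℝ bt (Θ x) (dT ℝ E Θ x u) v w =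
      bt (Θ x) (Γ (dT ℝ E Θ x u) v) w + bt (Θ x) v (Γ (dT ℝ E Θ x u) w)) :
    mvfderiv 𝓘(ℝ, E) (fun y => b y (Y y) (Z y)) x u =
      b x (chartCov Θ Γ Y x u) (Z x) + b x (Y x) (chartCov Θ Γ Z x u) := by
  rw [hΘ.mvfderiv_bilin hx hb hbt hY hZ, hΓ, hb.self_of_nhds, hb.self_of_nhds,
    hΘ.dT_chartCov hx, hΘ.dT_chartCov hx, map_add, map_add, add_apply]
  abel

/-- Parallelism of an endomorphism field, in terms of the Christoffel symbol. -/
lemma chartCov_endo {A : M → E → E} {At : G → G →L[ℝ] G} {x : M} (hx : x ∈ Θ.source)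
    (hA : ∀ᶠ y in 𝓝 x, ∀ u, dT ℝ E Θ y (A y u) = At (Θ y) (dT ℝ E Θ y u))
    (hAt : DifferentiableAt ℝ At (Θ x)) {Y : M → E}
    (hY : DifferentiableAt ℝ (vecIn ℝ E Θ Y) (Θ x)) {u : E}
    (hΓ : ∀ v, fderiv ℝ At (Θ x) (dT ℝ E Θ x u) v + Γ (dT ℝ E Θ x u) (At (Θ x) v) =
      At (Θ x) (Γ (dT ℝ E Θ x u) v)) :
    chartCov Θ Γ (fun y => A y (Y y)) x u = A x (chartCov Θ Γ Y x u) := by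
  refine hΘ.injective_dT hx ?_
  have hs : Tendsto Θ.symm (𝓝 (Θ x)) (𝓝 x) := by
    have := Θ.continuousAt_symm (Θ.map_source hx)
    rwa [ContinuousAt, Θ.left_inv hx] at this
  have h1 : vecIn ℝ E Θ (fun y => A y (Y y)) =ᶠ[𝓝 (Θ x)] fun w => At w (vecIn ℝ E Θ Y w) := by
    filter_upwards [hs.eventually hA, Θ.open_target.mem_nhds (Θ.map_source hx)] with w hw hw'
    rw [vecIn, hw, Θ.right_inv hw']
    rfl
  rw [hΘ.dT_chartCov hx, hA.self_of_nhds, hA.self_of_nhds, hΘ.dT_chartCov hx, h1.fderiv_eq,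
    (hAt.hasFDerivAt.clm_apply hY.hasFDerivAt).fderiv, map_add, ← hΓ,
    ← vecIn_apply (𝕜 := ℝ) (E := E) (X := Y) hx]
  simp only [add_apply, ContinuousLinearMap.comp_apply, ContinuousLinearMap.flip_apply]
  abel

variable [IsManifold 𝓘(ℂ, E) ω M]

/-- The flat parts reproduce the bracket in the chart and the symmetric Christoffel terms cancel. -/
lemma chartCov_torsionFree [CompleteSpace E] [CompleteSpace G] {X Y : ∀ x : M, TangentSpace 𝓘(ℝ, E) x}
    {x : M} (hx : x ∈ Θ.source)
    (hX : VDiffAt X x) (hY : VDiffAt Y x) (hΓ : ∀ u v, Γ u v = Γ v u) :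
    chartCov Θ Γ Y x (X x) - chartCov Θ Γ X x (Y x) = VectorField.mlieBracket 𝓘(ℝ, E) X Y x := by
  refine hΘ.injective_dT hx (Eq.trans ?_ (hΘ.dT_bracket hx hX hY).symm)
  refine (map_sub (dT ℝ E Θ x) _ _).trans ?_
  refine (congrArg₂ (fun a b : G => a - b) (hΘ.dT_chartCov (Y := Y) hx (X x))
    (hΘ.dT_chartCov (Y := X) hx (Y x))).trans ?_
  rw [hΓ]
  abel

end IsChart

end ChartConnections

end BiquaternionicExtension
end

open scoped Manifold ContDiff
noncomputable section
namespace BiquaternionicExtension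

/-! ### Parallelism in a local model -/

section Koszul

variable {A C : Type*} [NormedAddCommGroup A] [NormedSpace ℂ A] [NormedAddCommGroup C]
  [NormedSpace ℂ C] {o : A × C →L[ℂ] A × C →L[ℂ] ℂ}
  {D : A × C →L[ℂ] A × C →L[ℂ] A × C →L[ℂ] ℂ} (h : IsJet o D)
  {Γ : A × C →L[ℂ] A × C →L[ℂ] A × C} (hΓ : ∀ u v, IsKoszul o D u v (Γ u v))
include h hΓ

lemma IsJet.christoffel_symm (u v : A × C) : Γ u v = Γ v u :=
  h.koszul_unique (hΓ u v) (h.koszul_symm (hΓ v u))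

lemma IsJet.christoffel_horizontal {u v : A × C} (hu : u.1 = 0) (hv : v.2 = 0) : Γ u v = 0 :=
  h.koszul_zero hu hv (hΓ u v)

/-- The horizontal part of `v` contributes nothing, and vertical fields stay vertical. -/
lemma IsJet.christoffel_fst {u : A × C} (hu : u.1 = 0) (v : A × C) : (Γ u v).1 = 0 := by
  have h1 : v = (v.1, 0) + (0, v.2) := by simp
  rw [h1, map_add, h.christoffel_horizontal hΓ hu rfl, zero_add]
  exact h.koszul_vertical hu rfl (hΓ u _)

/-- `v` and its image differ by a horizontal vector, which is annihilated in vertical directions. -/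
lemma IsJet.christoffel_stdF {u : A × C} (hu : u.1 = 0) (v : A × C) :
    Γ u (stdF A C v) = Γ u v := by
  have h1 : stdF A C v = v - (2 : ℂ) • (v.1, 0) := by
    refine Prod.ext ?_ (by simp)
    simp only [stdF_apply, Prod.fst_sub, Prod.smul_fst]
    module
  have h2 : Γ u ((v.1, 0) : A × C) = 0 := h.christoffel_horizontal hΓ hu rfl
  rw [h1, map_sub, map_smul, h2, smul_zero, sub_zero]

/-- The symplectic form is parallel along the first foliation. -/
lemma IsJet.christoffel_form {u : A × C} (hu : u.1 = 0) (v w : A × C) :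
    o (Γ u v) w + o v (Γ u w) = D u v w := by
  -- Metric compatibility is applied to `F v`, so that the two occurrences of `F` cancel and `o`
  -- itself appears; on vertical vectors `F` is the identity.
  have h1 := h.koszul_metric (hΓ u (stdF A C v)) (hΓ u w)
  rw [stdF_stdF, h.christoffel_stdF hΓ hu] at h1
  have h2 : stdF A C (Γ u v) = Γ u v := Prod.ext (by simp [h.christoffel_fst hΓ hu]) rfl
  rwa [h2] at h1

end Koszul

section LocalModel

open Filter Topology Metric

variable {E : Type*} [NormedAddCommGroup E] [NormedSpace ℂ E] [FiniteDimensional ℂ E]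
  {N : Type*} [TopologicalSpace N] [ChartedSpace E N] [IsManifold 𝓘(ℂ, E) ω N]
  {E' : Type*} [NormedAddCommGroup E'] [NormedSpace ℂ E']
  {M : Type*} [TopologicalSpace M] [ChartedSpace E' M]

/-- The form depends on `Z` only through `Z.1`, which is constant along the vertical leaves. -/
lemma fderiv_modelB (g₀ : AnalyticMetric E N) (p : N) {Z : StdComplexification E}
    (hZ : Z.1 ∈ (chartAt E p).target) {u : StdComplexification E} (hu : u.1 = 0)
    (v w : StdComplexification E) : fderiv ℝ (modelB g₀ p) Z u v w = 0 := by
  have h2 : HasFDerivAt (fun Z : StdComplexification E => localMetric g₀ p Z.1 v.1 w.1) _ Z :=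
    (((((contDiffAt_localMetric g₀ p hZ).differentiableAt (by simp)).hasFDerivAt.comp Z
      hasFDerivAt_fst).clm_apply (hasFDerivAt_const v.1 Z)).clm_apply (hasFDerivAt_const w.1 Z))
  have h3 := h2.const_mul (1 / 2 : ℝ)
  have h4 := ((((contDiffAt_modelB g₀ p hZ).differentiableAt (by simp)).hasFDerivAt.clm_apply
    (hasFDerivAt_const v Z)).clm_apply (hasFDerivAt_const w Z))
  have h5 := congrArg (fun L : StdComplexification E →L[ℝ] ℝ => L u) (h4.unique h3)
  simpa [hu] using h5

omit [FiniteDimensional ℂ E] in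
lemma modelB_fst (g₀ : AnalyticMetric E N) (p : N) (Z : StdComplexification E)
    {v : StdComplexification E} (hv : v.1 = 0) (w : StdComplexification E) :
    modelB g₀ p Z v w = 0 := by
  rw [modelB_apply, hv, map_zero, zero_apply, mul_zero]

omit [FiniteDimensional ℂ E] in
lemma modelB_fst' (g₀ : AnalyticMetric E N) (p : N) (Z : StdComplexification E)
    {v : StdComplexification E} (hv : v.1 = 0) (w : StdComplexification E) :
    modelB g₀ p Z w v = 0 := by
  rw [modelB_apply, hv, map_zero, mul_zero]

namespace IsLocalModel

variable {f : N → M} {g₀ : AnalyticMetric E N} {q₁ q₂ : M → N}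
  {om : CBilinField E' M} {H : CEndoField E' M} {p : N}
  {Θ : OpenPartialHomeomorph M (StdComplexification E)} {ρ : ℝ}
  {omt : StdComplexification E → StdComplexification E →L[ℂ] StdComplexification E →L[ℂ] ℂ}
  (h : IsLocalModel f g₀ q₁ q₂ om H p Θ ρ omt) (hg₀ : IsKahler g₀)
  {Z : StdComplexification E} (hZ : Z ∈ polydisc (chartAt E p p) ρ)
include h hg₀ hZ

lemma hasFDerivAt_modelI (v : StdComplexification E) :
    HasFDerivAt (fun Z => modelI omt g₀ p Z v) ((fderiv ℝ (modelI omt g₀ p) Z).flip v) Z := by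
  have h1 := ((h.contDiffAt_modelI hg₀ hZ).differentiableAt (by simp)).hasFDerivAt.clm_apply
    (hasFDerivAt_const v Z)
  simpa using h1

lemma fderiv_modelI_sq (u v : StdComplexification E) :
    fderiv ℝ (modelI omt g₀ p) Z u (modelI omt g₀ p Z v) +
      modelI omt g₀ p Z (fderiv ℝ (modelI omt g₀ p) Z u v) = 0 := by
  have h1 := ((h.contDiffAt_modelI hg₀ hZ).differentiableAt (by simp)).hasFDerivAt.clm_apply
    (h.hasFDerivAt_modelI hg₀ hZ v)
  have h2 : HasFDerivAt (fun Z => modelI omt g₀ p Z (modelI omt g₀ p Z v))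
      (0 : StdComplexification E →L[ℝ] StdComplexification E) Z :=
    (hasFDerivAt_const (-v) Z).congr_of_eventuallyEq (by
      filter_upwards [(isOpen_polydisc _ _).mem_nhds hZ] with Z hZ
        using (h.isHyperI_model hg₀ hZ).sq v)
  have h3 := congrArg (fun L : StdComplexification E →L[ℝ] StdComplexification E => L u)
    (h1.unique h2)
  rw [add_comm]
  exact h3

/-- Vertical derivative of the equation `Re ω(I v, w) = -B(v, w)`, whose right-hand side is constant
along the leaf. -/
lemma fderiv_modelI_re_om_minus (u : StdComplexification E) (hu : u.1 = 0)
    {v : StdComplexification E} (hv : v.2 = 0) (w : StdComplexification E) :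
    (fderiv ℂ omt Z u (modelI omt g₀ p Z v) w +
      omt Z (fderiv ℝ (modelI omt g₀ p) Z u v) w).re = 0 := by
  obtain ⟨h0, h0'⟩ := fderiv_bilinR (h.analytic Z hZ).differentiableAt
  have h1 := (h0.hasFDerivAt.clm_apply (h.hasFDerivAt_modelI hg₀ hZ v)).clm_apply
    (hasFDerivAt_const w Z)
  have h2 := Complex.reCLM.hasFDerivAt.comp Z h1
  have h4 := (((((contDiffAt_modelB g₀ p (h.fst_mem hZ)).differentiableAt
    (by simp)).hasFDerivAt.clm_apply (hasFDerivAt_const v Z)).clm_apply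
    (hasFDerivAt_const w Z))).neg.congr_of_eventuallyEq
    (f₁ := Complex.reCLM ∘ fun Z => bilinR _ (omt Z) (modelI omt g₀ p Z v) w) (by
      filter_upwards [(isOpen_polydisc _ _).mem_nhds hZ] with Z hZ
      exact (h.isHyperI_model hg₀ hZ).re_om_minus v w (Prod.ext rfl (by simp [hv])))
  have h5 := congrArg (fun L : StdComplexification E →L[ℝ] ℝ => L u) (h2.unique h4)
  have h6 := fderiv_modelB g₀ p (h.fst_mem hZ) hu v w
  simp only [ContinuousLinearMap.comp_apply, add_apply, ContinuousLinearMap.flip_apply, neg_apply,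
    zero_apply, map_zero, zero_add, h6, h0', bilinR_apply, neg_zero, Complex.reCLM_apply] at h5
  rw [add_comm]
  exact h5

variable {Γ : StdComplexification E →L[ℂ] StdComplexification E →L[ℂ] StdComplexification E}
  (hΓ : ∀ u v, IsKoszul (omt Z) (fderiv ℂ omt Z) u v (Γ u v))
include hΓ

/-- `I` is parallel along the first foliation. -/
lemma parallel_modelI {u : StdComplexification E} (hu : u.1 = 0) (v : StdComplexification E) :
    fderiv ℝ (modelI omt g₀ p) Z u v + Γ u (modelI omt g₀ p Z v) =
      modelI omt g₀ p Z (Γ u v) := by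
  have hJ := h.isJet hg₀ hZ
  have hI := h.isHyperI_model hg₀ hZ
  have hbl := h.isBiLagrangian_model hg₀ hZ
  have hsq := h.fderiv_modelI_sq hg₀ hZ u
  have hminus := fun v hv => h.fderiv_modelI_re_om_minus hg₀ hZ u hu (v := v) hv
  generalize fderiv ℝ (modelI omt g₀ p) Z = I' at hsq hminus
  generalize modelI omt g₀ p Z = I at hI hsq hminus
  -- For horizontal `w`, `Γ u w = 0`. Pairing with `z` and using that `ω` is parallel along the
  -- leaf, the only remaining term is `Re ω(I w, Γ u z) = -B(w, Γ u z)`, which vanishes because `Γ u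
  -- z` is vertical.
  have key : ∀ w : StdComplexification E, w.2 = 0 → I' u w + Γ u (I w) - I (Γ u w) = 0 := by
    intro w hw
    refine hbl.re_nondeg _ fun z => ?_
    have h1 := hminus w hw z
    have h2 := hJ.christoffel_form hΓ hu (I w) z
    have h3 := hI.re_om_minus w (Γ u z) (Prod.ext rfl (by simp [hw]))
    rw [modelB_fst' g₀ p Z (hJ.christoffel_fst hΓ hu z), neg_zero] at h3
    rw [hJ.christoffel_horizontal hΓ hu hw, map_zero, sub_zero, map_add, add_apply,
      eq_sub_of_add_eq h2, Complex.add_re, Complex.sub_re, h3]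
    rw [Complex.add_re] at h1
    linarith
  -- A vertical `w` is `-I (I w)` with `I w` horizontal, so the differentiated relation `I² = -1`
  -- reduces this to the previous case.
  have key' : ∀ w : StdComplexification E, w.1 = 0 → I' u w + Γ u (I w) - I (Γ u w) = 0 := by
    intro w hw
    have hFw : stdFR E w = w := Prod.ext (by simp [hw]) rfl
    have h1 : (I w).2 = 0 := by
      have h2 := hI.F_comm w
      rw [hFw] at h2
      exact eq_zero_of_eq_neg (congrArg Prod.snd h2)
    have h3 : w = -(I (I w)) := by rw [hI.sq, neg_neg]
    have h4 := key (I w) h1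
    have h5 := hsq (I w)
    generalize I w = w' at h3 h4 h5
    rw [h3]
    simp only [map_neg, eq_neg_of_add_eq_zero_left h5]
    have h6 := congrArg I h4
    rw [map_sub, map_add, hI.sq, map_zero] at h6
    rw [← h6]
    abel
  have h1 : v = (v.1, 0) + (0, v.2) := by simp
  rw [← sub_eq_zero, h1]
  simp only [map_add]
  have e1 := key (v.1, 0) rfl
  have e2 := key' (0, v.2) rfl
  rw [← add_zero (0 : StdComplexification E)]
  nth_rw 2 [← e2]
  rw [← e1]
  abel

/-- `g` is parallel along the first foliation. -/
lemma parallel_modelG {u : StdComplexification E} (hu : u.1 = 0) (v w : StdComplexification E) :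
    fderiv ℝ (modelG omt g₀ p) Z u v w =
      modelG omt g₀ p Z (Γ u v) w + modelG omt g₀ p Z v (Γ u w) := by
  have hJ := h.isJet hg₀ hZ
  have hB := ((contDiffAt_modelB g₀ p (h.fst_mem hZ)).differentiableAt (n := ω) (by simp)).hasFDerivAt
  have h1 := ((hB.clm_apply (hasFDerivAt_const v Z)).clm_apply (hasFDerivAt_const w Z)).add
    ((hB.clm_apply (h.hasFDerivAt_modelI hg₀ hZ v)).clm_apply (h.hasFDerivAt_modelI hg₀ hZ w))
  have h2 := ((((h.contDiffAt_modelG hg₀ hZ).differentiableAt (n := ω) (by simp)).hasFDerivAt.clm_apply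
    (hasFDerivAt_const v Z)).clm_apply (hasFDerivAt_const w Z))
  have h3 := congrArg (fun L : StdComplexification E →L[ℝ] ℝ => L u) (h2.unique h1)
  have h4 := fderiv_modelB g₀ p (h.fst_mem hZ) hu
  -- In `g = B + B(I·, I·)` only `I` varies along the leaf, and its derivative is `I Γ - Γ I`. The
  -- values of `Γ u` are vertical, hence in the kernel of `B`.
  have h5 : ∀ v, fderiv ℝ (modelI omt g₀ p) Z u v =
      modelI omt g₀ p Z (Γ u v) - Γ u (modelI omt g₀ p Z v) := fun v =>
    eq_sub_of_add_eq (h.parallel_modelI hg₀ hZ hΓ hu v)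
  have h6 := fun v => modelB_fst g₀ p Z (hJ.christoffel_fst hΓ hu v)
  have h7 := fun v => modelB_fst' g₀ p Z (hJ.christoffel_fst hΓ hu v)
  have h8 : ∀ v w, modelG omt g₀ p Z v w = modelB g₀ p Z v w +
      modelB g₀ p Z (modelI omt g₀ p Z v) (modelI omt g₀ p Z w) := fun v w => rfl
  simp only [add_apply, ContinuousLinearMap.comp_apply, ContinuousLinearMap.flip_apply,
    zero_apply, map_zero, zero_add, h4, h5, map_sub, sub_apply, h6, h7, sub_zero, add_zero] at h3
  rw [h3, h8, h8, h6, h7]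
  ring

end IsLocalModel

end LocalModel

end BiquaternionicExtension
end

open scoped Manifold ContDiff
noncomputable section
namespace BiquaternionicExtension

/-! ### The hyperhermitian structure at a point -/

section LinearAlgebra

variable {T : Type*} [NormedAddCommGroup T] [NormedSpace ℂ T]

namespace IsBiLagrangian.IsHyperI

variable {om : T →L[ℂ] T →L[ℂ] ℂ} {F : T →L[ℝ] T} {B : T →L[ℝ] T →L[ℝ] ℝ} {I : T →L[ℝ] T}
  (h : IsHyperI om F B I)
include h

lemma form_pos {u : T} (hu : u ≠ 0) : 0 < B u u + B (I u) (I u) :=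
  lt_of_le_of_ne (add_nonneg (h.nonneg u) (h.nonneg (I u))) fun h0 => hu (h.definite u h0.symm)

lemma form_I (u v : T) :
    B (I u) (I v) + B (I (I u)) (I (I v)) = B u v + B (I u) (I v) := by
  rw [h.sq, h.sq, map_neg, map_neg, neg_apply, neg_neg, add_comm]

lemma form_J (hB : ∀ u v, B (Complex.I • u) (Complex.I • v) = B u v) (u v : T) :
    B (Complex.I • u) (Complex.I • v) + B (I (Complex.I • u)) (I (Complex.I • v)) =
      B u v + B (I u) (I v) := by
  rw [h.smul_I, h.smul_I, map_neg, map_neg, neg_apply, neg_neg, hB, hB]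

lemma K_sq (u : T) : I (Complex.I • I (Complex.I • u)) = -u := by
  rw [h.smul_I, h.sq, smul_neg, neg_neg, I_smul_I_smul]

/-- `g(I u, v)` is `Re om u v`. Replacing `u` by `i u` gives `g(K u, v) = -Im om u v`. -/
lemma complexification (u v : T) :
    ((B (I u) v + B (I (I u)) (I v) : ℝ) : ℂ) -
      Complex.I * ((B (I (Complex.I • u)) v + B (I (I (Complex.I • u))) (I v) : ℝ) : ℂ) =
      om u v := by
  have h1 : ∀ u v, B (I u) v + B (I (I u)) (I v) = (om u v).re := fun u v => by
    rw [h.sq, map_neg, neg_apply, ← sub_eq_add_neg, h.re_om]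
  rw [h1, h1, map_smul, smul_apply, smul_eq_mul]
  apply Complex.ext <;> simp

end IsBiLagrangian.IsHyperI

end LinearAlgebra

/-! ### The foliations and the closed holomorphic symplectic form on `M`. -/

section LocalModel

open Filter Topology Metric

variable {E : Type*} [NormedAddCommGroup E] [NormedSpace ℂ E] [FiniteDimensional ℂ E]
  {N : Type*} [TopologicalSpace N] [ChartedSpace E N] [IsManifold 𝓘(ℂ, E) ω N]
  {E' : Type*} [NormedAddCommGroup E'] [NormedSpace ℂ E'] [FiniteDimensional ℂ E']
  {M : Type*} [TopologicalSpace M] [ChartedSpace E' M] [IsManifold 𝓘(ℂ, E') ω M]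

namespace IsLocalModel

variable {f : N → M} {g₀ : AnalyticMetric E N} {q₁ q₂ : M → N}
  {om : CBilinField E' M} {H : CEndoField E' M} {p : N}
  {Θ : OpenPartialHomeomorph M (StdComplexification E)} {ρ : ℝ}
  {omt : StdComplexification E → StdComplexification E →L[ℂ] StdComplexification E →L[ℂ] ℂ}
  (h : IsLocalModel f g₀ q₁ q₂ om H p Θ ρ omt) {x : M} (hx : x ∈ Θ.source)
include h hx

omit [FiniteDimensional ℂ E'] [IsManifold 𝓘(ℂ, E') ω M] in
lemma rd_q₁_eq_zero_iff (u : E') :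
    (rd (E := E') (E' := E) q₁ x : E' →L[ℝ] E) u = (0 : E) ↔ (dT ℂ E' Θ x u).1 = 0 := by
  rw [h.rd_q₁ hx]
  refine ⟨fun h0 => ?_, fun h0 => by rw [h0, map_zero]⟩
  have h1 := (isChart_chartAt (𝕜 := ℝ) (E := E) p).dT_dS (h.fst_mem (h.mem_polydisc hx))
    (dT ℂ E' Θ x u).1
  rw [← h1, h0, map_zero]

omit [FiniteDimensional ℂ E'] [IsManifold 𝓘(ℂ, E') ω M] in
lemma rd_q₂_eq_zero_iff (u : E') :
    (rd (E := E') (E' := E) q₂ x : E' →L[ℝ] E) u = (0 : E) ↔ (dT ℂ E' Θ x u).2 = 0 := by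
  rw [h.rd_q₂ hx]
  refine ⟨fun h0 => ?_, fun h0 => by rw [h0, map_zero, map_zero]⟩
  have h1 := (isChart_chartAt (𝕜 := ℝ) (E := E) p).dT_dS (h.snd_mem (h.mem_polydisc hx))
    ((conjEquiv E).symm (dT ℂ E' Θ x u).2)
  rw [h0, map_zero] at h1
  exact (map_eq_zero_iff _ (conjEquiv E).symm.injective).1 h1.symm

omit [FiniteDimensional ℂ E'] [IsManifold 𝓘(ℂ, E') ω M] in
lemma mem_fibre₁ (u : E') : u ∈ fibreDistribution E E' q₁ x ↔ (dT ℂ E' Θ x u).1 = 0 :=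
  h.rd_q₁_eq_zero_iff hx u

omit [FiniteDimensional ℂ E'] [IsManifold 𝓘(ℂ, E') ω M] in
lemma mem_fibre₂ (u : E') : u ∈ fibreDistribution E E' q₂ x ↔ (dT ℂ E' Θ x u).2 = 0 :=
  h.rd_q₂_eq_zero_iff hx u

omit [FiniteDimensional ℂ E'] [IsManifold 𝓘(ℂ, E') ω M] in
lemma transverse : IsCompl (fibreDistribution E E' q₁ x) (fibreDistribution E E' q₂ x) := by
  constructor
  · refine Submodule.disjoint_def.2 fun (u : E') h1 h2 => h.isChart.injective_dT hx ?_
    exact (Prod.ext ((h.mem_fibre₁ hx u).1 h1) ((h.mem_fibre₂ hx u).1 h2) :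
      dT ℂ E' Θ x u = 0).trans (map_zero (dT ℂ E' Θ x)).symm
  · refine codisjoint_iff.2 (eq_top_iff.2 fun (u : E') _ => Submodule.mem_sup.2 ?_)
    refine ⟨(dS ℂ E' Θ (Θ x) (0, (dT ℂ E' Θ x u).2) : E'), (h.mem_fibre₁ hx _).2 ?_,
      (dS ℂ E' Θ (Θ x) ((dT ℂ E' Θ x u).1, 0) : E'), (h.mem_fibre₂ hx _).2 ?_, ?_⟩
    · rw [h.isChart.dT_dS' hx]
    · rw [h.isChart.dT_dS' hx]
    · refine ((dS ℂ E' Θ (Θ x)).map_add _ _).symm.trans ?_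
      rw [Prod.mk_add_mk, zero_add, add_zero]
      exact h.isChart.dS_dT hx u

omit [FiniteDimensional ℂ E'] [IsManifold 𝓘(ℂ, E') ω M] in
lemma paraStructure_fibre₁ {u : E'} (hu : u ∈ fibreDistribution E E' q₁ x) :
    paraStructure H x u = u := h.isChart.injective_dT hx <| by
  rw [h.dT_paraStructure hx]
  exact Prod.ext (by simp [(h.mem_fibre₁ hx u).1 hu]) rfl

omit [FiniteDimensional ℂ E'] [IsManifold 𝓘(ℂ, E') ω M] in
lemma paraStructure_fibre₂ {u : E'} (hu : u ∈ fibreDistribution E E' q₂ x) :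
    paraStructure H x u = -u := h.isChart.injective_dT hx <| by
  rw [h.dT_paraStructure hx, map_neg]
  exact Prod.ext rfl (by simp [(h.mem_fibre₂ hx u).1 hu])

omit [FiniteDimensional ℂ E'] [IsManifold 𝓘(ℂ, E') ω M] in
lemma om_real (u v : E') :
    om x u v = bilinR _ (omt (Θ x)) (dT ℝ E' Θ x u) (dT ℝ E' Θ x v) := by
  rw [bilinR_apply, h.isChart.dT_real hx, h.isChart.dT_real hx]
  exact (h.model x hx).om_eq u v

/-- The holomorphic symplectic form is closed. -/
lemma closed (hg₀ : IsKahler g₀) {X Y Z : ∀ x : M, TangentSpace 𝓘(ℝ, E') x}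
    (hX : VDiffAt X x) (hY : VDiffAt Y x) (hZ : VDiffAt Z x) :
    mvfderiv 𝓘(ℝ, E') (fun y => om y (toC (Y y)) (toC (Z y))) x (X x)
      - mvfderiv 𝓘(ℝ, E') (fun y => om y (toC (X y)) (toC (Z y))) x (Y x)
      + mvfderiv 𝓘(ℝ, E') (fun y => om y (toC (X y)) (toC (Y y))) x (Z x)
      - om x (toC (VectorField.mlieBracket 𝓘(ℝ, E') X Y x)) (toC (Z x))
      + om x (toC (VectorField.mlieBracket 𝓘(ℝ, E') X Z x)) (toC (Y x))
      - om x (toC (VectorField.mlieBracket 𝓘(ℝ, E') Y Z x)) (toC (X x)) = 0 := by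
  haveI : CompleteSpace E' := FiniteDimensional.complete ℂ E'
  haveI : CompleteSpace (StdComplexification E) := FiniteDimensional.complete ℂ _
  have hr := h.isChart.real
  have hJ := h.isJet hg₀ (h.mem_polydisc hx)
  obtain ⟨hd, hD⟩ := fderiv_bilinR (h.analytic _ (h.mem_polydisc hx)).differentiableAt
  have hev : ∀ᶠ y in 𝓝 x, ∀ u v : E', om y u v =
      bilinR _ (omt (Θ y)) (dT ℝ E' Θ y u) (dT ℝ E' Θ y v) := by
    filter_upwards [Θ.open_source.mem_nhds hx] with y hy using h.om_real hy
  have key := fun (A B : ∀ x : M, TangentSpace 𝓘(ℝ, E') x) (hA : VDiffAt A x) (hB : VDiffAt B x)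
      (u : E') => hr.mvfderiv_bilin (b := fun y (u v : E') => om y u v)
    (bt := fun Z => bilinR _ (omt Z)) hx hev hd ((hr.vdiffAt_iff hx).1 hA) ((hr.vdiffAt_iff hx).1 hB) u
  have hbr : ∀ A B : ∀ x : M, TangentSpace 𝓘(ℝ, E') x, VDiffAt A x → VDiffAt B x → ∀ w : E',
      om x (toC (VectorField.mlieBracket 𝓘(ℝ, E') A B x)) w =
        omt (Θ x) (fderiv ℝ (vecIn ℝ E' Θ B) (Θ x) (dT ℝ E' Θ x (A x)) -
          fderiv ℝ (vecIn ℝ E' Θ A) (Θ x) (dT ℝ E' Θ x (B x))) (dT ℝ E' Θ x w) :=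
    fun A B hA hB w => (h.om_real hx _ w).trans
      (congrArg (fun V => omt (Θ x) V (dT ℝ E' Θ x w)) (hr.dT_bracket hx hA hB))
  have e1 := key Y Z hY hZ (X x)
  have e2 := key X Z hX hZ (Y x)
  have e3 := key X Y hX hY (Z x)
  have e4 := hbr X Y hX hY (Z x)
  have e5 := hbr X Z hX hZ (Y x)
  have e6 := hbr Y Z hY hZ (X x)
  simp only [hD, bilinR_apply] at e1 e2 e3
  simp only [map_sub, sub_apply] at e4 e5 e6
  refine (congrArg₂ (· - ·) (congrArg₂ (· + ·) (congrArg₂ (· - ·) (congrArg₂ (· + ·)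
    (congrArg₂ (· - ·) e1 e2) e3) e4) e5) e6).trans ?_
  generalize (dT ℝ E' Θ x (X x)) = X', (dT ℝ E' Θ x (Y x)) = Y', (dT ℝ E' Θ x (Z x)) = Z'
  generalize fderiv ℝ (vecIn ℝ E' Θ X) (Θ x) = DX, fderiv ℝ (vecIn ℝ E' Θ Y) (Θ x) = DY,
    fderiv ℝ (vecIn ℝ E' Θ Z) (Θ x) = DZ
  -- Derivatives of the fields cancel against the brackets by skewness; what remains is closedness
  -- on constant fields.
  linear_combination hJ.closed X' Y' Z' - hJ.D_skew Y' X' Z' + hJ.skew Y' (DZ X') -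
    hJ.skew X' (DZ Y') + hJ.skew X' (DY Z')

end IsLocalModel

end LocalModel

end BiquaternionicExtension
end

open scoped Manifold ContDiff
noncomputable section
namespace BiquaternionicExtension

/-! ### The bi-Lagrangian connection in a local model -/

section LocalModel

open Filter Topology Metric

variable {E : Type*} [NormedAddCommGroup E] [NormedSpace ℂ E] [FiniteDimensional ℂ E]
  {N : Type*} [TopologicalSpace N] [ChartedSpace E N] [IsManifold 𝓘(ℂ, E) ω N]
  {E' : Type*} [NormedAddCommGroup E'] [NormedSpace ℂ E'] [FiniteDimensional ℂ E']
  {M : Type*} [TopologicalSpace M] [ChartedSpace E' M] [IsManifold 𝓘(ℂ, E') ω M]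

/-- The endomorphism field `K = I J`. -/
def fieldK (g₀ : AnalyticMetric E N) (q₁ q₂ : M → N) (om : CBilinField E' M)
    (H : CEndoField E' M) (x : M) : E' →L[ℝ] E' :=
  EndoField.mul (fieldI g₀ q₁ q₂ om H) (complexStructure E' M) x

namespace IsLocalModel

variable {f : N → M} {g₀ : AnalyticMetric E N} {q₁ q₂ : M → N}
  {om : CBilinField E' M} {H : CEndoField E' M} {p : N}
  {Θ : OpenPartialHomeomorph M (StdComplexification E)} {ρ : ℝ}
  {omt : StdComplexification E → StdComplexification E →L[ℂ] StdComplexification E →L[ℂ] ℂ}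
  (h : IsLocalModel f g₀ q₁ q₂ om H p Θ ρ omt) (hg₀ : IsKahler g₀) {x : M} (hx : x ∈ Θ.source)
include h hx

omit [IsManifold 𝓘(ℂ, E') ω M] [FiniteDimensional ℂ E'] in
lemma vecIn_paraStructure (Y : M → E') : vecIn ℝ E' Θ (fun y => paraStructure H y (Y y))
    =ᶠ[𝓝 (Θ x)] fun Z => stdFR E (vecIn ℝ E' Θ Y Z) := by
  filter_upwards [Θ.open_target.mem_nhds (Θ.map_source hx)] with Z hZ
  have h1 := h.dT_paraStructure (Θ.map_target hZ) (Y (Θ.symm Z))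
  rw [← h.isChart.dT_real (Θ.map_target hZ), ← h.isChart.dT_real (Θ.map_target hZ)] at h1
  exact h1

variable {Γ : StdComplexification E →L[ℂ] StdComplexification E →L[ℂ] StdComplexification E}
  (hΓ : ∀ u v, IsKoszul (omt (Θ x)) (fderiv ℂ omt (Θ x)) u v (Γ u v))
include hΓ hg₀

omit [FiniteDimensional ℂ E'] [IsManifold 𝓘(ℂ, E') ω M] in
-- `F` is constant in the chart and commutes with differentiation, so only the algebraic identity
-- `koszul_metric` is left.
lemma chartCov_metric {Y Z : M → E'}
    (hY : DifferentiableAt ℝ (vecIn ℝ E' Θ Y) (Θ x))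
    (hZ : DifferentiableAt ℝ (vecIn ℝ E' Θ Z) (Θ x)) (u : E') :
    mvfderiv 𝓘(ℝ, E') (fun y => om y (paraStructure H y (Y y)) (Z y)) x u =
      om x (paraStructure H x (chartCov Θ Γ Y x u)) (Z x) +
        om x (paraStructure H x (Y x)) (chartCov Θ Γ Z x u) := by
  have hr := h.isChart.real
  have hJ := h.isJet hg₀ (h.mem_polydisc hx)
  obtain ⟨hd, hD⟩ := fderiv_bilinR (h.analytic _ (h.mem_polydisc hx)).differentiableAt
  have hev : ∀ᶠ y in 𝓝 x, ∀ u v : E', om y u v =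
      bilinR _ (omt (Θ y)) (dT ℝ E' Θ y u) (dT ℝ E' Θ y v) := by
    filter_upwards [Θ.open_source.mem_nhds hx] with y hy using h.om_real hy
  have hF := h.vecIn_paraStructure hx Y
  have hFY : HasFDerivAt (vecIn ℝ E' Θ (fun y => paraStructure H y (Y y)))
      ((stdFR E).comp (fderiv ℝ (vecIn ℝ E' Θ Y) (Θ x))) (Θ x) :=
    ((stdFR E).hasFDerivAt.comp _ hY.hasFDerivAt).congr_of_eventuallyEq hF
  have hFx : ∀ v : E', dT ℝ E' Θ x (paraStructure H x v) =
      stdFR E (dT ℝ E' Θ x v) := fun v => by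
    rw [h.isChart.dT_real hx, h.isChart.dT_real hx, h.dT_paraStructure hx]
  refine (hr.mvfderiv_bilin (b := fun y (u v : E') => om y u v)
    (bt := fun Z => bilinR _ (omt Z)) hx hev hd hFY.differentiableAt hZ u).trans ?_
  rw [hFY.fderiv, h.om_real hx, h.om_real hx, hFx, hFx, hr.dT_chartCov hx, hr.dT_chartCov hx, hD]
  have h1 := hJ.koszul_metric (hΓ (dT ℝ E' Θ x u) (dT ℝ E' Θ x (Y x)))
    (hΓ (dT ℝ E' Θ x u) (dT ℝ E' Θ x (Z x)))
  simp only [bilinR_apply, map_add, add_apply, ContinuousLinearMap.comp_apply]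
  change _ = omt (Θ x) (stdFR E _) _ + omt (Θ x) (stdF E _ _) _ + (_ + omt (Θ x) (stdF E _ _) _)
  rw [show (stdFR E) (dT ℝ E' Θ x (Y x)) = stdF E (ConjModel E) (dT ℝ E' Θ x (Y x)) from rfl,
    ← h1]
  ring

lemma chartCov_fieldG {Y Z : M → E'}
    (hY : DifferentiableAt ℝ (vecIn ℝ E' Θ Y) (Θ x))
    (hZ : DifferentiableAt ℝ (vecIn ℝ E' Θ Z) (Θ x)) {u : E'}
    (hu : u ∈ fibreDistribution E E' q₁ x) :
    mvfderiv 𝓘(ℝ, E') (fun y => fieldG g₀ q₁ q₂ om H y (Y y) (Z y)) x u =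
      fieldG g₀ q₁ q₂ om H x (chartCov Θ Γ Y x u) (Z x) +
        fieldG g₀ q₁ q₂ om H x (Y x) (chartCov Θ Γ Z x u) := by
  have hu' := (h.mem_fibre₁ hx u).1 hu
  rw [← h.isChart.dT_real hx] at hu'
  refine h.isChart.real.chartCov_bilin (b := fun y (u v : E') => fieldG g₀ q₁ q₂ om H y u v)
    (bt := modelG omt g₀ p) hx ?_
    ((h.contDiffAt_modelG hg₀ (h.mem_polydisc hx)).differentiableAt (by simp)) hY hZ
    (h.parallel_modelG hg₀ (h.mem_polydisc hx) hΓ hu')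
  filter_upwards [Θ.open_source.mem_nhds hx] with y hy u v
  rw [h.fieldG_eq hy hg₀, h.isChart.dT_real hy, h.isChart.dT_real hy]

lemma chartCov_fieldI {Y : M → E'} (hY : DifferentiableAt ℝ (vecIn ℝ E' Θ Y) (Θ x)) {u : E'}
    (hu : u ∈ fibreDistribution E E' q₁ x) :
    chartCov Θ Γ (fun y => fieldI g₀ q₁ q₂ om H y (Y y)) x u =
      fieldI g₀ q₁ q₂ om H x (chartCov Θ Γ Y x u) := by
  have hu' := (h.mem_fibre₁ hx u).1 hu
  rw [← h.isChart.dT_real hx] at hu'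
  refine h.isChart.real.chartCov_endo (A := fun y (u : E') => fieldI g₀ q₁ q₂ om H y u)
    (At := modelI omt g₀ p) hx ?_
    ((h.contDiffAt_modelI hg₀ (h.mem_polydisc hx)).differentiableAt (by simp)) hY
    (h.parallel_modelI hg₀ (h.mem_polydisc hx) hΓ hu')
  filter_upwards [Θ.open_source.mem_nhds hx] with y hy u
  rw [h.isChart.dT_real hy, h.isChart.dT_real hy, h.dT_fieldI hy hg₀]

omit hΓ hg₀ [FiniteDimensional ℂ E'] [IsManifold 𝓘(ℂ, E') ω M] in
lemma chartCov_J {Y : M → E'} (hY : DifferentiableAt ℝ (vecIn ℝ E' Θ Y) (Θ x)) (u : E') :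
    DifferentiableAt ℝ (vecIn ℝ E' Θ (fun y => Complex.I • Y y)) (Θ x) ∧
    chartCov Θ Γ (fun y => Complex.I • Y y) x u = Complex.I • chartCov Θ Γ Y x u := by
  have hJ : ∀ᶠ y in 𝓝 x, ∀ u : E', dT ℝ E' Θ y (Complex.I • u) =
      (Complex.I • ContinuousLinearMap.id ℂ (StdComplexification E)).restrictScalars ℝ
        (dT ℝ E' Θ y u) := by
    filter_upwards [Θ.open_source.mem_nhds hx] with y hy u
    exact h.isChart.dT_smul_I hy u
  constructor
  · refine (hY.const_smul Complex.I).congr_of_eventuallyEq ?_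
    filter_upwards [Θ.open_target.mem_nhds (Θ.map_source hx)] with Z hZ
    exact h.isChart.dT_smul_I (Θ.map_target hZ) _
  · refine h.isChart.real.chartCov_endo (A := fun y (u : E') => Complex.I • u)
      (At := fun _ => (Complex.I • ContinuousLinearMap.id ℂ (StdComplexification E)).restrictScalars ℝ)
      hx hJ (differentiableAt_const _) hY fun v => ?_
    rw [fderiv_const_apply, zero_apply, zero_apply, zero_add]
    exact (Γ _).map_smul _ _

lemma chartCov_fieldK {Y : M → E'} (hY : DifferentiableAt ℝ (vecIn ℝ E' Θ Y) (Θ x)) {u : E'}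
    (hu : u ∈ fibreDistribution E E' q₁ x) :
    chartCov Θ Γ (fun y => fieldK g₀ q₁ q₂ om H y (Y y)) x u =
      fieldK g₀ q₁ q₂ om H x (chartCov Θ Γ Y x u) := by
  obtain ⟨h1, h2⟩ := h.chartCov_J hx (Γ := Γ) hY u
  exact (h.chartCov_fieldI hg₀ hx hΓ h1 hu).trans (congrArg (fieldI g₀ q₁ q₂ om H x) h2)

end IsLocalModel

end LocalModel

end BiquaternionicExtension
end

open scoped Manifold ContDiff
noncomputable section
namespace BiquaternionicExtension

/-! ### The hyperhermitian structure is an admissible extension -/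

section LocalModel

open Filter Topology Metric

variable {E : Type*} [NormedAddCommGroup E] [NormedSpace ℂ E] [FiniteDimensional ℂ E]
  {N : Type*} [TopologicalSpace N] [ChartedSpace E N] [IsManifold 𝓘(ℂ, E) ω N]
  {E' : Type*} [NormedAddCommGroup E'] [NormedSpace ℂ E'] [FiniteDimensional ℂ E']
  {M : Type*} [TopologicalSpace M] [ChartedSpace E' M] [IsManifold 𝓘(ℂ, E') ω M]

variable (E E') in
/-- The real differential, as a map between the model spaces. -/
def rdAt (f : N → M) (p : N) : E →L[ℝ] E' := rd (E := E) (E' := E') f p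

lemma complexifyBilin_zero_snd {b : E →L[ℝ] E →L[ℝ] ℝ} (w : E) (v : StdComplexification E) :
    complexifyBilin b (0, conjEquiv E w) v =
      (b ((1 / 2 : ℝ) • w) (stdRe E v) : ℂ) +
        Complex.I * (b ((1 / 2 : ℝ) • w) (stdIm E v) : ℂ) +
        Complex.I * ((b (Complex.I • (1 / 2 : ℝ) • w) (stdRe E v) : ℂ) +
        Complex.I * (b (Complex.I • (1 / 2 : ℝ) • w) (stdIm E v) : ℂ)) := by
  conv_lhs => rw [zero_snd_eq, ContinuousLinearEquiv.symm_apply_apply, ← realIncl_re_add_im v]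
  generalize (1 / 2 : ℝ) • w = w'
  simp only [map_add, map_smul, add_apply, smul_apply, complexifyBilin_realIncl, smul_eq_mul]
  ring

lemma fst_eq_re_add_im (v : StdComplexification E) :
    v.1 = stdRe E v + Complex.I • stdIm E v := by
  conv_lhs => rw [← realIncl_re_add_im v]
  simp [realIncl_apply]

namespace IsLocalModel

variable {f : N → M} {g₀ : AnalyticMetric E N} {q₁ q₂ : M → N}
  {om : CBilinField E' M} {H : CEndoField E' M} {p : N}
  {Θ : OpenPartialHomeomorph M (StdComplexification E)} {ρ : ℝ}
  {omt : StdComplexification E → StdComplexification E →L[ℂ] StdComplexification E →L[ℂ] ℂ}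
  (h : IsLocalModel f g₀ q₁ q₂ om H p Θ ρ omt)
include h

section RealPoints

variable (hg₀ : IsKahler g₀) {z : E} (hz : z ∈ ball (chartAt E p p) ρ)
include hg₀ hz

omit [FiniteDimensional ℂ E'] [IsManifold 𝓘(ℂ, E') ω M] in
-- At a real point `ω` is the complexification of `ω₀`, so the equation `Re ω(I u, v) = -B(u, v)`
-- that characterises `I` on horizontal vectors can be checked explicitly.
lemma modelI_fst (a : E) : modelI omt g₀ p (realIncl E z) (a, 0) =
    (0, conjEquiv E (Complex.I • a)) := by
  have hZ := realIncl_mem_polydisc.2 hz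
  have hzt := h.adapted.ball_subset hz
  have hI := h.isHyperI_model hg₀ hZ
  refine (h.isBiLagrangian_model hg₀ hZ).eq_of_re fun v => ?_
  rw [hI.re_om_minus _ v (by simp), h.omt_realIncl z hz, complexifyBilin_zero_snd]
  simp only [Complex.add_re, Complex.mul_re, Complex.mul_im, Complex.I_re, Complex.I_im,
    Complex.ofReal_re, Complex.ofReal_im, Complex.add_im]
  rw [modelB_apply, fst_eq_re_add_im v]
  simp only [localForm_apply g₀ p hzt, realIncl_apply]
  generalize stdRe E v = c, stdIm E v = d
  have h1 : localMetric g₀ p z (Complex.I • a) d = - localMetric g₀ p z a (Complex.I • d) := by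
    rw [← hg₀.localMetric_I p hzt, I_smul_I_smul, map_neg, neg_apply]
  have h2 : Complex.I • (1 / 2 : ℝ) • Complex.I • a = -((1 / 2 : ℝ) • a) := by
    rw [smul_comm Complex.I (1 / 2 : ℝ), I_smul_I_smul, smul_neg]
  rw [h2, smul_neg, smul_comm Complex.I (1 / 2 : ℝ) a]
  simp only [map_neg, map_smul, neg_apply, smul_apply, map_add, h1, smul_eq_mul]
  ring

omit [FiniteDimensional ℂ E'] [IsManifold 𝓘(ℂ, E') ω M] in
-- A real vector is a horizontal plus a vertical one; `I² = -1` derives the vertical case from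
-- `modelI_fst`.
lemma modelI_realIncl (a : E) : modelI omt g₀ p (realIncl E z) (realIncl E a) =
    realIncl E (Complex.I • a) := by
  have hI := h.isHyperI_model hg₀ (realIncl_mem_polydisc.2 hz)
  have h1 := h.modelI_fst hg₀ hz a
  have h2 := hI.sq (-(Complex.I • a), 0)
  rw [h.modelI_fst hg₀ hz, smul_neg, I_smul_I_smul, neg_neg] at h2
  have h3 : realIncl E a = (a, 0) + (0, conjEquiv E a) := by simp
  rw [h3, map_add, h1, h2]
  simp

omit [FiniteDimensional ℂ E'] [IsManifold 𝓘(ℂ, E') ω M] in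
-- The terms `B(a, b)` and `B(I a, I b)` each contribute half of `g₀`, as `g₀` is Hermitian. This is
-- the origin of the factor `1 / 2` in `modelB`.
lemma modelG_realIncl (a b : E) :
    modelG omt g₀ p (realIncl E z) (realIncl E a) (realIncl E b) = localMetric g₀ p z a b := by
  change modelB g₀ p (realIncl E z) (realIncl E a) (realIncl E b) +
    modelB g₀ p (realIncl E z) (modelI omt g₀ p (realIncl E z) (realIncl E a))
      (modelI omt g₀ p (realIncl E z) (realIncl E b)) = _
  rw [h.modelI_realIncl hg₀ hz, h.modelI_realIncl hg₀ hz, modelB_apply, modelB_apply]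
  simp only [realIncl_apply]
  rw [hg₀.localMetric_I p (h.adapted.ball_subset hz)]
  ring

end RealPoints

lemma isStraightening (hf : IsComplexification E E' f) (hp : f p ∈ Θ.source) :
    IsStraightening (E' := E') f p Θ where
  isChart := h.isChart
  mem := hp
  apply_f := by
    filter_upwards [hf.analytic.continuous.continuousAt.preimage_mem_nhds
      (Θ.open_source.mem_nhds hp)] with p' hp'
    exact (h.adapted.apply_f p' hp').2

lemma at_center (hf : IsComplexification E E' f) (hp : f p ∈ Θ.source) :
    Θ (f p) = realIncl E (chartAt E p p) ∧ ∀ u : E, dT ℂ E' Θ (f p)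
      (rdAt E E' f p u) =
      realIncl E (dT ℝ E (chartAt E p) p u) := by
  obtain ⟨-, h1, h2, h3⟩ :=
    (IsStraightening.eventually_dT hf.analytic (h.isStraightening hf hp)).self_of_nhds
  refine ⟨h2, fun u => ?_⟩
  exact (h.isChart.dT_real h1 (rdAt E E' f p u)).symm.trans (h3 u)

variable (hg₀ : IsKahler g₀)
include hg₀

lemma fieldI_extends (hf : IsComplexification E E' f) (hp : f p ∈ Θ.source) (u : E) :
    fieldI g₀ q₁ q₂ om H (f p) (rdAt E E' f p u) =
      rdAt E E' f p (Complex.I • u) := by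
  obtain ⟨h1, h2⟩ := h.at_center hf hp
  refine h.isChart.injective_dT hp ?_
  rw [h.dT_fieldI hp hg₀, h2, h2, h1, h.modelI_realIncl hg₀ (mem_ball_self h.adapted.pos),
    (isChart_chartAt (𝕜 := ℂ) (E := E) p).dT_smul_I (mem_chart_source E p)]

lemma fieldG_extends (hf : IsComplexification E E' f) (hp : f p ∈ Θ.source) (u v : E) :
    fieldG g₀ q₁ q₂ om H (f p) (rdAt E E' f p u)
      (rdAt E E' f p v) = innerAt g₀ p u v := by
  obtain ⟨h1, h2⟩ := h.at_center hf hp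
  rw [h.fieldG_eq hp hg₀, h2, h2, h1, h.modelG_realIncl hg₀ (mem_ball_self h.adapted.pos)]
  exact (isChart_chartAt (𝕜 := ℝ) (E := E) p).bilinIn_dT (mem_chart_source E p) (innerAt g₀) u v

section

variable {x : M} (hx : x ∈ Θ.source)
include hx

lemma contMDiffAt_fieldI : ContMDiffAt 𝓘(ℝ, E') (𝓘(ℝ, E').prod 𝓘(ℝ, E' →L[ℝ] E')) ∞
    (fun x => (⟨x, fieldI (E' := E') g₀ q₁ q₂ om H x⟩ : Bundle.TotalSpace (E' →L[ℝ] E')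
      (fun x : M => TangentSpace 𝓘(ℝ, E') x →L[ℝ] TangentSpace 𝓘(ℝ, E') x))) x := by
  refine (IsChart.contMDiffAt_endo_iff (E := E') (𝕜 := ℝ) (A := fieldI g₀ q₁ q₂ om H) h.isChart.real hx).2
    (((h.contDiffAt_modelI hg₀ (h.mem_polydisc hx)).of_le le_top).congr_of_eventuallyEq ?_)
  filter_upwards [Θ.open_target.mem_nhds (Θ.map_source hx)] with Z hZ using h.endoIn_fieldI hg₀ hZ

lemma contMDiffAt_fieldG : ContMDiffAt 𝓘(ℝ, E') (𝓘(ℝ, E').prod 𝓘(ℝ, E' →L[ℝ] E' →L[ℝ] ℝ)) ∞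
    (fun x => (⟨x, fieldG (E' := E') g₀ q₁ q₂ om H x⟩ : Bundle.TotalSpace (E' →L[ℝ] E' →L[ℝ] ℝ)
      (fun x : M => TangentSpace 𝓘(ℝ, E') x →L[ℝ] TangentSpace 𝓘(ℝ, E') x →L[ℝ] ℝ))) x := by
  refine (IsChart.contMDiffAt_bilin_iff (E := E') (𝕜 := ℝ) (b := fieldG g₀ q₁ q₂ om H) h.isChart.real hx).2
    (((h.contDiffAt_modelG hg₀ (h.mem_polydisc hx)).of_le le_top).congr_of_eventuallyEq ?_)
  filter_upwards [Θ.open_target.mem_nhds (Θ.map_source hx)] with Z hZ using h.bilinIn_fieldG hg₀ hZ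

omit hg₀ in
lemma contMDiffAt_J : ContMDiffAt 𝓘(ℝ, E') (𝓘(ℝ, E').prod 𝓘(ℝ, E' →L[ℝ] E')) ∞
    (fun x => (⟨x, complexStructure E' M x⟩ : Bundle.TotalSpace (E' →L[ℝ] E')
      (fun x : M => TangentSpace 𝓘(ℝ, E') x →L[ℝ] TangentSpace 𝓘(ℝ, E') x))) x := by
  refine (IsChart.contMDiffAt_endo_iff (E := E') (𝕜 := ℝ) (A := complexStructure E' M) h.isChart.real hx).2 ((contDiffAt_const
    (c := (Complex.I • ContinuousLinearMap.id ℂ (StdComplexification E)).restrictScalars ℝ)).congr_of_eventuallyEq ?_)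
  filter_upwards [Θ.open_target.mem_nhds (Θ.map_source hx)] with Z hZ
  refine ContinuousLinearMap.ext fun u => ?_
  refine (h.isChart.dT_smul_I (Θ.map_target hZ) (dS ℝ E' Θ Z u)).trans ?_
  rw [h.isChart.real.dT_dS hZ]
  rfl

lemma contMDiffAt_fieldK : ContMDiffAt 𝓘(ℝ, E') (𝓘(ℝ, E').prod 𝓘(ℝ, E' →L[ℝ] E')) ∞
    (fun x => (⟨x, fieldK (E' := E') g₀ q₁ q₂ om H x⟩ : Bundle.TotalSpace (E' →L[ℝ] E')
      (fun x : M => TangentSpace 𝓘(ℝ, E') x →L[ℝ] TangentSpace 𝓘(ℝ, E') x))) x := by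
  have h1 := ((h.contDiffAt_modelI hg₀ (h.mem_polydisc hx)).of_le (m := ∞) le_top).clm_comp
    (contDiffAt_const (c := (Complex.I •
      ContinuousLinearMap.id ℂ (StdComplexification E)).restrictScalars ℝ))
  refine (IsChart.contMDiffAt_endo_iff (E := E') (𝕜 := ℝ) (A := fieldK g₀ q₁ q₂ om H) h.isChart.real hx).2 (h1.congr_of_eventuallyEq ?_)
  filter_upwards [Θ.open_target.mem_nhds (Θ.map_source hx)] with Z hZ
  refine ContinuousLinearMap.ext fun u => ?_
  have h2 := h.isChart.dS_smul_I hZ u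
  have h3 := congrArg (fun L : StdComplexification E →L[ℝ] StdComplexification E =>
    L (Complex.I • u)) (h.endoIn_fieldI hg₀ hZ)
  refine Eq.trans ?_ h3
  exact congrArg (fun w => dT ℝ E' Θ (Θ.symm Z) (fieldI g₀ q₁ q₂ om H (Θ.symm Z) w)) h2.symm

end

end IsLocalModel

end LocalModel

end BiquaternionicExtension
end

open scoped Manifold ContDiff
noncomputable section
namespace BiquaternionicExtension

/-! ### Existence of the canonical structures -/

section Existence

open Filter Topology Metric

variable {E : Type*} [NormedAddCommGroup E] [NormedSpace ℂ E] [FiniteDimensional ℂ E]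
  {N : Type*} [TopologicalSpace N] [ChartedSpace E N] [IsManifold 𝓘(ℂ, E) ω N]
  {E' : Type*} [NormedAddCommGroup E'] [NormedSpace ℂ E'] [FiniteDimensional ℂ E']
  {M : Type*} [TopologicalSpace M] [ChartedSpace E' M] [IsManifold 𝓘(ℂ, E') ω M]
  {f : N → M} {g₀ : AnalyticMetric E N} {q₁ q₂ : M → N} {om : CBilinField E' M}
  {H : CEndoField E' M} {U : Set M}

/-- The bi-Lagrangian connection. -/
lemma exists_connection (hg₀ : IsKahler g₀) (hU : ∀ x ∈ U, ∃ p Θ ρ omt,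
      IsLocalModel (E' := E') f g₀ q₁ q₂ om H p Θ ρ omt ∧ x ∈ Θ.source) :
    ∃ cov : ConnectionOp E' M,
      IsLeviCivitaOn cov (fun x (u v : E') => om x (paraStructure H x u) v) U ∧
      IsParallelBilinAlong cov (fun x (u v : E') => fieldG g₀ q₁ q₂ om H x u v)
        (fibreDistribution E E' q₁) U ∧
      IsParallelEndoAlong cov (fieldI g₀ q₁ q₂ om H) (fibreDistribution E E' q₁) U ∧
      IsParallelEndoAlong cov (complexStructure E' M) (fibreDistribution E E' q₁) U ∧
      IsParallelEndoAlong cov (fieldK g₀ q₁ q₂ om H) (fibreDistribution E E' q₁) U := by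
  haveI : CompleteSpace E' := FiniteDimensional.complete ℂ E'
  haveI : CompleteSpace (StdComplexification E) := FiniteDimensional.complete ℂ _
  -- Local model and Christoffel symbol are chosen separately at each point. All requirements on the
  -- connection are pointwise, so no compatibility between the choices is needed; off `U` the value
  -- is `0`.
  have h1 : ∀ x : M, ∃ c : (M → E') → E' →L[ℝ] E', x ∈ U → ∃ p Θ ρ omt Γ,
      IsLocalModel (E' := E') f g₀ q₁ q₂ om H p Θ ρ omt ∧ x ∈ Θ.source ∧
      (∀ u v, IsKoszul (omt (Θ x)) (fderiv ℂ omt (Θ x)) u v (Γ u v)) ∧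
      c = fun Y => chartCov Θ Γ Y x := by
    intro x
    by_cases hx : x ∈ U
    · obtain ⟨p, Θ, ρ, omt, h, hxs⟩ := hU x hx
      obtain ⟨Γ, hΓ⟩ := (h.isJet hg₀ (h.mem_polydisc hxs)).exists_koszul
      exact ⟨_, fun _ => ⟨p, Θ, ρ, omt, Γ, h, hxs, hΓ, rfl⟩⟩
    · exact ⟨0, fun h => absurd h hx⟩
  choose c hc using h1
  refine ⟨fun Y x => c x Y, ⟨⟨?_, ?_⟩, ?_, ?_⟩, ?_, ?_, ?_, ?_⟩
  · intro Y Y' x hY hY' hx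
    obtain ⟨p, Θ, ρ, omt, Γ, h, hxs, hΓ, hcx⟩ := hc x hx
    have hr := h.isChart.real
    simp only [hcx]
    exact hr.chartCov_add hxs ((hr.vdiffAt_iff hxs).1 hY) ((hr.vdiffAt_iff hxs).1 hY')
  · intro Y φ x hY hφ hx
    obtain ⟨p, Θ, ρ, omt, Γ, h, hxs, hΓ, hcx⟩ := hc x hx
    have hr := h.isChart.real
    simp only [hcx]
    exact ContinuousLinearMap.ext fun u =>
      hr.chartCov_leibniz hxs ((hr.vdiffAt_iff hxs).1 hY) hφ u
  · intro x hx X Y hX hY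
    obtain ⟨p, Θ, ρ, omt, Γ, h, hxs, hΓ, hcx⟩ := hc x hx
    have hr := h.isChart.real
    simp only [hcx]
    exact hr.chartCov_torsionFree hxs hX hY
      ((h.isJet hg₀ (h.mem_polydisc hxs)).christoffel_symm hΓ)
  · intro x hx u _ Y Z hY hZ
    obtain ⟨p, Θ, ρ, omt, Γ, h, hxs, hΓ, hcx⟩ := hc x hx
    have hr := h.isChart.real
    simp only [hcx]
    exact h.chartCov_metric hg₀ hxs hΓ ((hr.vdiffAt_iff hxs).1 hY) ((hr.vdiffAt_iff hxs).1 hZ) u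
  · intro x hx u hu Y Z hY hZ
    obtain ⟨p, Θ, ρ, omt, Γ, h, hxs, hΓ, hcx⟩ := hc x hx
    have hr := h.isChart.real
    simp only [hcx]
    exact h.chartCov_fieldG hg₀ hxs hΓ ((hr.vdiffAt_iff hxs).1 hY) ((hr.vdiffAt_iff hxs).1 hZ) hu
  · intro x hx u hu Y hY
    obtain ⟨p, Θ, ρ, omt, Γ, h, hxs, hΓ, hcx⟩ := hc x hx
    have hr := h.isChart.real
    simp only [hcx]
    exact h.chartCov_fieldI hg₀ hxs hΓ ((hr.vdiffAt_iff hxs).1 hY) hu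
  · intro x hx u hu Y hY
    obtain ⟨p, Θ, ρ, omt, Γ, h, hxs, hΓ, hcx⟩ := hc x hx
    have hr := h.isChart.real
    simp only [hcx]
    exact (h.chartCov_J hxs ((hr.vdiffAt_iff hxs).1 hY) u).2
  · intro x hx u hu Y hY
    obtain ⟨p, Θ, ρ, omt, Γ, h, hxs, hΓ, hcx⟩ := hc x hx
    have hr := h.isChart.real
    simp only [hcx]
    exact h.chartCov_fieldK hg₀ hxs hΓ ((hr.vdiffAt_iff hxs).1 hY) hu

/-- The hyperhermitian structure is an admissible extension. -/
lemma isAdmissibleExtension (hg₀ : IsKahler g₀) (hf : IsComplexification E E' f)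
    (hgerm : ∀ p, IsGermAt (E' := E') f g₀ q₁ q₂ om H p)
    (hU : ∀ x ∈ U, ∃ p Θ ρ omt,
      IsLocalModel (E' := E') f g₀ q₁ q₂ om H p Θ ρ omt ∧ x ∈ Θ.source) :
    IsAdmissibleExtension f g₀ om (fieldG g₀ q₁ q₂ om H) (fieldI g₀ q₁ q₂ om H)
      (complexStructure E' M) (fieldK g₀ q₁ q₂ om H) U := by
  have hp : ∀ p, ∃ Θ ρ omt, IsLocalModel (E' := E') f g₀ q₁ q₂ om H p Θ ρ omt ∧ f p ∈ Θ.source :=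
    fun p => by
      obtain ⟨Θ, ρ, omt, h1, h2, -⟩ := (hgerm p).exists_localModel hf univ_mem
      exact ⟨Θ, ρ, omt, h1, h2⟩
  have hI : ∀ (p : N) (u : E), fieldI g₀ q₁ q₂ om H (f p) (rdAt E E' f p u) =
      rdAt E E' f p (Complex.I • u) := fun p u => by
    obtain ⟨Θ, ρ, omt, h1, h2⟩ := hp p
    exact h1.fieldI_extends hg₀ hf h2 u
  have hG : ∀ (p : N) (u v : E), fieldG g₀ q₁ q₂ om H (f p) (rdAt E E' f p u) (rdAt E E' f p v) =
      innerAt g₀ p u v := fun p u v => by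
    obtain ⟨Θ, ρ, omt, h1, h2⟩ := hp p
    exact h1.fieldG_extends hg₀ hf h2 u v
  have hpt : ∀ x ∈ U, IsHermitianPair (T := E') (paraStructure H x)
    (baseForm g₀ q₁ x) (baseForm g₀ q₁ x + baseForm g₀ q₂ x) ∧
    IsBiLagrangian.IsHyperI (T := E') (om x) (paraStructure H x)
    (baseForm g₀ q₁ x) (fieldI g₀ q₁ q₂ om H x) := fun x hx => by
    obtain ⟨p, Θ, ρ, omt, h, hxs⟩ := hU x hx
    exact ⟨h.isHermitianPair hxs hg₀, h.isHyperI hxs hg₀⟩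
  have hoI : IsOrthogonalOn (fieldG g₀ q₁ q₂ om H) (fieldI g₀ q₁ q₂ om H) U :=
    fun x hx (u v : E') => (hpt x hx).2.form_I u v
  have hoJ : IsOrthogonalOn (fieldG g₀ q₁ q₂ om H) (complexStructure E' M) U :=
    fun x hx (u v : E') => (hpt x hx).2.form_J (hpt x hx).1.B_I u v
  refine ⟨⟨⟨fun x hx => ?_, fun x hx (u v : E') => ?_, fun x hx (u : E') hu =>
    (hpt x hx).2.form_pos hu⟩, ⟨fun x hx => ?_, fun x hx => ?_, fun x hx => ?_⟩,
    ⟨fun x hx => (hpt x hx).2.sq, fun x hx => I_smul_I_smul (V := E'),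
      fun x hx => (hpt x hx).2.K_sq⟩, fun x hx (u : E') => ⟨rfl, ?_⟩,
    ⟨hoI, hoJ, fun x hx u v => (hoI x hx _ _).trans (hoJ x hx u v)⟩⟩, fun x hx => rfl, hG, hI,
    fun p u v => ?_, fun x hx => (hpt x hx).2.complexification⟩
  · obtain ⟨p, Θ, ρ, omt, h, hxs⟩ := hU x hx
    exact (h.contMDiffAt_fieldG hg₀ hxs).contMDiffWithinAt
  · exact congrArg₂ (· + ·) ((hpt x hx).1.B_symm u v) ((hpt x hx).1.B_symm _ _)
  · obtain ⟨p, Θ, ρ, omt, h, hxs⟩ := hU x hx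
    exact (h.contMDiffAt_fieldI hg₀ hxs).contMDiffWithinAt
  · obtain ⟨p, Θ, ρ, omt, h, hxs⟩ := hU x hx
    exact (h.contMDiffAt_J hxs).contMDiffWithinAt
  · obtain ⟨p, Θ, ρ, omt, h, hxs⟩ := hU x hx
    exact (h.contMDiffAt_fieldK hg₀ hxs).contMDiffWithinAt
  · have h1 : fieldI g₀ q₁ q₂ om H x (Complex.I • u) = -(Complex.I • fieldI g₀ q₁ q₂ om H x u) :=
      (hpt x hx).2.smul_I u
    exact h1.symm
  · refine (congrArg (fun w : E' => fieldG g₀ q₁ q₂ om H (f p) w (rdAt E E' f p v)) (hI p u)).trans ?_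
    exact hG p _ v

set_option synthInstance.maxHeartbeats 200000 in
/-- Existence of the canonical structures. -/
theorem exists_canonicalPackage [T2Space M] [SecondCountableTopology M] [Nonempty N]
    (hg₀ : IsKahler g₀) (hf : IsComplexification E E' f) :
    ∃ U : Set M, IsOpen U ∧ Set.range f ⊆ U ∧ Nonempty (CanonicalPackage E' f g₀ U) := by
  obtain ⟨q₁, q₂, om, H, hgerm⟩ := exists_forall_isGermAt hf g₀
  -- `S` collects the points at which the regularity and antiholomorphy clauses hold. It is a
  -- neighbourhood of each point of `N`.
  let S : Set M := {x | ContMDiffAt 𝓘(ℂ, E') 𝓘(ℂ, E) ω q₁ x ∧ ContMDiffAt 𝓘(ℝ, E') 𝓘(ℝ, E) ω q₂ x ∧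
    (∀ u : TangentSpace 𝓘(ℝ, E') x, rd (E := E') (E' := E) q₂ x (complexStructure E' M x u) =
      - complexStructure E N (q₂ x) (rd (E := E') (E' := E) q₂ x u)) ∧
    ContMDiffAt 𝓘(ℂ, E') (𝓘(ℂ, E').prod 𝓘(ℂ, E' →L[ℂ] E' →L[ℂ] ℂ)) ω
      (fun x => (⟨x, om x⟩ : Bundle.TotalSpace (E' →L[ℂ] E' →L[ℂ] ℂ)
        (fun x : M => TangentSpace 𝓘(ℂ, E') x →L[ℂ] TangentSpace 𝓘(ℂ, E') x →L[ℂ] ℂ))) x ∧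
    ContMDiffAt 𝓘(ℂ, E') (𝓘(ℂ, E').prod 𝓘(ℂ, E' →L[ℂ] E')) ω
      (fun x => (⟨x, H x⟩ : Bundle.TotalSpace (E' →L[ℂ] E')
        (fun x : M => TangentSpace 𝓘(ℂ, E') x →L[ℂ] TangentSpace 𝓘(ℂ, E') x))) x}
  have hS : ∀ p, S ∈ 𝓝 (f p) := fun p => by
    filter_upwards [(contMDiffAt_iff_contMDiffAt_nhds (by simp)).1 (hgerm p).q₁_smooth,
      (contMDiffAt_iff_contMDiffAt_nhds (by simp)).1 (hgerm p).q₂_smooth, (hgerm p).q₂_anti,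
      (contMDiffAt_iff_contMDiffAt_nhds (by simp)).1 (hgerm p).om_smooth,
      (contMDiffAt_iff_contMDiffAt_nhds (by simp)).1 (hgerm p).H_smooth] with x h1 h2 h3 h4 h5
    exact ⟨h1, h2, h3, h4, h5⟩
  -- Requiring the whole chart domain to lie in `S` makes `U` open, and every point of `U` comes
  -- with a local model.
  let U : Set M := {x | x ∈ S ∧ ∃ p Θ ρ omt,
      IsLocalModel (E' := E') f g₀ q₁ q₂ om H p Θ ρ omt ∧ x ∈ Θ.source ∧ Θ.source ⊆ S}
  have hUo : IsOpen U := isOpen_iff_mem_nhds.2 fun x hx => by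
    obtain ⟨-, p, Θ, ρ, omt, h, hxs, hΘS⟩ := hx
    filter_upwards [Θ.open_source.mem_nhds hxs] with y hy
    exact ⟨hΘS hy, p, Θ, ρ, omt, h, hy, hΘS⟩
  have hfU : Set.range f ⊆ U := by
    rintro _ ⟨p, rfl⟩
    obtain ⟨Θ, ρ, omt, h1, h2, h3⟩ := (hgerm p).exists_localModel hf (hS p)
    exact ⟨h3 h2, p, Θ, ρ, omt, h1, h2, h3⟩
  have hU : ∀ x ∈ U, ∃ p Θ ρ omt,
      IsLocalModel (E' := E') f g₀ q₁ q₂ om H p Θ ρ omt ∧ x ∈ Θ.source := fun x hx => by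
    obtain ⟨-, p, Θ, ρ, omt, h, hxs, -⟩ := hx
    exact ⟨p, Θ, ρ, omt, h, hxs⟩
  have hbl : ∀ x ∈ U, IsBiLagrangian (T := E') (om x) (paraStructure H x) := fun x hx => by
    obtain ⟨p, Θ, ρ, omt, h, hxs⟩ := hU x hx
    exact h.isBiLagrangian hxs hg₀
  have hF₁ : ∀ x ∈ U, ∀ u ∈ fibreDistribution E E' q₁ x, paraStructure H x u = u :=
    fun x hx u hu => by
      obtain ⟨p, Θ, ρ, omt, h, hxs⟩ := hU x hx
      exact h.paraStructure_fibre₁ hxs hu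
  have hF₂ : ∀ x ∈ U, ∀ u : E', u ∈ fibreDistribution E E' q₂ x → paraStructure H x u = -u :=
    fun x hx u hu => by
      obtain ⟨p, Θ, ρ, omt, h, hxs⟩ := hU x hx
      exact h.paraStructure_fibre₂ hxs hu
  obtain ⟨cov, hLC, hg, hI, hJ, hK⟩ := exists_connection (E' := E') (f := f) hg₀ hU
  refine ⟨U, hUo, hfU, Nonempty.intro ?_⟩
  exact
    { q₁ := q₁
      q₂ := q₂
      om := om
      F := paraStructure H
      canonical :=
        { holomorphic := fun x hx => hx.1.1.contMDiffWithinAt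
          analytic := fun x hx => hx.1.2.1.contMDiffWithinAt
          antiholomorphic := fun x hx => hx.1.2.2.1
          retract₁ := fun p => (hgerm p).retract₁.self_of_nhds
          retract₂ := fun p => (hgerm p).retract₂.self_of_nhds
          transverse := fun x hx => by
            obtain ⟨p, Θ, ρ, omt, h, hxs⟩ := hU x hx
            exact h.transverse hxs }
      extension :=
        { holomorphic := fun x hx => hx.1.2.2.2.1.contMDiffWithinAt
          extends_ := fun p => (hgerm p).om_extends.self_of_nhds }
      alternating := fun x hx => (hbl x hx).alt
      nondegenerate := fun x hx => (hbl x hx).nondeg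
      closed := fun x hx X Y Z hX hY hZ => by
        obtain ⟨p, Θ, ρ, omt, h, hxs⟩ := hU x hx
        exact h.closed hxs hg₀ hX hY hZ
      isotropic₁ := fun x hx u hu v hv => (hbl x hx).isotropic_plus (hF₁ x hx u hu) (hF₁ x hx v hv)
      isotropic₂ := fun x hx u hu v hv =>
        (hbl x hx).isotropic_minus (hF₂ x hx u hu) (hF₂ x hx v hv)
      F_eigen₁ := hF₁
      F_eigen₂ := hF₂
      cov := cov
      H := H
      g := fieldG g₀ q₁ q₂ om H
      I := fieldI g₀ q₁ q₂ om H
      J := complexStructure E' M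
      K := fieldK g₀ q₁ q₂ om H
      cov_leviCivita := hLC
      H_extension :=
        { holomorphic := fun x hx => hx.1.2.2.2.2.contMDiffWithinAt
          extends_ := fun p => (hgerm p).H_extends.self_of_nhds }
      admissible := isAdmissibleExtension hg₀ hf hgerm hU
      g_parallel := hg
      I_parallel := hI
      J_parallel := hJ
      K_parallel := hK }

end Existence

end BiquaternionicExtension
end

open scoped Manifold ContDiff
noncomputable section
namespace BiquaternionicExtension

/-! ### Tensors which are parallel along the first foliation -/

/-- The classical Koszul argument: metric compatibility for three permutations of the vectors,
combined using symmetry of the connection and of the metric. -/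
lemma IsJet.isKoszul_of_parallel {A C : Type*} [NormedAddCommGroup A] [NormedSpace ℂ A]
    [NormedAddCommGroup C] [NormedSpace ℂ C] {o : A × C →L[ℂ] A × C →L[ℂ] ℂ}
    {D : A × C →L[ℂ] A × C →L[ℂ] A × C →L[ℂ] ℂ} (h : IsJet o D) {c : A × C → A × C → A × C}
    (hc : ∀ u v, c u v = c v u)
    (hD : ∀ u v w, D u (stdF A C v) w = o (stdF A C (c u v)) w + o (stdF A C v) (c u w))
    (u v : A × C) : IsKoszul o D u v (c u v) := fun w => by
  have hm : ∀ u v, o (stdF A C u) v = o (stdF A C v) u := fun u v => by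
    rw [h.o_stdF, h.skew, neg_neg]
  rw [hD, hD, hD, hc v u, hc w u, hc w v, hm v (c u w), hm u (c v w), hm (c u w) v]
  ring

section LocalModel

open Filter Topology Metric

variable {E : Type*} [NormedAddCommGroup E] [NormedSpace ℂ E] [FiniteDimensional ℂ E]
  {N : Type*} [TopologicalSpace N] [ChartedSpace E N] [IsManifold 𝓘(ℂ, E) ω N]
  {E' : Type*} [NormedAddCommGroup E'] [NormedSpace ℂ E'] [FiniteDimensional ℂ E']
  {M : Type*} [TopologicalSpace M] [ChartedSpace E' M] [IsManifold 𝓘(ℂ, E') ω M]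

/-- A function whose derivative vanishes along the vertical leaves of a polydisc is determined by
its values at the real points. -/
lemma eq_realIncl_of_fderiv_eq_zero {W : Type*} [NormedAddCommGroup W] [NormedSpace ℝ W] {a : E}
    {ρ : ℝ} {φ : StdComplexification E → W} (hd : ∀ Z ∈ polydisc a ρ, DifferentiableAt ℝ φ Z)
    (h0 : ∀ Z ∈ polydisc a ρ, ∀ u : StdComplexification E, u.1 = 0 → fderiv ℝ φ Z u = 0)
    {Z : StdComplexification E} (hZ : Z ∈ polydisc a ρ) : φ Z = φ (realIncl E Z.1) := by
  have h1 : ∀ w ∈ ball a ρ, HasFDerivWithinAt (fun w : E => φ (Z.1, conjEquiv E w))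
      (0 : E →L[ℝ] W) (ball a ρ) w := fun w hw => by
    have hm : ((Z.1, conjEquiv E w) : StdComplexification E) ∈ polydisc a ρ :=
      ⟨hZ.1, by simpa using hw⟩
    have h2 : HasFDerivAt (fun w : E => ((Z.1, conjEquiv E w) : StdComplexification E))
        ((0 : E →L[ℝ] E).prod (conjEquiv E : E →L[ℝ] ConjModel E)) w :=
      (hasFDerivAt_const Z.1 w).prodMk (conjEquiv E : E →L[ℝ] ConjModel E).hasFDerivAt
    have h3 := (hd _ hm).hasFDerivAt.comp w h2
    have h4 : (fderiv ℝ φ (Z.1, conjEquiv E w)).comp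
        ((0 : E →L[ℝ] E).prod (conjEquiv E : E →L[ℝ] ConjModel E)) = 0 :=
      ContinuousLinearMap.ext fun u => h0 _ hm _ rfl
    rw [h4] at h3
    exact h3.hasFDerivWithinAt
  have h5 := (convex_ball a ρ).is_const_of_fderivWithin_eq_zero (𝕜 := ℝ)
    (fun w hw => (h1 w hw).differentiableWithinAt)
    (fun w hw => (h1 w hw).fderivWithin (isOpen_ball.uniqueDiffWithinAt hw)) hZ.2 hZ.1
  simpa [realIncl_apply] using h5

namespace IsLocalModel

variable {f : N → M} {g₀ : AnalyticMetric E N} {q₁ q₂ : M → N}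
  {om : CBilinField E' M} {H : CEndoField E' M} {p : N}
  {Θ : OpenPartialHomeomorph M (StdComplexification E)} {ρ : ℝ}
  {omt : StdComplexification E → StdComplexification E →L[ℂ] StdComplexification E →L[ℂ] ℂ}
  (h : IsLocalModel f g₀ q₁ q₂ om H p Θ ρ omt) (hg₀ : IsKahler g₀)
  {U : Set M} (hU : Θ.source ⊆ U) {cov : ConnectionOp E' M}
  {B : ∀ x : M, TangentSpace 𝓘(ℝ, E') x → TangentSpace 𝓘(ℝ, E') x → ℂ}
  (hB : ∀ x ∈ Θ.source, ∀ u v : E', B x u v = om x (paraStructure H x u) v)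
  (hLC : IsLeviCivitaOn cov B U)
include h

include hB in
omit [FiniteDimensional ℂ E'] [IsManifold 𝓘(ℂ, E') ω M] in
lemma biLagrangianMetric_eq {x : M} (hx : x ∈ Θ.source) (u v : E') : B x u v =
    omt (Θ x) (stdFR E (dT ℝ E' Θ x u)) (dT ℝ E' Θ x v) := by
  rw [hB x hx, h.om_real hx, bilinR_apply, h.isChart.dT_real hx, h.isChart.dT_real hx,
    h.dT_paraStructure hx, h.isChart.dT_real hx]

include hg₀ hU hB hLC

/-- An arbitrary Levi-Civita connection is symmetric and metric on the commuting coordinate fields,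
which is enough to pin it down there. -/
lemma isKoszul_coordField {x : M} (hx : x ∈ Θ.source) (u v : StdComplexification E) :
    IsKoszul (omt (Θ x)) (fderiv ℂ omt (Θ x)) u v
      (dT ℝ E' Θ x (cov (coordField Θ v) x (coordField Θ u x))) := by
  haveI : CompleteSpace E' := FiniteDimensional.complete ℂ E'
  haveI : CompleteSpace (StdComplexification E) := FiniteDimensional.complete ℂ _
  have hr := h.isChart.real
  have hd := fun V => hr.vdiffAt_coordField V hx
  obtain ⟨h0, hD⟩ := fderiv_bilinR (h.analytic _ (h.mem_polydisc hx)).differentiableAt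
  have hBt := fun y hy => h.biLagrangianMetric_eq hB (x := y) hy
  have hcx : ∀ V, dT ℝ E' Θ x (coordField Θ V x) = V := fun V => hr.dT_dS' hx V
  refine (h.isJet hg₀ (h.mem_polydisc hx)).isKoszul_of_parallel
    (c := fun u v => dT ℝ E' Θ x (cov (coordField Θ v) x (coordField Θ u x)))
    (fun u v => ?_) (fun u v w => ?_) u v
  · have h1 := (hLC.torsionFree x (hU hx) _ _ (hd u) (hd v)).trans
      (hr.mlieBracket_coordField u v hx)
    exact congrArg (dT ℝ E' Θ x) (sub_eq_zero.1 h1)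
  · have h1 := hLC.parallel x (hU hx) (coordField Θ u x) trivial _ _ (hd v) (hd w)
    have h2 : HasFDerivAt (fun Z => bilinR _ (omt Z) (stdFR E v) w) _ (Θ x) :=
      (h0.hasFDerivAt.clm_apply (hasFDerivAt_const (stdFR E v) (Θ x))).clm_apply
        (hasFDerivAt_const w (Θ x))
    have h3 := hr.mvfderiv_of_eqOn (φ := fun y => B y (coordField Θ v y) (coordField Θ w y))
      (φt := fun Z => bilinR _ (omt Z) (stdFR E v) w) hx (by
        filter_upwards [Θ.open_source.mem_nhds hx] with y hy
        refine (hBt y hy _ _).trans ?_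
        have hcy : ∀ V, dT ℝ E' Θ y (coordField Θ V y) = V := fun V => hr.dT_dS' hy V
        exact congrArg₂ (fun a b => omt (Θ y) (stdFR E a) b) (hcy v) (hcy w))
      h2.differentiableAt (coordField Θ u x)
    rw [h2.fderiv] at h3
    have h4 := h3.symm.trans (h1.trans (congrArg₂ (· + ·) (hBt x hx _ _) (hBt x hx _ _)))
    have h5 := hD u (stdFR E v) w
    rw [hcx u, hcx v, hcx w] at h4
    simp only [ContinuousLinearMap.comp_apply, add_apply, ContinuousLinearMap.flip_apply,
      zero_apply, map_zero, zero_add, h5] at h4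
    exact h4

lemma cov_coordField {x : M} (hx : x ∈ Θ.source) {u v : StdComplexification E} (hu : u.1 = 0)
    (hv : v.2 = 0) : cov (coordField Θ v) x (coordField Θ u x) = 0 := by
  refine h.isChart.real.injective_dT hx (((h.isJet hg₀ (h.mem_polydisc hx)).koszul_zero hu hv
    (h.isKoszul_coordField hg₀ hU hB hLC hx u v)).trans (map_zero (dT ℝ E' Θ x)).symm)

omit hU hB hLC hg₀ in
lemma coordField_mem_fibre {x : M} (hx : x ∈ Θ.source) {u : StdComplexification E}
    (hu : u.1 = 0) : coordField Θ u x ∈ fibreDistribution E E' q₁ x := by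
  refine (h.mem_fibre₁ hx _).2 ?_
  have h1 : dT ℝ E' Θ x (coordField Θ u x) = u := h.isChart.real.dT_dS' hx u
  exact (congrArg Prod.fst ((h.isChart.dT_real hx _).symm.trans h1)).trans hu

/-- A parallel metric is constant along the vertical leaves, on horizontal vectors. -/
lemma bilinIn_eq_of_parallel {g : BilinField E' M} (hg : IsSmoothBilinOn g U) (hUo : IsOpen U)
    (hpar : IsParallelBilinAlong cov (fun x u v => g x u v) (fibreDistribution E E' q₁) U)
    {Z : StdComplexification E} (hZ : Z ∈ polydisc (chartAt E p p) ρ) {v w : StdComplexification E}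
    (hv : v.2 = 0) (hw : w.2 = 0) :
    bilinIn ℝ E' Θ g Z v w = bilinIn ℝ E' Θ g (realIncl E Z.1) v w := by
  have hr := h.isChart.real
  have hd : ∀ x ∈ Θ.source, DifferentiableAt ℝ (fun Z => bilinIn ℝ E' Θ g Z v w) (Θ x) :=
    fun x hx => ((((hr.contMDiffAt_bilin_iff hx).1 (hg.contMDiffAt (hUo.mem_nhds (hU hx)))).differentiableAt
      (by simp)).clm_apply (differentiableAt_const v)).clm_apply (differentiableAt_const w)
  have hsource : ∀ Z ∈ polydisc (chartAt E p p) ρ, ∃ x ∈ Θ.source, Θ x = Z := fun Z hZ => by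
    rw [← h.adapted.target_eq] at hZ
    exact ⟨Θ.symm Z, Θ.map_target hZ, Θ.right_inv hZ⟩
  refine eq_realIncl_of_fderiv_eq_zero (φ := fun Z => bilinIn ℝ E' Θ g Z v w)
    (fun Z hZ => ?_) (fun Z hZ u hu => ?_) hZ
  · obtain ⟨x, hx, rfl⟩ := hsource Z hZ
    exact hd x hx
  · obtain ⟨x, hx, rfl⟩ := hsource Z hZ
    have h1 := hpar x (hU hx) _ (h.coordField_mem_fibre hx hu) _ _ (hr.vdiffAt_coordField v hx)
      (hr.vdiffAt_coordField w hx)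
    have h2 := hr.mvfderiv_of_eqOn (φ := fun y => g y (coordField Θ v y) (coordField Θ w y))
      (φt := fun Z => bilinIn ℝ E' Θ g Z v w) hx (by
        filter_upwards [Θ.open_source.mem_nhds hx] with y hy
        have h3 := hr.bilinIn_dT hy g (coordField Θ v y) (coordField Θ w y)
        have hcy : ∀ V, dT ℝ E' Θ y (coordField Θ V y) = V := fun V => hr.dT_dS' hy V
        rw [hcy, hcy] at h3
        exact h3.symm) (hd x hx) (coordField Θ u x)
    have hcx : dT ℝ E' Θ x (coordField Θ u x) = u := hr.dT_dS' hx u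
    rw [hcx] at h2
    refine h2.symm.trans (h1.trans ?_)
    have e1 := h.cov_coordField hg₀ hU hB hLC hx hu hv
    have e2 := h.cov_coordField hg₀ hU hB hLC hx hu hw
    have e3 : ∀ a b : E', a = 0 → b = 0 → g x a (coordField Θ w x) + g x (coordField Θ v x) b =
        (0 : ℝ) := by
      rintro a b rfl rfl
      refine (congrArg₂ (· + ·) ?_ (map_zero (g x (coordField Θ v x)))).trans (add_zero _)
      exact congrArg (fun L : E' →L[ℝ] ℝ => L (coordField Θ w x)) (map_zero (g x))
    exact e3 _ _ e1 e2

/-- The bi-Lagrangian metric of the images of horizontal vectors by a parallel endomorphism field is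
constant along the vertical leaves. -/
lemma endoIn_eq_of_parallel {A : EndoField E' M} (hA : IsSmoothEndoOn A U) (hUo : IsOpen U)
    (hpar : IsParallelEndoAlong cov A (fibreDistribution E E' q₁) U)
    {Z : StdComplexification E} (hZ : Z ∈ polydisc (chartAt E p p) ρ) {v w : StdComplexification E}
    (hv : v.2 = 0) (hw : w.2 = 0) :
    omt Z (stdFR E (endoIn ℝ E' Θ A Z v)) (endoIn ℝ E' Θ A Z w) =
      omt (realIncl E Z.1) (stdFR E (endoIn ℝ E' Θ A (realIncl E Z.1) v))
        (endoIn ℝ E' Θ A (realIncl E Z.1) w) := by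
  have hr := h.isChart.real
  have hdA : ∀ x ∈ Θ.source, DifferentiableAt ℝ (endoIn ℝ E' Θ A) (Θ x) := fun x hx =>
    ((hr.contMDiffAt_endo_iff hx).1 (hA.contMDiffAt (hUo.mem_nhds (hU hx)))).differentiableAt
      (by simp)
  have hd : ∀ x ∈ Θ.source, DifferentiableAt ℝ (fun Z => bilinR _ (omt Z)
      (stdFR E (endoIn ℝ E' Θ A Z v)) (endoIn ℝ E' Θ A Z w)) (Θ x) := fun x hx =>
    ((fderiv_bilinR (h.analytic _ (h.mem_polydisc hx)).differentiableAt).1.clm_apply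
      ((stdFR E).differentiableAt.comp (Θ x)
        ((hdA x hx).clm_apply (differentiableAt_const v)))).clm_apply
      ((hdA x hx).clm_apply (differentiableAt_const w))
  have hsource : ∀ Z ∈ polydisc (chartAt E p p) ρ, ∃ x ∈ Θ.source, Θ x = Z := fun Z hZ => by
    rw [← h.adapted.target_eq] at hZ
    exact ⟨Θ.symm Z, Θ.map_target hZ, Θ.right_inv hZ⟩
  have hAe : ∀ y ∈ Θ.source, ∀ V, dT ℝ E' Θ y (A y (coordField Θ V y)) =
      endoIn ℝ E' Θ A (Θ y) V := fun y hy V => by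
    have h1 := hr.endoIn_dT hy A (coordField Θ V y)
    have h2 : dT ℝ E' Θ y (coordField Θ V y) = V := hr.dT_dS' hy V
    rw [h2] at h1
    exact h1.symm
  have hvd : ∀ x ∈ Θ.source, ∀ V, VDiffAt (fun y => A y (coordField Θ V y)) x := fun x hx V => by
    refine (hr.vdiffAt_iff hx).2 (((hdA x hx).clm_apply
      (differentiableAt_const V)).congr_of_eventuallyEq ?_)
    filter_upwards [Θ.open_target.mem_nhds (Θ.map_source hx)] with Z hZ
    refine (hAe _ (Θ.map_target hZ) V).trans ?_
    rw [Θ.right_inv hZ]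
  refine eq_realIncl_of_fderiv_eq_zero (φ := fun Z => bilinR _ (omt Z)
      (stdFR E (endoIn ℝ E' Θ A Z v)) (endoIn ℝ E' Θ A Z w))
    (fun Z hZ => ?_) (fun Z hZ u hu => ?_) hZ
  · obtain ⟨x, hx, rfl⟩ := hsource Z hZ
    exact hd x hx
  · obtain ⟨x, hx, rfl⟩ := hsource Z hZ
    have hmem := h.coordField_mem_fibre hx hu
    have h1 := hLC.parallel x (hU hx) (coordField Θ u x) trivial _ _ (hvd x hx v) (hvd x hx w)
    have h2 := hr.mvfderiv_of_eqOn
      (φ := fun y => B y (A y (coordField Θ v y)) (A y (coordField Θ w y)))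
      (φt := fun Z => bilinR _ (omt Z) (stdFR E (endoIn ℝ E' Θ A Z v)) (endoIn ℝ E' Θ A Z w))
      hx (by
        filter_upwards [Θ.open_source.mem_nhds hx] with y hy
        refine (h.biLagrangianMetric_eq hB hy _ _).trans ?_
        exact congrArg₂ (fun a b => omt (Θ y) (stdFR E a) b) (hAe y hy v) (hAe y hy w))
      (hd x hx) (coordField Θ u x)
    have hcx : dT ℝ E' Θ x (coordField Θ u x) = u := hr.dT_dS' hx u
    rw [hcx] at h2
    refine h2.symm.trans (h1.trans ?_)
    -- `A` applied to a constant horizontal field is again parallel in vertical directions, so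
    -- metric compatibility makes the derivative vanish.
    have e0 : ∀ V : StdComplexification E, V.2 = 0 →
        cov (fun y => A y (coordField Θ V y)) x (coordField Θ u x) = 0 := fun V hV =>
      (hpar x (hU hx) _ hmem _ (hr.vdiffAt_coordField V hx)).trans
        ((congrArg (A x) (h.cov_coordField hg₀ hU hB hLC hx hu hV)).trans (map_zero (A x)))
    have e3 : ∀ a b a' b' : E', a = 0 → b = 0 → B x a a' + B x b' b = (0 : ℂ) := by
      rintro a b a' b' rfl rfl
      rw [h.biLagrangianMetric_eq hB hx, h.biLagrangianMetric_eq hB hx]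
      simp only [map_zero, zero_apply, add_zero]
    exact e3 _ _ _ _ (e0 v hv) (e0 w hw)

end IsLocalModel

end LocalModel

end BiquaternionicExtension
end

open scoped Manifold ContDiff
noncomputable section
namespace BiquaternionicExtension

/-! ### Uniqueness -/

section Uniqueness

open Filter Topology Metric

section

variable {T : Type*} [NormedAddCommGroup T] [NormedSpace ℂ T]
  {om : T →L[ℂ] T →L[ℂ] ℂ} {F : T →L[ℝ] T} {B : T →L[ℝ] T →L[ℝ] ℝ} {I : T →L[ℝ] T}

lemma IsBiLagrangian.IsHyperI.re_form (h : IsHyperI om F B I) (u v : T) : B (I u) v + B (I (I u)) (I v) = (om u v).re := by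
  rw [h.sq, map_neg, neg_apply, ← sub_eq_add_neg, h.re_om]

lemma IsBiLagrangian.IsHyperI.form_eq (h : IsHyperI om F B I) (u v : T) :
    B u v + B (I u) (I v) = -(om (I u) v).re := by
  rw [← h.re_form, h.sq, map_neg, map_neg, neg_apply, map_neg, neg_apply]
  ring

end

variable {E : Type*} [NormedAddCommGroup E] [NormedSpace ℂ E] [FiniteDimensional ℂ E]
  {N : Type*} [TopologicalSpace N] [ChartedSpace E N] [IsManifold 𝓘(ℂ, E) ω N]
  {E' : Type*} [NormedAddCommGroup E'] [NormedSpace ℂ E'] [FiniteDimensional ℂ E']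
  {M : Type*} [TopologicalSpace M] [ChartedSpace E' M] [IsManifold 𝓘(ℂ, E') ω M]
  {f : N → M} {g₀ : AnalyticMetric E N} {U : Set M}

namespace CanonicalPackage

variable (P : CanonicalPackage E' f g₀ U)

/-- The metric at `x`, as a form on the model space. -/
def gAt (x : M) : E' →L[ℝ] E' →L[ℝ] ℝ := P.g x

/-- The complex structure `I` at `x`, as an endomorphism of the model space. -/
def IAt (x : M) : E' →L[ℝ] E' := P.I x

section

variable {x : M} (hx : x ∈ U)
include hx

lemma IAt_sq (u : E') : P.IAt x (P.IAt x u) = -u := P.admissible.hyperHermitian.sq.1 x hx u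

lemma K_eq (u : E') : P.K x u = P.IAt x (Complex.I • u) := by
  have h1 := (P.admissible.hyperHermitian.product x hx u).1
  have h2 := congrArg (fun L : E' →L[ℝ] E' => P.IAt x (L u)) (P.admissible.J_eq x hx)
  exact h1.symm.trans h2

lemma IAt_smul_I (u : E') : P.IAt x (Complex.I • u) = -(Complex.I • P.IAt x u) := by
  have h1 := (P.admissible.hyperHermitian.product x hx u).2
  have h2 := congrArg (fun L : E' →L[ℝ] E' => -L (P.IAt x u)) (P.admissible.J_eq x hx)
  exact (P.K_eq hx u).symm.trans (h1.symm.trans h2)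

lemma gAt_IAt (u v : E') : P.gAt x (P.IAt x u) v = (P.om x u v).re := by
  have h1 := congrArg Complex.re (P.admissible.complexification x hx u v)
  refine Eq.trans ?_ h1
  change _ = ((P.gAt x (P.IAt x u) v : ℂ) - Complex.I * ((P.g x (P.K x u) v : ℝ) : ℂ)).re
  simp

lemma gAt_symm (u v : E') : P.gAt x u v = P.gAt x v u :=
  P.admissible.hyperHermitian.metric.symm x hx u v

lemma gAt_orthogonal (u v : E') : P.gAt x (P.IAt x u) (P.IAt x v) = P.gAt x u v :=
  P.admissible.hyperHermitian.orthogonal.1 x hx u v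

lemma gAt_definite (u : E') (hu : P.gAt x u u = 0) : u = 0 := by
  by_contra h0
  exact (P.admissible.hyperHermitian.metric.pos x hx u h0).ne' hu

lemma gAt_eq (u v : E') : P.gAt x u v = -(P.om x (P.IAt x u) v).re := by
  rw [← P.gAt_IAt hx, P.IAt_sq hx, map_neg, neg_apply, neg_neg]

end

variable (hUo : IsOpen U) (hfU : Set.range f ⊆ U)
include hUo hfU

omit [FiniteDimensional ℂ E] [FiniteDimensional ℂ E'] in
lemma isGermAt (p : N) : IsGermAt (E' := E') f g₀ P.q₁ P.q₂ P.om P.H p := by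
  have hU : U ∈ 𝓝 (f p) := hUo.mem_nhds (hfU ⟨p, rfl⟩)
  refine ⟨P.canonical.holomorphic.contMDiffAt hU, P.canonical.analytic.contMDiffAt hU, ?_,
    Eventually.of_forall P.canonical.retract₁, Eventually.of_forall P.canonical.retract₂,
    P.extension.holomorphic.contMDiffAt hU, P.H_extension.holomorphic.contMDiffAt hU,
    Eventually.of_forall P.extension.extends_, Eventually.of_forall P.H_extension.extends_⟩
  filter_upwards [hU] with x hx using P.canonical.antiholomorphic x hx

/-- The structures at the points of `N`. -/
lemma eq_at_range (hg₀ : IsKahler g₀) (hf : IsComplexification E E' f) (p : N) :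
    P.gAt (f p) = fieldG g₀ P.q₁ P.q₂ P.om P.H (f p) ∧
      P.IAt (f p) = fieldI g₀ P.q₁ P.q₂ P.om P.H (f p) := by
  obtain ⟨Θ, ρ, omt, h, hp, -⟩ := (P.isGermAt hUo hfU p).exists_localModel hf univ_mem
  have hx : f p ∈ U := hfU ⟨p, rfl⟩
  have hI := h.isHyperI hp hg₀
  have h1 : ∀ a : E, P.IAt (f p) (rdAt E E' f p a) =
      fieldI g₀ P.q₁ P.q₂ P.om P.H (f p) (rdAt E E' f p a) := fun a => by
    rw [h.fieldI_extends hg₀ hf hp]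
    exact P.admissible.I_extends p a
  have h2 : P.IAt (f p) = fieldI g₀ P.q₁ P.q₂ P.om P.H (f p) := by
    refine ContinuousLinearMap.ext fun u => ?_
    -- Along `N` the tangent space is `TN ⊕ J TN`. Both endomorphisms are antilinear, so agreement
    -- on `TN` is enough.
    obtain ⟨a, b, rfl⟩ : ∃ a b : E, u = rdAt E E' f p a + Complex.I • rdAt E E' f p b := by
      obtain ⟨_, ⟨a, rfl⟩, _, ⟨_, ⟨b, rfl⟩, rfl⟩, h3⟩ :=
        Submodule.mem_sup.1 ((hf.totallyReal p).sup_eq_top.ge (Submodule.mem_top (x := u)))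
      exact ⟨a, b, h3.symm⟩
    rw [map_add, map_add, P.IAt_smul_I hx, hI.smul_I, h1, h1]
  refine ⟨ContinuousLinearMap.ext fun u => ContinuousLinearMap.ext fun v => ?_, h2⟩
  exact (P.gAt_eq hx u v).trans ((congrArg (fun L : E' →L[ℝ] E' => -(P.om (f p) (L u) v).re)
    h2).trans (hI.form_eq u v).symm)

end CanonicalPackage

namespace IsLocalModel

variable {P : CanonicalPackage E' f g₀ U} {p : N}
  {Θ : OpenPartialHomeomorph M (StdComplexification E)} {ρ : ℝ}
  {omt : StdComplexification E → StdComplexification E →L[ℂ] StdComplexification E →L[ℂ] ℂ}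
  (h : IsLocalModel f g₀ P.q₁ P.q₂ P.om P.H p Θ ρ omt) (hU : Θ.source ⊆ U)
include h hU

lemma F_eq {x : M} (hx : x ∈ Θ.source) (u : E') : P.F x u = paraStructure P.H x u := by
  obtain ⟨a, ha, b, hb, rfl⟩ : ∃ a ∈ fibreDistribution E E' P.q₁ x,
      ∃ b ∈ fibreDistribution E E' P.q₂ x, (a + b : E') = u :=
    Submodule.mem_sup.1 ((h.transverse hx).sup_eq_top.ge (Submodule.mem_top (x := u)))
  refine (map_add (P.F x) a b).trans (Eq.trans ?_ ((paraStructure P.H x).map_add a b).symm)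
  exact congrArg₂ (fun a b : E' => a + b)
    ((P.F_eigen₁ x (hU hx) a ha).trans (h.paraStructure_fibre₁ hx ha).symm)
    ((P.F_eigen₂ x (hU hx) b hb).trans (h.paraStructure_fibre₂ hx hb).symm)

lemma metric_eq (x : M) (hx : x ∈ Θ.source) (u v : E') :
    P.metric x u v = P.om x (paraStructure P.H x u) v :=
  congrArg (fun w : E' => P.om x w v) (h.F_eq hU hx u)

omit hU in
lemma modelI_horizontal (hg₀ : IsKahler g₀) {Z v : StdComplexification E}
    (hZ : Z ∈ polydisc (chartAt E p p) ρ) (hv : v.2 = 0) : (modelI omt g₀ p Z v).1 = 0 := by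
  have h1 := (h.isHyperI_model hg₀ hZ).F_comm v
  have h2 : stdFR E v = -v := Prod.ext rfl (by simp [hv])
  rw [h2, map_neg, neg_inj] at h1
  exact eq_zero_of_eq_neg (congrArg Prod.fst h1)

omit hU in
lemma modelG_horizontal (hg₀ : IsKahler g₀) {Z v w : StdComplexification E}
    (hZ : Z ∈ polydisc (chartAt E p p) ρ) (hv : v.2 = 0) :
    modelG omt g₀ p Z v w = modelB g₀ p Z v w := by
  refine (congrArg (modelB g₀ p Z v w + ·) ?_).trans (add_zero _)
  exact modelB_fst g₀ p Z (h.modelI_horizontal hg₀ hZ hv) _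

/-- The structures of a package are determined by the germs of the canonical structures. -/
lemma package_eq (hUo : IsOpen U) (hfU : Set.range f ⊆ U) (hg₀ : IsKahler g₀)
    (hf : IsComplexification E E' f) {x : M} (hx : x ∈ Θ.source) :
    P.gAt x = fieldG g₀ P.q₁ P.q₂ P.om P.H x ∧ P.IAt x = fieldI g₀ P.q₁ P.q₂ P.om P.H x := by
  have hZ := h.mem_polydisc hx
  have hR : realIncl E (Θ x).1 ∈ polydisc (chartAt E p p) ρ := realIncl_mem_polydisc.2 hZ.1
  have hRt : realIncl E (Θ x).1 ∈ Θ.target := h.adapted.target_eq ▸ hR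
  have hsymm := h.adapted.symm_realIncl _ hZ.1
  obtain ⟨e1, e2⟩ := P.eq_at_range hUo hfU hg₀ hf ((chartAt E p).symm (Θ x).1)
  rw [← hsymm] at e1 e2
  have hbl := h.isBiLagrangian hx hg₀
  have hI := h.isHyperI hx hg₀
  have hr := h.isChart.real
  have hhor : ∀ u : E', paraStructure P.H x u = -u → (dT ℝ E' Θ x u).2 = 0 := fun u hu => by
    have h1 := h.dT_paraStructure hx u
    rw [hu, map_neg] at h1
    rw [h.isChart.dT_real hx]
    exact eq_zero_of_eq_neg (congrArg Prod.snd h1).symm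
  have hIR : endoIn ℝ E' Θ P.IAt (realIncl E (Θ x).1) = modelI omt g₀ p (realIncl E (Θ x).1) := by
    rw [← h.endoIn_fieldI hg₀ hRt, endoIn, endoIn, e2]
  have hGR : bilinIn ℝ E' Θ P.gAt (realIncl E (Θ x).1) = modelG omt g₀ p (realIncl E (Θ x).1) := by
    rw [← h.bilinIn_fieldG hg₀ hRt, bilinIn, bilinIn, e1]
  -- `ω(F I u, I v)` is constant along the vertical leaf through `x`. At the real point of the leaf
  -- `I` is the model one and sends horizontal vectors to vertical ones, so isotropy gives the value
  -- `0`.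
  have hswap : ∀ u, paraStructure P.H x u = -u → paraStructure P.H x (P.IAt x u) = P.IAt x u :=
    fun u hu => hbl.swap_of_isotropic (P.IAt_sq (hU hx)) (P.gAt_IAt (hU hx)) (P.gAt_symm (hU hx))
      (P.gAt_definite (hU hx)) (fun u v hu hv => by
        have h1 := h.endoIn_eq_of_parallel hg₀ hU (h.metric_eq hU) P.cov_leviCivita
          P.admissible.hyperHermitian.smooth.1 hUo P.I_parallel hZ (hhor u hu) (hhor v hv)
        change omt (Θ x) (stdFR E (endoIn ℝ E' Θ P.IAt (Θ x) (dT ℝ E' Θ x u)))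
          (endoIn ℝ E' Θ P.IAt (Θ x) (dT ℝ E' Θ x v)) =
          omt _ (stdFR E (endoIn ℝ E' Θ P.IAt _ _)) (endoIn ℝ E' Θ P.IAt _ _) at h1
        rw [hIR, hr.endoIn_dT hx, hr.endoIn_dT hx, (h.isJet hg₀ hR).iso₁ _ _
          (neg_eq_zero.2 (h.modelI_horizontal hg₀ hR (hhor u hu)))
          (h.modelI_horizontal hg₀ hR (hhor v hv))] at h1
        exact congrArg Complex.re ((h.biLagrangianMetric_eq
          (B := fun x (u v : E') => P.om x (paraStructure P.H x u) v) (fun _ _ _ _ => rfl) hx _ _).trans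
          h1)) hu
  obtain ⟨k1, k2, -⟩ := hbl.unique (P.IAt_sq (hU hx)) hI.sq (P.gAt_IAt (hU hx))
    (g' := fieldG g₀ P.q₁ P.q₂ P.om P.H x) hI.re_form (P.gAt_orthogonal (hU hx))
    (P.gAt_definite (hU hx)) hswap
    (fun u hu => by
      have h1 := hI.F_comm u
      rw [hu, map_neg, neg_inj] at h1
      exact h1.symm)
    -- On horizontal vectors `g` equals its value at the real point of the leaf. There it is
    -- `modelB`, which depends only on the first coordinate and thus has the same value at `Θ x`.
    (fun u v hu hv => by
      have h1 := h.bilinIn_eq_of_parallel hg₀ hU (h.metric_eq hU) P.cov_leviCivita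
          P.admissible.hyperHermitian.metric.smooth hUo P.g_parallel hZ (hhor u hu) (hhor v hv)
      change bilinIn ℝ E' Θ P.gAt (Θ x) (dT ℝ E' Θ x u) (dT ℝ E' Θ x v) =
        bilinIn ℝ E' Θ P.gAt _ _ _ at h1
      rw [hGR, hr.bilinIn_dT hx, h.modelG_horizontal hg₀ hR (hhor u hu)] at h1
      rw [h1, h.fieldG_eq hx hg₀, ← h.isChart.dT_real hx, ← h.isChart.dT_real hx,
        h.modelG_horizontal hg₀ hZ (hhor u hu)]
      rfl)
  exact ⟨k1, k2⟩

end IsLocalModel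

end Uniqueness

end BiquaternionicExtension
end

open scoped Manifold ContDiff
noncomputable section
namespace BiquaternionicExtension

/-! ### The biquaternionic and para-hyperhermitian structures -/

section LinearAlgebra

/-- `I A I = A` while `I I A = -A`, and both products have the same trace. -/
lemma trace_eq_zero_of_anticommute {T : Type*} [AddCommGroup T] [Module ℝ T] {I A : T →ₗ[ℝ] T}
    (hI : ∀ u, I (I u) = -u) (hA : ∀ u, I (A u) = -A (I u)) : LinearMap.trace ℝ T A = 0 := by
  have h1 : LinearMap.trace ℝ T (I * (I * A)) = LinearMap.trace ℝ T (I * A * I) :=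
    LinearMap.trace_mul_comm ℝ I (I * A)
  have h2 : I * (I * A) = -A := LinearMap.ext fun u => hI (A u)
  have h3 : I * A * I = A := LinearMap.ext fun u => by
    simp only [Module.End.mul_apply, hA, hI, map_neg, neg_neg]
  rw [h2, h3, map_neg] at h1
  linarith

end LinearAlgebra

section Biquaternionic

open Filter Topology Metric

variable {E : Type*} [NormedAddCommGroup E] [NormedSpace ℂ E] [FiniteDimensional ℂ E]
  {N : Type*} [TopologicalSpace N] [ChartedSpace E N] [IsManifold 𝓘(ℂ, E) ω N]
  {E' : Type*} [NormedAddCommGroup E'] [NormedSpace ℂ E'] [FiniteDimensional ℂ E']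
  {M : Type*} [TopologicalSpace M] [ChartedSpace E' M] [IsManifold 𝓘(ℂ, E') ω M]
  {f : N → M} {g₀ : AnalyticMetric E N} {U : Set M}

omit [FiniteDimensional ℂ E'] in
/-- Smoothness of an endomorphism field from its expression in a chart. -/
lemma IsChart.contMDiffAt_endo {G : Type*} [NormedAddCommGroup G] [NormedSpace ℝ G]
    {Θ : OpenPartialHomeomorph M G} (hΘ : IsChart ℝ E' Θ) {A : EndoField E' M}
    {At : G → G →L[ℝ] G} {x : M} (hx : x ∈ Θ.source)
    (hA : ∀ y ∈ Θ.source, ∀ u : E', dT ℝ E' Θ y (A y u) = At (Θ y) (dT ℝ E' Θ y u))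
    (hAt : ContDiffAt ℝ ∞ At (Θ x)) :
    ContMDiffAt 𝓘(ℝ, E') (𝓘(ℝ, E').prod 𝓘(ℝ, E' →L[ℝ] E')) ∞
      (fun x => (⟨x, A x⟩ : Bundle.TotalSpace (E' →L[ℝ] E')
        (fun x : M => TangentSpace 𝓘(ℝ, E') x →L[ℝ] TangentSpace 𝓘(ℝ, E') x))) x := by
  refine (hΘ.contMDiffAt_endo_iff hx).2 (hAt.congr_of_eventuallyEq ?_)
  filter_upwards [Θ.open_target.mem_nhds (Θ.map_source hx)] with Z hZ
  refine ContinuousLinearMap.ext fun u => ?_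
  have h1 := hA _ (Θ.map_target hZ) (dS ℝ E' Θ Z u)
  rw [hΘ.dT_dS hZ, Θ.right_inv hZ] at h1
  exact h1

namespace CanonicalPackage

variable (P : CanonicalPackage E' f g₀ U)

/-- The points near which the structures of a package have a local model. -/
def modelDomain : Set M :=
  {x | ∃ p Θ ρ omt, IsLocalModel f g₀ P.q₁ P.q₂ P.om P.H p Θ ρ omt ∧ x ∈ Θ.source ∧ Θ.source ⊆ U}

omit [FiniteDimensional ℂ E'] in
lemma isOpen_modelDomain : IsOpen P.modelDomain :=
  isOpen_iff_mem_nhds.2 fun x hx => by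
    obtain ⟨p, Θ, ρ, omt, h, hxs, hΘU⟩ := hx
    filter_upwards [Θ.open_source.mem_nhds hxs] with y hy
    exact ⟨p, Θ, ρ, omt, h, hy, hΘU⟩

omit [FiniteDimensional ℂ E'] in
lemma modelDomain_subset : P.modelDomain ⊆ U := fun x hx => by
  obtain ⟨p, Θ, ρ, omt, h, hxs, hΘU⟩ := hx
  exact hΘU hxs

lemma range_subset_modelDomain (hUo : IsOpen U) (hfU : Set.range f ⊆ U)
    (hf : IsComplexification E E' f) : Set.range f ⊆ P.modelDomain := by
  rintro _ ⟨p, rfl⟩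
  obtain ⟨Θ, ρ, omt, h1, h2, h3⟩ := (P.isGermAt hUo hfU p).exists_localModel hf
    (hUo.mem_nhds (hfU ⟨p, rfl⟩))
  exact ⟨p, Θ, ρ, omt, h1, h2, h3⟩

/-- The endomorphism `H` at `x`. -/
def HAt (x : M) : E' →L[ℂ] E' := P.H x

omit [FiniteDimensional ℂ E] [FiniteDimensional ℂ E'] in
-- This is `H = -JF`. All relations for `H` are deduced from those for `F` and `J`.
lemma HAt_eq (x : M) (u : E') : P.HAt x u = -(Complex.I • paraStructure P.H x u) := by
  have h1 : paraStructure P.H x u = P.HAt x (Complex.I • u) := rfl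
  rw [h1, map_smul, I_smul_I_smul, neg_neg]

omit [FiniteDimensional ℂ E'] in
lemma gAt_J {x : M} (hx : x ∈ P.modelDomain) (u v : E') : P.gAt x (Complex.I • u) (Complex.I • v) = P.gAt x u v := by
  have hxU := P.modelDomain_subset hx
  have h1 := P.admissible.hyperHermitian.orthogonal.2.1 x hxU u v
  rw [P.admissible.J_eq x hxU] at h1
  exact h1

omit [FiniteDimensional ℂ E'] in
lemma mul_J {x : M} (hx : x ∈ P.modelDomain) (u : E') : P.H.toReal.mul P.J x u = paraStructure P.H x u := by
  have h1 := P.admissible.J_eq x (P.modelDomain_subset hx)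
  exact congrArg (fun L : E' →L[ℝ] E' => P.HAt x (L u)) h1

variable (hUo : IsOpen U) (hfU : Set.range f ⊆ U) (hg₀ : IsKahler g₀)
  (hf : IsComplexification E E' f) {x : M} (hx : x ∈ P.modelDomain)
include hUo hfU hg₀ hf hx

lemma isHyperI : IsBiLagrangian (T := E') (P.om x) (paraStructure P.H x) ∧
    IsBiLagrangian.IsHyperI (T := E') (P.om x) (paraStructure P.H x) (baseForm g₀ P.q₁ x)
      (P.IAt x) := by
  obtain ⟨p, Θ, ρ, omt, h, hxs, hΘU⟩ := hx
  refine ⟨h.isBiLagrangian hxs hg₀, ?_⟩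
  rw [(h.package_eq hΘU hUo hfU hg₀ hf hxs).2]
  exact h.isHyperI hxs hg₀

/-- In `g = -Re ω(I·, ·)`, moving `F` past `I` and then across `ω` produces two signs that cancel,
and `F² = 1`. -/
lemma gAt_F (u v : E') : P.gAt x (paraStructure P.H x u) (paraStructure P.H x v) =
    P.gAt x u v := by
  obtain ⟨hbl, hI⟩ := P.isHyperI hUo hfU hg₀ hf hx
  have hxU := P.modelDomain_subset hx
  refine (P.gAt_eq hxU _ _).trans (Eq.trans ?_ (P.gAt_eq hxU u v).symm)
  refine congrArg (fun z : ℂ => -z.re) ?_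
  have key : ∀ {om : E' →L[ℂ] E' →L[ℂ] ℂ} (_ : IsBiLagrangian om (paraStructure P.H x)),
      om (P.IAt x (paraStructure P.H x u)) (paraStructure P.H x v) = om (P.IAt x u) v :=
    fun {om} hbl => by
      rw [hI.F_comm, map_neg, neg_apply, hbl.om_F, neg_neg, hbl.F_sq]
  exact key hbl

lemma gAt_H (u v : E') : P.gAt x (P.HAt x u) (P.HAt x v) = P.gAt x u v := by
  rw [P.HAt_eq, P.HAt_eq, map_neg, map_neg, neg_apply, neg_neg,
    P.gAt_J hx, P.gAt_F hUo hfU hg₀ hf hx]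

lemma HAt_IAt (u : E') : P.HAt x (P.IAt x u) = P.IAt x (P.HAt x u) := by
  obtain ⟨hbl, hI⟩ := P.isHyperI hUo hfU hg₀ hf hx
  rw [P.HAt_eq, P.HAt_eq, map_neg, hI.smul_I, hI.F_comm,
    smul_neg, neg_neg]

lemma HAt_sq (u : E') : P.HAt x (P.HAt x u) = -u := by
  obtain ⟨hbl, hI⟩ := P.isHyperI hUo hfU hg₀ hf hx
  rw [P.HAt_eq, P.HAt_eq, map_neg, hbl.F_smul_I, hbl.F_sq,
    smul_neg, I_smul_I_smul, neg_neg]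

/-- As `H` commutes with `I`, `HK = HIJ = I(HJ) = IF`. -/
lemma mul_K (u : E') : P.H.toReal.mul P.K x u = P.IAt x (paraStructure P.H x u) := by
  obtain ⟨hbl, hI⟩ := P.isHyperI hUo hfU hg₀ hf hx
  refine (congrArg (P.HAt x) (P.K_eq (P.modelDomain_subset hx) u)).trans ?_
  rw [P.HAt_IAt hUo hfU hg₀ hf hx, P.HAt_eq, hbl.F_smul_I, I_smul_I_smul, neg_neg]

lemma HAt_K (u : E') : P.HAt x (P.K x u) = P.K x (P.HAt x u) := by
  have hxU := P.modelDomain_subset hx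
  refine (congrArg (P.HAt x) (P.K_eq hxU u)).trans (Eq.trans ?_ (P.K_eq hxU _).symm)
  rw [P.HAt_IAt hUo hfU hg₀ hf hx, map_smul]

lemma contMDiffAt_H : ContMDiffAt 𝓘(ℝ, E') (𝓘(ℝ, E').prod 𝓘(ℝ, E' →L[ℝ] E')) ∞
    (fun x => (⟨x, P.H.toReal x⟩ : Bundle.TotalSpace (E' →L[ℝ] E')
      (fun x : M => TangentSpace 𝓘(ℝ, E') x →L[ℝ] TangentSpace 𝓘(ℝ, E') x))) x := by
  obtain ⟨p, Θ, ρ, omt, h, hxs, hΘU⟩ := hx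
  refine h.isChart.real.contMDiffAt_endo (At := fun _ => (stdH E).restrictScalars ℝ) hxs
    (fun y hy u => ?_) contDiffAt_const
  refine (h.isChart.dT_real hy _).trans (((h.model y hy).H_eq u).trans ?_)
  exact congrArg (stdH E) (h.isChart.dT_real hy u).symm

lemma contMDiffAt_mul_J : ContMDiffAt 𝓘(ℝ, E') (𝓘(ℝ, E').prod 𝓘(ℝ, E' →L[ℝ] E')) ∞
    (fun x => (⟨x, P.H.toReal.mul P.J x⟩ : Bundle.TotalSpace (E' →L[ℝ] E')
      (fun x : M => TangentSpace 𝓘(ℝ, E') x →L[ℝ] TangentSpace 𝓘(ℝ, E') x))) x := by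
  obtain ⟨p, Θ, ρ, omt, h, hxs, hΘU⟩ := hx
  refine h.isChart.real.contMDiffAt_endo (At := fun _ => stdFR E) hxs
    (fun y hy u => ?_) contDiffAt_const
  refine (congrArg (dT ℝ E' Θ y)
    (P.mul_J ⟨p, Θ, ρ, omt, h, hy, hΘU⟩ u)).trans ?_
  rw [h.isChart.dT_real hy, h.isChart.dT_real hy, h.dT_paraStructure hy]

lemma contMDiffAt_mul_K : ContMDiffAt 𝓘(ℝ, E') (𝓘(ℝ, E').prod 𝓘(ℝ, E' →L[ℝ] E')) ∞
    (fun x => (⟨x, P.H.toReal.mul P.K x⟩ : Bundle.TotalSpace (E' →L[ℝ] E')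
      (fun x : M => TangentSpace 𝓘(ℝ, E') x →L[ℝ] TangentSpace 𝓘(ℝ, E') x))) x := by
  obtain ⟨p, Θ, ρ, omt, h, hxs, hΘU⟩ := hx
  refine h.isChart.real.contMDiffAt_endo (At := fun Z => (modelI omt g₀ p Z).comp (stdFR E)) hxs
    (fun y hy u => ?_)
    (((h.contDiffAt_modelI hg₀ (h.mem_polydisc hxs)).of_le le_top).clm_comp contDiffAt_const)
  refine (congrArg (dT ℝ E' Θ y)
    (P.mul_K hUo hfU hg₀ hf ⟨p, Θ, ρ, omt, h, hy, hΘU⟩ u)).trans ?_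
  rw [(h.package_eq hΘU hUo hfU hg₀ hf hy).2, h.isChart.dT_real hy, h.isChart.dT_real hy,
    h.dT_fieldI hy hg₀, h.dT_paraStructure hy]
  rfl

end CanonicalPackage

end Biquaternionic

end BiquaternionicExtension
end

open scoped Manifold ContDiff
noncomputable section
namespace BiquaternionicExtension

/-! ### The structures carried by an arbitrary package, and uniqueness of their germ. -/

section Main

open Filter Topology Metric

variable {E : Type*} [NormedAddCommGroup E] [NormedSpace ℂ E] [FiniteDimensional ℂ E]
  {N : Type*} [TopologicalSpace N] [ChartedSpace E N] [IsManifold 𝓘(ℂ, E) ω N]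
  {E' : Type*} [NormedAddCommGroup E'] [NormedSpace ℂ E'] [FiniteDimensional ℂ E']
  {M : Type*} [TopologicalSpace M] [ChartedSpace E' M] [IsManifold 𝓘(ℂ, E') ω M]
  {f : N → M} {g₀ : AnalyticMetric E N} {U U' : Set M}

namespace CanonicalPackage

variable (P : CanonicalPackage E' f g₀ U)

section

variable (hUo : IsOpen U) (hfU : Set.range f ⊆ U) (hg₀ : IsKahler g₀)
  (hf : IsComplexification E E' f)
include hUo hfU hg₀ hf

/-- The structures of a package form an almost biquaternionic Hermitian structure. -/
lemma isAlmostBiquaternionicHermitianOn :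
    IsAlmostBiquaternionicHermitianOn P.g P.H.toReal P.I P.J P.K P.modelDomain := by
  have hh := P.admissible.hyperHermitian
  have hs := P.modelDomain_subset
  exact
    { metric := ⟨hh.metric.smooth.mono hs, fun x hx => hh.metric.symm x (hs hx),
        fun x hx => hh.metric.pos x (hs hx)⟩
      smooth := ⟨fun x hx => (P.contMDiffAt_H hUo hfU hg₀ hf hx).contMDiffWithinAt,
        hh.smooth.1.mono hs, hh.smooth.2.1.mono hs, hh.smooth.2.2.mono hs⟩
      sq := ⟨fun x hx => P.HAt_sq hUo hfU hg₀ hf hx, fun x hx => hh.sq.1 x (hs hx),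
        fun x hx => hh.sq.2.1 x (hs hx), fun x hx => hh.sq.2.2 x (hs hx)⟩
      product := fun x hx => hh.product x (hs hx)
      commute := ⟨fun x hx => P.HAt_IAt hUo hfU hg₀ hf hx, fun x hx (u : E') => by
          have h1 := P.admissible.J_eq x (hs hx)
          refine (congrArg (fun L : E' →L[ℝ] E' => P.HAt x (L u)) h1).trans (Eq.trans ?_
            (congrArg (fun L : E' →L[ℝ] E' => L (P.HAt x u)) h1).symm)
          exact (P.HAt x).map_smul Complex.I u,
        fun x hx => P.HAt_K hUo hfU hg₀ hf hx⟩
      orthogonal := ⟨fun x hx => P.gAt_H hUo hfU hg₀ hf hx,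
        fun x hx => hh.orthogonal.1 x (hs hx), fun x hx => hh.orthogonal.2.1 x (hs hx),
        fun x hx => hh.orthogonal.2.2 x (hs hx)⟩ }

/-- The structures of a package induce an almost para-hyper-Hermitian structure. -/
lemma isAlmostParaHyperHermitianOn :
    IsAlmostParaHyperHermitianOn P.g P.I (P.H.toReal.mul P.K) (P.H.toReal.mul P.J)
      P.modelDomain := by
  have hh := P.admissible.hyperHermitian
  have hs := P.modelDomain_subset
  have hF : ∀ x ∈ P.modelDomain, P.H.toReal.mul P.J x = paraStructure P.H x := fun x hx =>
    ContinuousLinearMap.ext (P.mul_J hx)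
  have hG : ∀ x ∈ P.modelDomain, P.H.toReal.mul P.K x = (P.IAt x).comp (paraStructure P.H x) :=
    fun x hx => ContinuousLinearMap.ext (P.mul_K hUo hfU hg₀ hf hx)
  have hI := fun x hx => (P.isHyperI hUo hfU hg₀ hf (x := x) hx).2
  have hbl := fun x hx => (P.isHyperI hUo hfU hg₀ hf (x := x) hx).1
  have hF_sq : ∀ x ∈ P.modelDomain, ∀ u, paraStructure P.H x (paraStructure P.H x u) = u :=
    fun x hx => (hbl x hx).F_sq
  have hFt : ∀ x ∈ P.modelDomain, LinearMap.trace ℝ E' (paraStructure P.H x).toLinearMap = 0 :=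
    fun x hx => trace_eq_zero_of_anticommute (I := (P.IAt x).toLinearMap) (hI x hx).sq
      (hI x hx).F_comm
  have hGt : ∀ x ∈ P.modelDomain,
      LinearMap.trace ℝ E' ((P.IAt x).comp (paraStructure P.H x)).toLinearMap = 0 :=
    fun x hx => trace_eq_zero_of_anticommute (I := (P.IAt x).toLinearMap) (hI x hx).sq fun u => by
      change P.IAt x (P.IAt x (paraStructure P.H x u)) =
        -P.IAt x (paraStructure P.H x (P.IAt x u))
      rw [(hI x hx).F_comm, map_neg, (hI x hx).F_comm, neg_neg]
  have hG_sq : ∀ x ∈ P.modelDomain, ∀ u, P.IAt x (paraStructure P.H x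
      (P.IAt x (paraStructure P.H x u))) = u := fun x hx u => by
    rw [← neg_neg (paraStructure P.H x (P.IAt x _)), ← (hI x hx).F_comm, hF_sq x hx, map_neg,
      (hI x hx).sq, neg_neg]
  have hGo : ∀ x ∈ P.modelDomain, ∀ u v, P.gAt x (P.IAt x (paraStructure P.H x u))
      (P.IAt x (paraStructure P.H x v)) = P.gAt x u v := fun x hx u v => by
    rw [P.gAt_orthogonal (hs hx), P.gAt_F hUo hfU hg₀ hf hx]
  refine ⟨⟨hh.metric.smooth.mono hs, fun x hx => hh.metric.symm x (hs hx),
    fun x hx => hh.metric.pos x (hs hx)⟩, ⟨hh.smooth.1.mono hs,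
      fun x hx => (P.contMDiffAt_mul_K hUo hfU hg₀ hf hx).contMDiffWithinAt,
      fun x hx => (P.contMDiffAt_mul_J hUo hfU hg₀ hf hx).contMDiffWithinAt⟩,
    ⟨fun x hx => hh.sq.1 x (hs hx), fun x hx (u : E') => ?_, fun x hx (u : E') => ?_⟩,
    fun x hx => ⟨?_, ?_⟩, fun x hx (u : E') => ⟨?_, ?_⟩,
    ⟨fun x hx => hh.orthogonal.1 x (hs hx), fun x hx (u v : E') => ?_,
      fun x hx (u v : E') => ?_⟩⟩
  · rw [hG x hx]; exact hG_sq x hx u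
  · rw [hF x hx]; exact hF_sq x hx u
  · rw [hG x hx]; exact hGt x hx
  · rw [hF x hx]; exact hFt x hx
  · rw [hF x hx, hG x hx]; rfl
  · rw [hF x hx, hG x hx]; exact ((hI x hx).F_comm u).symm
  · rw [hG x hx]; exact hGo x hx u v
  · rw [hF x hx]; exact P.gAt_F hUo hfU hg₀ hf hx u v

end

/-- The germ of the structures of a package is unique. -/
lemma eventuallyEq (P' : CanonicalPackage E' f g₀ U') (hUo : IsOpen U) (hUo' : IsOpen U')
    (hfU : Set.range f ⊆ U) (hfU' : Set.range f ⊆ U') (hg₀ : IsKahler g₀)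
    (hf : IsComplexification E E' f) (p : N) : ∀ᶠ x in 𝓝 (f p),
      P.g x = P'.g x ∧ P.H x = P'.H x ∧ P.I x = P'.I x ∧ P.J x = P'.J x ∧ P.K x = P'.K x := by
  have hgerm := P.isGermAt hUo hfU p
  obtain ⟨Θ, ρ, omt, h, hp, hO⟩ := hgerm.exists_localModel hf
    (inter_mem (inter_mem (hUo.mem_nhds (hfU ⟨p, rfl⟩)) (hUo'.mem_nhds (hfU' ⟨p, rfl⟩)))
      (hgerm.eventuallyEq hf (P'.isGermAt hUo' hfU' p)))
  -- The canonical germs of the two packages coincide on the chart domain, so one local model serves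
  -- both, and each package must equal the structure of that model.
  have h' : IsLocalModel f g₀ P'.q₁ P'.q₂ P'.om P'.H p Θ ρ omt :=
    { h with
      model := fun x hx => by
        obtain ⟨e1, e2, e3, e4⟩ := (hO hx).2
        obtain ⟨k1, k2, k3, k4⟩ := h.model x hx
        exact ⟨e1 ▸ k1, e2 ▸ k2, e3 ▸ k3, e4 ▸ k4⟩ }
  filter_upwards [Θ.open_source.mem_nhds hp] with x hx
  obtain ⟨k1, k2⟩ := h.package_eq (fun x hx => (hO hx).1.1) hUo hfU hg₀ hf hx
  obtain ⟨k1', k2'⟩ := h'.package_eq (fun x hx => (hO hx).1.2) hUo' hfU' hg₀ hf hx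
  have hI : P.IAt x = P'.IAt x := by
    rw [k2, k2']
    refine ContinuousLinearMap.ext fun u => h.isChart.injective_dT hx ?_
    rw [h.dT_fieldI hx hg₀, h'.dT_fieldI hx hg₀]
  have hg : P.gAt x = P'.gAt x := by
    rw [k1, k1']
    refine ContinuousLinearMap.ext fun u => ContinuousLinearMap.ext fun v => ?_
    rw [h.fieldG_eq hx hg₀, h'.fieldG_eq hx hg₀]
  refine ⟨hg, (hO hx).2.2.2.2, hI, (P.admissible.J_eq x (hO hx).1.1).trans
    (P'.admissible.J_eq x (hO hx).1.2).symm, ContinuousLinearMap.ext fun (u : E') => ?_⟩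
  exact (P.K_eq (hO hx).1.1 u).trans ((congrArg (fun L : E' →L[ℝ] E' => L (Complex.I • u)) hI).trans
    (P'.K_eq (hO hx).1.2 u).symm)

end CanonicalPackage

end Main

end BiquaternionicExtension
end

theorem mainTheorem10
    {E : Type*} [NormedAddCommGroup E] [NormedSpace ℂ E] [FiniteDimensional ℂ E]
    {N : Type*} [TopologicalSpace N] [T2Space N] [SecondCountableTopology N] [Nonempty N]
    [ChartedSpace E N] [IsManifold 𝓘(ℂ, E) ω N]
    {E' : Type*} [NormedAddCommGroup E'] [NormedSpace ℂ E'] [FiniteDimensional ℂ E']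
    {M : Type*} [TopologicalSpace M] [T2Space M] [SecondCountableTopology M]
    [ChartedSpace E' M] [IsManifold 𝓘(ℂ, E') ω M]
    (g₀ : BiquaternionicExtension.AnalyticMetric E N)
    (hg₀ : BiquaternionicExtension.IsKahler g₀)
    (f : N → M) (hf : BiquaternionicExtension.IsComplexification E E' f) :
    -- the canonical structures exist in some open neighbourhood of `N` in `M`
    (∃ U : Set M, IsOpen U ∧ Set.range f ⊆ U ∧
      Nonempty (BiquaternionicExtension.CanonicalPackage E' f g₀ U)) ∧
    -- their germ along `N` is unique
    (∀ U U' : Set M, IsOpen U → IsOpen U' → Set.range f ⊆ U → Set.range f ⊆ U' →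
      ∀ (P : BiquaternionicExtension.CanonicalPackage E' f g₀ U)
        (P' : BiquaternionicExtension.CanonicalPackage E' f g₀ U'),
        ∃ V : Set M, IsOpen V ∧ Set.range f ⊆ V ∧ V ⊆ U ∩ U' ∧
          ∀ x ∈ V, P.g x = P'.g x ∧ P.H x = P'.H x ∧ P.I x = P'.I x ∧ P.J x = P'.J x ∧
            P.K x = P'.K x) ∧
    -- they form an almost biquaternionic Hermitian structure near `N`, which induces an almost
    -- para-hyper-Hermitian structure
    (∀ U : Set M, IsOpen U → Set.range f ⊆ U →
      ∀ P : BiquaternionicExtension.CanonicalPackage E' f g₀ U,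
        ∃ V : Set M, IsOpen V ∧ Set.range f ⊆ V ∧ V ⊆ U ∧
          BiquaternionicExtension.IsAlmostBiquaternionicHermitianOn
            P.g P.H.toReal P.I P.J P.K V ∧
          BiquaternionicExtension.IsAlmostParaHyperHermitianOn
            P.g P.I (P.H.toReal.mul P.K) (P.H.toReal.mul P.J) V) := by
  refine ⟨BiquaternionicExtension.exists_canonicalPackage hg₀ hf,
    fun U U' hU hU' hfU hfU' P P' => ?_, fun U hU hfU P => ?_⟩
  -- Requiring equality near the point, and not only at it, makes this set open.
  · refine ⟨{x | x ∈ U ∩ U' ∧ ∀ᶠ y in nhds x, P.g y = P'.g y ∧ P.H y = P'.H y ∧ P.I y = P'.I y ∧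
      P.J y = P'.J y ∧ P.K y = P'.K y}, ?_, ?_, fun x hx => hx.1, fun x hx => hx.2.self_of_nhds⟩
    · exact (hU.inter hU').inter isOpen_setOf_eventually_nhds
    · rintro _ ⟨p, rfl⟩
      exact ⟨⟨hfU ⟨p, rfl⟩, hfU' ⟨p, rfl⟩⟩, P.eventuallyEq P' hU hU' hfU hfU' hg₀ hf p⟩
  · exact ⟨P.modelDomain, P.isOpen_modelDomain, P.range_subset_modelDomain hU hfU hf,
      P.modelDomain_subset, P.isAlmostBiquaternionicHermitianOn hU hfU hg₀ hf,
      P.isAlmostParaHyperHermitianOn hU hfU hg₀ hf⟩
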